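/- **Setting.** Let $\mathbb L$ be a finite set, $\mathsf N\in\mathbb N$, $\Xi=\mathbb R^{\mathsf N}$ with Euclidean norm, $0<R\le\infty$. Let $C$ be a complex symmetric normal matrix on $\mathbb L\times\{1,\dots,\mathsf N\}$ with $\Re\, C^{-1}$ positive definite. For a set $X$ let $\mathsf P(X)$ be the set of unordered pairs of distinct elements of $X$. For $s\in[0,1]^{\mathsf P(X)}$ let $C_s(x,y)=C(x,y)s(\{x,y\})$ with $s(\{x,x\})=1$ and $x,y\in X$; let $d\mu_{C_s}(\phi)=\det(2\pi C_s)^{-1/2}e^{-\frac12\langle\phi,C_s^{-1}\phi\rangle}d\phi$ on $\Xi^X$ (canonical square root: the product of the principal values of $(2\pi z)^{-1/2}$ over the eigenvalues $z$); and let $\chi_R(\phi)=\prod_{x}\chi(|\phi(x)|\le R)$. For $s\in[0,1]^{\mathsf P(\mathbb L)}$ let $\mathcal P(s)$ be the finest partition of $\mathbb L$ such that $s(\{x,y\})=0$ whenever $x,y$ lie in different elements. For a tree $T$ on $X$ and weights $s\in[0,1]^T$ let $s^T(\{x,y\})$ be the minimum of $s(\ell)$ over the edges $\ell$ of the $T$-path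 linking $x$ and $y$. Fix $J\in\Xi^{\mathbb L}$. Let $V_i(\phi;s;J)\in\mathbb C$ ($i=1,2$) be smooth in $(\phi,s)$ for $\phi\in\Xi^{\mathbb L}$ with $|\phi(x)|\le R$ for all $x$, and $s\in[0,1]^{\mathsf P(\mathbb L)}$. Assume that there are functions $V_1(\phi|_X;s|_X;J|_X)$ and $V_2(x;\phi|_X;s|_X;J|_X)$, $x\in X\subset\mathbb L$, of the restrictions to $X$, such that for all such $\phi,s$ $$V_1(\phi;s;J)=\sum_{X\in\mathcal P(s)}V_1(\phi|_X;s|_X;J|_X),\qquad V_2(\phi;s;J)=\sum_{X\in\mathcal P(s)}\sum_{x\in X}V_2(x;\phi|_X;s|_X;J|_X).$$ If $R=\infty$, assume also that for every $\varepsilon>0$ there is $K$ such that $\big|\prod_{\ell\in F}\partial_{s(\ell)}e^{V_1+V_2}(\phi;s^T;J)\big|\le K e^{\varepsilon\sum_x|\phi(x)|^2}$ for all $\phi\in\Xi^{\mathbb L}$, all trees $T$ on $\mathbb L$ with weights in $(0,1)$ and all $F\subset T$. Set $$\mathcal Z(J)=\int d\mu_C(\phi)\,\chi_R(\phi)\,e^{V_1(\phi;1;J)+V_2(\phi;1;J)}.$$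 **Activities.** For $\emptyset\ne X\subset\mathbb L$ let $$A'(X;\phi|_X;s;J|_X)=\exp\Big(V_1(\phi|_X;s;J|_X)+\sum_{x\in X}V_2(x;\phi|_X;s;J|_X)\Big),$$ $$A(X;J|_X)=\sum_{T}\ \sum_{F_C\sqcup F_V=T}\int_{[0,1]^T}\prod_{\ell\in T}ds(\ell)\int d\mu_{C_{s^T}}(\phi|_X)\prod_{\ell\in F_C}C(\ell)\partial_\ell\,\Big[\chi_R(\phi|_X)\prod_{\ell\in F_V}\partial_{s(\ell)}A'(X;\phi|_X;s;J|_X)\Big|_{s=s^T}\Big],$$ where $T$ runs over the trees with vertex set $X$ ($T=\emptyset$ if $|X|=1$), $F_C$ and $F_V$ may be empty, $C(\{x,y\})\partial_{\{x,y\}}=\sum_{m,n=1}^{\mathsf N}C((x,m),(y,n))\,\partial_{\phi(x,m)}\partial_{\phi(y,n)}$, and the $\phi$-derivatives are weak, i.e. the integral against $d\mu_{C_{s^T}}$ is the pairing of the distributional derivative with the Gaussian density. **Mayer series.** Put $\dot A(X)=A(X)\prod_{x\in X}A(\{x\})^{-1}$, $W(\{x\})=\log A(\{x\})$ and, for $|X|\ge2$,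 $$W(X)=\sum_{n\ge1}W_n(X),\qquad W_n(X)=\frac1{n!}\sum_{\substack{(X_1,\dots,X_n),\ |X_m|\ge2\\ X_1\cup\dots\cup X_n=X}}\rho(X_1,\dots,X_n)\prod_{m=1}^n\dot A(X_m),$$ where $\rho(X_1,\dots,X_n)=\sum_g(-1)^{|g|}$, over the connected graphs $g$ on $\{1,\dots,n\}$ all of whose edges $\{i,j\}$ satisfy $X_i\cap X_j\neq\emptyset$. The argument $J|_X$ is suppressed. **Theorem.** One has the polymer representation $\mathcal Z(J)=\sum_{\{X_m\}}\prod_mA(X_m;J|_{X_m})$, the sum being over all partitions of $\mathbb L$. If $A(\{x\};J|_{\{x\}})\ne0$ for all $x$, then $$\log\mathcal Z(J)=\sum_{\emptyset\ne X\subset\mathbb L}W(X;J|_X)$$ as a formal Mayer series, that is: 1. As formal power series in a variable $z$, the series $\sum_xW(\{x\})+\sum_{|X|\ge2}\sum_{n\ge1}z^nW_n(X)$ is a logarithm of $\sum_{\{X_m\}}z^{\#\{m:\,|X_m|\ge2\}}\prod_mA(X_m)$ (whose value at $z=1$ is $\mathcal Z(J)$), where the constant terms are related by $\exp\sum_xW(\{x\})=\prod_xA(\{x\})$.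 2. If the series $\sum_nW_n(X)$ converges absolutely for every $X$ with $|X|\ge2$, then $\sum_XW(X;J|_X)$ is a logarithm of $\mathcal Z(J)$: $\exp\big(\sum_XW(X;J|_X)\big)=\mathcal Z(J)$. -/

import Mathlib

noncomputable section

open scoped ENNReal ContDiff

/-- The target space `Ξ = ℝ^N` of the fields, with its Euclidean norm. -/
abbrev Spin (N : ℕ) : Type := EuclideanSpace ℝ (Fin N)

/-- The set `P(ι)` of all unordered pairs `{x, y}`, `x ≠ y`, of elements of `ι`. -/
abbrev Pair (ι : Type*) : Type _ := {e : Sym2 ι // ¬ e.IsDiag}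

namespace ClusterExpansion

/-! ### Restrictions to a subset -/

/-- The restriction `φ|_X` of a field. -/
def restrictField {L S : Type*} (X : Finset L) (φ : L → S) : X → S := fun x => φ x

/-- The restriction `s|_X` of interpolation parameters to the pairs in `X`. -/
def restrictPairs {L : Type*} (X : Finset L) (s : Pair L → ℝ) : Pair X → ℝ :=
  fun e => s ⟨e.1.map Subtype.val,
    fun h => e.2 ((Sym2.isDiag_map Subtype.val_injective).1 h)⟩

/-- The block of the covariance matrix with both sites in `X`. -/
def restrictCov {L : Type*} {N : ℕ} (X : Finset L) (C : Matrix (L × Fin N) (L × Fin N) ℂ) :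
    Matrix (X × Fin N) (X × Fin N) ℂ :=
  C.submatrix (fun ξ => ((ξ.1 : L), ξ.2)) (fun ξ => ((ξ.1 : L), ξ.2))

/-! ### Partitions, trees and interpolation parameters -/

/-- The graph on `L` whose edges are the pairs with nonzero interpolation parameter. -/
def linkGraph {L : Type*} (s : Pair L → ℝ) : SimpleGraph L :=
  SimpleGraph.fromEdgeSet {e | ∃ h : ¬ e.IsDiag, s ⟨e, h⟩ ≠ 0}

open scoped Classical in
/-- The partition `𝒫(s)` of `L`: the finest one such that `s({x, y}) = 0` for any `x`, `y` in
different parts (see `componentPartition_isLeast`). -/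
def componentPartition {L : Type*} [Fintype L] [DecidableEq L] (s : Pair L → ℝ) :
    Finpartition (Finset.univ : Finset L) :=
  Finpartition.ofSetoid (linkGraph s).reachableSetoid

/-- The graph with edge set `T`. -/
def pairGraph {ι : Type*} (T : Finset (Pair ι)) : SimpleGraph ι :=
  SimpleGraph.fromEdgeSet (Subtype.val '' (T : Set (Pair ι)))

/-- `s^T({x, y})` for a tree or forest `T` with edge weights `w`: the minimum of the weights of the
edges on the `T`-path linking `x` and `y`, and `0` if there is no such path. -/
def treeInterp {ι : Type*} (T : Finset (Pair ι)) (w : T → ℝ) : Pair ι → ℝ := fun e =>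
  sInf {r | ∃ (ℓ : T) (x y : ι) (p : (pairGraph T).Walk x y),
    p.IsPath ∧ s(x, y) = e.1 ∧ ℓ.1.1 ∈ p.edges ∧ r = w ℓ}

/-- The interpolated covariance `C_s(x, y) = C(x, y) s({x, y})`, where `s({x, x}) = 1`. -/
def interpCov {ι : Type*} [DecidableEq ι] {N : ℕ} (C : Matrix (ι × Fin N) (ι × Fin N) ℂ)
    (s : Pair ι → ℝ) : Matrix (ι × Fin N) (ι × Fin N) ℂ := fun ξ η =>
  if h : ξ.1 = η.1 then C ξ η
  else C ξ η * (s ⟨s(ξ.1, η.1), fun hd => h (Sym2.mk_isDiag_iff.1 hd)⟩ : ℂ)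

/-! ### Gaussian measure and characteristic function -/

/-- The density `det(2πC)^{-1/2} exp(-⟨φ, C⁻¹ φ⟩ / 2)` of the complex Gaussian measure `μ_C` with
respect to Lebesgue measure. The square root is the canonical one for a matrix whose eigenvalues
`z` have positive real part, namely the product of the principal values of `(2πz)^{-1/2}` over
the eigenvalues counted with multiplicity. -/
def gaussianDensity {ι : Type*} [Fintype ι] [DecidableEq ι] {N : ℕ}
    (C : Matrix (ι × Fin N) (ι × Fin N) ℂ) (φ : ι → Spin N) : ℂ :=
  (C.charpoly.roots.map fun z : ℂ => (2 * (Real.pi : ℂ) * z) ^ (-(1 / 2) : ℂ)).prod *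
    Complex.exp (-(1 / 2) * ∑ ξ : ι × Fin N, ∑ η : ι × Fin N,
      (φ ξ.1 ξ.2 : ℂ) * C⁻¹ ξ η * (φ η.1 η.2 : ℂ))

/-- The fields with `|φ(x)| ≤ R` for all `x`; the cutoff `R = ∞` is allowed. -/
def smallFields (ι : Type*) (N : ℕ) (R : ℝ≥0∞) : Set (ι → Spin N) :=
  {φ | ∀ x, ENNReal.ofReal ‖φ x‖ ≤ R}

open scoped Classical in
/-- The characteristic function `χ_R(φ) = ∏_x χ(|φ(x)| ≤ R)`. -/
def cutoff {ι : Type*} [Fintype ι] {N : ℕ} (R : ℝ≥0∞) (φ : ι → Spin N) : ℂ :=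
  ∏ x, if ENNReal.ofReal ‖φ x‖ ≤ R then 1 else 0

/-- The partition function `Z = ∫ dμ_C(φ) χ_R(φ) e^{V(φ)}`. -/
def partitionFunction {ι : Type*} [Fintype ι] [DecidableEq ι] {N : ℕ}
    (C : Matrix (ι × Fin N) (ι × Fin N) ℂ) (R : ℝ≥0∞) (V : (ι → Spin N) → ℂ) : ℂ :=
  ∫ φ : ι → Spin N, gaussianDensity C φ * (cutoff R φ * Complex.exp (V φ))

/-! ### Derivatives -/

/-- The product over `ℓ ∈ F` of the operators `D ℓ`, applied to `f`. It is used for families of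
partial derivatives, which commute, so that the order of the factors is immaterial. -/
def applyAll {κ α : Type*} (F : Finset κ) (D : κ → α → α) (f : α) : α := F.toList.foldr D f

/-- The partial derivative `∂_{s(ℓ)}`. -/
def pairDeriv {ι : Type*} [DecidableEq ι] (ℓ : Pair ι) (f : (Pair ι → ℝ) → ℂ) :
    (Pair ι → ℝ) → ℂ :=
  fun s => lineDeriv ℝ f s (Pi.single ℓ 1)

/-- A function `G` of the field, regarded as a distribution `θ ↦ ∫ G(φ) θ(φ) dφ`. -/
def toDistribution {ι : Type*} [Fintype ι] {N : ℕ} (G : (ι → Spin N) → ℂ) :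
    ((ι → Spin N) → ℂ) → ℂ :=
  fun θ => ∫ φ : ι → Spin N, G φ * θ φ

/-- The weak derivative `∂_{φ(ξ)} u` of a distribution: `⟨∂u, θ⟩ = -⟨u, ∂θ⟩`. -/
def weakDeriv {ι : Type*} [DecidableEq ι] {N : ℕ} (ξ : ι × Fin N)
    (u : ((ι → Spin N) → ℂ) → ℂ) : ((ι → Spin N) → ℂ) → ℂ :=
  fun θ => -u fun φ => lineDeriv ℝ θ φ (Pi.single ξ.1 (EuclideanSpace.single ξ.2 1))

open scoped Classical in
/-- The operator `C(ℓ)∂_ℓ = ∑_{m,n} C((x,m),(y,n)) ∂_{φ(x,m)} ∂_{φ(y,n)}` for `ℓ = {x, y}`, acting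
on distributions. The sum below runs over both orderings of the pair `ℓ`, hence the factor `1/2`
(`C` is symmetric). -/
def covDeriv {ι : Type*} [Fintype ι] [DecidableEq ι] {N : ℕ}
    (C : Matrix (ι × Fin N) (ι × Fin N) ℂ) (ℓ : Pair ι)
    (u : ((ι → Spin N) → ℂ) → ℂ) : ((ι → Spin N) → ℂ) → ℂ :=
  fun θ => (1 / 2) * ∑ ξ : ι × Fin N, ∑ η : ι × Fin N,
    if s(ξ.1, η.1) = ℓ.1 then C ξ η * weakDeriv ξ (weakDeriv η u) θ else 0

/-! ### The activities -/

open scoped Classical in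
/-- The activity `∑_T ∫_T dφ ds A'(φ; s^T)`, where `T` runs over the trees on `ι` and `∫_T` is the
operator `∑_{F_C ⊔ F_V = T} ∫_0^1 ds^T ∫ dμ_{C_{s^T}}(φ) ∏_{ℓ ∈ F_C} C(ℓ)∂_ℓ χ_R(φ)
∏_{ℓ ∈ F_V} ∂_{s(ℓ)}`. The derivatives `∂_{s(ℓ)}` act on `A'` as a function of all the parameters
`s`, before `s = s^T` is inserted; the derivatives `C(ℓ)∂_ℓ` act in the weak sense on the product of
`χ_R` with the result, and the distribution so obtained is integrated against `μ_{C_{s^T}}`, that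
is, it is evaluated on the density of this measure. -/
def treeActivity {ι : Type*} [Fintype ι] [DecidableEq ι] {N : ℕ}
    (C : Matrix (ι × Fin N) (ι × Fin N) ℂ) (R : ℝ≥0∞)
    (A' : (ι → Spin N) → (Pair ι → ℝ) → ℂ) : ℂ :=
  ∑ T : Finset (Pair ι) with (pairGraph T).IsTree, ∑ FC ∈ T.powerset,
    ∫ w in (Set.Icc 0 1 : Set (T → ℝ)),
      applyAll FC (covDeriv C)
        (toDistribution fun φ =>
          cutoff R φ * applyAll (T \ FC) pairDeriv (A' φ) (treeInterp T w))
        (gaussianDensity (interpCov C (treeInterp T w)))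

/-- The activity `A(X; J|_X)` obtained from
`A'(X; φ; s; J) = exp (V₁(φ; s; J) + ∑_{x ∈ X} V₂(x; φ; s; J))` for fields on `X`. -/
def activity {L : Type*} [DecidableEq L] {N : ℕ}
    (C : Matrix (L × Fin N) (L × Fin N) ℂ) (R : ℝ≥0∞)
    (V₁ : (X : Finset L) → (X → Spin N) → (Pair X → ℝ) → (X → Spin N) → ℂ)
    (V₂ : (X : Finset L) → X → (X → Spin N) → (Pair X → ℝ) → (X → Spin N) → ℂ)
    (X : Finset L) (J : X → Spin N) : ℂ :=
  treeActivity (restrictCov X C) R fun φ s =>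
    Complex.exp (V₁ X φ s J + ∑ x : X, V₂ X x φ s J)

/-! ### The Mayer expansion -/

/-- The incidence graph of `Y₁, …, Yₙ`. -/
def incidenceGraph {L : Type*} {n : ℕ} (Y : Fin n → Finset L) : SimpleGraph (Fin n) where
  Adj i j := i ≠ j ∧ ¬ Disjoint (Y i) (Y j)
  symm := ⟨fun _ _ h => ⟨h.1.symm, fun hd => h.2 hd.symm⟩⟩
  loopless := ⟨fun _ h => h.1 rfl⟩

open scoped Classical in
/-- The Ursell function `ρ(Y₁, …, Yₙ) = ∑_g (-1)^{|g|}`, over the connected subgraphs `g` (on all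
of `{1, …, n}`) of the incidence graph. -/
def ursell {L : Type*} {n : ℕ} (Y : Fin n → Finset L) : ℂ :=
  ∑ g : SimpleGraph (Fin n) with g ≤ incidenceGraph Y ∧ g.Connected, (-1) ^ g.edgeSet.ncard

/-- The normalized activity `A(X) ∏_{x ∈ X} A({x})⁻¹`. -/
def normActivity {L : Type*} (A : Finset L → ℂ) (X : Finset L) : ℂ :=
  A X * ∏ x ∈ X, (A {x})⁻¹

open scoped Classical in
/-- The contribution to `W(X)`, `|X| ≥ 2`, of the unordered collections of `n` (not necessarily
distinct) polymers of size at least two whose union is `X`, as `1/n!` times a sum over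
sequences. -/
def mayerTerm {L : Type*} [Fintype L] (A : Finset L → ℂ) (X : Finset L) (n : ℕ) : ℂ :=
  (n.factorial : ℂ)⁻¹ *
    ∑ Y : Fin n → Finset L with (∀ m, 2 ≤ (Y m).card) ∧ Finset.univ.biUnion Y = X,
      ursell Y * ∏ m, normActivity A (Y m)

/-- `W(X)`: equal to `log A({x})` for `X = {x}`, and to the sum of the Mayer series if
`|X| ≥ 2`. -/
def mayerW {L : Type*} [Fintype L] (A : Finset L → ℂ) (X : Finset L) : ℂ :=
  if 2 ≤ X.card then ∑' n, mayerTerm A X n else Complex.log (A X)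

/-- `W(X)` as a formal power series in a variable that counts the polymers of size at least
two. -/
def mayerSeries {L : Type*} [Fintype L] (A : Finset L → ℂ) (X : Finset L) : PowerSeries ℂ :=
  if 2 ≤ X.card then PowerSeries.mk (mayerTerm A X) else PowerSeries.C (Complex.log (A X))

/-- The polymer sum `∑_{{X_m} ∈ 𝒫(L)} ∏_m A(X_m)` over all partitions of `L`. -/
def polymerSum {L : Type*} [Fintype L] [DecidableEq L] (A : Finset L → ℂ) : ℂ :=
  ∑ P : Finpartition (Finset.univ : Finset L), ∏ X ∈ P.parts, A X

/-- The polymer sum as a formal power series in a variable that counts the polymers of size at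
least two. -/
def polymerSeries {L : Type*} [Fintype L] [DecidableEq L] (A : Finset L → ℂ) : PowerSeries ℂ :=
  ∑ P : Finpartition (Finset.univ : Finset L), ∏ X ∈ P.parts,
    if 2 ≤ X.card then PowerSeries.C (A X) * PowerSeries.X else PowerSeries.C (A X)

/-- The formal power series `w` is a logarithm of `f`: the constant term of `w` is a complex
logarithm of that of `f`, and the rest of `w` is the formal logarithm of `f / f(0)`. -/
def IsFormalLog (w f : PowerSeries ℂ) : Prop :=
  Complex.exp (PowerSeries.constantCoeff w) = PowerSeries.constantCoeff f ∧
    PowerSeries.logOf (PowerSeries.C (PowerSeries.constantCoeff f)⁻¹ * f) =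
      w - PowerSeries.C (PowerSeries.constantCoeff w)

/-! ### Integrability without a cutoff -/

/-- The interpolated Boltzmann factor `e^{V(φ; s)}` and its derivatives `∏_{ℓ ∈ F} ∂_{s(ℓ)}`,
`F ⊆ T`, grow more slowly than any Gaussian in `φ`, uniformly over the parameters `s = s^T` of all
trees `T` on `ι` with weights in `(0, 1)`. -/
def SubGaussian {ι : Type*} [Fintype ι] [DecidableEq ι] {N : ℕ}
    (V : (ι → Spin N) → (Pair ι → ℝ) → ℂ) : Prop :=
  ∀ ε : ℝ, 0 < ε → ∃ K : ℝ, ∀ T : Finset (Pair ι), (pairGraph T).IsTree →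
    ∀ F : Finset (Pair ι), F ⊆ T → ∀ w : T → ℝ, (∀ ℓ, w ℓ ∈ Set.Ioo (0 : ℝ) 1) →
      ∀ φ : ι → Spin N,
        ‖applyAll F pairDeriv (fun s => Complex.exp (V φ s)) (treeInterp T w)‖ ≤
          K * Real.exp (ε * ∑ x, ‖φ x‖ ^ 2)

/-! ### The defining property of the partition of the interpolation parameters -/

theorem linkGraph_adj {L : Type*} (s : Pair L → ℝ) (e : Pair L) (x y : L) (h : s(x, y) = e.1)
    (hs : s e ≠ 0) : (linkGraph s).Adj x y := by
  obtain ⟨e, he⟩ := e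
  subst h
  exact (SimpleGraph.fromEdgeSet_adj _).2 ⟨⟨he, hs⟩, fun hxy => he (Sym2.mk_isDiag_iff.2 hxy)⟩

/-- `componentPartition s` is the finest partition such that `s` vanishes on all pairs with
elements in different parts. -/
theorem componentPartition_isLeast {L : Type*} [Fintype L] [DecidableEq L] (s : Pair L → ℝ) :
    IsLeast {P : Finpartition (Finset.univ : Finset L) |
      ∀ (e : Pair L) (x y : L), s(x, y) = e.1 → P.part x ≠ P.part y → s e = 0}
      (componentPartition s) := by
  classical
  have key : ∀ a b, b ∈ (componentPartition s).part a ↔ (linkGraph s).Reachable a b :=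
    fun a b => Finpartition.mem_part_ofSetoid_iff_rel
  constructor
  · intro e x y h hne
    by_contra hs
    refine hne ?_
    have := (key x y).2 (linkGraph_adj s e x y h hs).reachable
    exact ((componentPartition s).part_eq_of_mem
      ((componentPartition s).part_mem.2 (Finset.mem_univ x)) this).symm
  · intro P hP X hX
    obtain ⟨x, hx⟩ := (componentPartition s).nonempty_of_mem_parts hX
    refine ⟨P.part x, P.part_mem.2 (Finset.mem_univ x), fun y hy => ?_⟩
    have hX' : (componentPartition s).part x = X :=
      (componentPartition s).part_eq_of_mem hX hx
    have hr : (linkGraph s).Reachable x y := (key x y).1 (by rw [hX']; exact hy)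
    have hpart : P.part x = P.part y := by
      obtain ⟨p⟩ := hr
      clear hy hx hX'
      induction p with
      | nil => rfl
      | @cons u v w huv p ih =>
        refine Eq.trans ?_ ih
        obtain ⟨⟨hd, hs⟩, -⟩ := (SimpleGraph.fromEdgeSet_adj _).1 huv
        by_contra hne
        exact hs (hP ⟨_, hd⟩ u v rfl hne)
    rw [hpart]
    exact P.mem_part (Finset.mem_univ y)

end ClusterExpansion

end

/-! ### Combinatorics of the Mayer expansion -/

noncomputable section

open scoped ENNReal ContDiff

namespace ClusterExpansion

/-! ### Signed sums over graphs -/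

/-! The proof has two independent halves: an interpolation that produces the polymer sum, and a
combinatorial computation of its logarithm.

Fix `φ` and let `h(s)` be the density of `μ_{C_s}` at `φ` times `e^{V(φ; s)}`, so that `h(1)` is the
integrand of `Z` up to the cutoff. `forest_formula` writes `h(1)` as a sum over forests `F` of
integrals of `∏_{ℓ ∈ F} ∂_{s(ℓ)} h` at `s^F`. It arises by lowering a common value `u` of all
parameters from `1` to `0`: the fundamental theorem of calculus yields the value at `u = 0` plus
terms in which one pair is differentiated and becomes an edge. Its weight is frozen at the current
`u`, all pairs that the forest now links stay fixed, and the rest continue downwards.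

Between different trees of `F` the parameters `s^F` vanish, so the density and `e^V` both factor
over the trees. A forest is a partition with a tree on each part (`sum_forests`), and Fubini gives
the sum over partitions of products of activities (`IsLocal.integrand_eq_sum`,
`IsLocal.integral_eq_polymerSum`). On a single part, the Leibniz rule distributes the derivatives
over `F_C ⊔ F_V`. Those that hit the density become `C(ℓ)∂_ℓ` by the heat equation `∂_{s(ℓ)} ρ =
C(ℓ)∂_ℓ ρ`, and the definition of the weak derivative transfers them to the other factor, whose
cutoff is not smooth (`applyAll_covDeriv_toDistribution`).

The analysis rests on one positivity fact: if the numerical range of `C` lies in `Re z ≥ c`, so does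
that of `C_{s^F}`, because `s^F` has equivalence relations as level sets and `C_{s^F}` is thus an
average of block truncations of `C` (`Coercive.interpCov`). It makes all densities well defined,
smooth in `s` and uniformly Gaussian. The regularity of the local factors is not assumed but
recovered from that of `V` by extending fields and parameters by zero (`IsLocal.exists_const`,
`IsLocal.isRegular`).

For the logarithm, divide by the activities of the single points; what remains is a gas of polymers
with hard-core exclusion. The exclusion factor is a signed sum over all subgraphs of the overlap
graph (`graphSum_eq_ite`). Splitting off the component of a marked vertex gives `f' = w' f` for the
exponential generating functions of all and of connected graphs (`derivative_tupleSeries`), so `w`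
is the formal logarithm of `f`. If the Mayer series converge absolutely, the same equation holds on
`[0, 1)`, and continuity up to `1` gives `f(1) = exp w(1)` (`tsum_eq_exp_tsum`). -/

open scoped Classical in
/-- The sum of `(-1)^{|g|}` over all subgraphs `g` of `G`. -/
def graphSum {V : Type*} [Fintype V] (G : SimpleGraph V) : ℂ :=
  ∑ g : SimpleGraph V with g ≤ G, (-1) ^ g.edgeSet.ncard

open scoped Classical in
/-- The sum of `(-1)^{|g|}` over all connected spanning subgraphs `g` of `G`. -/
def connectedGraphSum {V : Type*} [Fintype V] (G : SimpleGraph V) : ℂ :=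
  ∑ g : SimpleGraph V with g ≤ G ∧ g.Connected, (-1) ^ g.edgeSet.ncard

/-- The disjoint union of a graph on `S` and a graph on the complement of `S`. -/
def glueGraphs {V : Type*} (S : Set V) (g₁ : SimpleGraph S) (g₂ : SimpleGraph (Sᶜ : Set V)) :
    SimpleGraph V :=
  g₁.map (Function.Embedding.subtype _) ⊔ g₂.map (Function.Embedding.subtype _)

theorem glueGraphs_adj {V : Type*} (S : Set V) (g₁ : SimpleGraph S)
    (g₂ : SimpleGraph (Sᶜ : Set V)) (a b : V) :
    (glueGraphs S g₁ g₂).Adj a b ↔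
      (∃ (ha : a ∈ S) (hb : b ∈ S), g₁.Adj ⟨a, ha⟩ ⟨b, hb⟩) ∨
        ∃ (ha : a ∈ Sᶜ) (hb : b ∈ Sᶜ), g₂.Adj ⟨a, ha⟩ ⟨b, hb⟩ := by
  simp only [glueGraphs, SimpleGraph.sup_adj, SimpleGraph.map_adj, Function.Embedding.subtype_apply,
    Subtype.exists]
  constructor
  · rintro (⟨x, hx, y, hy, h, rfl, rfl⟩ | ⟨x, hx, y, hy, h, rfl, rfl⟩)
    · exact Or.inl ⟨hx, hy, h⟩
    · exact Or.inr ⟨hx, hy, h⟩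
  · rintro (⟨hx, hy, h⟩ | ⟨hx, hy, h⟩)
    · exact Or.inl ⟨_, hx, _, hy, h, rfl, rfl⟩
    · exact Or.inr ⟨_, hx, _, hy, h, rfl, rfl⟩

theorem induce_glueGraphs_left {V : Type*} (S : Set V) (g₁ : SimpleGraph S)
    (g₂ : SimpleGraph (Sᶜ : Set V)) : (glueGraphs S g₁ g₂).induce S = g₁ := by
  ext a b
  rw [SimpleGraph.induce_adj, glueGraphs_adj]
  constructor
  · rintro (⟨_, _, h⟩ | ⟨h, _⟩)
    · exact h
    · exact absurd a.2 h
  · exact fun h => Or.inl ⟨a.2, b.2, h⟩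

theorem induce_glueGraphs_right {V : Type*} (S : Set V) (g₁ : SimpleGraph S)
    (g₂ : SimpleGraph (Sᶜ : Set V)) : (glueGraphs S g₁ g₂).induce Sᶜ = g₂ := by
  ext a b
  rw [SimpleGraph.induce_adj, glueGraphs_adj]
  constructor
  · rintro (⟨h, _⟩ | ⟨_, _, h⟩)
    · exact absurd h a.2
    · exact h
  · exact fun h => Or.inr ⟨a.2, b.2, h⟩

theorem ncard_edgeSet_glueGraphs {V : Type*} [Finite V] (S : Set V) (g₁ : SimpleGraph S)
    (g₂ : SimpleGraph (Sᶜ : Set V)) :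
    (glueGraphs S g₁ g₂).edgeSet.ncard = g₁.edgeSet.ncard + g₂.edgeSet.ncard := by
  rw [glueGraphs, SimpleGraph.edgeSet_sup, SimpleGraph.edgeSet_map, SimpleGraph.edgeSet_map,
    Set.ncard_union_eq, Set.ncard_image_of_injective _ (Function.Embedding.injective _),
    Set.ncard_image_of_injective _ (Function.Embedding.injective _)]
  rw [Set.disjoint_left]
  rintro _ ⟨e, -, rfl⟩ ⟨e', -, h⟩
  induction e with | _ a b
  induction e' with | _ c d
  have := congrArg (fun z => (a : V) ∈ z) h
  simp only [Function.Embedding.sym2Map_apply, Sym2.map_mk, Function.Embedding.subtype_apply,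
    Sym2.mem_iff, true_or, eq_iff_iff, iff_true] at this
  rcases this with h | h
  · exact c.2 (h ▸ a.2)
  · exact d.2 (h ▸ a.2)

theorem reachable_glueGraphs_iff {V : Type*} (S : Set V) (g₁ : SimpleGraph S)
    (g₂ : SimpleGraph (Sᶜ : Set V)) (hg₁ : g₁.Connected) (v : V) (hv : v ∈ S) (w : V) :
    (glueGraphs S g₁ g₂).Reachable v w ↔ w ∈ S := by
  constructor
  · rintro ⟨p⟩
    induction p with
    | nil => exact hv
    | cons h p ih =>
      refine ih ?_
      rcases (glueGraphs_adj S g₁ g₂ _ _).1 h with ⟨_, hb, _⟩ | ⟨ha, _⟩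
      · exact hb
      · exact absurd hv ha
  · intro hw
    let f : g₁ →g glueGraphs S g₁ g₂ :=
      ⟨Subtype.val, fun {a b} h => (glueGraphs_adj S g₁ g₂ _ _).2 (Or.inl ⟨a.2, b.2, h⟩)⟩
    exact (hg₁.preconnected ⟨v, hv⟩ ⟨w, hw⟩).map f

/-- A connected component has no edges to its complement, so cutting the graph along it loses
nothing. -/
theorem glueGraphs_induce {V : Type*} (g : SimpleGraph V) (v : V) (S : Set V)
    (hS : ∀ w, w ∈ S ↔ g.Reachable v w) : glueGraphs S (g.induce S) (g.induce Sᶜ) = g := by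
  ext a b
  rw [glueGraphs_adj]
  constructor
  · rintro (⟨_, _, h⟩ | ⟨_, _, h⟩) <;> exact h
  · intro h
    by_cases ha : a ∈ S
    · exact Or.inl ⟨ha, (hS b).2 (((hS a).1 ha).trans h.reachable), h⟩
    · refine Or.inr ⟨ha, fun hb => ha ((hS a).2 (((hS b).1 hb).trans h.symm.reachable)), h⟩

theorem connected_induce_of_reachable {V : Type*} (g : SimpleGraph V) (v : V) (S : Set V)
    (hS : ∀ w, w ∈ S ↔ g.Reachable v w) : (g.induce S).Connected := by
  have : S = (g.connectedComponentMk v).supp := by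
    ext w
    rw [hS, SimpleGraph.ConnectedComponent.mem_supp_iff, SimpleGraph.ConnectedComponent.eq]
    exact ⟨fun h => h.symm, fun h => h.symm⟩
  subst this
  exact SimpleGraph.ConnectedComponent.connected_toSimpleGraph _

-- Subgraphs are sorted by the component `S` of the marked vertex `v`: on `S` the graph is
-- connected, on the complement it is arbitrary, and the sign is multiplicative.
open scoped Classical in
theorem graphSum_eq_sum_component {V : Type*} [Fintype V] (G : SimpleGraph V) (v : V) :
    graphSum G = ∑ S : Finset V with v ∈ S,
      connectedGraphSum (G.induce (S : Set V)) * graphSum (G.induce ((S : Set V)ᶜ)) := by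
  let comp : SimpleGraph V → Finset V := fun g => Finset.univ.filter fun w => g.Reachable v w
  rw [graphSum, ← Finset.sum_fiberwise_of_maps_to (g := comp)
    (t := Finset.univ.filter fun S => v ∈ S)
    (fun g _ => by simp only [comp, Finset.mem_filter, Finset.mem_univ, true_and]; exact .rfl)]
  refine Finset.sum_congr rfl fun S hS => ?_
  rw [connectedGraphSum, graphSum, Finset.sum_mul_sum, ← Finset.sum_product']
  simp only [Finset.mem_filter, Finset.mem_univ, true_and] at hS
  have hcomp : ∀ g, comp g = S ↔ ∀ w, w ∈ (S : Set V) ↔ g.Reachable v w := by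
    intro g
    simp only [comp, Finset.ext_iff, Finset.mem_filter, Finset.mem_univ, true_and,
      Finset.mem_coe, iff_comm]
  refine Finset.sum_bij' (fun g _ => (g.induce (S : Set V), g.induce ((S : Set V)ᶜ)))
    (fun p _ => glueGraphs (S : Set V) p.1 p.2) ?_ ?_ ?_ ?_ ?_
  · intro g hg
    simp only [Finset.mem_filter, Finset.mem_univ, true_and, hcomp] at hg
    simp only [Finset.mem_product, Finset.mem_filter, Finset.mem_univ, true_and]
    exact ⟨⟨fun a b h => hg.1 h, connected_induce_of_reachable g v _ hg.2⟩, fun a b h => hg.1 h⟩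
  · rintro ⟨g₁, g₂⟩ hg
    simp only [Finset.mem_product, Finset.mem_filter, Finset.mem_univ, true_and] at hg
    simp only [Finset.mem_filter, Finset.mem_univ, true_and, hcomp]
    refine ⟨fun a b h => ?_, fun w => (reachable_glueGraphs_iff _ g₁ g₂ hg.1.2 v hS w).symm⟩
    rcases (glueGraphs_adj _ g₁ g₂ _ _).1 h with ⟨_, _, h⟩ | ⟨_, _, h⟩
    · exact hg.1.1 h
    · exact hg.2 h
  · intro g hg
    simp only [Finset.mem_filter, Finset.mem_univ, true_and, hcomp] at hg
    exact glueGraphs_induce g v _ hg.2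
  · rintro ⟨g₁, g₂⟩ hg
    exact Prod.ext (induce_glueGraphs_left _ _ _) (induce_glueGraphs_right _ _ _)
  · intro g hg
    simp only [Finset.mem_filter, Finset.mem_univ, true_and, hcomp] at hg
    rw [← pow_add, ← ncard_edgeSet_glueGraphs, glueGraphs_induce g v _ hg.2]

theorem ncard_edgeSet_comap {V W : Type*} (e : V ≃ W) (g : SimpleGraph W) :
    (g.comap e).edgeSet.ncard = g.edgeSet.ncard :=
  Nat.card_congr (SimpleGraph.Iso.comap e g).mapEdgeSet

theorem graphSum_comap {V W : Type*} [Fintype V] [Fintype W] (e : V ≃ W) (G : SimpleGraph W) :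
    graphSum (G.comap e) = graphSum G := by
  classical
  refine (Finset.sum_bij' (fun g _ => g.comap e) (fun g _ => g.comap e.symm) ?_ ?_ ?_ ?_ ?_).symm
  · intro g hg
    simp only [Finset.mem_filter, Finset.mem_univ, true_and] at hg ⊢
    exact fun a b h => hg h
  · intro g hg
    simp only [Finset.mem_filter, Finset.mem_univ, true_and] at hg ⊢
    intro a b h
    simpa using hg h
  · intro g _; ext; simp
  · intro g _; ext; simp
  · intro g _; rw [ncard_edgeSet_comap]

theorem connectedGraphSum_comap {V W : Type*} [Fintype V] [Fintype W] (e : V ≃ W)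
    (G : SimpleGraph W) : connectedGraphSum (G.comap e) = connectedGraphSum G := by
  classical
  refine (Finset.sum_bij' (fun g _ => g.comap e) (fun g _ => g.comap e.symm) ?_ ?_ ?_ ?_ ?_).symm
  · intro g hg
    simp only [Finset.mem_filter, Finset.mem_univ, true_and] at hg ⊢
    exact ⟨fun a b h => hg.1 h, (SimpleGraph.Iso.comap e g).connected_iff.2 hg.2⟩
  · intro g hg
    simp only [Finset.mem_filter, Finset.mem_univ, true_and] at hg ⊢
    exact ⟨fun a b h => by simpa using hg.1 h,
      (SimpleGraph.Iso.comap e.symm g).connected_iff.2 hg.2⟩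
  · intro g _; ext; simp
  · intro g _; ext; simp
  · intro g _; rw [ncard_edgeSet_comap]

/-- The alternating sum over all sets of edges is `(1 - 1)` to the number of edges of `G`. For an
overlap graph it is therefore the indicator of pairwise disjointness. -/
theorem graphSum_eq_ite {V : Type*} [Fintype V] (G : SimpleGraph V) [Decidable (G = ⊥)] :
    graphSum G = if G = ⊥ then 1 else 0 := by
  classical
  have h : graphSum G = ∑ E ∈ G.edgeSet.toFinset.powerset, (-1 : ℂ) ^ E.card := by
    refine Finset.sum_bij' (fun g _ => g.edgeSet.toFinset)
      (fun E _ => SimpleGraph.fromEdgeSet (E : Set (Sym2 V))) ?_ ?_ ?_ ?_ ?_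
    · intro g hg
      simp only [Finset.mem_filter, Finset.mem_univ, true_and] at hg
      simpa using hg
    · intro E hE
      simp only [Finset.mem_filter, Finset.mem_univ, true_and, Finset.mem_powerset] at hE ⊢
      intro a b hab
      rw [SimpleGraph.fromEdgeSet_adj] at hab
      simpa using hE hab.1
    · intro g hg
      simp
    · intro E hE
      have hE' : (E : Set (Sym2 V)) ⊆ G.edgeSet := by simpa using hE
      ext e
      simp only [SimpleGraph.edgeSet_fromEdgeSet, Set.mem_toFinset, Set.mem_sdiff, Finset.mem_coe]
      exact ⟨fun h => h.1, fun h => ⟨h, G.not_isDiag_of_mem_edgeSet (hE' h)⟩⟩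
    · intro g hg
      rw [Set.ncard_eq_toFinset_card']
  rw [h]
  have := Finset.sum_powerset_neg_one_pow_card (x := G.edgeSet.toFinset)
  have h2 := congrArg (Int.cast : ℤ → ℂ) this
  push_cast at h2
  rw [h2]
  simp

end ClusterExpansion

end

noncomputable section

open scoped ENNReal ContDiff

namespace ClusterExpansion

/-! ### Sums over tuples of polymers -/

/-- The graph of all intersecting pairs of a family of sets. -/
def overlapGraph {L V : Type*} (Y : V → Finset L) : SimpleGraph V where
  Adj i j := i ≠ j ∧ ¬ Disjoint (Y i) (Y j)
  symm := ⟨fun _ _ h => ⟨h.1.symm, fun hd => h.2 hd.symm⟩⟩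
  loopless := ⟨fun _ h => h.1 rfl⟩

theorem ursell_eq_connectedGraphSum {L : Type*} {n : ℕ} (Y : Fin n → Finset L) :
    ursell Y = connectedGraphSum (overlapGraph Y) := by
  classical
  unfold ursell connectedGraphSum
  refine Finset.sum_congr ?_ fun _ _ => rfl
  ext g
  simp only [Finset.mem_filter, Finset.mem_univ, true_and]
  exact Iff.rfl

/-- The sum over families of pairwise disjoint polymers with activities `b`. -/
def tupleSum {L : Type*} [Fintype L] (b : Finset L → ℂ) (V : Type*) [Fintype V] [DecidableEq V] :
    ℂ :=
  ∑ Y : V → Finset L, graphSum (overlapGraph Y) * ∏ v, b (Y v)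

/-- The sum over families of polymers with activities `b`, weighted with the Ursell function. -/
def connectedTupleSum {L : Type*} [Fintype L] (b : Finset L → ℂ) (V : Type*) [Fintype V]
    [DecidableEq V] : ℂ :=
  ∑ Y : V → Finset L, connectedGraphSum (overlapGraph Y) * ∏ v, b (Y v)

theorem tupleSum_congr {L : Type*} [Fintype L] (b : Finset L → ℂ) {V W : Type*} [Fintype V]
    [DecidableEq V] [Fintype W] [DecidableEq W] (e : V ≃ W) : tupleSum b V = tupleSum b W := by
  refine Fintype.sum_equiv (e.arrowCongr (Equiv.refl _)) _ _ fun Y => ?_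
  rw [← graphSum_comap e]
  congr 1
  · congr 1
    ext i j
    simp [overlapGraph]
  · exact Fintype.prod_equiv e _ _ fun v => by simp

theorem connectedTupleSum_congr {L : Type*} [Fintype L] (b : Finset L → ℂ) {V W : Type*}
    [Fintype V] [DecidableEq V] [Fintype W] [DecidableEq W] (e : V ≃ W) :
    connectedTupleSum b V = connectedTupleSum b W := by
  refine Fintype.sum_equiv (e.arrowCongr (Equiv.refl _)) _ _ fun Y => ?_
  rw [← connectedGraphSum_comap e]
  congr 1
  · congr 1
    ext i j
    simp [overlapGraph]
  · exact Fintype.prod_equiv e _ _ fun v => by simp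

/-- A family indexed by `V` is a pair of families, on `S` and on its complement, and each factor
depends on one of the two only. -/
theorem sum_induce_mul_induce {L : Type*} [Fintype L] (b : Finset L → ℂ) {V : Type*}
    [Fintype V] [DecidableEq V] (S : Set V) [Fintype S] [Fintype (Sᶜ : Set V)] :
    ∑ Y : V → Finset L, connectedGraphSum ((overlapGraph Y).induce S) *
      graphSum ((overlapGraph Y).induce Sᶜ) * ∏ v, b (Y v) =
      connectedTupleSum b S * tupleSum b (Sᶜ : Set V) := by
  classical
  have h : ∀ Y : V → Finset L, ∏ v, b (Y v) =
      (∏ v : S, b (Y v)) * ∏ v : (Sᶜ : Set V), b (Y v) := fun Y => by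
    rw [← Fintype.prod_subtype_mul_prod_subtype (· ∈ S) fun v => b (Y v)]
    congr!
  have h1 : ∀ Y : V → Finset L, (overlapGraph Y).induce S = overlapGraph fun v : S => Y v := by
    intro Y
    ext i j
    exact and_congr_left' Subtype.coe_injective.ne_iff
  have h2 : ∀ Y : V → Finset L, (overlapGraph Y).induce Sᶜ =
      overlapGraph fun v : (Sᶜ : Set V) => Y v := by
    intro Y
    ext i j
    exact and_congr_left' Subtype.coe_injective.ne_iff
  simp_rw [h, h1, h2]
  rw [connectedTupleSum, tupleSum, Finset.sum_mul_sum, ← Finset.sum_product']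
  refine Finset.sum_bij' (fun Y _ => (fun v : S => Y v, fun v : (Sᶜ : Set V) => Y v))
    (fun p _ v => if hv : v ∈ S then p.1 ⟨v, hv⟩ else p.2 ⟨v, hv⟩) ?_ ?_ ?_ ?_ ?_
  · exact fun _ _ => Finset.mem_univ _
  · exact fun _ _ => Finset.mem_univ _
  · intro Y _
    funext v
    simp
  · rintro ⟨Y₁, Y₂⟩ _
    refine Prod.ext ?_ ?_
    · funext v
      simp
    · funext v
      simp [show (v : V) ∉ S from v.2]
  · intro Y _
    exact mul_mul_mul_comm _ _ _ _

open scoped Classical in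
theorem tupleSum_eq_sum_component {L : Type*} [Fintype L] (b : Finset L → ℂ) {V : Type*}
    [Fintype V] [DecidableEq V] (v : V) :
    tupleSum b V = ∑ S : Finset V with v ∈ S,
      connectedTupleSum b (S : Set V) * tupleSum b ((S : Set V)ᶜ : Set V) := by
  rw [tupleSum]
  simp_rw [graphSum_eq_sum_component _ v, Finset.sum_mul]
  rw [Finset.sum_comm]
  refine Finset.sum_congr (by ext S; simp) fun S _ => ?_
  rw [← sum_induce_mul_induce]
  refine Finset.sum_congr rfl fun Y _ => ?_
  congr!

/-- The component of the vertex `0` consists of `0` and `k` of the other `n` vertices; by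
relabelling, its contribution depends on `k` alone. -/
theorem tupleSum_succ {L : Type*} [Fintype L] (b : Finset L → ℂ) (n : ℕ) :
    tupleSum b (Fin (n + 1)) = ∑ k ∈ Finset.range (n + 1),
      (n.choose k : ℂ) * (connectedTupleSum b (Fin (k + 1)) * tupleSum b (Fin (n - k))) := by
  classical
  rw [tupleSum_eq_sum_component b (0 : Fin (n + 1))]
  have h1 : ∀ S : Finset (Fin (n + 1)), connectedTupleSum b (S : Set (Fin (n + 1))) *
      tupleSum b ((S : Set (Fin (n + 1)))ᶜ : Set (Fin (n + 1))) =
      connectedTupleSum b (Fin S.card) * tupleSum b (Fin (n + 1 - S.card)) := by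
    intro S
    congr 1
    · exact connectedTupleSum_congr b (Fintype.equivFinOfCardEq (by simp))
    · refine tupleSum_congr b (Fintype.equivFinOfCardEq ?_)
      rw [Fintype.card_compl_set]
      simp
  simp_rw [h1]
  have hc : ((Finset.univ : Finset (Fin (n + 1))).erase 0).card = n := by simp
  have h2 := Finset.sum_powerset_apply_card (fun k => connectedTupleSum b (Fin (k + 1)) *
    tupleSum b (Fin (n - k))) (x := (Finset.univ : Finset (Fin (n + 1))).erase 0)
  rw [hc] at h2
  simp_rw [nsmul_eq_mul] at h2
  rw [← h2]
  refine Finset.sum_bij' (fun S _ => S.erase 0) (fun S _ => insert 0 S) ?_ ?_ ?_ ?_ ?_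
  · intro S _
    rw [Finset.mem_powerset]
    exact Finset.erase_subset_erase _ (Finset.subset_univ _)
  · intro S _
    simp
  · intro S hS
    simp only [Finset.mem_filter, Finset.mem_univ, true_and] at hS
    exact Finset.insert_erase hS
  · intro S hS
    rw [Finset.mem_powerset] at hS
    exact Finset.erase_insert fun h => by simpa using hS h
  · intro S hS
    simp only [Finset.mem_filter, Finset.mem_univ, true_and] at hS
    have := Finset.card_erase_add_one hS
    rw [this, show n - (S.erase 0).card = n + 1 - S.card by omega]

theorem connectedTupleSum_zero {L : Type*} [Fintype L] (b : Finset L → ℂ) :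
    connectedTupleSum b (Fin 0) = 0 := by
  classical
  refine Finset.sum_eq_zero fun Y _ => ?_
  have : connectedGraphSum (overlapGraph Y) = 0 := by
    rw [connectedGraphSum, Finset.filter_false_of_mem, Finset.sum_empty]
    rintro g - ⟨-, hg⟩
    exact hg.nonempty.elim fun i => i.elim0
  rw [this, zero_mul]

theorem tupleSum_zero {L : Type*} [Fintype L] (b : Finset L → ℂ) : tupleSum b (Fin 0) = 1 := by
  classical
  have : ∀ Y : Fin 0 → Finset L, graphSum (overlapGraph Y) = 1 := fun Y => by
    rw [graphSum_eq_ite, if_pos (Subsingleton.elim _ _)]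
  simp [tupleSum, this]

/-! ### The formal logarithm -/

-- Substituting `F - 1` into the geometric series inverts `F`, so the formal logarithm of `F` has
-- the derivative `F' / F = G'`; both sides have constant term zero.
open PowerSeries in
theorem logOf_eq_of_derivative {F G : PowerSeries ℂ} (hF : constantCoeff F = 1)
    (hG : constantCoeff G = 0) (h : d⁄dX ℂ F = d⁄dX ℂ G * F) : logOf F = G := by
  have hsub : HasSubst (F - 1) := HasSubst.of_constantCoeff_zero' (by simp [hF])
  refine derivative.ext ?_ ?_
  · rw [logOf_eq, derivative_subst hsub, deriv_log]
    have h1 : (mk fun n ↦ algebraMap ℚ ℂ ((-1 : ℚ) ^ n)) * (1 + X : PowerSeries ℂ) = 1 := by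
      ext n
      cases n with
      | zero => simp [mul_add]
      | succ n => simp [mul_add, coeff_succ_mul_X, coeff_one, pow_succ]
    have h2 := congrArg (fun f => PowerSeries.subst (F - 1) f) h1
    simp only [subst_mul hsub, subst_add hsub, subst_X hsub] at h2
    have h3 : PowerSeries.subst (F - 1) (1 : PowerSeries ℂ) = 1 := by
      rw [← coe_substAlgHom hsub, map_one]
    rw [h3, add_sub_cancel] at h2
    rw [map_sub, derivative_one, sub_zero, h]
    rw [← mul_one (d⁄dX ℂ G)] 
    conv_rhs => rw [← h2]
    ring
  · rw [constantCoeff_logOf hF, hG]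

/-- The generating function of the sums over tuples of pairwise disjoint polymers. -/
def tupleSeries {L : Type*} [Fintype L] (b : Finset L → ℂ) : PowerSeries ℂ :=
  PowerSeries.mk fun n => (n.factorial : ℂ)⁻¹ * tupleSum b (Fin n)

/-- The generating function of the Ursell-weighted sums over tuples of polymers. -/
def connectedTupleSeries {L : Type*} [Fintype L] (b : Finset L → ℂ) : PowerSeries ℂ :=
  PowerSeries.mk fun n => (n.factorial : ℂ)⁻¹ * connectedTupleSum b (Fin n)

-- Division by the factorials turns the binomial recursion `tupleSum_succ` into a Cauchy product.
open PowerSeries in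
theorem derivative_tupleSeries {L : Type*} [Fintype L] (b : Finset L → ℂ) :
    d⁄dX ℂ (tupleSeries b) = d⁄dX ℂ (connectedTupleSeries b) * tupleSeries b := by
  ext n
  rw [coeff_derivative, coeff_mul, Finset.Nat.sum_antidiagonal_eq_sum_range_succ_mk]
  simp only [coeff_derivative, tupleSeries, connectedTupleSeries, coeff_mk]
  rw [tupleSum_succ, Finset.mul_sum, Finset.sum_mul]
  refine Finset.sum_congr rfl fun k hk => ?_
  have hk' : k ≤ n := by simpa [Nat.lt_succ_iff] using hk
  rw [Nat.cast_choose ℂ hk', Nat.factorial_succ, Nat.factorial_succ]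
  have h1 := Nat.cast_ne_zero (R := ℂ).2 n.factorial_ne_zero
  have h2 := Nat.cast_ne_zero (R := ℂ).2 k.factorial_ne_zero
  have h3 := Nat.cast_ne_zero (R := ℂ).2 (n - k).factorial_ne_zero
  have h4 := Nat.cast_add_one_ne_zero (R := ℂ) n
  have h5 := Nat.cast_add_one_ne_zero (R := ℂ) k
  push_cast
  field_simp

theorem constantCoeff_tupleSeries {L : Type*} [Fintype L] (b : Finset L → ℂ) :
    PowerSeries.constantCoeff (tupleSeries b) = 1 := by
  simp [tupleSeries, ← PowerSeries.coeff_zero_eq_constantCoeff_apply, tupleSum_zero]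

theorem constantCoeff_connectedTupleSeries {L : Type*} [Fintype L] (b : Finset L → ℂ) :
    PowerSeries.constantCoeff (connectedTupleSeries b) = 0 := by
  simp [connectedTupleSeries, ← PowerSeries.coeff_zero_eq_constantCoeff_apply,
    connectedTupleSum_zero]

theorem logOf_tupleSeries {L : Type*} [Fintype L] (b : Finset L → ℂ) :
    PowerSeries.logOf (tupleSeries b) = connectedTupleSeries b :=
  logOf_eq_of_derivative (constantCoeff_tupleSeries b) (constantCoeff_connectedTupleSeries b)
    (derivative_tupleSeries b)

end ClusterExpansion

end

noncomputable section

open scoped ENNReal ContDiff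

namespace ClusterExpansion

/-! ### The polymer sum as a sum over tuples of disjoint polymers -/

/-- A family of pairwise disjoint sets of size at least two. -/
def IsPolymerFamily {L : Type*} (𝒮 : Finset (Finset L)) : Prop :=
  (∀ X ∈ 𝒮, 2 ≤ X.card) ∧ (𝒮 : Set (Finset L)).PairwiseDisjoint id

/-- The partition with a given family of disjoint parts and all other points as singletons. -/
def partitionOfPolymers {L : Type*} [Fintype L] [DecidableEq L] (𝒮 : Finset (Finset L))
    (h2 : ∀ X ∈ 𝒮, 2 ≤ X.card) (hd : (𝒮 : Set (Finset L)).PairwiseDisjoint id) :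
    Finpartition (Finset.univ : Finset L) :=
  Finpartition.ofExistsUnique
    (𝒮 ∪ (Finset.univ.filter fun x : L => ∀ X ∈ 𝒮, x ∉ X).image fun x => {x})
    (fun _ _ => Finset.subset_univ _)
    (by
      intro x _
      by_cases hx : ∀ X ∈ 𝒮, x ∉ X
      · refine ⟨{x}, ⟨Finset.mem_union_right _ (Finset.mem_image.2 ⟨x, by simpa using hx, rfl⟩),
          Finset.mem_singleton_self x⟩, ?_⟩
        rintro Y ⟨hY, hxY⟩
        rcases Finset.mem_union.1 hY with hY | hY
        · exact absurd hxY (hx Y hY)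
        · obtain ⟨y, -, rfl⟩ := Finset.mem_image.1 hY
          rw [Finset.mem_singleton.1 hxY]
      · push Not at hx
        obtain ⟨X, hX, hxX⟩ := hx
        refine ⟨X, ⟨Finset.mem_union_left _ hX, hxX⟩, ?_⟩
        rintro Y ⟨hY, hxY⟩
        rcases Finset.mem_union.1 hY with hY | hY
        · exact hd.elim_finset hY hX x hxY hxX
        · obtain ⟨y, hy, rfl⟩ := Finset.mem_image.1 hY
          rw [Finset.mem_singleton.1 hxY] at hxX
          simp only [Finset.mem_filter, Finset.mem_univ, true_and] at hy
          exact absurd hxX (hy X hX))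
    (by
      intro h
      rcases Finset.mem_union.1 h with h | h
      · simpa using h2 _ h
      · obtain ⟨y, -, hy⟩ := Finset.mem_image.1 h
        exact Finset.singleton_ne_empty y hy)

-- A partition is determined by its parts of size at least two, because all remaining points are
-- singletons, and every disjoint family of such sets occurs.
open scoped Classical in
theorem sum_finpartition_eq_sum_polymers {L M : Type*} [Fintype L] [DecidableEq L]
    [AddCommMonoid M] (g : Finset (Finset L) → M) :
    ∑ P : Finpartition (Finset.univ : Finset L), g (P.parts.filter fun X => 2 ≤ X.card) =
      ∑ 𝒮 : Finset (Finset L) with IsPolymerFamily 𝒮, g 𝒮 := by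
  have key : ∀ (P : Finpartition (Finset.univ : Finset L)) (x : L),
      (∀ X ∈ P.parts.filter fun X => 2 ≤ X.card, x ∉ X) ↔ {x} ∈ P.parts := by
    intro P x
    have hx := P.part_mem.2 (Finset.mem_univ x)
    have hx' := P.mem_part (Finset.mem_univ x)
    constructor
    · intro h
      have h1 : ¬ 2 ≤ (P.part x).card := fun h2 => h _ (by simp [h2, hx]) hx'
      have : P.part x = {x} := by
        rw [Finset.eq_singleton_iff_unique_mem]
        refine ⟨hx', fun y hy => ?_⟩
        exact Finset.card_le_one.1 (by omega) _ hy _ hx'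
      rwa [← this]
    · intro h X hX hxX
      rw [Finset.mem_filter] at hX
      have := P.eq_of_mem_parts hX.1 h hxX (Finset.mem_singleton_self x)
      subst this
      simp at hX
  refine Finset.sum_bij' (fun P _ => P.parts.filter fun X => 2 ≤ X.card)
    (fun 𝒮 h => partitionOfPolymers 𝒮 (Finset.mem_filter.1 h).2.1 (Finset.mem_filter.1 h).2.2)
    ?_ ?_ ?_ ?_ ?_
  · intro P _
    simp only [Finset.mem_filter, Finset.mem_univ, true_and]
    exact ⟨fun X hX => (Finset.mem_filter.1 hX).2, P.disjoint.subset (by simp [Set.subset_def]; tauto)⟩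
  · exact fun _ _ => Finset.mem_univ _
  · intro P _
    refine Finpartition.ext ?_
    change _ ∪ _ = _
    ext X
    rw [Finset.mem_union, Finset.mem_image]
    simp only [Finset.mem_filter (s := (Finset.univ : Finset L)), Finset.mem_univ, true_and, key]
    constructor
    · rintro (h | ⟨x, hx, rfl⟩)
      · exact (Finset.mem_filter.1 h).1
      · exact hx
    · intro hX
      by_cases h2 : 2 ≤ X.card
      · exact Or.inl (Finset.mem_filter.2 ⟨hX, h2⟩)
      · obtain ⟨x, hx⟩ := P.nonempty_of_mem_parts hX
        have : X = {x} := by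
          rw [Finset.eq_singleton_iff_unique_mem]
          exact ⟨hx, fun y hy => Finset.card_le_one.1 (by omega) _ hy _ hx⟩
        exact Or.inr ⟨x, this ▸ hX, this.symm⟩
  · intro 𝒮 h
    have h2 := (Finset.mem_filter.1 h).2.1
    change (𝒮 ∪ _).filter _ = 𝒮
    ext X
    rw [Finset.mem_filter, Finset.mem_union, Finset.mem_image]
    constructor
    · rintro ⟨hX | ⟨x, -, rfl⟩, hc⟩
      · exact hX
      · simp at hc
    · exact fun hX => ⟨Or.inl hX, h2 X hX⟩
  · exact fun _ _ => rfl

open scoped Classical in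
theorem card_injective_image_eq {α : Type*} [Fintype α] (𝒮 : Finset α) :
    (Finset.univ.filter fun Y : Fin 𝒮.card → α =>
      Function.Injective Y ∧ Finset.univ.image Y = 𝒮).card = 𝒮.card.factorial := by
  have h := Fintype.card_equiv 𝒮.equivFin.symm
  rw [Fintype.card_fin] at h
  rw [← h, ← Finset.card_univ]
  symm
  refine Finset.card_bij (fun e _ => fun i => (e i : α)) ?_ ?_ ?_
  · intro e _
    simp only [Finset.mem_filter, Finset.mem_univ, true_and]
    refine ⟨Subtype.coe_injective.comp e.injective, ?_⟩
    ext x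
    simp only [Finset.mem_image, Finset.mem_univ, true_and]
    exact ⟨fun ⟨i, hi⟩ => hi ▸ (e i).2, fun hx => ⟨e.symm ⟨x, hx⟩, by simp⟩⟩
  · intro e _ e' _ h
    ext i
    exact congrFun h i
  · intro Y hY
    simp only [Finset.mem_filter, Finset.mem_univ, true_and] at hY
    have hmem : ∀ i, Y i ∈ 𝒮 := fun i => hY.2 ▸ Finset.mem_image_of_mem Y (Finset.mem_univ i)
    refine ⟨Equiv.ofBijective (fun i => (⟨Y i, hmem i⟩ : 𝒮)) ⟨?_, ?_⟩, Finset.mem_univ _, rfl⟩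
    · exact fun i j hij => hY.1 (congrArg Subtype.val hij)
    · rintro ⟨x, hx⟩
      rw [← hY.2] at hx
      obtain ⟨i, -, hi⟩ := Finset.mem_image.1 hx
      exact ⟨i, Subtype.ext hi⟩

theorem overlapGraph_eq_bot_iff {L V : Type*} (Y : V → Finset L) :
    overlapGraph Y = ⊥ ↔ ∀ i j, i ≠ j → Disjoint (Y i) (Y j) := by
  rw [← SimpleGraph.edgeSet_eq_empty, Set.eq_empty_iff_forall_notMem]
  constructor
  · intro h i j hij
    by_contra hd
    exact h s(i, j) ⟨hij, hd⟩
  · intro h e he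
    induction e with | _ i j
    exact he.2 (h i j he.1)

-- Disjoint nonempty sets are distinct, so a pairwise disjoint tuple enumerates a family, and a
-- family of `n` polymers has `n!` enumerations. This factor cancels the `1 / n!` of the generating
-- function.
open scoped Classical in
theorem tupleSum_eq_sum_polymers {L : Type*} [Fintype L] (a : Finset L → ℂ) (n : ℕ) :
    tupleSum (fun X => if 2 ≤ X.card then a X else 0) (Fin n) =
      n.factorial * ∑ 𝒮 : Finset (Finset L) with
        IsPolymerFamily 𝒮 ∧ 𝒮.card = n, ∏ X ∈ 𝒮, a X := by
  have h1 : tupleSum (fun X => if 2 ≤ X.card then a X else 0) (Fin n) =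
      ∑ Y : Fin n → Finset L with (∀ i, 2 ≤ (Y i).card) ∧ ∀ i j, i ≠ j → Disjoint (Y i) (Y j),
        ∏ i, a (Y i) := by
    rw [tupleSum, Finset.sum_filter]
    refine Finset.sum_congr rfl fun Y _ => ?_
    rw [graphSum_eq_ite]
    by_cases hd : ∀ i j, i ≠ j → Disjoint (Y i) (Y j)
    · rw [if_pos ((overlapGraph_eq_bot_iff Y).2 hd), one_mul]
      by_cases h2 : ∀ i, 2 ≤ (Y i).card
      · rw [if_pos ⟨h2, hd⟩]
        exact Finset.prod_congr rfl fun i _ => if_pos (h2 i)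
      · rw [if_neg fun h => h2 h.1]
        push Not at h2
        obtain ⟨i, hi⟩ := h2
        exact Finset.prod_eq_zero (Finset.mem_univ i) (if_neg (by omega))
    · rw [if_neg fun h => hd ((overlapGraph_eq_bot_iff Y).1 h), if_neg fun h => hd h.2, zero_mul]
  have hinj : ∀ Y : Fin n → Finset L, (∀ i, 2 ≤ (Y i).card) →
      (∀ i j, i ≠ j → Disjoint (Y i) (Y j)) → Function.Injective Y := by
    intro Y h2 hd i j hij
    by_contra hne
    have := hd i j hne
    rw [← hij, disjoint_self] at this
    have h2i := h2 i
    rw [this] at h2i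
    simp at h2i
  rw [h1, Finset.mul_sum, ← Finset.sum_fiberwise_of_maps_to
    (g := fun Y : Fin n → Finset L => Finset.univ.image Y)
    (t := Finset.univ.filter fun 𝒮 : Finset (Finset L) => IsPolymerFamily 𝒮 ∧ 𝒮.card = n)]
  · refine Finset.sum_congr rfl fun 𝒮 h𝒮 => ?_
    simp only [Finset.mem_filter, Finset.mem_univ, true_and] at h𝒮
    obtain ⟨⟨h2, hd⟩, rfl⟩ := h𝒮
    rw [← card_injective_image_eq 𝒮, ← nsmul_eq_mul, ← Finset.sum_const]
    have hset : (Finset.univ.filter fun Y : Fin 𝒮.card → Finset L =>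
        (∀ i, 2 ≤ (Y i).card) ∧ ∀ i j, i ≠ j → Disjoint (Y i) (Y j)).filter
          (fun Y => Finset.univ.image Y = 𝒮) = Finset.univ.filter fun Y : Fin 𝒮.card → Finset L =>
      Function.Injective Y ∧ Finset.univ.image Y = 𝒮 := by
      ext Y
      simp only [Finset.mem_filter, Finset.mem_univ, true_and]
      constructor
      · exact fun ⟨⟨h, h'⟩, h''⟩ => ⟨hinj Y h h', h''⟩
      · rintro ⟨h, h'⟩
        have hmem : ∀ i, Y i ∈ 𝒮 := fun i => h' ▸ Finset.mem_image_of_mem Y (Finset.mem_univ i)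
        exact ⟨⟨fun i => h2 _ (hmem i), fun i j hij => hd (hmem i) (hmem j) (h.ne hij)⟩, h'⟩
    rw [hset]
    refine Finset.sum_congr (by congr!) fun Y hY => ?_
    simp only [Finset.mem_filter, Finset.mem_univ, true_and] at hY
    conv_rhs => rw [← hY.2]
    convert (Finset.prod_image (f := a) (g := Y) fun i _ j _ h => hY.1 h).symm
  · intro Y hY
    simp only [Finset.mem_filter, Finset.mem_univ, true_and] at hY ⊢
    have hY' := hinj Y hY.1 hY.2
    refine ⟨⟨by simpa using hY.1, ?_⟩, ?_⟩
    · simp only [Finset.coe_image, Finset.coe_univ, Set.image_univ]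
      rintro _ ⟨i, rfl⟩ _ ⟨j, rfl⟩ hij
      exact hY.2 i j fun h => hij (h ▸ rfl)
    · rw [Finset.card_image_of_injective _ hY', Finset.card_univ, Fintype.card_fin]

theorem prod_singleton_parts {L M : Type*} [Fintype L] [DecidableEq L] [CommMonoid M]
    (P : Finpartition (Finset.univ : Finset L)) (f : L → M) :
    ∏ x, f x = ∏ X ∈ P.parts, ∏ x ∈ X, f x := by
  conv_lhs => rw [← P.biUnion_parts]
  exact Finset.prod_biUnion P.disjoint

theorem activity_of_card_lt_two {L : Type*} [Fintype L] [DecidableEq L] (A : Finset L → ℂ)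
    {X : Finset L} (hX : X.Nonempty) (h2 : ¬ 2 ≤ X.card) : A X = ∏ x ∈ X, A {x} := by
  obtain ⟨x, hx⟩ := hX
  have : X = {x} := by
    rw [Finset.eq_singleton_iff_unique_mem]
    exact ⟨hx, fun y hy => Finset.card_le_one.1 (by omega) _ hy _ hx⟩
  rw [this, Finset.prod_singleton]

/-- The activities in the Mayer expansion: normalized, and supported on sets of size at least
two. -/
def mayerActivity {L : Type*} (A : Finset L → ℂ) (X : Finset L) : ℂ :=
  if 2 ≤ X.card then normActivity A X else 0

-- The factor `∏ A({x})` is distributed over the parts of the partition. Divided by it, a singleton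
-- contributes `1`, and only the parts counted by the variable remain, with normalized activities.
open scoped Classical in
theorem polymerSeries_eq {L : Type*} [Fintype L] [DecidableEq L] (A : Finset L → ℂ)
    (hA : ∀ x, A {x} ≠ 0) :
    polymerSeries A = PowerSeries.C (∏ x, A {x}) * tupleSeries (mayerActivity A) := by
  have h1 : ∀ P : Finpartition (Finset.univ : Finset L), (∏ X ∈ P.parts,
      if 2 ≤ X.card then PowerSeries.C (A X) * PowerSeries.X else PowerSeries.C (A X)) =
      PowerSeries.C (∏ x, A {x}) * ∏ X ∈ P.parts.filter (fun X => 2 ≤ X.card),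
        (PowerSeries.C (normActivity A X) * PowerSeries.X) := by
    intro P
    rw [prod_singleton_parts P, map_prod, Finset.prod_filter, ← Finset.prod_mul_distrib]
    refine Finset.prod_congr rfl fun X hX => ?_
    split_ifs with h2
    · rw [← mul_assoc, ← map_mul, normActivity, mul_comm, mul_comm (∏ x ∈ X, A {x}), mul_assoc,
        ← Finset.prod_mul_distrib]
      rw [Finset.prod_congr rfl fun x _ => inv_mul_cancel₀ (hA x), Finset.prod_const_one, mul_one,
        mul_comm]
    · rw [mul_one, activity_of_card_lt_two A (P.nonempty_of_mem_parts hX) h2]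
  rw [polymerSeries]
  simp_rw [h1]
  rw [← Finset.mul_sum, sum_finpartition_eq_sum_polymers (M := PowerSeries ℂ) fun 𝒮 =>
    ∏ X ∈ 𝒮, (PowerSeries.C (normActivity A X) * PowerSeries.X)]
  congr 1
  ext n
  rw [map_sum, tupleSeries, PowerSeries.coeff_mk]
  change _ = _ * tupleSum (fun X => if 2 ≤ X.card then normActivity A X else 0) (Fin n)
  rw [tupleSum_eq_sum_polymers, ← mul_assoc,
    inv_mul_cancel₀ (Nat.cast_ne_zero.2 n.factorial_ne_zero), one_mul, ← Finset.filter_filter,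
    Finset.sum_filter (fun 𝒮 : Finset (Finset L) => 𝒮.card = n)]
  refine Finset.sum_congr rfl fun 𝒮 _ => ?_
  rw [Finset.prod_mul_distrib, Finset.prod_const, ← map_prod, PowerSeries.coeff_C_mul,
    PowerSeries.coeff_X_pow]
  simp [eq_comm]

end ClusterExpansion

end

noncomputable section

open scoped ENNReal ContDiff

namespace ClusterExpansion

/-! ### The Mayer expansion -/

-- Summing over `X` removes the constraint on the union of the polymers, which has at least two
-- elements as soon as there is a polymer.
open scoped Classical in
theorem sum_mayerTerm {L : Type*} [Fintype L] (A : Finset L → ℂ) (n : ℕ) :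
    ∑ X : Finset L with 2 ≤ X.card, mayerTerm A X n =
      (n.factorial : ℂ)⁻¹ * connectedTupleSum (mayerActivity A) (Fin n) := by
  simp only [mayerTerm]
  rw [← Finset.mul_sum]
  congr 1
  have h1 : connectedTupleSum (mayerActivity A) (Fin n) =
      ∑ Y : Fin n → Finset L with ∀ i, 2 ≤ (Y i).card,
        ursell Y * ∏ m, normActivity A (Y m) := by
    rw [connectedTupleSum, Finset.sum_filter]
    refine Finset.sum_congr rfl fun Y _ => ?_
    rw [← ursell_eq_connectedGraphSum]
    by_cases h2 : ∀ i, 2 ≤ (Y i).card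
    · rw [if_pos h2]
      congr 1
      exact Finset.prod_congr rfl fun i _ => if_pos (h2 i)
    · rw [if_neg h2]
      push Not at h2
      obtain ⟨i, hi⟩ := h2
      rw [Finset.prod_eq_zero (Finset.mem_univ i) (if_neg (by omega)), mul_zero]
  -- The case `n = 0` is separate: the empty tuple has empty union and is missing on the left, and
  -- on the right it admits no connected graph.
  rcases n.eq_zero_or_pos with rfl | hn
  · rw [connectedTupleSum_zero]
    refine Finset.sum_eq_zero fun X hX => ?_
    rw [Finset.filter_false_of_mem, Finset.sum_empty]
    rintro Y - ⟨-, hY⟩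
    rw [Finset.mem_filter, ← hY] at hX
    simp at hX
  · rw [h1, ← Finset.sum_fiberwise_of_maps_to
      (g := fun Y : Fin n → Finset L => Finset.univ.biUnion Y)
      (t := Finset.univ.filter fun X : Finset L => 2 ≤ X.card)]
    · refine Finset.sum_congr rfl fun X _ => ?_
      rw [Finset.filter_filter]
    · intro Y hY
      simp only [Finset.mem_filter, Finset.mem_univ, true_and] at hY ⊢
      exact (hY ⟨0, hn⟩).trans (Finset.card_le_card
        (Finset.subset_biUnion_of_mem Y (Finset.mem_univ _)))

theorem sum_nonempty_eq {L M : Type*} [Fintype L] [DecidableEq L] [AddCommMonoid M]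
    (f : Finset L → M) :
    ∑ X : Finset L with X.Nonempty, f X =
      ∑ x, f {x} + ∑ X : Finset L with 2 ≤ X.card, f X := by
  have h := Finset.sum_filter_add_sum_filter_not
    (Finset.univ.filter fun X : Finset L => X.Nonempty) (fun X => X.card = 1) f
  rw [← h, Finset.filter_filter, Finset.filter_filter]
  congr 1
  · refine (Finset.sum_bij (fun x _ => {x}) ?_ ?_ ?_ ?_).symm
    · simp
    · simp
    · intro X hX
      simp only [Finset.mem_filter, Finset.mem_univ, true_and] at hX
      obtain ⟨x, hx⟩ := Finset.card_eq_one.1 hX.2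
      exact ⟨x, Finset.mem_univ _, hx.symm⟩
    · exact fun _ _ => rfl
  · refine Finset.sum_congr ?_ fun _ _ => rfl
    ext X
    simp only [Finset.mem_filter, Finset.mem_univ, true_and, ← Finset.card_pos]
    omega

theorem sum_mayerSeries {L : Type*} [Fintype L] [DecidableEq L] (A : Finset L → ℂ) :
    ∑ X : Finset L with X.Nonempty, mayerSeries A X =
      PowerSeries.C (∑ x, Complex.log (A {x})) + connectedTupleSeries (mayerActivity A) := by
  rw [sum_nonempty_eq]
  congr 1
  · rw [map_sum]
    exact Finset.sum_congr rfl fun x _ => if_neg (by simp)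
  · ext n
    rw [map_sum, connectedTupleSeries, PowerSeries.coeff_mk]
    classical
    rw [← sum_mayerTerm]
    refine Finset.sum_congr (by congr!) fun X hX => ?_
    rw [mayerSeries, if_pos (Finset.mem_filter.1 hX).2, PowerSeries.coeff_mk]

theorem exp_sum_log {L : Type*} [Fintype L] (A : Finset L → ℂ) (hA : ∀ x, A {x} ≠ 0) :
    Complex.exp (∑ x, Complex.log (A {x})) = ∏ x, A {x} := by
  rw [Complex.exp_sum]
  exact Finset.prod_congr rfl fun x _ => Complex.exp_log (hA x)

theorem isFormalLog_mayerSeries {L : Type*} [Fintype L] [DecidableEq L] (A : Finset L → ℂ)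
    (hA : ∀ x, A {x} ≠ 0) :
    IsFormalLog (∑ X : Finset L with X.Nonempty, mayerSeries A X) (polymerSeries A) := by
  have h0 : ∏ x, A {x} ≠ 0 := Finset.prod_ne_zero_iff.2 fun x _ => hA x
  rw [IsFormalLog, sum_mayerSeries, polymerSeries_eq A hA]
  simp only [map_add, map_mul, PowerSeries.constantCoeff_C, constantCoeff_connectedTupleSeries,
    constantCoeff_tupleSeries, add_zero, mul_one]
  refine ⟨exp_sum_log A hA, ?_⟩
  rw [← mul_assoc, ← map_mul, inv_mul_cancel₀ h0, map_one, one_mul, logOf_tupleSeries,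
    add_sub_cancel_left]

/-- Summability at `1` bounds the coefficients, and a ratio `r` strictly between `|x|` and `1`
dominates the termwise derivatives. -/
theorem hasDerivAt_tsum_mul_pow {a : ℕ → ℂ} (ha : Summable a) {x : ℝ} (hx : |x| < 1) :
    HasDerivAt (fun y : ℝ => ∑' n, a n * (y : ℂ) ^ n)
      (∑' n : ℕ, ((n : ℂ) + 1) * a (n + 1) * (x : ℂ) ^ n) x ∧
      Summable fun n : ℕ => ‖((n : ℂ) + 1) * a (n + 1) * (x : ℂ) ^ n‖ := by
  obtain ⟨r, hr, hr1⟩ := exists_between hx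
  have hr0 : 0 ≤ r := (abs_nonneg x).trans hr.le
  obtain ⟨B, hB⟩ : ∃ B, ∀ n, ‖a n‖ ≤ B := by
    obtain ⟨B, hB⟩ := ha.tendsto_atTop_zero.norm.bddAbove_range
    exact ⟨B, fun n => hB ⟨n, rfl⟩⟩
  have hB0 : 0 ≤ B := (norm_nonneg _).trans (hB 0)
  have hs : Summable fun n : ℕ => B * (((n : ℝ) + 1) * r ^ n) := by
    refine Summable.mul_left _ ?_
    have h1 := summable_pow_mul_geometric_of_norm_lt_one (R := ℝ) 1 (r := r)
      (by rwa [Real.norm_of_nonneg hr0])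
    have h2 := summable_geometric_of_lt_one hr0 hr1
    refine (h1.add h2).congr fun n => ?_
    ring
  have hbound : ∀ (n : ℕ) (y : ℝ), |y| < r →
      ‖((n : ℂ) + 1) * a (n + 1) * (y : ℂ) ^ n‖ ≤ B * (((n : ℝ) + 1) * r ^ n) := by
    intro n y hy
    rw [norm_mul, norm_mul, norm_pow, Complex.norm_real, Real.norm_eq_abs]
    have : ‖(n : ℂ) + 1‖ = (n : ℝ) + 1 := by
      rw [← Nat.cast_succ, Complex.norm_natCast, Nat.cast_succ]
    rw [this, mul_comm ((n : ℝ) + 1), mul_assoc]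
    gcongr
    exact hB _
  refine ⟨?_, Summable.of_nonneg_of_le (fun _ => norm_nonneg _) (fun n => hbound n x hr) hs⟩
  have hu : Summable fun n : ℕ =>
      if n = 0 then 0 else B * ((((n - 1 : ℕ) : ℝ) + 1) * r ^ (n - 1)) := by
    rw [← summable_nat_add_iff 1]
    simpa using hs
  have hd := hasDerivAt_tsum_of_isPreconnected (𝕜 := ℝ) (F := ℂ)
    (g := fun n y => a n * (y : ℂ) ^ n) (g' := fun n y => a n * (n * (y : ℂ) ^ (n - 1)))
    (t := Set.Ioo (-r) r) (y₀ := 0) (y := x) hu isOpen_Ioo isPreconnected_Ioo ?_ ?_ ?_ ?_ ?_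
  · refine hd.congr_deriv ?_
    rw [tsum_eq_zero_add']
    · simp only [Nat.cast_zero, zero_mul, mul_zero, zero_add]
      refine tsum_congr fun n => ?_
      push_cast
      ring
    · refine Summable.of_norm (Summable.of_nonneg_of_le (fun _ => norm_nonneg _) (fun n => ?_) hs)
      refine le_trans (le_of_eq ?_) (hbound n x hr)
      push_cast
      congr 1
      ring
  · intro n y _
    have h1 : HasDerivAt (fun z : ℂ => a n * z ^ n) (a n * (n * (y : ℂ) ^ (n - 1))) (y : ℂ) :=
      (hasDerivAt_pow n (y : ℂ)).const_mul (a n)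
    exact h1.comp_ofReal
  · intro n y hy
    rcases n with _ | n
    · simp
    · rw [if_neg (Nat.succ_ne_zero n)]
      refine le_trans (le_of_eq ?_) (hbound n y (abs_lt.2 hy))
      push_cast
      congr 1
      ring
  · exact ⟨by linarith [(abs_nonneg x).trans_lt hr], (abs_nonneg x).trans_lt hr⟩
  · refine summable_of_ne_finset_zero (s := {0}) fun n hn => ?_
    simp only [Finset.mem_singleton] at hn
    simp [hn]
  · exact abs_lt.1 hr

/-- The recursion says that the two power series satisfy `f' = w' f` on `[0, 1)`, so `f exp(-w)` is
constant there. Absolute summability at `1` makes both continuous up to the end point, and the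
values at `0` fix the constant. -/
theorem tsum_eq_exp_tsum {t g : ℕ → ℂ} (ht : Summable t) (hg : Summable g) (ht0 : t 0 = 1)
    (hg0 : g 0 = 0) (h : ∀ n : ℕ, ((n : ℂ) + 1) * t (n + 1) =
      ∑ k ∈ Finset.range (n + 1), ((k : ℂ) + 1) * g (k + 1) * t (n - k)) :
    ∑' n, t n = Complex.exp (∑' n, g n) := by
  have hcont : ∀ {a : ℕ → ℂ}, Summable a →
      ContinuousOn (fun y : ℝ => ∑' n, a n * (y : ℂ) ^ n) (Set.Icc 0 1) := by
    intro a ha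
    refine continuousOn_tsum (u := fun n => ‖a n‖) (fun n => by fun_prop) ha.norm ?_
    intro n y hy
    rw [norm_mul, norm_pow, Complex.norm_real, Real.norm_of_nonneg hy.1]
    exact mul_le_of_le_one_right (norm_nonneg _) (pow_le_one₀ hy.1 hy.2)
  have key := constant_of_has_deriv_right_zero (a := (0 : ℝ)) (b := 1)
    (f := fun y : ℝ => (∑' n, t n * (y : ℂ) ^ n) * Complex.exp (-∑' n, g n * (y : ℂ) ^ n))
    ((hcont ht).mul (hcont hg).neg.cexp) ?_ 1 ⟨zero_le_one, le_rfl⟩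
  · have hz : ∀ a : ℕ → ℂ, ∑' n, a n * ((0 : ℝ) : ℂ) ^ n = a 0 := by
      intro a
      rw [tsum_eq_single 0 fun n hn => by simp [hn]]
      simp
    simp only [hz, ht0, hg0, Complex.ofReal_one, one_pow, mul_one, neg_zero, Complex.exp_zero,
      Complex.exp_neg] at key
    exact (mul_inv_eq_one₀ (Complex.exp_ne_zero _)).1 key
  · intro x hx
    have hx1 : |x| < 1 := by rw [abs_of_nonneg hx.1]; exact hx.2
    obtain ⟨hdt, hst⟩ := hasDerivAt_tsum_mul_pow ht hx1
    obtain ⟨hdg, hsg⟩ := hasDerivAt_tsum_mul_pow hg hx1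
    have hsn : Summable fun n => ‖t n * (x : ℂ) ^ n‖ := by
      refine Summable.of_nonneg_of_le (fun _ => norm_nonneg _) (fun n => ?_) ht.norm
      rw [norm_mul, norm_pow, Complex.norm_real, Real.norm_eq_abs]
      exact mul_le_of_le_one_right (norm_nonneg _) (pow_le_one₀ (abs_nonneg _) hx1.le)
    have hprod : ∑' n : ℕ, ((n : ℂ) + 1) * t (n + 1) * (x : ℂ) ^ n =
        (∑' n : ℕ, ((n : ℂ) + 1) * g (n + 1) * (x : ℂ) ^ n) * ∑' n, t n * (x : ℂ) ^ n := by
      rw [tsum_mul_tsum_eq_tsum_sum_range_of_summable_norm hsg hsn]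
      refine tsum_congr fun n => ?_
      rw [h, Finset.sum_mul]
      refine Finset.sum_congr rfl fun k hk => ?_
      have hk' : n = k + (n - k) := by
        have := Finset.mem_range.1 hk
        omega
      conv_lhs => rw [hk', pow_add]
      rw [Nat.add_sub_cancel_left]
      ring
    have hd := hdt.mul hdg.neg.cexp
    refine (hd.congr_deriv ?_).hasDerivWithinAt
    simp only [Pi.neg_apply]
    rw [hprod]
    ring

/-- At `z = 1` the generating function of disjoint tuples is a finite sum, because a family of
distinct subsets of `L` has bounded size. The Mayer terms are summable for each of the finitely many
`X`, hence also after summation over `X`, and `tsum_eq_exp_tsum` applies. -/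
theorem exp_sum_mayerW {L : Type*} [Fintype L] [DecidableEq L] (A : Finset L → ℂ)
    (hA : ∀ x, A {x} ≠ 0) (hs : ∀ X : Finset L, 2 ≤ X.card → Summable (mayerTerm A X)) :
    Complex.exp (∑ X : Finset L with X.Nonempty, mayerW A X) = polymerSum A := by
  classical
  have h1 : polymerSum A = (∏ x, A {x}) *
      ∑ 𝒮 : Finset (Finset L) with IsPolymerFamily 𝒮, ∏ X ∈ 𝒮, normActivity A X := by
    rw [← sum_finpartition_eq_sum_polymers fun 𝒮 => ∏ X ∈ 𝒮, normActivity A X, Finset.mul_sum]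
    refine Finset.sum_congr rfl fun P _ => ?_
    rw [prod_singleton_parts P, Finset.prod_filter, ← Finset.prod_mul_distrib]
    refine Finset.prod_congr rfl fun X hX => ?_
    split_ifs with h2
    · rw [normActivity, mul_left_comm, ← Finset.prod_mul_distrib,
        Finset.prod_congr rfl fun x _ => mul_inv_cancel₀ (hA x), Finset.prod_const_one, mul_one]
    · rw [mul_one, activity_of_card_lt_two A (P.nonempty_of_mem_parts hX) h2]
  have ht : ∀ n : ℕ, (n.factorial : ℂ)⁻¹ * tupleSum (mayerActivity A) (Fin n) =
      ∑ 𝒮 : Finset (Finset L) with IsPolymerFamily 𝒮 ∧ 𝒮.card = n,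
        ∏ X ∈ 𝒮, normActivity A X := by
    intro n
    change _ * tupleSum (fun X => if 2 ≤ X.card then normActivity A X else 0) (Fin n) = _
    rw [tupleSum_eq_sum_polymers, ← mul_assoc,
      inv_mul_cancel₀ (Nat.cast_ne_zero.2 n.factorial_ne_zero), one_mul]
  have hzero : ∀ n, n ∉ Finset.range (Fintype.card (Finset L) + 1) →
      (n.factorial : ℂ)⁻¹ * tupleSum (mayerActivity A) (Fin n) = 0 := by
    intro n hn
    rw [ht, Finset.filter_false_of_mem, Finset.sum_empty]
    rintro 𝒮 - ⟨-, rfl⟩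
    exact hn (Finset.mem_range.2 (Nat.lt_succ_of_le (Finset.card_le_univ 𝒮)))
  have h2 : ∑' n : ℕ, (n.factorial : ℂ)⁻¹ * tupleSum (mayerActivity A) (Fin n) =
      ∑ 𝒮 : Finset (Finset L) with IsPolymerFamily 𝒮, ∏ X ∈ 𝒮, normActivity A X := by
    rw [tsum_eq_sum hzero, ← Finset.sum_fiberwise_of_maps_to (g := Finset.card)
      (t := Finset.range (Fintype.card (Finset L) + 1))]
    · refine Finset.sum_congr rfl fun n _ => ?_
      rw [ht, Finset.filter_filter]
    · exact fun 𝒮 _ => Finset.mem_range.2 (Nat.lt_succ_of_le (Finset.card_le_univ 𝒮))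
  have hsum : ∀ X ∈ Finset.univ.filter fun X : Finset L => 2 ≤ X.card,
      Summable (mayerTerm A X) := fun X hX => hs X (Finset.mem_filter.1 hX).2
  have h3 : ∑ X : Finset L with 2 ≤ X.card, mayerW A X =
      ∑' n : ℕ, (n.factorial : ℂ)⁻¹ * connectedTupleSum (mayerActivity A) (Fin n) := by
    rw [tsum_congr fun n => (sum_mayerTerm A n).symm, Summable.tsum_finsetSum (by convert hsum)]
    refine Finset.sum_congr (by congr!) fun X hX => ?_
    rw [mayerW, if_pos (Finset.mem_filter.1 hX).2]
  have h4 : ∑ x, mayerW A {x} = ∑ x, Complex.log (A {x}) :=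
    Finset.sum_congr rfl fun x _ => if_neg (by simp)
  rw [sum_nonempty_eq, Complex.exp_add, h4, exp_sum_log A hA, h1, h3, ← h2]
  congr 1
  symm
  refine tsum_eq_exp_tsum ?_ ?_ ?_ ?_ ?_
  · exact summable_of_ne_finset_zero hzero
  · refine (summable_sum hsum).congr fun n => ?_
    rw [← sum_mayerTerm]
  · simp [tupleSum_zero]
  · simp [connectedTupleSum_zero]
  · intro n
    have := congrArg (PowerSeries.coeff n) (derivative_tupleSeries (mayerActivity A))
    rw [PowerSeries.coeff_derivative, PowerSeries.coeff_mul,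
      Finset.Nat.sum_antidiagonal_eq_sum_range_succ_mk] at this
    simp only [PowerSeries.coeff_derivative, tupleSeries, connectedTupleSeries,
      PowerSeries.coeff_mk] at this
    rw [mul_comm, this]
    exact Finset.sum_congr rfl fun k _ => by ring

end ClusterExpansion

end

/-! ### The forest formula -/

noncomputable section

open scoped ENNReal ContDiff

namespace ClusterExpansion

/-! ### Forests and interpolation parameters -/

theorem pairGraph_adj {ι : Type*} (T : Finset (Pair ι)) (x y : ι) :
    (pairGraph T).Adj x y ↔ ∃ ℓ ∈ T, ℓ.1 = s(x, y) := by
  rw [pairGraph, SimpleGraph.fromEdgeSet_adj]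
  constructor
  · rintro ⟨⟨ℓ, hℓ, h⟩, -⟩
    exact ⟨ℓ, hℓ, h⟩
  · rintro ⟨ℓ, hℓ, h⟩
    exact ⟨⟨ℓ, hℓ, h⟩, fun hxy => ℓ.2 (h ▸ Sym2.mk_isDiag_iff.2 hxy)⟩

theorem mem_edgeSet_pairGraph {ι : Type*} (T : Finset (Pair ι)) (e : Sym2 ι) :
    e ∈ (pairGraph T).edgeSet ↔ ∃ ℓ ∈ T, ℓ.1 = e := by
  induction e with | _ x y
  exact pairGraph_adj T x y

theorem pairGraph_mono {ι : Type*} {T T' : Finset (Pair ι)} (h : T ⊆ T') :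
    pairGraph T ≤ pairGraph T' := by
  intro x y hxy
  obtain ⟨ℓ, hℓ, h'⟩ := (pairGraph_adj _ _ _).1 hxy
  exact (pairGraph_adj _ _ _).2 ⟨ℓ, h hℓ, h'⟩

/-- The graph of the edges in `T` with weight at least `t`. -/
def thresholdGraph {ι : Type*} (T : Finset (Pair ι)) (w : T → ℝ) (t : ℝ) : SimpleGraph ι :=
  SimpleGraph.fromEdgeSet {e | ∃ ℓ : T, ℓ.1.1 = e ∧ t ≤ w ℓ}

theorem thresholdGraph_adj {ι : Type*} (T : Finset (Pair ι)) (w : T → ℝ) (t : ℝ) (x y : ι) :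
    (thresholdGraph T w t).Adj x y ↔ ∃ ℓ : T, ℓ.1.1 = s(x, y) ∧ t ≤ w ℓ := by
  rw [thresholdGraph, SimpleGraph.fromEdgeSet_adj]
  constructor
  · exact fun h => h.1
  · rintro ⟨ℓ, h, h'⟩
    exact ⟨⟨ℓ, h, h'⟩, fun hxy => ℓ.1.2 (h ▸ Sym2.mk_isDiag_iff.2 hxy)⟩

theorem thresholdGraph_le {ι : Type*} (T : Finset (Pair ι)) (w : T → ℝ) (t : ℝ) :
    thresholdGraph T w t ≤ pairGraph T := by
  intro x y h
  obtain ⟨ℓ, h, -⟩ := (thresholdGraph_adj _ _ _ _ _).1 h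
  exact (pairGraph_adj _ _ _).2 ⟨ℓ.1, ℓ.2, h⟩

/-- The edges of `T` on a `T`-path linking the two ends of `e`. -/
def pathEdges {ι : Type*} (T : Finset (Pair ι)) (e : Pair ι) : Set T :=
  {ℓ | ∃ (x y : ι) (p : (pairGraph T).Walk x y), p.IsPath ∧ s(x, y) = e.1 ∧ ℓ.1.1 ∈ p.edges}

theorem treeInterp_eq {ι : Type*} (T : Finset (Pair ι)) (w : T → ℝ) (e : Pair ι) :
    treeInterp T w e = sInf (w '' pathEdges T e) := by
  rw [treeInterp]
  congr 1
  ext r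
  constructor
  · rintro ⟨ℓ, x, y, p, hp, he, hℓ, rfl⟩
    exact ⟨ℓ, ⟨x, y, p, hp, he, hℓ⟩, rfl⟩
  · rintro ⟨ℓ, ⟨x, y, p, hp, he, hℓ⟩, rfl⟩
    exact ⟨ℓ, x, y, p, hp, he, hℓ, rfl⟩

theorem mem_pathEdges_of_mk {ι : Type*} {T : Finset (Pair ι)} {e : Pair ι} {x y : ι}
    (h : s(x, y) = e.1) {ℓ : T} (hℓ : ℓ ∈ pathEdges T e) :
    ∃ p : (pairGraph T).Walk x y, p.IsPath ∧ ℓ.1.1 ∈ p.edges := by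
  obtain ⟨x', y', p, hp, he, hℓ⟩ := hℓ
  rw [← h, Sym2.eq_iff] at he
  rcases he with ⟨rfl, rfl⟩ | ⟨rfl, rfl⟩
  · exact ⟨p, hp, hℓ⟩
  · exact ⟨p.reverse, hp.reverse, by simpa using hℓ⟩

/-- The minimum along the unique `T`-path is at least `t` exactly if the path survives when the
edges of weight less than `t` are deleted. Most properties of `s^T` below are read off from these
level sets. Positivity of `t` matters: the value is `0`, an infimum over the empty set, on pairs
that `T` does not link. -/
theorem le_treeInterp_iff {ι : Type*} {T : Finset (Pair ι)} (hT : (pairGraph T).IsAcyclic)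
    (w : T → ℝ) {t : ℝ} (ht : 0 < t) {e : Pair ι} {x y : ι} (h : s(x, y) = e.1) :
    t ≤ treeInterp T w e ↔ (thresholdGraph T w t).Reachable x y := by
  have hbdd : BddBelow (w '' pathEdges T e) := (Set.toFinite _).bddBelow
  rw [treeInterp_eq]
  constructor
  · intro hle
    have hne : (w '' pathEdges T e).Nonempty := by
      rw [Set.nonempty_iff_ne_empty]
      intro h0
      rw [h0, Real.sInf_empty] at hle
      exact absurd ht (not_lt.2 hle)
    obtain ⟨_, ℓ, hℓ, rfl⟩ := hne
    obtain ⟨p, hp, -⟩ := mem_pathEdges_of_mk h hℓ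
    refine ⟨p.transfer _ fun e' he' => ?_⟩
    obtain ⟨ℓ', hℓ', rfl⟩ := (mem_edgeSet_pairGraph T e').1 (p.edges_subset_edgeSet he')
    have hle' : t ≤ w ⟨ℓ', hℓ'⟩ :=
      hle.trans (csInf_le hbdd ⟨⟨ℓ', hℓ'⟩, ⟨x, y, p, hp, h, he'⟩, rfl⟩)
    obtain ⟨e', he'd⟩ := ℓ'
    induction e' with | _ a b
    exact (thresholdGraph_adj _ _ _ _ _).2 ⟨⟨_, hℓ'⟩, rfl, hle'⟩
  · rintro hr
    obtain ⟨q, hq⟩ := hr.exists_isPath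
    let p := q.mapLe (thresholdGraph_le T w t)
    have hp : p.IsPath := (SimpleGraph.Walk.isPath_mapLe _).2 hq
    have hpe : p.edges = q.edges := SimpleGraph.Walk.edges_mapLe_eq_edges _ _
    have hlow : ∀ ℓ : T, ℓ.1.1 ∈ p.edges → t ≤ w ℓ := by
      intro ℓ hℓ
      rw [hpe] at hℓ
      have := q.edges_subset_edgeSet hℓ
      obtain ⟨⟨⟨e', he'⟩, hT'⟩, hw⟩ : ∃ ℓ₀ : T, ℓ₀ = ℓ := ⟨ℓ, rfl⟩
      subst hw
      induction e' with | _ a b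
      obtain ⟨ℓ', h1, h2⟩ := (thresholdGraph_adj _ _ _ _ _).1 this
      rwa [show ℓ' = ⟨⟨s(a, b), he'⟩, hT'⟩ from Subtype.ext (Subtype.ext h1)] at h2
    refine le_csInf ?_ ?_
    · have hxy : x ≠ y := fun hxy => e.2 (h ▸ Sym2.mk_isDiag_iff.2 hxy)
      obtain ⟨e', he'⟩ : ∃ e', e' ∈ p.edges := by
        refine List.exists_mem_of_ne_nil _ fun h0 => hxy ?_
        rw [SimpleGraph.Walk.edges_eq_nil] at h0
        exact h0.eq
      obtain ⟨ℓ', hℓ', rfl⟩ := (mem_edgeSet_pairGraph T e').1 (p.edges_subset_edgeSet he')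
      exact ⟨_, ⟨ℓ', hℓ'⟩, ⟨x, y, p, hp, h, he'⟩, rfl⟩
    · rintro _ ⟨ℓ, hℓ, rfl⟩
      obtain ⟨p', hp', hℓ'⟩ := mem_pathEdges_of_mk h hℓ
      have : p' = p := congrArg Subtype.val ((hT.subsingleton_path _ _).elim ⟨p', hp'⟩ ⟨p, hp⟩)
      exact hlow ℓ (this ▸ hℓ')

theorem treeInterp_nonneg {ι : Type*} (T : Finset (Pair ι)) (w : T → ℝ) (hw : ∀ ℓ, 0 ≤ w ℓ)
    (e : Pair ι) : 0 ≤ treeInterp T w e := by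
  rw [treeInterp_eq]
  refine Real.sInf_nonneg ?_
  rintro _ ⟨ℓ, -, rfl⟩
  exact hw ℓ

theorem treeInterp_le_one {ι : Type*} (T : Finset (Pair ι)) (w : T → ℝ) (hw : ∀ ℓ, w ℓ ≤ 1)
    (e : Pair ι) : treeInterp T w e ≤ 1 := by
  rw [treeInterp_eq]
  rcases (pathEdges T e).eq_empty_or_nonempty with h | ⟨ℓ, hℓ⟩
  · simp [h]
  · exact (csInf_le (Set.toFinite (w '' pathEdges T e)).bddBelow ⟨ℓ, hℓ, rfl⟩).trans (hw ℓ)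

theorem continuous_treeInterp {ι : Type*} (T : Finset (Pair ι)) :
    Continuous (treeInterp T : (T → ℝ) → Pair ι → ℝ) := by
  classical
  refine continuous_pi fun e => ?_
  simp only [treeInterp_eq]
  rcases (pathEdges T e).eq_empty_or_nonempty with h | h
  · simp only [h, Set.image_empty]
    exact continuous_const
  · have hfin := (pathEdges T e).toFinite
    have hne : hfin.toFinset.Nonempty := by simpa using h
    have : ∀ w : T → ℝ, sInf (w '' pathEdges T e) = hfin.toFinset.inf' hne w := by
      intro w
      rw [Finset.inf'_eq_csInf_image]
      simp
    simp only [this]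
    exact Continuous.finset_inf'_apply hne fun ℓ _ => continuous_apply ℓ

theorem eq_of_forall_pos_le_iff {a b : ℝ} (ha : 0 ≤ a) (hb : 0 ≤ b)
    (h : ∀ t, 0 < t → (t ≤ a ↔ t ≤ b)) : a = b := by
  refine le_antisymm ?_ ?_
  · rcases ha.eq_or_lt with h0 | h0
    · exact h0 ▸ hb
    · exact (h a h0).1 le_rfl
  · rcases hb.eq_or_lt with h0 | h0
    · exact h0 ▸ ha
    · exact (h b h0).2 le_rfl

/-- Interpolation parameters `s` in `[0, 1]` for which `1 - s` is an ultrametric. -/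
def IsUltra {ι : Type*} (s : Pair ι → ℝ) : Prop :=
  s ∈ Set.Icc (0 : Pair ι → ℝ) 1 ∧ ∀ (e₁ e₂ e₃ : Pair ι) (x y z : ι),
    s(x, y) = e₁.1 → s(y, z) = e₂.1 → s(x, z) = e₃.1 → min (s e₁) (s e₂) ≤ s e₃

/-- The interpolation parameters that are `s^T` between sites linked by `T`, and `u` otherwise,
provided that `u` does not exceed the weights. -/
def forestInterp {ι : Type*} (T : Finset (Pair ι)) (θ : Pair ι → ℝ) (u : ℝ) : Pair ι → ℝ :=
  fun e => max u (treeInterp T (fun ℓ => θ ℓ) e)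

/-- At levels above `u`, the relation that the parameter is at least `t` is reachability in a graph,
hence transitive; at levels up to `u` it holds for all pairs. -/
theorem isUltra_forestInterp {ι : Type*} {T : Finset (Pair ι)} (hT : (pairGraph T).IsAcyclic)
    {θ : Pair ι → ℝ} (hθ : θ ∈ Set.Icc (0 : Pair ι → ℝ) 1) {u : ℝ} (hu : u ∈ Set.Icc (0 : ℝ) 1) :
    IsUltra (forestInterp T θ u) := by
  refine ⟨⟨fun e => hu.1.trans (le_max_left _ _), fun e => max_le hu.2
    (treeInterp_le_one _ _ (fun ℓ => hθ.2 ℓ) e)⟩, ?_⟩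
  intro e₁ e₂ e₃ x y z h₁ h₂ h₃
  by_contra hlt
  rw [not_le, lt_min_iff] at hlt
  have h0 : 0 ≤ forestInterp T θ u e₃ := hu.1.trans (le_max_left _ _)
  set t := min (forestInterp T θ u e₁) (forestInterp T θ u e₂) with ht
  have htlt : forestInterp T θ u e₃ < t := lt_min hlt.1 hlt.2
  have ht0 : 0 < t := h0.trans_lt htlt
  have hut : u < t := (le_max_left _ _).trans_lt htlt
  have g₁ : t ≤ treeInterp T (fun ℓ => θ ℓ) e₁ :=
    (le_max_iff.1 (min_le_left _ _ : t ≤ forestInterp T θ u e₁)).resolve_left (not_le.2 hut)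
  have g₂ : t ≤ treeInterp T (fun ℓ => θ ℓ) e₂ :=
    (le_max_iff.1 (min_le_right _ _ : t ≤ forestInterp T θ u e₂)).resolve_left (not_le.2 hut)
  rw [le_treeInterp_iff hT _ ht0 h₁] at g₁
  rw [le_treeInterp_iff hT _ ht0 h₂] at g₂
  have g₃ := (le_treeInterp_iff hT _ ht0 h₃).2 (g₁.trans g₂)
  exact absurd (g₃.trans (le_max_right _ _)) (not_le.2 htlt)

theorem forestInterp_zero {ι : Type*} {T : Finset (Pair ι)} {θ : Pair ι → ℝ}
    (hθ : ∀ ℓ, 0 ≤ θ ℓ) : forestInterp T θ 0 = treeInterp T (fun ℓ => θ ℓ) :=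
  funext fun e => max_eq_right (treeInterp_nonneg _ _ (fun ℓ => hθ ℓ) e)

theorem forestInterp_empty {ι : Type*} {θ : Pair ι → ℝ} :
    forestInterp ∅ θ 1 = 1 := by
  funext e
  rw [forestInterp, treeInterp_eq]
  have : pathEdges ∅ e = ∅ := Set.eq_empty_of_forall_notMem fun ℓ => (Finset.notMem_empty _ ℓ.2).elim
  rw [this, Set.image_empty, Real.sInf_empty]
  simp

/-- The ends of `e` are linked by `T`. -/
def Linked {ι : Type*} (T : Finset (Pair ι)) (e : Pair ι) : Prop :=
  ∃ x y, s(x, y) = e.1 ∧ (pairGraph T).Reachable x y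

theorem linked_iff {ι : Type*} {T : Finset (Pair ι)} {e : Pair ι} {x y : ι} (h : s(x, y) = e.1) :
    Linked T e ↔ (pairGraph T).Reachable x y := by
  constructor
  · rintro ⟨x', y', h', hr⟩
    rw [← h, Sym2.eq_iff] at h'
    rcases h' with ⟨rfl, rfl⟩ | ⟨rfl, rfl⟩
    · exact hr
    · exact hr.symm
  · exact fun hr => ⟨x, y, h, hr⟩

theorem linked_of_mem {ι : Type*} {T : Finset (Pair ι)} {e : Pair ι} (he : e ∈ T) :
    Linked T e := by
  obtain ⟨e, hd⟩ := e
  induction e with | _ x y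
  exact ⟨x, y, rfl, ((pairGraph_adj T x y).2 ⟨_, he, rfl⟩).reachable⟩

theorem pairGraph_insert {ι : Type*} [DecidableEq ι] (T : Finset (Pair ι)) (e : Pair ι) :
    pairGraph (insert e T) = pairGraph T ⊔ SimpleGraph.fromEdgeSet {e.1} := by
  rw [pairGraph, pairGraph, ← SimpleGraph.fromEdgeSet_union]
  congr 1
  rw [Finset.coe_insert, Set.image_insert_eq, Set.insert_eq, Set.union_comm]

theorem isAcyclic_insert_iff {ι : Type*} [DecidableEq ι] {T : Finset (Pair ι)} {e : Pair ι}
    (hT : (pairGraph T).IsAcyclic) (he : e ∉ T) :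
    (pairGraph (insert e T)).IsAcyclic ↔ ¬ Linked T e := by
  obtain ⟨e, hd⟩ := e
  induction e with | _ x y
  rw [pairGraph_insert, linked_iff (e := ⟨s(x, y), hd⟩) rfl]
  change (_ ⊔ SimpleGraph.edge x y).IsAcyclic ↔ _
  rw [SimpleGraph.isAcyclic_sup_fromEdgeSet_iff]
  have hxy : x ≠ y := fun h => hd (Sym2.mk_isDiag_iff.2 h)
  have hadj : ¬ (pairGraph T).Adj x y := by
    rw [pairGraph_adj]
    rintro ⟨ℓ, hℓ, h⟩
    exact he (by rwa [show (⟨s(x, y), hd⟩ : Pair ι) = ℓ from Subtype.ext h.symm])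
  constructor
  · intro h hr
    rcases h.2 hr with h | h
    · exact hxy h
    · exact hadj h
  · exact fun h => ⟨hT, fun hr => absurd hr h⟩

theorem isAcyclic_mono {ι : Type*} {T T' : Finset (Pair ι)} (h : T ⊆ T')
    (hT : (pairGraph T').IsAcyclic) : (pairGraph T).IsAcyclic :=
  hT.anti (pairGraph_mono h)

theorem forestInterp_of_not_linked {ι : Type*} {T : Finset (Pair ι)} {e : Pair ι}
    (he : ¬ Linked T e) (θ : Pair ι → ℝ) {u : ℝ} (hu : 0 ≤ u) : forestInterp T θ u e = u := by
  rw [forestInterp, treeInterp_eq]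
  have : pathEdges T e = ∅ :=
    Set.eq_empty_of_forall_notMem fun ℓ ⟨x, y, p, _, h, _⟩ => he ⟨x, y, h, ⟨p⟩⟩
  rw [this, Set.image_empty, Real.sInf_empty, max_eq_left hu]

/-- If all weights are at least `u`, so is every minimum along a path, and the maximum with `u` has
no effect. -/
theorem forestInterp_of_linked {ι : Type*} {T : Finset (Pair ι)} (hT : (pairGraph T).IsAcyclic)
    {e : Pair ι} (he : Linked T e) (θ : Pair ι → ℝ) {u : ℝ} (hu : 0 ≤ u)
    (hθ : ∀ ℓ ∈ T, u ≤ θ ℓ) :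
    forestInterp T θ u e = treeInterp T (fun ℓ => θ ℓ) e := by
  refine max_eq_right ?_
  obtain ⟨x, y, h, hr⟩ := he
  rcases hu.eq_or_lt with rfl | hu
  · exact treeInterp_nonneg _ _ (fun ℓ => hθ ℓ ℓ.2) e
  · rw [le_treeInterp_iff hT _ hu h]
    refine hr.mono fun a b hab => ?_
    obtain ⟨ℓ, hℓ, h'⟩ := (pairGraph_adj _ _ _).1 hab
    exact (thresholdGraph_adj _ _ _ _ _).2 ⟨⟨ℓ, hℓ⟩, h', hθ ℓ hℓ⟩

/-- The new edge of weight `v` is invisible at levels above `v`, and at levels up to `v` all pairs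
count anyway. The expansion can therefore restart from the larger forest at the point that it has
reached. -/
theorem forestInterp_insert {ι : Type*} [DecidableEq ι] {T : Finset (Pair ι)} {e : Pair ι}
    (hT : (pairGraph T).IsAcyclic) (he : ¬ Linked T e) (θ : Pair ι → ℝ)
    {v : ℝ} (hv : 0 ≤ v) :
    forestInterp (insert e T) (Function.update θ e v) v = forestInterp T θ v := by
  have heT : e ∉ T := fun h => he (linked_of_mem h)
  have hT' := (isAcyclic_insert_iff hT heT).2 he
  funext f
  obtain ⟨f, hd⟩ := f
  induction f with | _ x y
  refine eq_of_forall_pos_le_iff (hv.trans (le_max_left _ _)) (hv.trans (le_max_left _ _)) ?_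
  intro t ht
  rw [forestInterp, forestInterp, le_max_iff, le_max_iff,
    le_treeInterp_iff hT' _ ht (x := x) (y := y) rfl, le_treeInterp_iff hT _ ht (x := x) (y := y) rfl]
  by_cases htv : t ≤ v
  · simp [htv]
  · have : thresholdGraph (insert e T) (fun ℓ => Function.update θ e v ℓ) t =
        thresholdGraph T (fun ℓ => θ ℓ) t := by
      ext a b
      rw [thresholdGraph_adj, thresholdGraph_adj]
      constructor
      · rintro ⟨⟨ℓ, hℓ⟩, h, hw⟩
        by_cases hℓe : ℓ = e
        · subst hℓe
          simp only [Function.update_self] at hw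
          exact absurd hw htv
        · refine ⟨⟨ℓ, (Finset.mem_insert.1 hℓ).resolve_left hℓe⟩, h, ?_⟩
          simpa [Function.update_of_ne hℓe] using hw
      · rintro ⟨⟨ℓ, hℓ⟩, h, hw⟩
        have hℓe : ℓ ≠ e := fun h => heT (h ▸ hℓ)
        exact ⟨⟨ℓ, Finset.mem_insert_of_mem hℓ⟩, h, by simpa [Function.update_of_ne hℓe] using hw⟩
    rw [this]

end ClusterExpansion

end

noncomputable section

open scoped ENNReal ContDiff

namespace ClusterExpansion

open MeasureTheory

/-! ### The uniform measure on a cube -/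

/-- The uniform distribution on `[0, 1]^κ`. -/
def cubeMeasure (κ : Type*) [Fintype κ] : Measure (κ → ℝ) :=
  Measure.pi fun _ => volume.restrict (Set.Icc 0 1)

instance isProbabilityMeasure_restrict_unit :
    IsProbabilityMeasure ((volume : Measure ℝ).restrict (Set.Icc 0 1)) :=
  ⟨by simp⟩

instance isProbabilityMeasure_cubeMeasure (κ : Type*) [Fintype κ] :
    IsProbabilityMeasure (cubeMeasure κ) := by
  unfold cubeMeasure; infer_instance

theorem cubeMeasure_eq (κ : Type*) [Fintype κ] :
    cubeMeasure κ = (volume : Measure (κ → ℝ)).restrict (Set.Icc 0 1) := by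
  rw [cubeMeasure, volume_pi, ← Set.pi_univ_Icc, Measure.restrict_pi_pi]
  rfl

/-- Fubini for a single coordinate without splitting the index set: the coordinate `k` is replaced
by an independent uniform variable. -/
theorem measurePreserving_update {κ : Type*} [Fintype κ] [DecidableEq κ] (k : κ) :
    MeasurePreserving (fun p : ℝ × (κ → ℝ) => Function.update p.2 k p.1)
      ((volume.restrict (Set.Icc 0 1)).prod (cubeMeasure κ)) (cubeMeasure κ) := by
  have hm : Measurable (fun p : ℝ × (κ → ℝ) => Function.update p.2 k p.1) := by
    refine measurable_pi_lambda _ fun i => ?_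
    by_cases h : i = k
    · subst h; simpa using measurable_fst
    · simp only [Function.update_of_ne h]
      exact (measurable_pi_apply i).comp measurable_snd
  refine ⟨hm, ?_⟩
  symm
  refine Measure.pi_eq fun s hs => ?_
  rw [Measure.map_apply hm (MeasurableSet.univ_pi hs)]
  have : (fun p : ℝ × (κ → ℝ) => Function.update p.2 k p.1) ⁻¹' (Set.univ.pi s) =
      s k ×ˢ Set.univ.pi (Function.update s k Set.univ) := by
    ext ⟨v, w⟩
    simp only [Set.mem_preimage, Set.mem_univ_pi, Set.mem_prod]
    constructor
    · intro h
      refine ⟨by simpa using h k, fun i => ?_⟩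
      by_cases hi : i = k
      · subst hi; simp
      · simpa [Function.update_of_ne hi] using h i
    · rintro ⟨h1, h2⟩ i
      by_cases hi : i = k
      · subst hi; simpa using h1
      · simpa [Function.update_of_ne hi] using h2 i
  rw [this, Measure.prod_prod, cubeMeasure, Measure.pi_pi,
    ← Finset.mul_prod_erase Finset.univ _ (Finset.mem_univ k),
    ← Finset.mul_prod_erase Finset.univ (fun i => volume.restrict (Set.Icc 0 1) (s i))
      (Finset.mem_univ k), Function.update_self, measure_univ, one_mul]
  congr 1
  refine Finset.prod_congr rfl fun i hi => ?_
  rw [Function.update_of_ne (Finset.ne_of_mem_erase hi)]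

/-- Equality of two coordinates defines a hyperplane, which is a null set. Almost surely, then, the
largest of several weights is attained only once. -/
theorem ae_injective_cubeMeasure (κ : Type*) [Fintype κ] :
    ∀ᵐ w ∂cubeMeasure κ, Function.Injective w := by
  classical
  have h : ∀ i j : κ, i ≠ j → ∀ᵐ w ∂cubeMeasure κ, w i ≠ w j := by
    intro i j hij
    rw [cubeMeasure_eq]
    refine ae_restrict_of_ae ?_
    have := Measure.addHaar_submodule (volume : Measure (κ → ℝ))
      (LinearMap.ker ((LinearMap.proj i : (κ → ℝ) →ₗ[ℝ] ℝ) - LinearMap.proj j)) (by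
        intro h
        have h1 : (Pi.single i 1 : κ → ℝ) ∈
          LinearMap.ker ((LinearMap.proj i : (κ → ℝ) →ₗ[ℝ] ℝ) - LinearMap.proj j) := h ▸ trivial
        simp [hij.symm] at h1)
    rw [ae_iff]
    refine measure_mono_null (fun w hw => ?_) this
    simp only [ne_eq, not_not, Set.mem_ofPred_eq] at hw
    simp [hw]
  have h2 : ∀ᵐ w ∂cubeMeasure κ, ∀ i j : κ, i ≠ j → w i ≠ w j := by
    simp only [ae_all_iff]
    exact h
  filter_upwards [h2] with w hw i j hij
  by_contra hne
  exact hw i j hne hij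

theorem ae_mem_cube (κ : Type*) [Fintype κ] :
    ∀ᵐ w ∂cubeMeasure κ, w ∈ Set.Icc (0 : κ → ℝ) 1 := by
  rw [cubeMeasure_eq]
  exact ae_restrict_mem measurableSet_Icc

theorem ae_mem_open_cube (κ : Type*) [Fintype κ] :
    ∀ᵐ w ∂cubeMeasure κ, ∀ i, w i ∈ Set.Ioo (0 : ℝ) 1 := by
  rw [ae_all_iff]
  intro i
  have h : ∀ᵐ x ∂((volume : Measure ℝ).restrict (Set.Icc 0 1)), x ∈ Set.Ioo (0 : ℝ) 1 := by
    rw [← restrict_Ioo_eq_restrict_Icc]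
    exact ae_restrict_mem measurableSet_Ioo
  exact (Measure.quasiMeasurePreserving_eval
    (μ := fun _ : κ => (volume : Measure ℝ).restrict (Set.Icc 0 1)) i).ae h

theorem integrable_cubeMeasure {κ : Type*} [Fintype κ] {f : (κ → ℝ) → ℂ}
    (hf : ContinuousOn f (Set.Icc 0 1)) : Integrable f (cubeMeasure κ) := by
  rw [cubeMeasure_eq]
  exact hf.integrableOn_compact isCompact_Icc

theorem measurableSet_forall_le {κ : Type*} [Fintype κ] (S : Finset κ) (f : (κ → ℝ) → ℝ)
    (hf : Measurable f) : MeasurableSet {w : κ → ℝ | ∀ j ∈ S, w j ≤ f w} := by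
  simp only [Set.ofPred_forall]
  exact Finset.measurableSet_biInter _ fun j _ => measurableSet_le (measurable_pi_apply j) hf

theorem measurableSet_le_and_forall_le {κ : Type*} [Fintype κ] (S : Finset κ) (k : κ) (u : ℝ) :
    MeasurableSet {w : κ → ℝ | w k ≤ u ∧ ∀ j ∈ S, w j ≤ w k} :=
  (measurableSet_le (measurable_pi_apply k) measurable_const).inter
    (measurableSet_forall_le S _ (measurable_pi_apply k))

/-! ### The forest formula, abstractly -/

open scoped Classical in
/-- The contribution of a forest `F'` to the expansion that starts from the forest `F` with
weights `θ`: the edges in `F' \ F` carry independent weights, which are at most `u`. -/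
def forestTerm {ι : Type*} [Fintype ι] [DecidableEq ι]
    (D : Finset (Pair ι) → (Pair ι → ℝ) → ℂ)
    (F F' : Finset (Pair ι)) (θ : Pair ι → ℝ) (u : ℝ) : ℂ :=
  ∫ θ', if ∀ j ∈ F' \ F, θ' j ≤ u then D F' (treeInterp F' fun ℓ => F.piecewise θ θ' ℓ) else 0
    ∂cubeMeasure (Pair ι)

open scoped Classical in
theorem integrable_forest_ite {ι : Type*} [Fintype ι] [DecidableEq ι]
    (D : Finset (Pair ι) → (Pair ι → ℝ) → ℂ)
    (hcont : ∀ F : Finset (Pair ι), (pairGraph F).IsAcyclic →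
      ContinuousOn (fun θ : Pair ι → ℝ => D F (treeInterp F fun ℓ => θ ℓ)) (Set.Icc 0 1))
    {F F' : Finset (Pair ι)} (hF' : (pairGraph F').IsAcyclic)
    {θ : Pair ι → ℝ} (hθ : θ ∈ Set.Icc (0 : Pair ι → ℝ) 1) (p : (Pair ι → ℝ) → Prop)
    [DecidablePred p] (hp : MeasurableSet {θ' | p θ'}) :
    Integrable (fun θ' => if p θ' then D F' (treeInterp F' fun ℓ => F.piecewise θ θ' ℓ) else 0)
      (cubeMeasure (Pair ι)) := by
  have h1 : ContinuousOn (fun θ' => D F' (treeInterp F' fun ℓ => F.piecewise θ θ' ℓ))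
      (Set.Icc 0 1) := by
    refine (hcont F' hF').comp (g := fun θ : Pair ι → ℝ => D F' (treeInterp F' fun ℓ => θ ℓ))
      (f := fun θ' => F.piecewise θ θ') (Continuous.continuousOn ?_) ?_
    · refine continuous_pi fun i => ?_
      by_cases hi : i ∈ F
      · simpa [Finset.piecewise, hi] using continuous_const
      · simpa [Finset.piecewise, hi] using continuous_apply i
    · intro θ' hθ'
      constructor
      · intro i
        by_cases hi : i ∈ F
        · simpa [Finset.piecewise, hi] using hθ.1 i
        · simpa [Finset.piecewise, hi] using hθ'.1 i
      · intro i
        by_cases hi : i ∈ F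
        · simpa [Finset.piecewise, hi] using hθ.2 i
        · simpa [Finset.piecewise, hi] using hθ'.2 i
  exact ((integrable_cubeMeasure h1).indicator hp).congr
    (Filter.Eventually.of_forall fun θ' => by simp [Set.indicator])

-- The integration variable `v` becomes the coordinate `ℓ` of the uniform point `θ'`, and the bound
-- `v` on the other new weights becomes the condition that `ℓ` carries the largest one.
open scoped Classical in
theorem integral_forestTerm_insert {ι : Type*} [Fintype ι] [DecidableEq ι]
    (D : Finset (Pair ι) → (Pair ι → ℝ) → ℂ)
    (hcont : ∀ F : Finset (Pair ι), (pairGraph F).IsAcyclic →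
      ContinuousOn (fun θ : Pair ι → ℝ => D F (treeInterp F fun ℓ => θ ℓ)) (Set.Icc 0 1))
    {F F' : Finset (Pair ι)} (hF' : (pairGraph F').IsAcyclic)
    {ℓ : Pair ι} (hℓ : ℓ ∉ F) {θ : Pair ι → ℝ} (hθ : θ ∈ Set.Icc (0 : Pair ι → ℝ) 1)
    {u : ℝ} (hu : u ∈ Set.Icc (0 : ℝ) 1) :
    IntervalIntegrable (fun v => forestTerm D (insert ℓ F) F' (Function.update θ ℓ v) v)
      volume 0 u ∧
    ∫ v in 0..u, forestTerm D (insert ℓ F) F' (Function.update θ ℓ v) v =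
      ∫ θ', if θ' ℓ ≤ u ∧ ∀ j ∈ F' \ insert ℓ F, θ' j ≤ θ' ℓ then
        D F' (treeInterp F' fun ℓ => F.piecewise θ θ' ℓ) else 0 ∂cubeMeasure (Pair ι) := by
  set g : (Pair ι → ℝ) → ℂ := fun θ' => if θ' ℓ ≤ u ∧ ∀ j ∈ F' \ insert ℓ F, θ' j ≤ θ' ℓ then
        D F' (treeInterp F' fun ℓ => F.piecewise θ θ' ℓ) else 0 with hg
  have hgi : Integrable g (cubeMeasure (Pair ι)) :=
    integrable_forest_ite D hcont hF' hθ _ (measurableSet_le_and_forall_le (F' \ insert ℓ F) ℓ u)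
  have hmp := measurePreserving_update ℓ
  have hgi' := hmp.integrable_comp_of_integrable hgi
  have hval : ∀ v θ', g (Function.update θ' ℓ v) = if v ≤ u then
      (if ∀ j ∈ F' \ insert ℓ F, θ' j ≤ v then D F' (treeInterp F' fun e =>
        (insert ℓ F).piecewise (Function.update θ ℓ v) θ' e) else 0) else 0 := by
    intro v θ'
    have h1 : (∀ j ∈ F' \ insert ℓ F, Function.update θ' ℓ v j ≤ v) ↔
        ∀ j ∈ F' \ insert ℓ F, θ' j ≤ v := by
      refine forall₂_congr fun j hj => ?_
      have : j ≠ ℓ := fun h => (Finset.mem_sdiff.1 hj).2 (h ▸ Finset.mem_insert_self _ _)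
      rw [Function.update_of_ne this]
    have h2 : F.piecewise θ (Function.update θ' ℓ v) =
        (insert ℓ F).piecewise (Function.update θ ℓ v) θ' := by
      funext j
      by_cases hj : j = ℓ
      · subst hj
        simp [Finset.piecewise, hℓ]
      · simp [Finset.piecewise, hj]
    simp only [hg, Function.update_self, h1, h2]
    split_ifs <;> tauto
  have hint : ∀ v, ∫ θ', g (Function.update θ' ℓ v) ∂cubeMeasure (Pair ι) =
      (Set.Iic u).indicator
        (fun v => forestTerm D (insert ℓ F) F' (Function.update θ ℓ v) v) v := by
    intro v
    by_cases hv : v ≤ u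
    · rw [Set.indicator_of_mem (show v ∈ Set.Iic u from hv)]
      simp only [hval, if_pos hv]
      rfl
    · rw [Set.indicator_of_notMem (show v ∉ Set.Iic u from hv)]
      simp only [hval, if_neg hv, integral_zero]
  have hset : Set.Icc (0 : ℝ) 1 ∩ Set.Iic u = Set.Icc 0 u := by
    ext v
    simp only [Set.mem_inter_iff, Set.mem_Icc, Set.mem_Iic]
    exact ⟨fun h => ⟨h.1.1, h.2⟩, fun h => ⟨⟨h.1, h.2.trans hu.2⟩, h.2⟩⟩
  constructor
  · rw [intervalIntegrable_iff_integrableOn_Icc_of_le hu.1, ← hset]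
    have := hgi'.integral_prod_left
    simp only [Function.comp_apply, hint] at this
    rw [integrable_indicator_iff measurableSet_Iic] at this
    rwa [IntegrableOn, Set.inter_comm, ← Measure.restrict_restrict measurableSet_Iic]
  · rw [← hmp.map_eq, integral_map hmp.measurable.aemeasurable
      (by rw [hmp.map_eq]; exact hgi.aestronglyMeasurable)]
    refine Eq.trans ?_ (integral_prod (g ∘ fun p => Function.update p.2 ℓ p.1) hgi').symm
    simp only [Function.comp_apply, hint]
    rw [integral_indicator measurableSet_Iic, Measure.restrict_restrict measurableSet_Iic,
      Set.inter_comm, hset, intervalIntegral.integral_of_le hu.1, integral_Icc_eq_integral_Ioc]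

-- The new edge of largest weight is almost surely unique, so the events indexed by `ℓ` split the
-- region where all new weights are at most `u`.
open scoped Classical in
theorem sum_forest_max {ι : Type*} [Fintype ι] [DecidableEq ι]
    (D : Finset (Pair ι) → (Pair ι → ℝ) → ℂ)
    (hcont : ∀ F : Finset (Pair ι), (pairGraph F).IsAcyclic →
      ContinuousOn (fun θ : Pair ι → ℝ => D F (treeInterp F fun ℓ => θ ℓ)) (Set.Icc 0 1))
    {F F' : Finset (Pair ι)} (hF' : (pairGraph F').IsAcyclic)
    (hne : (F' \ F).Nonempty) {θ : Pair ι → ℝ} (hθ : θ ∈ Set.Icc (0 : Pair ι → ℝ) 1) (u : ℝ) :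
    ∑ ℓ ∈ F' \ F, ∫ θ', (if θ' ℓ ≤ u ∧ ∀ j ∈ F' \ insert ℓ F, θ' j ≤ θ' ℓ then
        D F' (treeInterp F' fun ℓ => F.piecewise θ θ' ℓ) else 0) ∂cubeMeasure (Pair ι) =
      forestTerm D F F' θ u := by
  rw [← integral_finsetSum _ fun ℓ _ => integrable_forest_ite D hcont hF' hθ
    (fun θ' => θ' ℓ ≤ u ∧ ∀ j ∈ F' \ insert ℓ F, θ' j ≤ θ' ℓ)
    (measurableSet_le_and_forall_le (F' \ insert ℓ F) ℓ u)]
  refine integral_congr_ae ?_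
  filter_upwards [ae_injective_cubeMeasure (Pair ι)] with θ' hinj
  obtain ⟨k, hk, hmax⟩ := Finset.exists_max_image (F' \ F) θ' hne
  rw [Finset.sum_eq_single_of_mem k hk]
  · refine if_congr ⟨fun h j hj => (hmax j hj).trans h.1, fun h => ⟨h k hk, fun j hj => ?_⟩⟩ rfl rfl
    refine hmax j (Finset.mem_sdiff.2 ⟨(Finset.mem_sdiff.1 hj).1, fun h' => ?_⟩)
    exact (Finset.mem_sdiff.1 hj).2 (Finset.mem_insert_of_mem h')
  · intro ℓ hℓ hne
    refine if_neg fun h => hne (hinj (le_antisymm (hmax ℓ hℓ) (h.2 k ?_)))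
    rw [Finset.mem_sdiff, Finset.mem_insert] 
    refine ⟨(Finset.mem_sdiff.1 hk).1, ?_⟩
    rintro (h | h)
    · exact hne h.symm
    · exact (Finset.mem_sdiff.1 hk).2 h

-- Induction on the number of pairs outside `F`. Each use of `hFTC` adds one edge, and edges appear
-- in the order of decreasing weights. Given the final forest `F'`, the edge added first is the one
-- of largest new weight, and summing over it removes the ordering (`sum_forest_max`).
open scoped Classical in
theorem forest_expansion {ι : Type*} [Fintype ι] [DecidableEq ι]
    (D : Finset (Pair ι) → (Pair ι → ℝ) → ℂ)
    (hcont : ∀ F : Finset (Pair ι), (pairGraph F).IsAcyclic →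
      ContinuousOn (fun θ : Pair ι → ℝ => D F (treeInterp F fun ℓ => θ ℓ)) (Set.Icc 0 1))
    (hFTC : ∀ (F : Finset (Pair ι)), (pairGraph F).IsAcyclic →
      ∀ θ ∈ Set.Icc (0 : Pair ι → ℝ) 1, ∀ u ∈ Set.Icc (0 : ℝ) 1, (∀ ℓ ∈ F, u ≤ θ ℓ) →
        D F (forestInterp F θ u) = D F (treeInterp F fun ℓ => θ ℓ) +
          ∑ ℓ ∈ (Set.toFinite {ℓ | ¬ Linked F ℓ}).toFinset,
            ∫ v in 0..u, D (insert ℓ F) (forestInterp F θ v))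
    (F : Finset (Pair ι)) (hF : (pairGraph F).IsAcyclic)
    {θ : Pair ι → ℝ} (hθ : θ ∈ Set.Icc (0 : Pair ι → ℝ) 1) {u : ℝ} (hu : u ∈ Set.Icc (0 : ℝ) 1)
    (huθ : ∀ ℓ ∈ F, u ≤ θ ℓ) :
    D F (forestInterp F θ u) =
      ∑ F' : Finset (Pair ι) with F ⊆ F' ∧ (pairGraph F').IsAcyclic, forestTerm D F F' θ u := by
  induction hn : Fᶜ.card using Nat.strong_induction_on generalizing F θ u with
  | _ n ih =>
  rw [hFTC F hF θ hθ u hu huθ]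
  have hself : forestTerm D F F θ u = D F (treeInterp F fun ℓ => θ ℓ) := by
    simp [forestTerm]
  have hmem : F ∈ Finset.univ.filter
      fun F' : Finset (Pair ι) => F ⊆ F' ∧ (pairGraph F').IsAcyclic := by
    simpa using hF
  rw [← Finset.add_sum_erase _ _ hmem, hself]
  congr 1
  have hstep : ∀ ℓ ∈ (Set.toFinite {ℓ | ¬ Linked F ℓ}).toFinset,
      ∫ v in 0..u, D (insert ℓ F) (forestInterp F θ v) =
      ∑ F' : Finset (Pair ι) with insert ℓ F ⊆ F' ∧ (pairGraph F').IsAcyclic,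
        ∫ θ', if θ' ℓ ≤ u ∧ ∀ j ∈ F' \ insert ℓ F, θ' j ≤ θ' ℓ then
          D F' (treeInterp F' fun ℓ => F.piecewise θ θ' ℓ) else 0 ∂cubeMeasure (Pair ι) := by
    intro ℓ hℓ
    have hℓ' : ¬ Linked F ℓ := by simpa using hℓ
    have hℓF : ℓ ∉ F := fun h => hℓ' (linked_of_mem h)
    have hac := (isAcyclic_insert_iff hF hℓF).2 hℓ'
    have h1 : ∀ v ∈ Set.uIcc 0 u, D (insert ℓ F) (forestInterp F θ v) =
        ∑ F' : Finset (Pair ι) with insert ℓ F ⊆ F' ∧ (pairGraph F').IsAcyclic,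
          forestTerm D (insert ℓ F) F' (Function.update θ ℓ v) v := by
      intro v hv
      rw [Set.uIcc_of_le hu.1] at hv
      have hv1 : v ∈ Set.Icc (0 : ℝ) 1 := ⟨hv.1, hv.2.trans hu.2⟩
      -- The number `v` is both the weight of the new edge and the new upper limit, so the induction
      -- hypothesis applies to `insert ℓ F`.
      rw [← forestInterp_insert hF hℓ' θ hv.1]
      refine ih (insert ℓ F)ᶜ.card ?_ (insert ℓ F) hac ?_ hv1 ?_ rfl
      · rw [← hn]
        refine Finset.card_lt_card ?_
        rw [Finset.compl_ssubset_compl]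
        exact Finset.ssubset_insert hℓF
      · constructor
        · intro i
          by_cases hi : i = ℓ
          · subst hi; simpa using hv1.1
          · simpa [Function.update_of_ne hi] using hθ.1 i
        · intro i
          by_cases hi : i = ℓ
          · subst hi; simpa using hv1.2
          · simpa [Function.update_of_ne hi] using hθ.2 i
      · intro j hj
        by_cases hi : j = ℓ
        · subst hi; simp
        · rw [Function.update_of_ne hi]
          exact hv.2.trans (huθ j ((Finset.mem_insert.1 hj).resolve_left hi))
    rw [intervalIntegral.integral_congr h1, intervalIntegral.integral_finsetSum]
    · exact Finset.sum_congr rfl fun F' hF' =>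
        (integral_forestTerm_insert D hcont (Finset.mem_filter.1 hF').2.2 hℓF hθ hu).2
    · exact fun F' hF' =>
        (integral_forestTerm_insert D hcont (Finset.mem_filter.1 hF').2.2 hℓF hθ hu).1
  rw [Finset.sum_congr rfl hstep]
  rw [Finset.sum_comm' (t' := (Finset.univ.filter
      fun F' : Finset (Pair ι) => F ⊆ F' ∧ (pairGraph F').IsAcyclic).erase F)
      (s' := fun F' => F' \ F)]
  · refine Finset.sum_congr rfl fun F' hF' => ?_
    rw [Finset.mem_erase, Finset.mem_filter] at hF'
    refine sum_forest_max D hcont hF'.2.2.2 ?_ hθ u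
    rw [Finset.sdiff_nonempty]
    exact fun h => hF'.1 (h.antisymm hF'.2.2.1)
  · intro ℓ F'
    simp only [Set.Finite.mem_toFinset, Set.mem_ofPred_eq, Finset.mem_filter, Finset.mem_univ,
      true_and, Finset.mem_sdiff, Finset.mem_erase, Finset.insert_subset_iff]
    constructor
    · rintro ⟨h1, ⟨h2, h3⟩, h4⟩
      have : ℓ ∉ F := fun h => h1 (linked_of_mem h)
      exact ⟨⟨h2, this⟩, fun h => this (h ▸ h2), h3, h4⟩
    · rintro ⟨⟨h1, h2⟩, -, h3, h4⟩
      refine ⟨?_, ⟨h1, h3⟩, h4⟩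
      rw [← isAcyclic_insert_iff hF h2]
      exact isAcyclic_mono (Finset.insert_subset h1 h3) h4

-- The expansion starts from the empty forest at `u = 1`, where all parameters equal `1` and the
-- upper bound on the weights is void.
open scoped Classical in
theorem forest_formula_aux {ι : Type*} [Fintype ι] [DecidableEq ι]
    (D : Finset (Pair ι) → (Pair ι → ℝ) → ℂ)
    (hcont : ∀ F : Finset (Pair ι), (pairGraph F).IsAcyclic →
      ContinuousOn (fun θ : Pair ι → ℝ => D F (treeInterp F fun ℓ => θ ℓ)) (Set.Icc 0 1))
    (hFTC : ∀ (F : Finset (Pair ι)), (pairGraph F).IsAcyclic →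
      ∀ θ ∈ Set.Icc (0 : Pair ι → ℝ) 1, ∀ u ∈ Set.Icc (0 : ℝ) 1, (∀ ℓ ∈ F, u ≤ θ ℓ) →
        D F (forestInterp F θ u) = D F (treeInterp F fun ℓ => θ ℓ) +
          ∑ ℓ ∈ (Set.toFinite {ℓ | ¬ Linked F ℓ}).toFinset,
            ∫ v in 0..u, D (insert ℓ F) (forestInterp F θ v)) :
    D ∅ 1 = ∑ F : Finset (Pair ι) with (pairGraph F).IsAcyclic,
      ∫ θ, D F (treeInterp F fun ℓ => θ ℓ) ∂cubeMeasure (Pair ι) := by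
  have h0 : (pairGraph (∅ : Finset (Pair ι))).IsAcyclic := by
    have : pairGraph (∅ : Finset (Pair ι)) = ⊥ := by
      ext x y
      simp [pairGraph_adj]
    rw [this]
    exact SimpleGraph.isAcyclic_bot
  have := forest_expansion D hcont hFTC ∅ h0 (θ := 1) ⟨zero_le_one, le_rfl⟩ (u := 1)
    ⟨zero_le_one, le_rfl⟩ (by simp)
  rw [forestInterp_empty] at this
  rw [this]
  refine Finset.sum_congr (by simp) fun F _ => ?_
  refine integral_congr_ae ?_
  filter_upwards [ae_mem_cube (Pair ι)] with θ hθ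
  have h1 : ∀ j ∈ F \ ∅, θ j ≤ 1 := fun j _ => hθ.2 j
  rw [if_pos h1]
  simp

end ClusterExpansion

end

noncomputable section

open scoped ENNReal ContDiff

namespace ClusterExpansion

open MeasureTheory

/-! ### Products of commuting operators -/

/-- `applyAll` composes in the unspecified order of `Finset.toList`. Derivatives commute only on
smooth functions (`P`) and only up to equality on a set (`r`), so independence of the order is
stated relative to both. -/
theorem foldr_perm_rel {κ α : Type*} {D : κ → α → α} {r : α → α → Prop} (hr : Equivalence r)
    {P : α → Prop} (hP : ∀ k f, P f → P (D k f)) (hD : ∀ k f g, r f g → r (D k f) (D k g))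
    (hcomm : ∀ j k f, P f → r (D j (D k f)) (D k (D j f))) {l₁ l₂ : List κ} (h : l₁.Perm l₂)
    {f : α} (hf : P f) : r (l₁.foldr D f) (l₂.foldr D f) := by
  have hPl : ∀ l : List κ, P (l.foldr D f) := fun l => by
    induction l with
    | nil => exact hf
    | cons k l ih => exact hP k _ ih
  induction h with
  | nil => exact hr.refl _
  | cons k _ ih => exact hD k _ _ ih
  | swap j k l => exact hcomm _ _ _ (hPl l)
  | trans _ _ ih₁ ih₂ => exact hr.trans ih₁ ih₂

theorem applyAll_empty {κ α : Type*} (D : κ → α → α) (f : α) : applyAll ∅ D f = f := by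
  simp [applyAll]

theorem equivalence_eqOn {E : Type*} (K : Set E) : Equivalence fun f g : E → ℂ => Set.EqOn f g K :=
  ⟨fun _ _ _ => rfl, fun h => h.symm, fun h h' => h.trans h'⟩

/-! ### Directional derivatives within a set -/

/-- The derivative of `g` within `K` in the direction `v`. -/
def dirWithin {E : Type*} [NormedAddCommGroup E] [NormedSpace ℝ E] (K : Set E) (v : E)
    (g : E → ℂ) : E → ℂ :=
  fun p => fderivWithin ℝ g K p v

section DirWithin

variable {E : Type*} [NormedAddCommGroup E] [NormedSpace ℝ E] {K : Set E}

theorem ContDiffOn.dirWithin (hK : UniqueDiffOn ℝ K) {g : E → ℂ} (hg : ContDiffOn ℝ ∞ g K)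
    (v : E) : ContDiffOn ℝ ∞ (dirWithin K v g) K :=
  (hg.fderivWithin hK (by simp)).clm_apply contDiffOn_const

theorem dirWithin_congr {g g' : E → ℂ} (h : Set.EqOn g g' K) (v : E) :
    Set.EqOn (dirWithin K v g) (dirWithin K v g') K := fun p hp => by
  rw [dirWithin, dirWithin, fderivWithin_congr h (h hp)]

/-- The second derivative within `K` is symmetric at limits of interior points, which is what `hK'`
provides. The parameters of a forest that is not a tree have zero entries and lie on the boundary of
the cube, hence the derivatives within a set. -/
theorem dirWithin_comm (hK : UniqueDiffOn ℝ K) (hK' : K ⊆ closure (interior K)) {g : E → ℂ}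
    (hg : ContDiffOn ℝ ∞ g K) (v w : E) :
    Set.EqOn (dirWithin K v (dirWithin K w g)) (dirWithin K w (dirWithin K v g)) K := by
  intro p hp
  have hd : DifferentiableWithinAt ℝ (fderivWithin ℝ g K) K p :=
    ((hg.fderivWithin hK (m := ∞) (by simp)).differentiableOn (by simp)) p hp
  have h : ∀ a b : E, dirWithin K a (dirWithin K b g) p =
      fderivWithin ℝ (fderivWithin ℝ g K) K p a b := by
    intro a b
    unfold dirWithin
    rw [fderivWithin_clm_apply (hK p hp) hd (differentiableWithinAt_const b)]
    simp
  rw [h, h]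
  exact ContDiffWithinAt.isSymmSndFDerivWithinAt (hg p hp)
    (by
      rw [minSmoothness_of_isRCLikeNormedField]
      exact WithTop.coe_le_coe.2 (le_top : (2 : ℕ∞) ≤ ⊤)) hK (hK' hp) hp v w

theorem ContDiffOn.foldr_dirWithin (hK : UniqueDiffOn ℝ K) {g : E → ℂ} (hg : ContDiffOn ℝ ∞ g K)
    {κ : Type*} (v : κ → E) (l : List κ) :
    ContDiffOn ℝ ∞ (l.foldr (fun k => ClusterExpansion.dirWithin K (v k)) g) K := by
  induction l with
  | nil => exact hg
  | cons k l ih => exact ContDiffOn.dirWithin hK ih (v k)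

theorem foldr_dirWithin_perm (hK : UniqueDiffOn ℝ K) (hK' : K ⊆ closure (interior K)) {g : E → ℂ}
    (hg : ContDiffOn ℝ ∞ g K) {κ : Type*} (v : κ → E) {l₁ l₂ : List κ} (h : l₁.Perm l₂) :
    Set.EqOn (l₁.foldr (fun k => dirWithin K (v k)) g)
      (l₂.foldr (fun k => dirWithin K (v k)) g) K :=
  foldr_perm_rel (equivalence_eqOn K) (P := fun f => ContDiffOn ℝ ∞ f K)
    (fun k _ hf => ContDiffOn.dirWithin hK hf (v k)) (fun k _ _ h => dirWithin_congr h (v k))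
    (fun j k _ hf => dirWithin_comm hK hK' hf (v j) (v k)) h hg

theorem applyAll_dirWithin_insert (hK : UniqueDiffOn ℝ K) (hK' : K ⊆ closure (interior K))
    {g : E → ℂ} (hg : ContDiffOn ℝ ∞ g K) {κ : Type*} [DecidableEq κ] (v : κ → E) {F : Finset κ}
    {k : κ} (hk : k ∉ F) :
    Set.EqOn (applyAll (insert k F) (fun k => dirWithin K (v k)) g)
      (dirWithin K (v k) (applyAll F (fun k => dirWithin K (v k)) g)) K :=
  foldr_dirWithin_perm hK hK' hg v (Finset.toList_insert hk)

theorem applyAll_dirWithin_map (hK : UniqueDiffOn ℝ K) (hK' : K ⊆ closure (interior K))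
    {g : E → ℂ} (hg : ContDiffOn ℝ ∞ g K) {κ κ' : Type*} (v : κ' → E) (F : Finset κ)
    (e : κ ↪ κ') :
    Set.EqOn (applyAll (F.map e) (fun k => dirWithin K (v k)) g)
      (applyAll F (fun k => dirWithin K (v (e k))) g) K := by
  have hp : (F.map e).toList.Perm (F.toList.map e) := by
    rw [← Multiset.coe_eq_coe, ← Multiset.map_coe, Finset.coe_toList, Finset.coe_toList,
      Finset.map_val]
  refine (foldr_dirWithin_perm hK hK' hg v hp).trans ?_
  rw [List.foldr_map]
  exact fun _ _ => rfl

theorem lineDeriv_eq_dirWithin {g : E → ℂ} {p v : E} (hg : DifferentiableWithinAt ℝ g K p)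
    (hv : ∀ᶠ t : ℝ in nhds 0, p + t • v ∈ K) : lineDeriv ℝ g p v = dirWithin K v g p :=
  ((hg.hasFDerivWithinAt.hasLineDerivWithinAt v).hasLineDerivAt' hv).lineDeriv

/-- `pairDeriv` is a two-sided derivative, while `G` is differentiated within `K`. The two agree
along `a` as soon as `U` contains short segments in the directions of `S`; `U` need not be open, nor
`a` map into the interior of `K`. -/
theorem foldr_pairDeriv_eq {ι : Type*} [DecidableEq ι] [Fintype ι] (hK : UniqueDiffOn ℝ K)
    {G : E → ℂ} (hG : ContDiffOn ℝ ∞ G K) {g : (Pair ι → ℝ) → ℂ} {U : Set (Pair ι → ℝ)}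
    {a : (Pair ι → ℝ) → E} {v : Pair ι → E} {c : ℂ} {S : Set (Pair ι)}
    (hU : ∀ s ∈ U, ∀ ℓ ∈ S, ∀ᶠ t : ℝ in nhds 0, s + t • (Pi.single ℓ 1 : Pair ι → ℝ) ∈ U)
    (ha : ∀ s (t : ℝ) ℓ, a (s + t • (Pi.single ℓ 1 : Pair ι → ℝ)) = a s + t • v ℓ)
    (haU : Set.MapsTo a U K) (hg : ∀ s ∈ U, g s = c * G (a s)) (l : List (Pair ι))
    (hl : ∀ ℓ ∈ l, ℓ ∈ S) : ∀ s ∈ U, l.foldr pairDeriv g s =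
      c * l.foldr (fun ℓ => dirWithin K (v ℓ)) G (a s) := by
  induction l with
  | nil => exact hg
  | cons ℓ l ih =>
    intro s hs
    have ih' := ih fun ℓ' h => hl ℓ' (List.mem_cons_of_mem _ h)
    have hev := hU s hs ℓ (hl ℓ List.mem_cons_self)
    have hsm := ContDiffOn.foldr_dirWithin hK hG v l
    set G' := l.foldr (fun ℓ => dirWithin K (v ℓ)) G
    have h1 : lineDeriv ℝ G' (a s) (v ℓ) = dirWithin K (v ℓ) G' (a s) :=
      lineDeriv_eq_dirWithin (hsm.differentiableOn (by simp) _ (haU hs))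
        (hev.mono fun t ht => ha s t ℓ ▸ haU ht)
    simp only [List.foldr_cons]
    rw [← h1, pairDeriv, lineDeriv, lineDeriv, ← deriv_const_mul_field]
    refine Filter.EventuallyEq.deriv_eq (hev.mono fun t ht => ?_)
    simp only [ih' _ ht, ha]

theorem applyAll_pairDeriv_eq_of_isOpen {ι : Type*} [DecidableEq ι] [Fintype ι]
    {U : Set (Pair ι → ℝ)} (hU : IsOpen U) {f : (Pair ι → ℝ) → ℂ} (hf : ContDiffOn ℝ ∞ f U)
    (F : Finset (Pair ι)) : Set.EqOn (applyAll F pairDeriv f)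
      (applyAll F (fun ℓ => dirWithin U (Pi.single ℓ 1)) f) U := by
  intro s hs
  refine (foldr_pairDeriv_eq (c := 1) (S := Set.univ) (a := id) hU.uniqueDiffOn hf ?_
    (fun _ _ _ => rfl) (Set.mapsTo_id U) (fun _ _ => (one_mul _).symm) F.toList
    (fun _ _ => trivial) s hs).trans (one_mul _)
  intro s hs ℓ _
  have hc : Continuous fun t : ℝ => s + t • (Pi.single ℓ 1 : Pair ι → ℝ) := by fun_prop
  exact hc.continuousAt.eventually_mem (hU.mem_nhds (by simpa using hs))

/-- Each derivative hits one of the two factors; `F` collects those that hit `f`. -/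
theorem applyAll_dirWithin_mul {κ : Type*} [DecidableEq κ] (hK : UniqueDiffOn ℝ K)
    (hK' : K ⊆ closure (interior K)) {f g : E → ℂ} (hf : ContDiffOn ℝ ∞ f K)
    (hg : ContDiffOn ℝ ∞ g K) (v : κ → E) (T : Finset κ) :
    Set.EqOn (applyAll T (fun k => dirWithin K (v k)) (f * g))
      (∑ F ∈ T.powerset, applyAll F (fun k => dirWithin K (v k)) f *
        applyAll (T \ F) (fun k => dirWithin K (v k)) g) K := by
  induction T using Finset.induction_on with
  | empty => simp [applyAll_empty, Set.eqOn_refl]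
  | insert k T hk ih =>
    refine (applyAll_dirWithin_insert hK hK' (hf.mul hg) v hk).trans ?_
    refine (dirWithin_congr ih (v k)).trans ?_
    intro p hp
    have hsm : ∀ {h : E → ℂ}, ContDiffOn ℝ ∞ h K → ∀ F : Finset κ,
        DifferentiableWithinAt ℝ (applyAll F (fun k => dirWithin K (v k)) h) K p :=
      fun hh F => (ContDiffOn.foldr_dirWithin hK hh v _).differentiableOn (by simp) p hp
    rw [dirWithin, fderivWithin_sum (hK p hp) fun F _ => (hsm hf F).mul (hsm hg _),
      Finset.sum_powerset_insert hk, sum_apply, Pi.add_apply,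
      Finset.sum_apply, Finset.sum_apply, ← Finset.sum_add_distrib]
    refine Finset.sum_congr rfl fun F hF => ?_
    rw [Finset.mem_powerset] at hF
    have hkF : k ∉ F := fun h => hk (hF h)
    rw [fderivWithin_mul (hK p hp) (hsm hf F) (hsm hg _)]
    have e1 : insert k T \ F = insert k (T \ F) := Finset.insert_sdiff_of_notMem _ hkF
    have e2 : insert k T \ insert k F = T \ F := by
      ext j
      simp only [Finset.mem_sdiff, Finset.mem_insert]
      constructor
      · rintro ⟨h | h, h'⟩
        · exact absurd (Or.inl h) h'
        · exact ⟨h, fun h'' => h' (Or.inr h'')⟩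
      · rintro ⟨h, h'⟩
        refine ⟨Or.inr h, ?_⟩
        rintro (h'' | h'')
        · exact hk (h'' ▸ h)
        · exact h' h''
    rw [e1, e2, Pi.mul_apply, Pi.mul_apply,
      applyAll_dirWithin_insert hK hK' hg v (fun h => hk (Finset.mem_sdiff.1 h).1) hp,
      applyAll_dirWithin_insert hK hK' hf v hkF hp]
    simp only [add_apply, smul_apply, smul_eq_mul,
      dirWithin]
    ring

end DirWithin

theorem applyAll_pairDeriv_mul {ι : Type*} [DecidableEq ι] [Fintype ι]
    {U : Set (Pair ι → ℝ)} (hU : IsOpen U) {f g : (Pair ι → ℝ) → ℂ} (hf : ContDiffOn ℝ ∞ f U)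
    (hg : ContDiffOn ℝ ∞ g U) (T : Finset (Pair ι)) {s : Pair ι → ℝ} (hs : s ∈ U) :
    applyAll T pairDeriv (fun s => f s * g s) s = ∑ F ∈ T.powerset,
      applyAll F pairDeriv f s * applyAll (T \ F) pairDeriv g s := by
  have hU' : U ⊆ closure (interior U) := by
    rw [hU.interior_eq]
    exact subset_closure
  have := applyAll_dirWithin_mul hU.uniqueDiffOn hU' hf hg (fun ℓ => Pi.single ℓ 1) T hs
  refine ((applyAll_pairDeriv_eq_of_isOpen hU (hf.mul hg) T hs).trans this).trans ?_
  rw [Finset.sum_apply]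
  refine Finset.sum_congr rfl fun F _ => ?_
  rw [Pi.mul_apply, applyAll_pairDeriv_eq_of_isOpen hU hf F hs,
    applyAll_pairDeriv_eq_of_isOpen hU hg (T \ F) hs]

/-! ### The forest formula -/

open scoped Classical in
/-- The Brydges–Kennedy–Abdesselam–Rivasseau forest formula. -/
theorem forest_formula {ι : Type*} [Fintype ι] [DecidableEq ι] {K : Set (Pair ι → ℝ)}
    (hK : UniqueDiffOn ℝ K) (hK' : K ⊆ closure (interior K)) (hultra : ∀ s, IsUltra s → s ∈ K)
    {h : (Pair ι → ℝ) → ℂ} (hh : ContDiffOn ℝ ∞ h K) :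
    h 1 = ∑ F : Finset (Pair ι) with (pairGraph F).IsAcyclic,
      ∫ θ, applyAll F (fun ℓ => dirWithin K (Pi.single ℓ 1)) h (treeInterp F fun ℓ => θ ℓ)
        ∂cubeMeasure (Pair ι) := by
  have hmem : ∀ F : Finset (Pair ι), (pairGraph F).IsAcyclic → ∀ θ ∈ Set.Icc (0 : Pair ι → ℝ) 1,
      ∀ u ∈ Set.Icc (0 : ℝ) 1, forestInterp F θ u ∈ K := fun F hF θ hθ u hu =>
    hultra _ (isUltra_forestInterp hF hθ hu)
  have hmem0 : ∀ F : Finset (Pair ι), (pairGraph F).IsAcyclic →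
      ∀ θ ∈ Set.Icc (0 : Pair ι → ℝ) 1, (treeInterp F fun ℓ => θ ℓ) ∈ K := by
    intro F hF θ hθ
    rw [← forestInterp_zero fun ℓ => hθ.1 ℓ]
    exact hmem F hF θ hθ 0 ⟨le_rfl, zero_le_one⟩
  have hsm : ∀ F : Finset (Pair ι), ContDiffOn ℝ ∞
      (applyAll F (fun ℓ => dirWithin K (Pi.single ℓ 1)) h) K :=
    fun F => ContDiffOn.foldr_dirWithin hK hh (fun ℓ => Pi.single ℓ 1) _
  have key := forest_formula_aux
    (fun F => applyAll F (fun ℓ => dirWithin K (Pi.single ℓ 1)) h) ?_ ?_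
  · simpa [applyAll_empty] using key
  · intro F hF
    refine (hsm F).continuousOn.comp (Continuous.continuousOn ?_) fun θ hθ => hmem0 F hF θ hθ
    exact (continuous_treeInterp F).comp (continuous_pi fun ℓ => continuous_apply _)
  · intro F hF θ hθ u hu huθ
    set g := applyAll F (fun ℓ => dirWithin K (Pi.single ℓ 1)) h with hg
    set S := (Set.toFinite {ℓ | ¬ Linked F ℓ}).toFinset with hS
    -- Only the pairs not linked by `F` move with the common value `v`. While `v` stays below the
    -- weights, `forestInterp F θ v` runs along a straight line in the direction `d`, and its
    -- derivative is the sum of the partial derivatives in `S`.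
    set d : Pair ι → ℝ := ∑ ℓ ∈ S, Pi.single ℓ 1 with hd
    have hcurve : ∀ v ∈ Set.Icc 0 u,
        forestInterp F θ v = (treeInterp F fun ℓ => θ ℓ) + v • d := by
      intro v hv
      funext e
      have hde : d e = if Linked F e then 0 else 1 := by
        simp only [hd, Finset.sum_apply, Pi.single_apply, Finset.sum_ite_eq]
        simp [hS]
      by_cases he : Linked F e
      · rw [forestInterp_of_linked hF he θ hv.1 fun ℓ hℓ => hv.2.trans (huθ ℓ hℓ)]
        simp [hde, he]
      · rw [forestInterp_of_not_linked he θ hv.1]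
        have := forestInterp_of_not_linked he θ le_rfl
        rw [forestInterp_zero fun ℓ => hθ.1 ℓ] at this
        simp [hde, he, this]
    have hmapsto : ∀ v ∈ Set.Icc 0 u, (treeInterp F fun ℓ => θ ℓ) + v • d ∈ K := by
      intro v hv
      rw [← hcurve v hv]
      exact hmem F hF θ hθ v ⟨hv.1, hv.2.trans hu.2⟩
    have hcc : Continuous fun v : ℝ => (treeInterp F fun ℓ => θ ℓ) + v • d := by fun_prop
    have hpt : ∀ v ∈ Set.Icc 0 u, ∑ ℓ ∈ S, applyAll (insert ℓ F)
        (fun ℓ => dirWithin K (Pi.single ℓ 1)) h (forestInterp F θ v) =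
        fderivWithin ℝ g K ((treeInterp F fun ℓ => θ ℓ) + v • d) d := by
      intro v hv
      rw [hd, map_sum]
      refine Finset.sum_congr rfl fun ℓ hℓ => ?_
      have hℓ' : ¬ Linked F ℓ := by simpa [hS] using hℓ
      rw [hcurve v hv, applyAll_dirWithin_insert hK hK' hh (fun ℓ => Pi.single ℓ 1)
        (fun h => hℓ' (linked_of_mem h)) (hmapsto v hv)]
      rfl
    have hterm : ∀ ℓ, ContinuousOn (fun v => applyAll (insert ℓ F)
        (fun ℓ => dirWithin K (Pi.single ℓ 1)) h (forestInterp F θ v)) (Set.Icc 0 u) := by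
      intro ℓ
      refine ContinuousOn.congr (f := fun v => applyAll (insert ℓ F)
        (fun ℓ => dirWithin K (Pi.single ℓ 1)) h ((treeInterp F fun ℓ => θ ℓ) + v • d)) ?_
        fun v hv => by simp only [hcurve v hv]
      exact (hsm _).continuousOn.comp hcc.continuousOn hmapsto
    rw [← intervalIntegral.integral_finsetSum fun ℓ _ =>
      ((hterm ℓ).mono (by rw [Set.uIcc_of_le hu.1])).intervalIntegrable]
    have hftc := intervalIntegral.integral_eq_sub_of_hasDerivAt_of_le hu.1
      (f := fun v => g ((treeInterp F fun ℓ => θ ℓ) + v • d))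
      (f' := fun v => ∑ ℓ ∈ S, applyAll (insert ℓ F)
        (fun ℓ => dirWithin K (Pi.single ℓ 1)) h (forestInterp F θ v))
      ((hsm F).continuousOn.comp hcc.continuousOn hmapsto) ?_ ?_
    · rw [hftc, hcurve u ⟨hu.1, le_rfl⟩]
      simp
    · intro v hv
      rw [hpt v ⟨hv.1.le, hv.2.le⟩]
      have h1 := ((hsm F).differentiableOn (by simp) _
        (hmapsto v ⟨hv.1.le, hv.2.le⟩)).hasFDerivWithinAt
      have h2 : HasDerivAt (fun v : ℝ => (treeInterp F fun ℓ => θ ℓ) + v • d) d v := by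
        simpa using ((hasDerivAt_id v).smul_const d).const_add (treeInterp F fun ℓ => θ ℓ)
      have h3 := h1.comp_hasDerivWithinAt (s := Set.Icc 0 u) v h2.hasDerivWithinAt hmapsto
      exact h3.hasDerivAt (Icc_mem_nhds hv.1 hv.2)
    · refine ContinuousOn.intervalIntegrable ?_
      rw [Set.uIcc_of_le hu.1]
      exact continuousOn_finsetSum _ fun ℓ _ => hterm ℓ

end ClusterExpansion

end

/-! ### Complex Gaussian densities: coercivity, smoothness, heat equation, decay and factorization
-/

noncomputable section

open scoped ENNReal ContDiff

namespace ClusterExpansion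

open MeasureTheory Matrix

/-! ### Coercive matrices -/

section Coercive

variable {n : Type*} [Fintype n]

/-- The numerical range of `M` lies in the half plane `Re z ≥ c`. -/
def Coercive (c : ℝ) (M : Matrix n n ℂ) : Prop :=
  ∀ v : n → ℂ, c * ∑ i, ‖v i‖ ^ 2 ≤ (star v ⬝ᵥ M *ᵥ v).re

theorem star_dotProduct_mulVec (M : Matrix n n ℂ) (v : n → ℂ) :
    star v ⬝ᵥ M *ᵥ v = ∑ i, ∑ j, star (v i) * M i j * v j := by
  simp only [dotProduct, mulVec, Finset.mul_sum, mul_assoc, Pi.star_apply]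

theorem sum_norm_sq_pos {v : n → ℂ} (hv : v ≠ 0) : 0 < ∑ i, ‖v i‖ ^ 2 := by
  obtain ⟨i, hi⟩ := Function.ne_iff.1 hv
  exact Finset.sum_pos' (fun _ _ => by positivity) ⟨i, Finset.mem_univ _, by
    have : 0 < ‖v i‖ := norm_pos_iff.2 hi
    positivity⟩

theorem Coercive.det_ne_zero [DecidableEq n] {c : ℝ} (hc : 0 < c) {M : Matrix n n ℂ}
    (hM : Coercive c M) : M.det ≠ 0 := by
  intro h
  obtain ⟨v, hv, hv'⟩ := Matrix.exists_mulVec_eq_zero_iff.2 h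
  have := hM v
  rw [hv', dotProduct_zero, Complex.zero_re] at this
  exact absurd this (not_le.2 (mul_pos hc (sum_norm_sq_pos hv)))

/-- An eigenvalue is a Rayleigh quotient, hence lies in the half plane `Re z ≥ c`, away from the cut
of the principal powers. -/
theorem Coercive.re_root_pos [DecidableEq n] {c : ℝ} (hc : 0 < c) {M : Matrix n n ℂ}
    (hM : Coercive c M) {z : ℂ} (hz : z ∈ M.charpoly.roots) : 0 < z.re := by
  have hz' : M.charpoly.IsRoot z := Polynomial.isRoot_of_mem_roots hz
  rw [Polynomial.IsRoot, Matrix.eval_charpoly] at hz'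
  obtain ⟨v, hv, hv'⟩ := Matrix.exists_mulVec_eq_zero_iff.2 hz'
  have h1 : M *ᵥ v = z • v := by
    rw [Matrix.sub_mulVec, sub_eq_zero] at hv'
    rw [← hv']
    ext i
    simp [Matrix.scalar_apply, Matrix.mulVec_diagonal]
  have h2 := hM v
  have h3 : star v ⬝ᵥ v = ((∑ i, ‖v i‖ ^ 2 : ℝ) : ℂ) := by
    simp only [dotProduct, Complex.ofReal_sum]
    refine Finset.sum_congr rfl fun i _ => ?_
    rw [← Complex.normSq_eq_norm_sq, Pi.star_apply, Complex.star_def,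
      ← Complex.normSq_eq_conj_mul_self]
  rw [h1, dotProduct_smul, h3, smul_eq_mul, Complex.re_mul_ofReal] at h2
  have h4 := sum_norm_sq_pos hv
  exact hc.trans_le (le_of_mul_le_mul_right h2 h4)

theorem norm_sq_mulVec_le (M : Matrix n n ℂ) (v : n → ℂ) :
    ∑ i, ‖(M *ᵥ v) i‖ ^ 2 ≤ (∑ i, ∑ j, ‖M i j‖ ^ 2) * ∑ i, ‖v i‖ ^ 2 := by
  rw [Finset.sum_mul]
  refine Finset.sum_le_sum fun i _ => ?_
  have h : ‖(M *ᵥ v) i‖ ≤ ∑ j, ‖M i j‖ * ‖v j‖ := by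
    refine (norm_sum_le _ _).trans (Finset.sum_le_sum fun j _ => ?_)
    rw [norm_mul]
  exact (pow_le_pow_left₀ (norm_nonneg _) h 2).trans (Finset.sum_mul_sq_le_sq_mul_sq _ _ _)

/-- With `u = M⁻¹ v` one has `Re ⟨v, M⁻¹ v⟩ = Re ⟨u, M u⟩ ≥ c |u|²`, while `|v|² ≤ b |u|²` because
`b` bounds the squared Hilbert–Schmidt norm. -/
theorem Coercive.inv [DecidableEq n] {c b : ℝ} (hc : 0 < c) {M : Matrix n n ℂ}
    (hM : Coercive c M) (hb : 0 < b) (hMb : ∑ i, ∑ j, ‖M i j‖ ^ 2 ≤ b) :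
    Coercive (c / b) M⁻¹ := by
  intro v
  have hdet : IsUnit M.det := (hM.det_ne_zero hc).isUnit
  set u := M⁻¹ *ᵥ v
  have hv : v = M *ᵥ u := by
    rw [Matrix.mulVec_mulVec, Matrix.mul_nonsing_inv _ hdet, Matrix.one_mulVec]
  have h1 : (star v ⬝ᵥ u).re = (star u ⬝ᵥ M *ᵥ u).re := by
    rw [← hv]
    have : star v ⬝ᵥ u = star (star u ⬝ᵥ v) := by
      rw [Matrix.star_dotProduct]
    rw [this, Complex.star_def, Complex.conj_re]
  rw [h1]
  refine le_trans ?_ (hM u)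
  have h2 : ∑ i, ‖v i‖ ^ 2 ≤ b * ∑ i, ‖u i‖ ^ 2 := by
    rw [hv]
    exact (norm_sq_mulVec_le M u).trans
      (mul_le_mul_of_nonneg_right hMb (Finset.sum_nonneg fun _ _ => by positivity))
  calc c / b * ∑ i, ‖v i‖ ^ 2 ≤ c / b * (b * ∑ i, ‖u i‖ ^ 2) := by gcongr
    _ = c * ∑ i, ‖u i‖ ^ 2 := by field_simp

theorem Coercive.submatrix {m : Type*} [Fintype m] {c : ℝ} {M : Matrix n n ℂ} (hM : Coercive c M)
    {f : m → n} (hf : Function.Injective f) : Coercive c (M.submatrix f f) := by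
  intro v
  have hext : ∀ i, Function.extend f v 0 (f i) = v i := fun i => hf.extend_apply v 0 i
  have hext0 : ∀ j, j ∉ Set.range f → Function.extend f v 0 j = 0 := fun j hj => by
    rw [Function.extend_apply' _ _ _ (fun ⟨i, hi⟩ => hj ⟨i, hi⟩), Pi.zero_apply]
  have h := hM (Function.extend f v 0)
  rw [star_dotProduct_mulVec] at h ⊢
  have h1 : ∑ i, ‖v i‖ ^ 2 = ∑ j, ‖Function.extend f v 0 j‖ ^ 2 := by
    refine Fintype.sum_of_injective f hf _ _ (fun j hj => ?_) fun i => by rw [hext]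
    rw [hext0 j hj]; simp
  rw [h1]
  refine h.trans_eq (congrArg Complex.re (Eq.symm ?_))
  refine Fintype.sum_of_injective f hf _ (fun i => ∑ j, star (Function.extend f v 0 i) * M i j *
    Function.extend f v 0 j) (fun j hj => ?_) fun i => ?_
  · simp only [hext0 j hj]; simp
  · have h2 : ∀ k ∉ Set.range f, star (Function.extend f v 0 (f i)) * M (f i) k *
        Function.extend f v 0 k = 0 := fun k hk => by rw [hext0 k hk, mul_zero]
    exact Fintype.sum_of_injective (M := ℂ) f hf _ _ h2 fun k => by simp [hext]

/-- Apply the hypothesis to the part of `v` in each block and add: the off-diagonal blocks never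
enter. -/
theorem Coercive.blocks {q : Type*} [Fintype q] [DecidableEq q] {c : ℝ} {M : Matrix n n ℂ}
    (hM : Coercive c M) (k : n → q) :
    Coercive c (Matrix.of fun i j => if k i = k j then M i j else 0) := by
  intro v
  have h : ∑ a, c * ∑ i, ‖(if k i = a then v i else 0 : ℂ)‖ ^ 2 ≤
      ∑ a, (star (fun i => if k i = a then v i else 0) ⬝ᵥ
        M *ᵥ fun i => if k i = a then v i else 0).re :=
    Finset.sum_le_sum fun a _ => hM _
  have h1 : ∑ i, ‖v i‖ ^ 2 = ∑ a, ∑ i, ‖(if k i = a then v i else 0 : ℂ)‖ ^ 2 := by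
    rw [Finset.sum_comm]
    refine Finset.sum_congr rfl fun i _ => ?_
    rw [Finset.sum_eq_single (k i)] <;> simp +contextual [eq_comm]
  rw [h1, Finset.mul_sum]
  refine h.trans_eq ?_
  rw [← Complex.re_sum]
  refine congrArg Complex.re ?_
  simp only [star_dotProduct_mulVec, Matrix.of_apply]
  rw [Finset.sum_comm]
  refine Finset.sum_congr rfl fun i _ => ?_
  rw [Finset.sum_comm]
  refine Finset.sum_congr rfl fun j _ => ?_
  rw [Finset.sum_eq_single (k i)]
  · by_cases h : k i = k j
    · simp [h]
    · simp [h, Ne.symm h]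
  · intro a _ ha
    simp [Ne.symm ha]
  · simp

/-- The form changes by at most `δ (∑ |v i|)²`, which Cauchy–Schwarz bounds by `δ n |v|²`. This
makes the set of admissible parameters open. -/
theorem Coercive.perturb {c δ : ℝ} {M M' : Matrix n n ℂ} (hM : Coercive c M)
    (h : ∀ i j, ‖M' i j - M i j‖ ≤ δ) : Coercive (c - δ * Fintype.card n) M' := by
  intro v
  have h1 := hM v
  have h2 : |(star v ⬝ᵥ (M' - M) *ᵥ v).re| ≤ δ * Fintype.card n * ∑ i, ‖v i‖ ^ 2 := by
    refine (Complex.abs_re_le_norm _).trans ?_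
    rw [star_dotProduct_mulVec]
    calc _ ≤ ∑ i, ∑ j, ‖v i‖ * δ * ‖v j‖ := by
          refine (norm_sum_le _ _).trans (Finset.sum_le_sum fun i _ => (norm_sum_le _ _).trans
            (Finset.sum_le_sum fun j _ => ?_))
          rw [norm_mul, norm_mul, norm_star]
          gcongr
          exact h i j
      _ = δ * (∑ i, ‖v i‖) ^ 2 := by
          rw [sq, Finset.sum_mul_sum, Finset.mul_sum]
          refine Finset.sum_congr rfl fun i _ => ?_
          rw [Finset.mul_sum]
          exact Finset.sum_congr rfl fun j _ => by ring
      _ ≤ _ := by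
          rcases isEmpty_or_nonempty n with hn | ⟨⟨i⟩⟩
          · simp
          have hδ : 0 ≤ δ := (norm_nonneg _).trans (h i i)
          rw [mul_assoc]
          gcongr
          exact sq_sum_le_card_mul_sum_sq
  have h3 : (star v ⬝ᵥ M' *ᵥ v).re = (star v ⬝ᵥ M *ᵥ v).re + (star v ⬝ᵥ (M' - M) *ᵥ v).re := by
    rw [← Complex.add_re, ← dotProduct_add, ← Matrix.add_mulVec, add_sub_cancel]
  rw [h3]
  linarith [abs_le.1 h2]

theorem exists_coercive {M : Matrix n n ℂ} (hM : ∀ v ≠ 0, 0 < (star v ⬝ᵥ M *ᵥ v).re) :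
    ∃ c > 0, Coercive c M := by
  set f : EuclideanSpace ℂ n → ℝ := fun v => (star v.ofLp ⬝ᵥ M *ᵥ v.ofLp).re
  have hf : Continuous f := by
    simp only [f, star_dotProduct_mulVec]
    fun_prop
  rcases isEmpty_or_nonempty n with hn | hn
  · exact ⟨1, one_pos, fun v => by simp⟩
  obtain ⟨v₀, hv₀, hmin⟩ := (isCompact_sphere (0 : EuclideanSpace ℂ n) 1).exists_isMinOn
    (NormedSpace.sphere_nonempty.2 zero_le_one) hf.continuousOn
  have hv₀' : v₀.ofLp ≠ 0 := by
    intro h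
    have : v₀ = 0 := by ext i; simp [h]
    simp [this] at hv₀
  refine ⟨f v₀, hM _ hv₀', fun v => ?_⟩
  rcases eq_or_ne v 0 with rfl | hv
  · simp
  set u : EuclideanSpace ℂ n := WithLp.toLp 2 v
  have hu : u ≠ 0 := fun h => hv (by
    have := congrArg WithLp.ofLp h
    simpa [u] using this)
  have hnu : 0 < ‖u‖ := norm_pos_iff.2 hu
  have hsq : ∑ i, ‖v i‖ ^ 2 = ‖u‖ ^ 2 := by rw [EuclideanSpace.norm_sq_eq]
  have h1 : f v₀ ≤ f ((‖u‖⁻¹ : ℝ) • u) := hmin (by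
    rw [mem_sphere_zero_iff_norm, norm_smul, norm_inv, norm_norm, inv_mul_cancel₀ hnu.ne'])
  have h2 : f ((‖u‖⁻¹ : ℝ) • u) = (‖u‖ ^ 2)⁻¹ * (star v ⬝ᵥ M *ᵥ v).re := by
    simp only [f, star_dotProduct_mulVec, u]
    rw [← Complex.re_ofReal_mul]
    congr 1
    rw [Finset.mul_sum]
    refine Finset.sum_congr rfl fun i _ => ?_
    rw [Finset.mul_sum]
    refine Finset.sum_congr rfl fun j _ => ?_
    simp
    ring
  rw [h2] at h1
  rw [hsq]
  calc f v₀ * ‖u‖ ^ 2 ≤ (‖u‖ ^ 2)⁻¹ * (star v ⬝ᵥ M *ᵥ v).re * ‖u‖ ^ 2 := by gcongr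
    _ = _ := by field_simp

/-- As `C⁻¹` is symmetric, the cross terms between the real and imaginary parts of a vector drop out
of the real part of its form. Positivity of `Re C⁻¹` on real vectors thus makes `C⁻¹` coercive on
complex ones, and inversion carries this over to `C`. -/
theorem exists_coercive_of_posDef_inv [DecidableEq n] {C : Matrix n n ℂ} (hC : C.IsSymm)
    (hpos : (C⁻¹.map Complex.re).PosDef) : ∃ c > 0, Coercive c C := by
  set B := C⁻¹
  have hB : ∀ i j, B i j = B j i := fun i j => by
    have : Bᵀ = B := by rw [Matrix.transpose_nonsing_inv, hC.eq]
    exact congrFun₂ this j i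
  obtain ⟨c, hc, hBc⟩ : ∃ c > 0, Coercive c B := by
    refine exists_coercive fun v hv => ?_
    have key : (star v ⬝ᵥ B *ᵥ v).re =
        (star (fun i => (v i).re) ⬝ᵥ B.map Complex.re *ᵥ fun i => (v i).re) +
        (star (fun i => (v i).im) ⬝ᵥ B.map Complex.re *ᵥ fun i => (v i).im) := by
      have h0 : ∑ i, ∑ j, ((v i).re * (B i j).im * (v j).im - (v i).im * (B i j).im * (v j).re)
          = 0 := by
        simp only [Finset.sum_sub_distrib]
        rw [sub_eq_zero, Finset.sum_comm]
        refine Finset.sum_congr rfl fun i _ => Finset.sum_congr rfl fun j _ => ?_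
        rw [hB i j]; ring
      rw [← sub_eq_zero, ← neg_eq_zero, ← h0, star_dotProduct_mulVec]
      simp only [dotProduct, mulVec, Finset.mul_sum, Complex.re_sum, ← Finset.sum_add_distrib,
        ← Finset.sum_sub_distrib, ← Finset.sum_neg_distrib]
      refine Finset.sum_congr rfl fun i _ => Finset.sum_congr rfl fun j _ => ?_
      simp
      ring
    rw [key]
    by_cases h : (fun i => (v i).re) = 0
    · have h' : (fun i => (v i).im) ≠ 0 := fun h' =>
        hv (funext fun i => Complex.ext (congrFun h i) (congrFun h' i))
      exact add_pos_of_nonneg_of_pos (hpos.posSemidef.dotProduct_mulVec_nonneg _)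
        (hpos.dotProduct_mulVec_pos h')
    · exact add_pos_of_pos_of_nonneg (hpos.dotProduct_mulVec_pos h)
        (hpos.posSemidef.dotProduct_mulVec_nonneg _)
  -- Being coercive, `C⁻¹` is invertible; this excludes the default value of the inverse of a
  -- singular matrix.
  have hdet : IsUnit C.det := by
    rw [← Matrix.isUnit_nonsing_inv_det_iff]
    exact (hBc.det_ne_zero hc).isUnit
  have hb : 0 < (∑ i, ∑ j, ‖B i j‖ ^ 2) + 1 := by positivity
  refine ⟨_, div_pos hc hb, ?_⟩
  have := hBc.inv hc hb (le_add_of_nonneg_right zero_le_one)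
  rwa [Matrix.nonsing_inv_nonsing_inv _ hdet] at this

end Coercive

/-! ### The interpolated covariance -/

section InterpCov

variable {ι : Type*} [DecidableEq ι] {N : ℕ} {C : Matrix (ι × Fin N) (ι × Fin N) ℂ}

/-- The factor multiplying `C(x, y)` in the interpolated covariance. -/
def pairWeight (s : Pair ι → ℝ) (x y : ι) : ℝ :=
  if h : x = y then 1 else s ⟨s(x, y), fun hd => h (Sym2.mk_isDiag_iff.1 hd)⟩

theorem interpCov_apply (s : Pair ι → ℝ) (ξ η : ι × Fin N) :
    interpCov C s ξ η = C ξ η * (pairWeight s ξ.1 η.1 : ℂ) := by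
  unfold interpCov pairWeight
  split_ifs <;> simp


theorem pairWeight_comm (s : Pair ι → ℝ) (x y : ι) : pairWeight s x y = pairWeight s y x := by
  unfold pairWeight
  by_cases h : x = y
  · simp [h]
  · rw [dif_neg h, dif_neg (Ne.symm h)]
    congr 2
    exact Sym2.eq_swap

theorem pairWeight_mem {s : Pair ι → ℝ} (hs : s ∈ Set.Icc (0 : Pair ι → ℝ) 1) (x y : ι) :
    pairWeight s x y ∈ Set.Icc (0 : ℝ) 1 := by
  unfold pairWeight
  split_ifs
  · simp
  · exact ⟨hs.1 _, hs.2 _⟩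

theorem IsUltra.min_pairWeight_le {s : Pair ι → ℝ} (hs : IsUltra s) (x y z : ι) :
    min (pairWeight s x y) (pairWeight s y z) ≤ pairWeight s x z := by
  by_cases hxz : x = z
  · rw [show pairWeight s x z = 1 by simp [pairWeight, hxz]]
    exact (min_le_left _ _).trans (pairWeight_mem hs.1 x y).2
  by_cases hxy : x = y
  · subst hxy; exact min_le_right _ _
  by_cases hyz : y = z
  · subst hyz; exact min_le_left _ _
  simp only [pairWeight, dif_neg hxz, dif_neg hxy, dif_neg hyz]
  exact hs.2 _ _ _ x y z rfl rfl rfl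

theorem isSymm_interpCov (hC : C.IsSymm) (s : Pair ι → ℝ) : (interpCov C s).IsSymm := by
  ext ξ η
  rw [Matrix.transpose_apply, interpCov_apply, interpCov_apply, pairWeight_comm, hC.apply]

/-- Layer cake: `s` is the integral over `t ∈ (0, 1]` of the indicator of `t ≤ s`. For ultrametric
parameters `t ≤ s` is an equivalence relation of sites, so each layer is a block truncation of `C`,
coercive with the same constant, and so is the average. -/
theorem Coercive.interpCov [Fintype ι] {c : ℝ} (hC : Coercive c C) {s : Pair ι → ℝ}
    (hs : IsUltra s) : Coercive c (interpCov C s) := by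
  classical
  intro v
  have h0 : ∀ t : ℝ, t ∈ Set.Ioc (0 : ℝ) 1 → c * ∑ ξ, ‖v ξ‖ ^ 2 ≤ ∑ ξ, ∑ η,
      (Set.Iic (pairWeight s ξ.1 η.1)).indicator (fun _ => (star (v ξ) * C ξ η * v η).re) t := by
    intro t ht
    let S : Setoid ι := ⟨fun x y => t ≤ pairWeight s x y, ⟨fun x => by simpa [pairWeight] using ht.2,
      fun {x y} h => by rwa [pairWeight_comm], fun {x y z} h h' =>
        (le_min h h').trans (hs.min_pairWeight_le x y z)⟩⟩
    have h := hC.blocks (fun ξ : ι × Fin N => (Quotient.mk S ξ.1)) v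
    rw [star_dotProduct_mulVec] at h
    refine h.trans (le_of_eq ?_)
    simp only [Complex.re_sum]
    refine Finset.sum_congr rfl fun ξ _ => Finset.sum_congr rfl fun η _ => ?_
    rw [Matrix.of_apply, Set.indicator_apply]
    have : Quotient.mk S ξ.1 = Quotient.mk S η.1 ↔ t ∈ Set.Iic (pairWeight s ξ.1 η.1) :=
      Quotient.eq
    simp only [this]
    split_ifs <;> simp
  have hint : ∀ a r : ℝ, Integrable ((Set.Iic a).indicator fun _ => r)
      (volume.restrict (Set.Ioc (0 : ℝ) 1)) := fun a r =>
    (integrable_const r).indicator measurableSet_Iic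
  have h1 : ∫ _ in Set.Ioc (0 : ℝ) 1, c * ∑ ξ, ‖v ξ‖ ^ 2 ≤ ∫ t in Set.Ioc (0 : ℝ) 1, ∑ ξ, ∑ η,
      (Set.Iic (pairWeight s ξ.1 η.1)).indicator (fun _ => (star (v ξ) * C ξ η * v η).re) t :=
    setIntegral_mono_on (integrable_const _)
      (integrable_finsetSum _ fun _ _ => integrable_finsetSum _ fun _ _ => hint _ _)
      measurableSet_Ioc h0
  have h2 : ∀ a ∈ Set.Icc (0 : ℝ) 1, ∀ r : ℝ,
      ∫ t in Set.Ioc (0 : ℝ) 1, (Set.Iic a).indicator (fun _ => r) t = r * a := by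
    intro a ha r
    rw [integral_indicator measurableSet_Iic, Measure.restrict_restrict measurableSet_Iic,
      setIntegral_const, Set.inter_comm, Set.Ioc_inter_Iic, min_eq_right ha.2, Measure.real,
      Real.volume_Ioc, sub_zero, ENNReal.toReal_ofReal ha.1, smul_eq_mul, mul_comm]
  rw [setIntegral_const, integral_finsetSum _ fun _ _ => integrable_finsetSum _ fun _ _ => hint _ _]
    at h1
  simp only [integral_finsetSum _ fun _ _ => hint _ _] at h1
  simp only [Measure.real, Real.volume_Ioc, sub_zero, ENNReal.toReal_ofReal zero_le_one,
    one_smul] at h1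
  refine h1.trans (le_of_eq ?_)
  rw [star_dotProduct_mulVec]
  simp only [Complex.re_sum]
  refine Finset.sum_congr rfl fun ξ _ => Finset.sum_congr rfl fun η _ => ?_
  rw [h2 _ (pairWeight_mem hs.1 _ _), interpCov_apply, ← mul_assoc,
    mul_right_comm (star (v ξ) * C ξ η),
    Complex.re_mul_ofReal]

end InterpCov

end ClusterExpansion

end

noncomputable section

open scoped ENNReal ContDiff

namespace ClusterExpansion

open MeasureTheory Matrix

/-! ### The normalisation of the complex Gaussian density -/

section GaussNorm

variable {n : Type*} [Fintype n] [DecidableEq n]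

/-- The canonical `det(2πM)^{-1/2}`. -/
def gaussNorm (M : Matrix n n ℂ) : ℂ :=
  (M.charpoly.roots.map fun z : ℂ => (2 * (Real.pi : ℂ) * z) ^ (-(1 / 2) : ℂ)).prod

theorem card_roots_charpoly (M : Matrix n n ℂ) :
    M.charpoly.roots.card = Fintype.card n := by
  rw [← (IsAlgClosed.splits M.charpoly).natDegree_eq_card_roots, Matrix.charpoly_natDegree_eq_dim]

theorem eval_charpoly_eq_prod (M : Matrix n n ℂ) (x : ℂ) :
    (Matrix.scalar n x - M).det = (M.charpoly.roots.map fun z => x - z).prod := by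
  rw [← Matrix.eval_charpoly]
  conv_lhs => rw [(IsAlgClosed.splits M.charpoly).eq_prod_roots_of_monic M.charpoly_monic]
  rw [Polynomial.eval_multiset_prod, Multiset.map_map]
  simp

theorem det_segment (M : Matrix n n ℂ) (t : ℂ) :
    ((1 - t) • (1 : Matrix n n ℂ) + t • M).det =
      (M.charpoly.roots.map fun z => 1 - t + t * z).prod := by
  rcases eq_or_ne t 0 with rfl | ht
  · simp
  have h1 : (1 - t) • (1 : Matrix n n ℂ) + t • M =
      (-t) • (Matrix.scalar n (-(1 - t) / t) - M) := by
    ext i j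
    simp only [Matrix.add_apply, Matrix.smul_apply, Matrix.sub_apply, Matrix.scalar_apply,
      Matrix.diagonal_apply, Matrix.one_apply, smul_eq_mul]
    split_ifs <;> field_simp <;> ring
  rw [h1, Matrix.det_smul, eval_charpoly_eq_prod, ← card_roots_charpoly M,
    ← Multiset.prod_replicate, ← Multiset.map_const', ← Multiset.prod_map_mul]
  congr 1
  refine Multiset.map_congr rfl fun z _ => ?_
  field_simp
  ring

theorem gaussNorm_sq_mul {M : Matrix n n ℂ} (h : ∀ z ∈ M.charpoly.roots, 0 < z.re) :
    gaussNorm M ^ 2 * ((2 * (Real.pi : ℂ)) ^ Fintype.card n * M.det) = 1 := by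
  rw [Matrix.det_eq_prod_roots_charpoly, ← card_roots_charpoly M, gaussNorm]
  generalize M.charpoly.roots = m at h
  induction m using Multiset.induction_on with
  | empty => simp
  | cons z m ih =>
    have ih' := ih fun w hw => h w (Multiset.mem_cons_of_mem hw)
    have hz : z ≠ 0 := fun hz => by simpa [hz] using h z (Multiset.mem_cons_self z m)
    have hp : (2 * (Real.pi : ℂ) * z) ≠ 0 := by
      simp [hz, Real.pi_ne_zero]
    have h2 : ((2 * (Real.pi : ℂ) * z) ^ (-(1 / 2) : ℂ)) ^ 2 * (2 * (Real.pi : ℂ) * z) = 1 := by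
      rw [← Complex.cpow_nat_mul]
      norm_num
      rw [Complex.cpow_neg_one]
      field_simp
    simp only [Multiset.map_cons, Multiset.prod_cons, Multiset.card_cons]
    rw [pow_succ _ m.card]
    linear_combination ((m.map fun z : ℂ => (2 * (Real.pi : ℂ) * z) ^ (-(1 / 2) : ℂ)).prod ^ 2 *
      ((2 * (Real.pi : ℂ)) ^ m.card * m.prod)) * h2 + ih'

theorem re_segment_pos {z : ℂ} (hz : 0 < z.re) {t : ℝ} (ht : t ∈ Set.Icc (0 : ℝ) 1) :
    0 < ((1 : ℂ) - t + t * z).re := by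
  rw [Complex.add_re, Complex.sub_re, Complex.one_re, Complex.ofReal_re, Complex.re_ofReal_mul]
  rcases ht.1.eq_or_lt with h0 | h0
  · rw [← h0]; simp
  · have := mul_pos h0 hz
    linarith [ht.2]

theorem hasDerivAt_sum_log {m : Multiset ℂ} (h : ∀ z ∈ m, 0 < z.re) {t : ℝ}
    (ht : t ∈ Set.Icc (0 : ℝ) 1) :
    HasDerivAt (fun t : ℝ => (m.map fun z => Complex.log (1 - t + t * z)).sum)
      ((m.map fun z : ℂ => (z - 1) / (1 - t + t * z)).sum) t := by
  induction m using Multiset.induction_on with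
  | empty => simpa using hasDerivAt_const t (0 : ℂ)
  | cons z m ih =>
    have ih' := ih fun w hw => h w (Multiset.mem_cons_of_mem hw)
    have hz := h z (Multiset.mem_cons_self z m)
    simp only [Multiset.map_cons, Multiset.sum_cons]
    refine HasDerivAt.add ?_ ih'
    have hpos := re_segment_pos hz ht
    have hd : HasDerivAt (fun t : ℝ => (1 : ℂ) - t + t * z) (z - 1) t := by
      have := ((hasDerivAt_id t).ofReal_comp.const_sub 1).add
        ((hasDerivAt_id t).ofReal_comp.mul_const z)
      exact this.congr_deriv (by push_cast; ring)
    exact hd.clog_real (Complex.mem_slitPlane_iff.2 (Or.inl hpos))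


/-- The eigenvalues form an unordered multiset, which does not display its dependence on the matrix.
The logarithmic derivative of the determinant along the segment from `1` to `M` does, and its
integral is the sum of principal logarithms because the eigenvalues `1 - t + t z` stay in the right
half plane. -/
theorem sum_log_eq_integral {M : Matrix n n ℂ} (h : ∀ z ∈ M.charpoly.roots, 0 < z.re) :
    (M.charpoly.roots.map Complex.log).sum = ∫ t in (0 : ℝ)..1,
      deriv (fun t : ℝ => ((1 - (t : ℂ)) • (1 : Matrix n n ℂ) + (t : ℂ) • M).det) t /
        ((1 - (t : ℂ)) • (1 : Matrix n n ℂ) + (t : ℂ) • M).det := by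
  have hpos : ∀ t ∈ Set.Icc (0 : ℝ) 1, ∀ z ∈ M.charpoly.roots, (1 : ℂ) - t + t * z ≠ 0 :=
    fun t ht z hz h0 => by simpa [h0] using re_segment_pos (h z hz) ht
  set H : ℝ → ℂ := fun t => (M.charpoly.roots.map fun z => Complex.log (1 - t + t * z)).sum
  have hH : ∀ t ∈ Set.Icc (0 : ℝ) 1, HasDerivAt H
      (M.charpoly.roots.map fun z : ℂ => (z - 1) / (1 - t + t * z)).sum t :=
    fun t ht => hasDerivAt_sum_log h ht
  have hexp : ∀ t : ℝ, (∀ z ∈ M.charpoly.roots, (1 : ℂ) - t + t * z ≠ 0) → Complex.exp (H t) =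
      ((1 - (t : ℂ)) • (1 : Matrix n n ℂ) + (t : ℂ) • M).det := by
    intro t ht
    rw [det_segment, Complex.exp_multiset_sum, Multiset.map_map]
    congr 1
    exact Multiset.map_congr rfl fun z hz => Complex.exp_log (ht z hz)
  have hderiv : ∀ t ∈ Set.Ioo (0 : ℝ) 1,
      deriv (fun t : ℝ => ((1 - (t : ℂ)) • (1 : Matrix n n ℂ) + (t : ℂ) • M).det) t /
        ((1 - (t : ℂ)) • (1 : Matrix n n ℂ) + (t : ℂ) • M).det =
      (M.charpoly.roots.map fun z : ℂ => (z - 1) / (1 - t + t * z)).sum := by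
    intro t ht
    have hd := (hH t (Set.Ioo_subset_Icc_self ht)).cexp
    have heq : (fun t => Complex.exp (H t)) =ᶠ[nhds t]
        fun t : ℝ => ((1 - (t : ℂ)) • (1 : Matrix n n ℂ) + (t : ℂ) • M).det := by
      filter_upwards [Ioo_mem_nhds ht.1 ht.2] with t' ht'
      exact hexp t' (hpos t' (Set.Ioo_subset_Icc_self ht'))
    rw [← heq.deriv_eq, hd.deriv, ← hexp t (hpos t (Set.Ioo_subset_Icc_self ht)),
      mul_div_cancel_left₀ _ (Complex.exp_ne_zero _)]
  have hcont : ContinuousOn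
      (fun t : ℝ => (M.charpoly.roots.map fun z : ℂ => (z - 1) / (1 - t + t * z)).sum)
      (Set.Icc 0 1) := by
    generalize M.charpoly.roots = m at hpos
    induction m using Multiset.induction_on with
    | empty => simpa using continuousOn_const
    | cons z m ih =>
      simp only [Multiset.map_cons, Multiset.sum_cons]
      refine ContinuousOn.add (ContinuousOn.div continuousOn_const (by fun_prop)
        fun t ht => hpos t ht z (Multiset.mem_cons_self z m)) (ih fun t ht w hw =>
          hpos t ht w (Multiset.mem_cons_of_mem hw))
  have hint := intervalIntegral.integral_eq_sub_of_hasDerivAt (a := 0) (b := 1) (f := H)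
    (fun t ht => hH t (by rwa [Set.uIcc_of_le zero_le_one] at ht))
    (by rw [← Set.uIcc_of_le zero_le_one] at hcont; exact hcont.intervalIntegrable)
  have h0 : H 0 = 0 := by simp [H]
  have h1 : H 1 = (M.charpoly.roots.map Complex.log).sum := by simp [H]
  rw [h0, h1, sub_zero] at hint
  rw [← hint]
  refine intervalIntegral.integral_congr_ae ?_
  have h01 : ∀ᵐ t : ℝ, t ≠ 1 := by simp [ae_iff]
  filter_upwards [h01] with t ht1 ht
  rw [Set.uIoc_of_le zero_le_one] at ht
  exact (hderiv t ⟨ht.1, lt_of_le_of_ne ht.2 ht1⟩).symm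

/-- As `2π > 0`, the principal logarithm satisfies `log (2πz) = log (2π) + log z`, so the product of
powers is the exponential of a sum of logarithms. -/
theorem gaussNorm_eq_exp {M : Matrix n n ℂ} (h : ∀ z ∈ M.charpoly.roots, 0 < z.re) :
    gaussNorm M = (2 * (Real.pi : ℂ)) ^ (-(1 / 2) * (Fintype.card n : ℂ)) *
      Complex.exp (-(1 / 2) * (M.charpoly.roots.map Complex.log).sum) := by
  rw [gaussNorm, ← card_roots_charpoly M]
  generalize M.charpoly.roots = m at h
  have h2 : (2 * (Real.pi : ℂ)) ≠ 0 := by simp [Real.pi_ne_zero]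
  induction m using Multiset.induction_on with
  | empty => simp
  | cons z m ih =>
    have hz : z ≠ 0 := fun hz => by simpa [hz] using h z (Multiset.mem_cons_self z m)
    simp only [Multiset.map_cons, Multiset.prod_cons, Multiset.card_cons, Multiset.sum_cons]
    rw [ih fun w hw => h w (Multiset.mem_cons_of_mem hw)]
    have h3 : (2 * (Real.pi : ℂ) * z) ^ (-(1 / 2) : ℂ) =
        (2 * (Real.pi : ℂ)) ^ (-(1 / 2) : ℂ) * Complex.exp (-(1 / 2) * Complex.log z) := by
      have h4 : (2 * (Real.pi : ℂ)) = ((2 * Real.pi : ℝ) : ℂ) := by push_cast; ring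
      rw [Complex.cpow_def_of_ne_zero (mul_ne_zero h2 hz), Complex.cpow_def_of_ne_zero h2, h4,
        Complex.log_ofReal_mul (by positivity) hz, ← Complex.exp_add,
        Complex.ofReal_log (by positivity)]
      congr 1
      ring
    rw [h3]
    push_cast
    rw [mul_add, mul_add, Complex.cpow_add _ _ h2, Complex.exp_add, mul_one]
    ring

theorem continuousOn_gaussNorm {E : Type*} [NormedAddCommGroup E] [NormedSpace ℝ E] {O : Set E}
    {M : E → Matrix n n ℂ} (hM : ∀ i j, ContDiff ℝ ∞ fun s => M s i j)
    (hO : ∀ s ∈ O, ∀ z ∈ (M s).charpoly.roots, 0 < z.re) :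
    ContinuousOn (fun s => gaussNorm (M s)) O := by
  set P : E × ℝ → ℂ := fun p =>
    ((1 - (p.2 : ℂ)) • (1 : Matrix n n ℂ) + (p.2 : ℂ) • M p.1).det
  have hP : ContDiff ℝ ∞ P := by
    simp only [P, Matrix.det_apply, Matrix.add_apply, Matrix.smul_apply]
    refine ContDiff.sum fun σ _ => ContDiff.const_smul _ (contDiff_prod fun i _ => ?_)
    have h1 : ContDiff ℝ ∞ fun p : E × ℝ => (p.2 : ℂ) :=
      Complex.ofRealCLM.contDiff.comp contDiff_snd
    exact ((contDiff_const.sub h1).smul contDiff_const).add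
      (h1.smul ((hM _ _).comp contDiff_fst))
  have hP' : ∀ s t, deriv (fun t : ℝ => P (s, t)) t = fderiv ℝ P (s, t) (0, 1) := by
    intro s t
    have h1 : HasFDerivAt P (fderiv ℝ P (s, t)) (s, t) :=
      (hP.differentiable (by simp) _).hasFDerivAt
    have h2 : HasDerivAt (fun t : ℝ => ((s, t) : E × ℝ)) (0, 1) t :=
      (hasDerivAt_const t s).prodMk (hasDerivAt_id t)
    exact (h1.comp_hasDerivAt t h2).deriv
  have hP0 : ∀ s ∈ O, ∀ t ∈ Set.Icc (0 : ℝ) 1, P (s, t) ≠ 0 := by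
    intro s hs t ht
    simp only [P]
    rw [det_segment]
    refine Multiset.prod_ne_zero fun h0 => ?_
    obtain ⟨z, hz, hz0⟩ := Multiset.mem_map.1 h0
    simpa [hz0] using re_segment_pos (hO s hs z hz) ht
  -- Projecting `t` to `[0, 1]` makes the integrand continuous, with nonvanishing denominator, for
  -- all real `t`, as the theorem on parametric integrals requires.
  have hc : Continuous fun s : O => ∫ t in (0 : ℝ)..1,
      fderiv ℝ P (s, (Set.projIcc 0 1 zero_le_one t : ℝ)) (0, 1) /
        P (s, (Set.projIcc (0 : ℝ) 1 zero_le_one t : ℝ)) := by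
    refine intervalIntegral.continuous_parametric_intervalIntegral_of_continuous' ?_ 0 1
    have hq : Continuous fun p : O × ℝ =>
        (((p.1 : E), (Set.projIcc (0 : ℝ) 1 zero_le_one p.2 : ℝ)) : E × ℝ) := by
      refine (continuous_subtype_val.comp continuous_fst).prodMk
        (continuous_subtype_val.comp (continuous_projIcc.comp continuous_snd))
    refine Continuous.div ?_ (hP.continuous.comp hq) fun p => hP0 _ p.1.2 _ (Subtype.prop _)
    exact ((hP.continuous_fderiv (by simp)).comp hq).clm_apply continuous_const
  rw [continuousOn_iff_continuous_domRestrict]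
  have hfin : (O.domRestrict fun s => gaussNorm (M s)) = fun s : O =>
      (2 * (Real.pi : ℂ)) ^ (-(1 / 2) * (Fintype.card n : ℂ)) *
      Complex.exp (-(1 / 2) * ∫ t in (0 : ℝ)..1,
      fderiv ℝ P (s, (Set.projIcc 0 1 zero_le_one t : ℝ)) (0, 1) /
        P (s, (Set.projIcc (0 : ℝ) 1 zero_le_one t : ℝ))) := by
    funext s
    rw [Set.domRestrict_apply, gaussNorm_eq_exp (hO s s.2), sum_log_eq_integral (hO s s.2)]
    congr 3
    refine intervalIntegral.integral_congr fun t ht => ?_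
    rw [Set.uIcc_of_le zero_le_one] at ht
    simp only [Set.projIcc_of_mem zero_le_one ht]
    rw [← hP']
  rw [hfin]
  fun_prop

theorem contDiff_det {E : Type*} [NormedAddCommGroup E] [NormedSpace ℝ E]
    {M : E → Matrix n n ℂ} (hM : ∀ i j, ContDiff ℝ ∞ fun s => M s i j) :
    ContDiff ℝ ∞ fun s => (M s).det := by
  simp only [Matrix.det_apply]
  exact ContDiff.sum fun σ _ => ContDiff.const_smul _ (contDiff_prod fun i _ => hM _ _)

/-- A continuous square root of a smooth nonvanishing function is smooth: near `s₀` its ratio to the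
value at `s₀` has positive real part, so that ratio is the principal square root of the smooth
function `det M(s₀) / det M(s)`. -/
theorem contDiffOn_gaussNorm {E : Type*} [NormedAddCommGroup E] [NormedSpace ℝ E] {O : Set E}
    (hOo : IsOpen O) {M : E → Matrix n n ℂ} (hM : ∀ i j, ContDiff ℝ ∞ fun s => M s i j)
    (hO : ∀ s ∈ O, ∀ z ∈ (M s).charpoly.roots, 0 < z.re) :
    ContDiffOn ℝ ∞ (fun s => gaussNorm (M s)) O := by
  intro s₀ hs₀
  refine ContDiffAt.contDiffWithinAt ?_
  have hsq := fun s hs => gaussNorm_sq_mul (hO s hs)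
  have hne : ∀ s ∈ O, gaussNorm (M s) ≠ 0 := fun s hs h0 => by simpa [h0] using hsq s hs
  have hdet : ∀ s ∈ O, (M s).det ≠ 0 := fun s hs h0 => by simpa [h0] using hsq s hs
  have hev : (fun s => gaussNorm (M s)) =ᶠ[nhds s₀] fun s => gaussNorm (M s₀) *
      Complex.exp (Complex.log ((M s₀).det / (M s).det) * 2⁻¹) := by
    have hcu : ContinuousAt (fun s => (gaussNorm (M s) / gaussNorm (M s₀)).re) s₀ :=
      Complex.continuous_re.continuousAt.comp
        (((continuousOn_gaussNorm hM hO).continuousAt (hOo.mem_nhds hs₀)).div_const _)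
    have h1 : ∀ᶠ s in nhds s₀, 0 < (gaussNorm (M s) / gaussNorm (M s₀)).re :=
      hcu.eventually_const_lt (by simp [div_self (hne s₀ hs₀)])
    filter_upwards [h1, hOo.mem_nhds hs₀] with s hs hsO
    have h2 := Complex.sq_cpow_two_inv hs
    have h3 : (gaussNorm (M s) / gaussNorm (M s₀)) ^ 2 = (M s₀).det / (M s).det := by
      rw [div_pow, div_eq_div_iff (pow_ne_zero 2 (hne s₀ hs₀)) (hdet s hsO)]
      have hp : (2 * (Real.pi : ℂ)) ^ Fintype.card n ≠ 0 :=
        pow_ne_zero _ (by simp [Real.pi_ne_zero])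
      refine mul_left_cancel₀ hp ?_
      linear_combination hsq s hsO - hsq s₀ hs₀
    rw [h3, Complex.cpow_def_of_ne_zero (div_ne_zero (hdet s₀ hs₀) (hdet s hsO))] at h2
    rw [h2, mul_div_cancel₀ _ (hne s₀ hs₀)]
  refine ContDiffAt.congr_of_eventuallyEq ?_ hev
  refine contDiffAt_const.mul (ContDiffAt.cexp (ContDiffAt.mul ?_ contDiffAt_const))
  have h1 : ContDiffAt ℝ ∞ (fun s => (M s₀).det / (M s).det) s₀ :=
    contDiffAt_const.mul ((contDiff_det hM).contDiffAt.inv (hdet s₀ hs₀))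
  have h2 : ContDiffAt ℝ ∞ Complex.log ((M s₀).det / (M s₀).det) := by
    rw [div_self (hdet s₀ hs₀)]
    exact (Complex.contDiffAt_log (by simp)).restrict_scalars ℝ
  exact ContDiffAt.comp s₀ h2 h1

/-- Jacobi's formula, from the expansion of `det (1 + t X)` to first order. -/
theorem hasDerivAt_det_add_smul {M : Matrix n n ℂ} (hM : IsUnit M.det) (E : Matrix n n ℂ) :
    HasDerivAt (fun t : ℝ => (M + (t : ℂ) • E).det) (M.det * (M⁻¹ * E).trace) 0 := by
  have h1 : ∀ t : ℂ, (M + t • E).det = M.det * (1 + t • (M⁻¹ * E)).det := fun t => by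
    rw [← Matrix.det_mul, mul_add, mul_one, Matrix.mul_smul, ← mul_assoc,
      Matrix.mul_nonsing_inv _ hM, one_mul]
  simp only [h1]
  refine HasDerivAt.const_mul _ ?_
  rw [funext fun t : ℝ => Matrix.det_one_add_smul (t : ℂ) (M⁻¹ * E)]
  set p := (det (1 + (Polynomial.X : Polynomial ℂ) •
    (M⁻¹ * E).map Polynomial.C)).divX.divX
  have h2 : HasDerivAt (fun t : ℂ => 1 + (M⁻¹ * E).trace * t + p.eval t * t ^ 2)
      ((M⁻¹ * E).trace) 0 := by
    have := (((hasDerivAt_id (0 : ℂ)).const_mul (M⁻¹ * E).trace).const_add 1).add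
      ((p.hasDerivAt 0).mul (hasDerivAt_pow 2 (0 : ℂ)))
    exact this.congr_deriv (by simp)
  exact h2.comp_ofReal (z := 0)

end GaussNorm

end ClusterExpansion

end

noncomputable section

open scoped ENNReal ContDiff

namespace ClusterExpansion

open MeasureTheory Matrix

/-! ### Dependence of the Gaussian density on the interpolation parameters -/

section Density

variable {ι : Type*} [Fintype ι] [DecidableEq ι] {N : ℕ} (C : Matrix (ι × Fin N) (ι × Fin N) ℂ)

/-- The parameters for which the interpolated covariance defines a Gaussian measure. -/
def covSet : Set (Pair ι → ℝ) := {s | ∃ c > 0, Coercive c (interpCov C s)}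

theorem contDiff_interpCov (ξ η : ι × Fin N) : ContDiff ℝ ∞ fun s => interpCov C s ξ η := by
  have hw : ContDiff ℝ ∞ fun s : Pair ι → ℝ => pairWeight s ξ.1 η.1 := by
    unfold pairWeight
    by_cases h : ξ.1 = η.1
    · simp only [dif_pos h]
      exact contDiff_const
    · simp only [dif_neg h]
      exact contDiff_apply ℝ ℝ _
  simp only [interpCov_apply]
  exact contDiff_const.mul (Complex.ofRealCLM.contDiff.comp hw)

theorem isOpen_covSet : IsOpen (covSet C) := by
  rw [isOpen_iff_mem_nhds]
  rintro s ⟨c, hc, hs⟩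
  -- With this choice the loss `δ n` in `Coercive.perturb` is less than `c / 2`.
  set δ : ℝ := c / (2 * (Fintype.card (ι × Fin N) + 1)) with hδ
  have hδ0 : 0 < δ := by positivity
  have hev : ∀ᶠ s' in nhds s, ∀ ξ η, ‖interpCov C s' ξ η - interpCov C s ξ η‖ ≤ δ := by
    rw [Filter.eventually_all]
    intro ξ
    rw [Filter.eventually_all]
    intro η
    have h : ContinuousAt (fun s' => ‖interpCov C s' ξ η - interpCov C s ξ η‖) s :=
      (((contDiff_interpCov C ξ η).continuous.sub continuous_const).norm).continuousAt
    exact (h.eventually_lt_const (by simpa using hδ0)).mono fun _ h => h.le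
  filter_upwards [hev] with s' hs'
  refine ⟨_, ?_, hs.perturb hs'⟩
  have h1 : δ * (2 * (Fintype.card (ι × Fin N) + 1)) = c := by rw [hδ]; field_simp
  nlinarith

theorem det_interpCov_ne_zero {s : Pair ι → ℝ} (hs : s ∈ covSet C) : (interpCov C s).det ≠ 0 := by
  obtain ⟨c, hc, h⟩ := hs
  exact h.det_ne_zero hc

theorem contDiffOn_inv_interpCov (ξ η : ι × Fin N) :
    ContDiffOn ℝ ∞ (fun s => (interpCov C s)⁻¹ ξ η) (covSet C) := by
  simp only [Matrix.inv_def, Matrix.smul_apply, Matrix.adjugate_apply, Ring.inverse_eq_inv',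
    smul_eq_mul]
  refine ContDiffOn.mul (ContDiffOn.inv (contDiff_det (contDiff_interpCov C)).contDiffOn
    fun s hs => det_interpCov_ne_zero C hs) (contDiff_det fun i j => ?_).contDiffOn
  simp only [Matrix.updateRow_apply]
  split_ifs
  · exact contDiff_const
  · exact contDiff_interpCov C i j

theorem contDiffOn_gaussNorm_interpCov :
    ContDiffOn ℝ ∞ (fun s => gaussNorm (interpCov C s)) (covSet C) :=
  contDiffOn_gaussNorm (isOpen_covSet C) (contDiff_interpCov C)
    fun _ ⟨_, hc, h⟩ _ hz => h.re_root_pos hc hz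

/-- The density of the Gaussian measure with covariance `C_s`, as a function of the field and the
parameters. -/
def density (p : (ι → Spin N) × (Pair ι → ℝ)) : ℂ := gaussianDensity (interpCov C p.2) p.1

/-- The complexified components of a field. -/
def components (φ : ι → Spin N) : ι × Fin N → ℂ := fun ξ => (φ ξ.1 ξ.2 : ℂ)

theorem gaussianDensity_eq (M : Matrix (ι × Fin N) (ι × Fin N) ℂ) (φ : ι → Spin N) :
    gaussianDensity M φ = gaussNorm M *
      Complex.exp (-(1 / 2) * (components φ ⬝ᵥ M⁻¹ *ᵥ components φ)) := by
  simp only [gaussianDensity, gaussNorm, components, dotProduct, mulVec, Finset.mul_sum, mul_assoc]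

theorem contDiff_component (ξ : ι × Fin N) :
    ContDiff ℝ ∞ fun φ : ι → Spin N => components φ ξ := by
  refine Complex.ofRealCLM.contDiff.comp ?_
  exact (contDiff_piLp_apply 2).comp (contDiff_apply ℝ (Spin N) ξ.1)

theorem contDiffOn_density : ContDiffOn ℝ ∞ (density C) (Set.univ ×ˢ covSet C) := by
  have hm : Set.MapsTo Prod.snd ((Set.univ : Set (ι → Spin N)) ×ˢ covSet C) (covSet C) :=
    fun p hp => hp.2
  have h1 : ContDiffOn ℝ ∞ (fun p : (ι → Spin N) × (Pair ι → ℝ) => gaussNorm (interpCov C p.2))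
      (Set.univ ×ˢ covSet C) :=
    (contDiffOn_gaussNorm_interpCov C).comp contDiff_snd.contDiffOn hm
  have h2 : ∀ ξ, ContDiffOn ℝ ∞ (fun p : (ι → Spin N) × (Pair ι → ℝ) => components p.1 ξ)
      (Set.univ ×ˢ covSet C) := fun ξ =>
    ((contDiff_component ξ).comp contDiff_fst).contDiffOn
  have h3 : ∀ ξ η, ContDiffOn ℝ ∞
      (fun p : (ι → Spin N) × (Pair ι → ℝ) => (interpCov C p.2)⁻¹ ξ η)
      (Set.univ ×ˢ covSet C) := fun ξ η =>
    (contDiffOn_inv_interpCov C ξ η).comp contDiff_snd.contDiffOn hm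
  refine ContDiffOn.congr (f := fun p : (ι → Spin N) × (Pair ι → ℝ) =>
    gaussNorm (interpCov C p.2) * Complex.exp (-(1 / 2) * ∑ ξ, components p.1 ξ * ∑ η,
      (interpCov C p.2)⁻¹ ξ η * components p.1 η)) ?_ fun p _ => by
      simp only [density, gaussianDensity_eq, dotProduct, mulVec]
  exact h1.mul (ContDiffOn.cexp (contDiffOn_const.mul (ContDiffOn.sum fun ξ _ => (h2 ξ).mul
    (ContDiffOn.sum fun η _ => (h3 ξ η).mul (h2 η)))))

/-- The direction of the component `φ(ξ)` of the field. -/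
def fieldDir (ξ : ι × Fin N) : ι → Spin N := Pi.single ξ.1 (EuclideanSpace.single ξ.2 1)

theorem components_add_smul (φ : ι → Spin N) (t : ℝ) (ξ : ι × Fin N) :
    components (φ + t • fieldDir ξ) = components φ + (t : ℂ) • Pi.single ξ 1 := by
  funext η
  obtain ⟨x, m⟩ := ξ
  obtain ⟨y, n⟩ := η
  simp only [components, fieldDir, Pi.add_apply, Pi.smul_apply, PiLp.add_apply, PiLp.smul_apply,
    smul_eq_mul, Complex.ofReal_add, Complex.ofReal_mul]
  congr 2
  rcases eq_or_ne y x with rfl | h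
  · rcases eq_or_ne n m with rfl | h'
    · simp
    · simp [h']
  · simp [h]

theorem hasDerivAt_gaussianDensity_field {M : Matrix (ι × Fin N) (ι × Fin N) ℂ} (hM : M.IsSymm)
    (φ : ι → Spin N) (ξ : ι × Fin N) :
    HasDerivAt (fun t : ℝ => gaussianDensity M (φ + t • fieldDir ξ))
      (-(M⁻¹ *ᵥ components φ) ξ * gaussianDensity M φ) 0 := by
  have hM' : (M⁻¹)ᵀ = M⁻¹ := by rw [Matrix.transpose_nonsing_inv, hM.eq]
  have hquad : ∀ t : ℝ, components (φ + t • fieldDir ξ) ⬝ᵥ M⁻¹ *ᵥ components (φ + t • fieldDir ξ) =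
      components φ ⬝ᵥ M⁻¹ *ᵥ components φ + (t : ℂ) * (2 * (M⁻¹ *ᵥ components φ) ξ) +
        (t : ℂ) ^ 2 * M⁻¹ ξ ξ := by
    intro t
    rw [components_add_smul, Matrix.mulVec_add, dotProduct_add, add_dotProduct, add_dotProduct,
      Matrix.mulVec_smul, dotProduct_smul, dotProduct_smul, smul_dotProduct, smul_dotProduct,
      single_one_dotProduct, Matrix.mulVec_single_one, single_one_dotProduct]
    have h : components φ ⬝ᵥ M⁻¹.col ξ = (M⁻¹ *ᵥ components φ) ξ := by
      rw [dotProduct_comm]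
      conv_lhs => rw [← hM']
      rfl
    rw [h]
    simp only [smul_eq_mul, Matrix.col_apply]
    ring
  simp only [gaussianDensity_eq, hquad]
  have h1 : HasDerivAt (fun t : ℝ => -(1 / 2 : ℂ) * (components φ ⬝ᵥ M⁻¹ *ᵥ components φ +
      (t : ℂ) * (2 * (M⁻¹ *ᵥ components φ) ξ) + (t : ℂ) ^ 2 * M⁻¹ ξ ξ))
      (-(M⁻¹ *ᵥ components φ) ξ) 0 := by
    have h2 := (((((hasDerivAt_id (0 : ℂ)).mul_const (2 * (M⁻¹ *ᵥ components φ) ξ)).const_add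
      (components φ ⬝ᵥ M⁻¹ *ᵥ components φ)).add
      ((hasDerivAt_pow 2 (0 : ℂ)).mul_const (M⁻¹ ξ ξ))).const_mul (-(1 / 2 : ℂ))).comp_ofReal
        (z := 0)
    exact h2.congr_deriv (by simp)
  refine (h1.cexp.const_mul (gaussNorm M)).congr_deriv ?_
  simp
  ring

/-- The derivative of the interpolated covariance with respect to `s(ℓ)`. -/
def covPart (ℓ : Pair ι) : Matrix (ι × Fin N) (ι × Fin N) ℂ := fun ξ η =>
  if s(ξ.1, η.1) = ℓ.1 then C ξ η else 0

theorem interpCov_add_smul (s : Pair ι → ℝ) (t : ℝ) (ℓ : Pair ι) :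
    interpCov C (s + t • Pi.single ℓ 1) = interpCov C s + (t : ℂ) • covPart C ℓ := by
  ext ξ η
  simp only [interpCov_apply, pairWeight, Matrix.add_apply, Matrix.smul_apply, covPart, smul_eq_mul]
  by_cases h : ξ.1 = η.1
  · have h' : s(ξ.1, η.1) ≠ ℓ.1 := fun h' => ℓ.2 (h' ▸ Sym2.mk_isDiag_iff.2 h)
    simp [h]
    intro h''
    exact absurd (h ▸ h'') h'
  · simp only [dif_neg h, Pi.add_apply, Pi.smul_apply, Pi.single_apply, Subtype.ext_iff]
    by_cases h' : s(ξ.1, η.1) = ℓ.1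
    · simp [h']; ring
    · simp [h']

theorem hasDerivAt_comp_line {E F : Type*} [NormedAddCommGroup E] [NormedSpace ℝ E]
    [NormedAddCommGroup F] [NormedSpace ℝ F]
    {f : E → F} {U : Set E} (hU : IsOpen U) (hf : ContDiffOn ℝ ∞ f U) {p : E} (hp : p ∈ U)
    (v : E) : HasDerivAt (fun t : ℝ => f (p + t • v)) (lineDeriv ℝ f p v) 0 :=
  ((hf.contDiffAt (hU.mem_nhds hp)).differentiableAt (by simp)).lineDifferentiableAt.hasLineDerivAt

theorem eventually_line_mem {E : Type*} [NormedAddCommGroup E] [NormedSpace ℝ E] {U : Set E}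
    (hU : IsOpen U) {p : E} (hp : p ∈ U) (v : E) : ∀ᶠ t : ℝ in nhds 0, p + t • v ∈ U := by
  have hc : Continuous fun t : ℝ => p + t • v := by fun_prop
  exact hc.continuousAt.eventually_mem (hU.mem_nhds (by simpa using hp))

/-- Differentiate `g² (2π)ⁿ det C_s = 1` and use Jacobi's formula; the branch of the root plays no
further role. -/
theorem hasDerivAt_gaussNorm_interpCov {s : Pair ι → ℝ} (hs : s ∈ covSet C) (ℓ : Pair ι) :
    HasDerivAt (fun t : ℝ => gaussNorm (interpCov C (s + t • Pi.single ℓ 1)))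
      (-(1 / 2) * ((interpCov C s)⁻¹ * covPart C ℓ).trace * gaussNorm (interpCov C s)) 0 := by
  have h1 := hasDerivAt_comp_line (isOpen_covSet C) (contDiffOn_gaussNorm_interpCov C) hs
    (Pi.single ℓ 1)
  set f' := lineDeriv ℝ (fun s => gaussNorm (interpCov C s)) s (Pi.single ℓ 1)
  have hsq : ∀ s ∈ covSet C, gaussNorm (interpCov C s) ^ 2 *
      ((2 * (Real.pi : ℂ)) ^ Fintype.card (ι × Fin N) * (interpCov C s).det) = 1 :=
    fun s ⟨c, hc, h⟩ => gaussNorm_sq_mul fun z hz => h.re_root_pos hc hz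
  have h2 := hasDerivAt_det_add_smul (det_interpCov_ne_zero C hs).isUnit (covPart C ℓ)
  simp only [← interpCov_add_smul] at h2
  have h3 := (h1.pow 2).mul (h2.const_mul ((2 * (Real.pi : ℂ)) ^ Fintype.card (ι × Fin N)))
  have h4 := h3.congr_of_eventuallyEq (f₁ := fun _ => 1)
    ((eventually_line_mem (isOpen_covSet C) hs (Pi.single ℓ 1)).mono fun t ht => (hsq _ ht).symm)
  have h5 := h4.unique (hasDerivAt_const _ _)
  refine h1.congr_deriv ?_
  have h6 := hsq s hs
  set g := gaussNorm (interpCov C s)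
  have hg : g ≠ 0 := fun h0 => by simp [h0] at h6
  simp only [zero_smul, add_zero, Nat.cast_ofNat, Nat.add_one_sub_one, pow_one, Pi.pow_apply] at h5
  set D := (2 * (Real.pi : ℂ)) ^ Fintype.card (ι × Fin N) * (interpCov C s).det with hD
  have hD0 : D ≠ 0 := fun h0 => by simp [h0] at h6
  have h7 : g * D ≠ 0 := mul_ne_zero hg hD0
  refine mul_left_cancel₀ h7 ?_
  linear_combination (1 / 2) * h5

/-- Differentiate `C_s⁻¹ C_s = 1`, which holds along the line for small `t`. -/
theorem hasDerivAt_inv_interpCov {s : Pair ι → ℝ} (hs : s ∈ covSet C) (ℓ : Pair ι)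
    (ξ η : ι × Fin N) :
    HasDerivAt (fun t : ℝ => (interpCov C (s + t • Pi.single ℓ 1))⁻¹ ξ η)
      (-((interpCov C s)⁻¹ * covPart C ℓ * (interpCov C s)⁻¹) ξ η) 0 := by
  have h1 := fun ξ η => hasDerivAt_comp_line (isOpen_covSet C) (contDiffOn_inv_interpCov C ξ η) hs
    (Pi.single ℓ 1)
  set B' : Matrix (ι × Fin N) (ι × Fin N) ℂ := fun ξ η =>
    lineDeriv ℝ (fun s => (interpCov C s)⁻¹ ξ η) s (Pi.single ℓ 1)
  set B := (interpCov C s)⁻¹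
  have hu : IsUnit (interpCov C s).det := (det_interpCov_ne_zero C hs).isUnit
  have hM : ∀ ξ η, HasDerivAt (fun t : ℝ => interpCov C (s + t • Pi.single ℓ 1) ξ η)
      (covPart C ℓ ξ η) 0 := by
    intro ξ η
    simp only [interpCov_add_smul, Matrix.add_apply, Matrix.smul_apply, smul_eq_mul]
    have := (((hasDerivAt_id (0 : ℂ)).mul_const (covPart C ℓ ξ η)).const_add
      (interpCov C s ξ η)).comp_ofReal (z := 0)
    exact this.congr_deriv (by simp)
  have h2 : B' * interpCov C s + B * covPart C ℓ = 0 := by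
    ext i j
    have h3 : HasDerivAt (fun t : ℝ => ∑ k, (interpCov C (s + t • Pi.single ℓ 1))⁻¹ i k *
        interpCov C (s + t • Pi.single ℓ 1) k j)
        (∑ k, (B' i k * interpCov C s k j + B i k * covPart C ℓ k j)) 0 := by
      refine HasDerivAt.fun_sum fun k _ => ?_
      have := (h1 i k).mul (hM k j)
      simp only [zero_smul, add_zero] at this
      exact this
    have h4 := h3.congr_of_eventuallyEq (f₁ := fun _ => (1 : Matrix _ _ ℂ) i j)
      ((eventually_line_mem (isOpen_covSet C) hs (Pi.single ℓ 1)).mono fun t ht => by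
        simp only
        rw [← Matrix.mul_apply, Matrix.nonsing_inv_mul _ (det_interpCov_ne_zero C ht).isUnit])
    rw [Matrix.add_apply, Matrix.mul_apply, Matrix.mul_apply, ← Finset.sum_add_distrib,
      Matrix.zero_apply]
    exact h4.unique (hasDerivAt_const _ _)
  have h5 : B' = -(B * covPart C ℓ * B) := by
    calc B' = B' * interpCov C s * B := by
          rw [mul_assoc, Matrix.mul_nonsing_inv _ hu, mul_one]
      _ = _ := by rw [eq_neg_of_add_eq_zero_left h2, Matrix.neg_mul]
  refine (h1 ξ η).congr_deriv ?_
  exact congrFun₂ h5 ξ η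

/-- The bracket is what two field derivatives bring down from a Gaussian, so the right side is
already `C(ℓ)∂_ℓ` of the density; `isHeat_density` draws this conclusion. -/
theorem hasDerivAt_density {C} (hC : C.IsSymm) (φ : ι → Spin N) {s : Pair ι → ℝ}
    (hs : s ∈ covSet C) (ℓ : Pair ι) :
    HasDerivAt (fun t : ℝ => gaussianDensity (interpCov C (s + t • Pi.single ℓ 1)) φ)
      ((1 / 2) * ∑ ξ, ∑ η, covPart C ℓ ξ η * ((-(interpCov C s)⁻¹ ξ η +
        ((interpCov C s)⁻¹ *ᵥ components φ) ξ * ((interpCov C s)⁻¹ *ᵥ components φ) η) *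
          gaussianDensity (interpCov C s) φ)) 0 := by
  have hB : ∀ ξ η, (interpCov C s)⁻¹ ξ η = (interpCov C s)⁻¹ η ξ := fun ξ η => by
    have : ((interpCov C s)⁻¹)ᵀ = (interpCov C s)⁻¹ := by
      rw [Matrix.transpose_nonsing_inv, (isSymm_interpCov hC s).eq]
    exact congrFun₂ this η ξ
  have hn := hasDerivAt_gaussNorm_interpCov C hs ℓ
  have hq : HasDerivAt (fun t : ℝ => components φ ⬝ᵥ
      (interpCov C (s + t • Pi.single ℓ 1))⁻¹ *ᵥ components φ)
      (-∑ ξ, ∑ η, covPart C ℓ ξ η * (((interpCov C s)⁻¹ *ᵥ components φ) ξ *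
        ((interpCov C s)⁻¹ *ᵥ components φ) η)) 0 := by
    obtain ⟨w, hw⟩ : ∃ w, w = (interpCov C s)⁻¹ *ᵥ components φ := ⟨_, rfl⟩
    rw [← hw]
    simp only [dotProduct, mulVec]
    refine (HasDerivAt.fun_sum fun ξ _ => (HasDerivAt.fun_sum fun η _ =>
      (hasDerivAt_inv_interpCov C hs ℓ ξ η).mul_const _).const_mul _).congr_deriv ?_
    have h1 : ∑ i, components φ i * ∑ j,
        -((interpCov C s)⁻¹ * covPart C ℓ * (interpCov C s)⁻¹) i j * components φ j =
        -(components φ ⬝ᵥ ((interpCov C s)⁻¹ * covPart C ℓ * (interpCov C s)⁻¹) *ᵥ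
          components φ) := by
      simp only [dotProduct, mulVec, neg_mul, Finset.sum_neg_distrib, mul_neg]
    have h2 : components φ ᵥ* (interpCov C s)⁻¹ = (interpCov C s)⁻¹ *ᵥ components φ := by
      rw [← Matrix.vecMul_transpose, Matrix.transpose_nonsing_inv, (isSymm_interpCov hC s).eq]
    rw [h1, ← Matrix.mulVec_mulVec, ← Matrix.mulVec_mulVec, Matrix.dotProduct_mulVec, h2, ← hw]
    simp only [dotProduct, mulVec, Finset.mul_sum]
    congr 1
    exact Finset.sum_congr rfl fun ξ _ => Finset.sum_congr rfl fun η _ => by ring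
  simp only [gaussianDensity_eq]
  refine (hn.mul (hq.const_mul (-(1 / 2 : ℂ))).cexp).congr_deriv ?_
  simp only [zero_smul, add_zero]
  have htr : ((interpCov C s)⁻¹ * covPart C ℓ).trace =
      ∑ ξ, ∑ η, covPart C ℓ ξ η * (interpCov C s)⁻¹ ξ η := by
    simp only [Matrix.trace, Matrix.diag_apply, Matrix.mul_apply]
    rw [Finset.sum_comm]
    exact Finset.sum_congr rfl fun i _ => Finset.sum_congr rfl fun j _ => by rw [hB j i, mul_comm]
  rw [htr]
  simp only [Finset.mul_sum, Finset.sum_mul, ← Finset.sum_add_distrib, ← Finset.sum_neg_distrib]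
  refine Finset.sum_congr rfl fun ξ _ => Finset.sum_congr rfl fun η _ => ?_
  ring

end Density

end ClusterExpansion

end

noncomputable section

open scoped ENNReal ContDiff

namespace ClusterExpansion

open MeasureTheory Matrix

/-! ### Polynomials times the Gaussian density -/

section GaussClass

variable {ι : Type*} [Fintype ι] [DecidableEq ι] {N : ℕ} (C : Matrix (ι × Fin N) (ι × Fin N) ℂ)

/-- The algebra of functions of `(φ, s)` generated by the components of the field and by the
entries of `C_s⁻¹`. -/
def gaussAlg : Subalgebra ℂ ((ι → Spin N) × (Pair ι → ℝ) → ℂ) :=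
  Algebra.adjoin ℂ (Set.range (fun ξ p => components p.1 ξ) ∪
    Set.range fun (ξ : (ι × Fin N) × (ι × Fin N)) p => (interpCov C p.2)⁻¹ ξ.1 ξ.2)

/-- The products of elements of `gaussAlg C` and the Gaussian density. -/
def gaussClass : Submodule ℂ ((ι → Spin N) × (Pair ι → ℝ) → ℂ) :=
  (Subalgebra.toSubmodule (gaussAlg C)).map (LinearMap.mulRight ℂ (density C))

/-- The functions of the field obtained from `gaussClass C` by fixing the parameters. -/
def gaussSlice (s : Pair ι → ℝ) : Submodule ℂ ((ι → Spin N) → ℂ) :=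
  (gaussClass C).map (LinearMap.funLeft ℂ ℂ fun φ => (φ, s))

variable {C}

theorem mem_gaussClass {ψ : (ι → Spin N) × (Pair ι → ℝ) → ℂ} :
    ψ ∈ gaussClass C ↔ ∃ Q ∈ gaussAlg C, Q * density C = ψ := Iff.rfl

theorem component_mem_gaussAlg (ξ : ι × Fin N) :
    (fun p : (ι → Spin N) × (Pair ι → ℝ) => components p.1 ξ) ∈ gaussAlg C :=
  Algebra.subset_adjoin (Or.inl ⟨ξ, rfl⟩)

theorem inv_interpCov_mem_gaussAlg (ξ η : ι × Fin N) :
    (fun p : (ι → Spin N) × (Pair ι → ℝ) => (interpCov C p.2)⁻¹ ξ η) ∈ gaussAlg C :=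
  Algebra.subset_adjoin (Or.inr ⟨(ξ, η), rfl⟩)

theorem density_mem_gaussClass : density C ∈ gaussClass C :=
  ⟨1, (gaussAlg C).one_mem, one_mul _⟩

theorem gaussAlg_hasDerivAt {Q : (ι → Spin N) × (Pair ι → ℝ) → ℂ} (hQ : Q ∈ gaussAlg C)
    (ξ : ι × Fin N) : ∃ Q' ∈ gaussAlg C, ∀ φ s,
      HasDerivAt (fun t : ℝ => Q (φ + t • fieldDir ξ, s)) (Q' (φ, s)) 0 := by
  induction hQ using Algebra.adjoin_induction with
  | mem Q hQ =>
    rcases hQ with ⟨η, rfl⟩ | ⟨η, rfl⟩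
    · refine ⟨algebraMap ℂ _ ((Pi.single ξ 1 : ι × Fin N → ℂ) η), (gaussAlg C).algebraMap_mem _,
        fun φ s => ?_⟩
      simp only [components_add_smul, Pi.add_apply, Pi.smul_apply, smul_eq_mul]
      have := (((hasDerivAt_id (0 : ℂ)).mul_const ((Pi.single ξ 1 : ι × Fin N → ℂ) η)).const_add
        (components φ η)).comp_ofReal (z := 0)
      exact this.congr_deriv (by simp)
    · exact ⟨0, (gaussAlg C).zero_mem, fun φ s =>
        hasDerivAt_const (0 : ℝ) ((interpCov C s)⁻¹ η.1 η.2)⟩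
  | algebraMap r => exact ⟨0, (gaussAlg C).zero_mem, fun φ s => hasDerivAt_const _ _⟩
  | add f g _ _ ihf ihg =>
    obtain ⟨f', hf', hf⟩ := ihf
    obtain ⟨g', hg', hg⟩ := ihg
    exact ⟨f' + g', (gaussAlg C).add_mem hf' hg', fun φ s => (hf φ s).add (hg φ s)⟩
  | mul f g hfm hgm ihf ihg =>
    obtain ⟨f', hf', hf⟩ := ihf
    obtain ⟨g', hg', hg⟩ := ihg
    refine ⟨f' * g + f * g', (gaussAlg C).add_mem ((gaussAlg C).mul_mem hf' hgm)
      ((gaussAlg C).mul_mem hfm hg'), fun φ s => ((hf φ s).mul (hg φ s)).congr_deriv ?_⟩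
    simp

/-- A field derivative of the density brings down the factor `-(C_s⁻¹ φ)(ξ)`, which belongs to the
algebra, so the class is stable under field derivatives. -/
theorem gaussClass_hasDerivAt (hC : C.IsSymm) {ψ : (ι → Spin N) × (Pair ι → ℝ) → ℂ}
    (hψ : ψ ∈ gaussClass C) (ξ : ι × Fin N) : ∃ ψ' ∈ gaussClass C, ∀ φ s,
      HasDerivAt (fun t : ℝ => ψ (φ + t • fieldDir ξ, s)) (ψ' (φ, s)) 0 := by
  obtain ⟨Q, hQ, rfl⟩ := mem_gaussClass.1 hψ
  obtain ⟨Q', hQ', hd⟩ := gaussAlg_hasDerivAt hQ ξ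
  set L : (ι → Spin N) × (Pair ι → ℝ) → ℂ := ∑ η,
    (fun p => (interpCov C p.2)⁻¹ ξ η) * fun p => components p.1 η
  have hL : L ∈ gaussAlg C := (gaussAlg C).sum_mem fun η _ =>
    (gaussAlg C).mul_mem (inv_interpCov_mem_gaussAlg ξ η) (component_mem_gaussAlg η)
  refine ⟨(Q' - Q * L) * density C, ⟨_, (gaussAlg C).sub_mem hQ' ((gaussAlg C).mul_mem hQ hL),
    rfl⟩, fun φ s => ?_⟩
  refine ((hd φ s).mul (hasDerivAt_gaussianDensity_field (isSymm_interpCov hC s) φ ξ)).congr_deriv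
    ?_
  have hLs : L (φ, s) = ((interpCov C s)⁻¹ *ᵥ components φ) ξ := by
    simp [L, Finset.sum_apply, mulVec, dotProduct]
  simp only [Pi.mul_apply, Pi.sub_apply, hLs, zero_smul, add_zero, density]
  ring

theorem gaussSlice_lineDeriv (hC : C.IsSymm) {s : Pair ι → ℝ} {θ : (ι → Spin N) → ℂ}
    (hθ : θ ∈ gaussSlice C s) (ξ : ι × Fin N) :
    (fun φ => lineDeriv ℝ θ φ (fieldDir ξ)) ∈ gaussSlice C s ∧
      ∀ φ, LineDifferentiableAt ℝ θ φ (fieldDir ξ) := by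
  obtain ⟨ψ, hψ, rfl⟩ := hθ
  obtain ⟨ψ', hψ', hd⟩ := gaussClass_hasDerivAt hC hψ ξ
  refine ⟨⟨ψ', hψ', funext fun φ => ((hd φ s).deriv).symm⟩, fun φ => (hd φ s).differentiableAt⟩

theorem gaussAlg_continuous {Q : (ι → Spin N) × (Pair ι → ℝ) → ℂ} (hQ : Q ∈ gaussAlg C)
    (s : Pair ι → ℝ) : Continuous fun φ => Q (φ, s) := by
  induction hQ using Algebra.adjoin_induction with
  | mem Q hQ =>
    rcases hQ with ⟨η, rfl⟩ | ⟨η, rfl⟩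
    · exact (contDiff_component η).continuous
    · exact (continuous_const :
        Continuous fun _ : ι → Spin N => (interpCov C s)⁻¹ η.1 η.2)
  | algebraMap r => exact continuous_const
  | add f g _ _ hf hg => exact hf.add hg
  | mul f g _ _ hf hg => exact hf.mul hg

theorem gaussSlice_continuous {s : Pair ι → ℝ} {θ : (ι → Spin N) → ℂ}
    (hθ : θ ∈ gaussSlice C s) : Continuous θ := by
  obtain ⟨ψ, ⟨Q, hQ, rfl⟩, rfl⟩ := hθ
  refine (gaussAlg_continuous hQ s).mul ?_
  simp only [density, gaussianDensity_eq, dotProduct, mulVec]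
  have h : ∀ ξ, Continuous fun φ : ι → Spin N => components φ ξ := fun ξ =>
    (contDiff_component ξ).continuous
  fun_prop

/-! ### Distributions that are linear on Gaussian test functions -/

/-- The restriction of `u` to `W` is linear. -/
def IsLinearOn {V : Type*} [AddCommGroup V] [Module ℂ V] (W : Submodule ℂ V) (u : V → ℂ) : Prop :=
  ∃ Λ : W →ₗ[ℂ] ℂ, ∀ θ : W, u θ = Λ θ

/-- Distributions are represented by bare functions of the test function, and the integral is
additive only where it converges. Linearity on Gaussian test functions is what allows finite sums to
be exchanged with them later. -/
theorem isLinearOn_toDistribution {W : Submodule ℂ ((ι → Spin N) → ℂ)} {G : (ι → Spin N) → ℂ}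
    (hG : ∀ θ ∈ W, Integrable fun φ => G φ * θ φ) : IsLinearOn W (toDistribution G) := by
  refine ⟨⟨⟨fun θ => toDistribution G θ, fun θ θ' => ?_⟩, fun c θ => ?_⟩, fun θ => rfl⟩
  · simp only [toDistribution, Submodule.coe_add, Pi.add_apply, mul_add]
    exact integral_add (hG _ θ.2) (hG _ θ'.2)
  · simp only [toDistribution, Submodule.coe_smul, Pi.smul_apply, smul_eq_mul, RingHom.id_apply]
    rw [← integral_const_mul]
    exact integral_congr_ae (Filter.Eventually.of_forall fun φ => by ring)

theorem IsLinearOn.weakDeriv (hC : C.IsSymm) {s : Pair ι → ℝ} {u : ((ι → Spin N) → ℂ) → ℂ}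
    (hu : IsLinearOn (gaussSlice C s) u) (ξ : ι × Fin N) :
    IsLinearOn (gaussSlice C s) (weakDeriv ξ u) := by
  obtain ⟨Λ, hΛ⟩ := hu
  set D : gaussSlice C s →ₗ[ℂ] gaussSlice C s :=
    { toFun := fun θ => ⟨fun φ => lineDeriv ℝ θ.1 φ (fieldDir ξ), (gaussSlice_lineDeriv hC θ.2 ξ).1⟩
      map_add' := fun θ θ' => Subtype.ext <| funext fun φ =>
        deriv_fun_add ((gaussSlice_lineDeriv hC θ.2 ξ).2 φ) ((gaussSlice_lineDeriv hC θ'.2 ξ).2 φ)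
      map_smul' := fun c θ => Subtype.ext <| funext fun φ =>
        deriv_fun_const_smul c ((gaussSlice_lineDeriv hC θ.2 ξ).2 φ) }
  refine ⟨-Λ.comp D, fun θ => ?_⟩
  rw [LinearMap.neg_apply, LinearMap.comp_apply, ← hΛ]
  rfl

/-- The second order operator `C(ℓ)∂_ℓ` acting on functions of the field. -/
def fieldHeat (C : Matrix (ι × Fin N) (ι × Fin N) ℂ) (ℓ : Pair ι) (θ : (ι → Spin N) → ℂ) :
    (ι → Spin N) → ℂ := fun φ =>
  (1 / 2) * ∑ ξ, ∑ η, covPart C ℓ ξ η *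
    lineDeriv ℝ (fun φ => lineDeriv ℝ θ φ (fieldDir ξ)) φ (fieldDir η)

theorem covDeriv_apply (ℓ : Pair ι) (u : ((ι → Spin N) → ℂ) → ℂ) (θ : (ι → Spin N) → ℂ) :
    covDeriv C ℓ u θ = (1 / 2) * ∑ ξ, ∑ η, covPart C ℓ ξ η *
      u fun φ => lineDeriv ℝ (fun φ => lineDeriv ℝ θ φ (fieldDir ξ)) φ (fieldDir η) := by
  simp only [covDeriv, weakDeriv, neg_neg, covPart, ite_mul, zero_mul]
  congr 1

theorem IsLinearOn.covDeriv (hC : C.IsSymm) {s : Pair ι → ℝ} {u : ((ι → Spin N) → ℂ) → ℂ}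
    (hu : IsLinearOn (gaussSlice C s) u) (ℓ : Pair ι) :
    IsLinearOn (gaussSlice C s) (covDeriv C ℓ u) := by
  choose Λ hΛ using fun (ξ η : ι × Fin N) => (hu.weakDeriv hC η).weakDeriv hC ξ
  refine ⟨(1 / 2 : ℂ) • ∑ ξ, ∑ η, covPart C ℓ ξ η • Λ ξ η, fun θ => ?_⟩
  rw [covDeriv_apply]
  simp only [LinearMap.smul_apply, LinearMap.sum_apply, ← hΛ, smul_eq_mul, ClusterExpansion.weakDeriv,
    neg_neg]
  rfl

/-- The signs of the two weak derivatives cancel, and linearity pulls the sum over the components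
into the argument. -/
theorem covDeriv_eq_fieldHeat (hC : C.IsSymm) {s : Pair ι → ℝ} {u : ((ι → Spin N) → ℂ) → ℂ}
    (hu : IsLinearOn (gaussSlice C s) u) (ℓ : Pair ι) {θ : (ι → Spin N) → ℂ}
    (hθ : θ ∈ gaussSlice C s) : covDeriv C ℓ u θ = u (fieldHeat C ℓ θ) := by
  obtain ⟨Λ, hΛ⟩ := hu
  set θ₂ : ι × Fin N → ι × Fin N → gaussSlice C s := fun ξ η =>
    ⟨fun φ => lineDeriv ℝ (fun φ => lineDeriv ℝ θ φ (fieldDir ξ)) φ (fieldDir η),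
      (gaussSlice_lineDeriv hC (gaussSlice_lineDeriv hC hθ ξ).1 η).1⟩
  have h : fieldHeat C ℓ θ =
      (((1 / 2 : ℂ) • ∑ ξ, ∑ η, covPart C ℓ ξ η • θ₂ ξ η : gaussSlice C s) :
        (ι → Spin N) → ℂ) := by
    funext φ
    simp [fieldHeat, θ₂]
  rw [h, hΛ, covDeriv_apply]
  simp only [map_smul, map_sum, smul_eq_mul]
  simp only [← hΛ, θ₂]

theorem isLinearOn_foldr_covDeriv (hC : C.IsSymm) {s : Pair ι → ℝ} {u : ((ι → Spin N) → ℂ) → ℂ}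
    (hu : IsLinearOn (gaussSlice C s) u) (l : List (Pair ι)) :
    IsLinearOn (gaussSlice C s) (l.foldr (covDeriv C) u) := by
  induction l with
  | nil => exact hu
  | cons ℓ l ih => exact ih.covDeriv hC ℓ

/-! ### The heat equation -/

variable (C) in
/-- The set of all fields and of all parameters for which the Gaussian measure is defined. -/
def covDomain : Set ((ι → Spin N) × (Pair ι → ℝ)) := Set.univ ×ˢ covSet C

theorem mem_covDomain (φ : ι → Spin N) {s : Pair ι → ℝ} (hs : s ∈ covSet C) :
    (φ, s) ∈ covDomain C := ⟨trivial, hs⟩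

theorem isOpen_covDomain : IsOpen (covDomain C) := isOpen_univ.prod (isOpen_covSet C)

theorem uniqueDiffOn_covDomain : UniqueDiffOn ℝ (covDomain C) :=
  IsOpen.uniqueDiffOn isOpen_covDomain

theorem covDomain_subset : covDomain C ⊆ closure (interior (covDomain C)) := by
  rw [(isOpen_covDomain (C := C)).interior_eq]
  exact subset_closure

variable (C) in
/-- The derivative with respect to the component `ξ` of the field. -/
def fieldPartial (ξ : ι × Fin N) :
    ((ι → Spin N) × (Pair ι → ℝ) → ℂ) → (ι → Spin N) × (Pair ι → ℝ) → ℂ :=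
  dirWithin (covDomain C) (fieldDir ξ, 0)

variable (C) in
/-- The derivative with respect to the parameter `s(ℓ)`. -/
def pairPartial (ℓ : Pair ι) :
    ((ι → Spin N) × (Pair ι → ℝ) → ℂ) → (ι → Spin N) × (Pair ι → ℝ) → ℂ :=
  dirWithin (covDomain C) (0, Pi.single ℓ 1)

variable (C) in
/-- The operator `C(ℓ)∂_ℓ` acting on functions of the field and the parameters. -/
def heatOp (ℓ : Pair ι) (ψ : (ι → Spin N) × (Pair ι → ℝ) → ℂ) :
    (ι → Spin N) × (Pair ι → ℝ) → ℂ := fun p =>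
  (1 / 2) * ∑ ξ, ∑ η, covPart C ℓ ξ η * fieldPartial C η (fieldPartial C ξ ψ) p

theorem fieldPartial_eq {ψ : (ι → Spin N) × (Pair ι → ℝ) → ℂ}
    (hψ : ContDiffOn ℝ ∞ ψ (covDomain C)) (ξ : ι × Fin N) (φ : ι → Spin N) {s : Pair ι → ℝ}
    (hs : s ∈ covSet C) : fieldPartial C ξ ψ (φ, s) =
      lineDeriv ℝ (fun φ => ψ (φ, s)) φ (fieldDir ξ) := by
  have hp := mem_covDomain φ hs
  have h := lineDeriv_eq_dirWithin (hψ.differentiableOn (by simp) _ hp)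
    (eventually_line_mem (isOpen_covDomain (C := C)) hp (fieldDir ξ, 0))
  rw [fieldPartial, ← h, lineDeriv, lineDeriv]
  simp

theorem pairPartial_eq {ψ : (ι → Spin N) × (Pair ι → ℝ) → ℂ}
    (hψ : ContDiffOn ℝ ∞ ψ (covDomain C)) (ℓ : Pair ι) (φ : ι → Spin N) {s : Pair ι → ℝ}
    (hs : s ∈ covSet C) : pairPartial C ℓ ψ (φ, s) =
      lineDeriv ℝ (fun s => ψ (φ, s)) s (Pi.single ℓ 1) := by
  have hp := mem_covDomain φ hs
  have h := lineDeriv_eq_dirWithin (hψ.differentiableOn (by simp) _ hp)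
    (eventually_line_mem (isOpen_covDomain (C := C)) hp (0, Pi.single ℓ 1))
  rw [pairPartial, ← h, lineDeriv, lineDeriv]
  simp

theorem contDiffOn_fieldPartial {ψ : (ι → Spin N) × (Pair ι → ℝ) → ℂ}
    (hψ : ContDiffOn ℝ ∞ ψ (covDomain C)) (ξ : ι × Fin N) :
    ContDiffOn ℝ ∞ (fieldPartial C ξ ψ) (covDomain C) :=
  ContDiffOn.dirWithin uniqueDiffOn_covDomain hψ _

theorem heatOp_eq {ψ : (ι → Spin N) × (Pair ι → ℝ) → ℂ}
    (hψ : ContDiffOn ℝ ∞ ψ (covDomain C)) (ℓ : Pair ι) (φ : ι → Spin N) {s : Pair ι → ℝ}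
    (hs : s ∈ covSet C) : heatOp C ℓ ψ (φ, s) = fieldHeat C ℓ (fun φ => ψ (φ, s)) φ := by
  simp only [heatOp, fieldHeat, fieldPartial_eq (contDiffOn_fieldPartial hψ _) _ _ hs,
    fieldPartial_eq hψ _ _ hs]

variable (C) in
/-- The smooth functions on `covDomain C` that belong to `gaussClass C` and solve the heat
equation. -/
structure IsHeat (ψ : (ι → Spin N) × (Pair ι → ℝ) → ℂ) : Prop where
  smooth : ContDiffOn ℝ ∞ ψ (covDomain C)
  mem : ∃ ψ' ∈ gaussClass C, Set.EqOn ψ ψ' (covDomain C)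
  heat : ∀ ℓ, Set.EqOn (pairPartial C ℓ ψ) (heatOp C ℓ ψ) (covDomain C)

theorem fieldPartial_mem (hC : C.IsSymm) {ψ ψ' : (ι → Spin N) × (Pair ι → ℝ) → ℂ}
    (hψ : ContDiffOn ℝ ∞ ψ (covDomain C)) (hψ' : ψ' ∈ gaussClass C)
    (h : Set.EqOn ψ ψ' (covDomain C)) (ξ : ι × Fin N) :
    ∃ ψ'' ∈ gaussClass C, Set.EqOn (fieldPartial C ξ ψ) ψ'' (covDomain C) := by
  obtain ⟨ψ'', hm, hd⟩ := gaussClass_hasDerivAt hC hψ' ξ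
  refine ⟨ψ'', hm, fun p hp => ?_⟩
  rw [show p = (p.1, p.2) from rfl, fieldPartial_eq hψ ξ p.1 hp.2, ← (hd p.1 p.2).deriv, lineDeriv]
  congr 1
  exact funext fun t => h ⟨trivial, hp.2⟩

theorem heatOp_mem (hC : C.IsSymm) {ψ ψ' : (ι → Spin N) × (Pair ι → ℝ) → ℂ}
    (hψ : ContDiffOn ℝ ∞ ψ (covDomain C)) (hψ' : ψ' ∈ gaussClass C)
    (h : Set.EqOn ψ ψ' (covDomain C)) (ℓ : Pair ι) :
    ∃ ψ'' ∈ gaussClass C, Set.EqOn (heatOp C ℓ ψ) ψ'' (covDomain C) := by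
  choose ψ₁ hm₁ he₁ using fieldPartial_mem hC hψ hψ' h
  choose ψ₂ hm₂ he₂ using fun ξ η =>
    fieldPartial_mem hC (contDiffOn_fieldPartial hψ ξ) (hm₁ ξ) (he₁ ξ) η
  refine ⟨(1 / 2 : ℂ) • ∑ ξ, ∑ η, covPart C ℓ ξ η • ψ₂ ξ η, ?_, fun p hp => ?_⟩
  · exact Submodule.smul_mem _ _ (Submodule.sum_mem _ fun ξ _ => Submodule.sum_mem _ fun η _ =>
      Submodule.smul_mem _ _ (hm₂ ξ η))
  · simp only [heatOp, Pi.smul_apply, Finset.sum_apply, smul_eq_mul]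
    congr 1
    exact Finset.sum_congr rfl fun ξ _ => Finset.sum_congr rfl fun η _ => by rw [he₂ ξ η hp]

theorem isHeat_density (hC : C.IsSymm) : IsHeat C (density C) := by
  refine ⟨contDiffOn_density C, ⟨_, density_mem_gaussClass, fun _ _ => rfl⟩, fun ℓ p hp => ?_⟩
  have hsm : ContDiffOn ℝ ∞ (density C) (covDomain C) := contDiffOn_density C
  rw [show p = (p.1, p.2) from rfl, pairPartial_eq hsm ℓ p.1 hp.2, heatOp_eq hsm ℓ p.1 hp.2]
  have hB := hasDerivAt_density hC p.1 hp.2 ℓ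
  refine (HasDerivAt.deriv hB).trans ?_
  simp only [fieldHeat]
  congr 1
  refine Finset.sum_congr rfl fun ξ _ => Finset.sum_congr rfl fun η _ => ?_
  congr 1
  set B := (interpCov C p.2)⁻¹
  have h1 : ∀ φ, lineDeriv ℝ (fun φ => density C (φ, p.2)) φ (fieldDir ξ) =
      -(B *ᵥ components φ) ξ * gaussianDensity (interpCov C p.2) φ := fun φ =>
    (hasDerivAt_gaussianDensity_field (isSymm_interpCov hC p.2) φ ξ).deriv
  have h2 : HasDerivAt (fun t : ℝ => (B *ᵥ components (p.1 + t • fieldDir η)) ξ) (B ξ η) 0 := by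
    simp only [components_add_smul, Matrix.mulVec_add, Matrix.mulVec_smul,
      Matrix.mulVec_single_one, Pi.add_apply, Pi.smul_apply, Matrix.col_apply, smul_eq_mul]
    have := (((hasDerivAt_id (0 : ℂ)).mul_const (B ξ η)).const_add
      ((B *ᵥ components p.1) ξ)).comp_ofReal (z := 0)
    exact this.congr_deriv (by simp)
  simp only [h1]
  have h3 := h2.neg.mul
    (hasDerivAt_gaussianDensity_field (isSymm_interpCov hC p.2) p.1 η)
  refine Eq.trans ?_ h3.deriv.symm
  simp only [zero_smul, add_zero, Pi.neg_apply]
  ring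

/-- The coefficients of `heatOp` do not depend on `φ` or `s`, so it commutes with derivatives in the
parameters. These therefore map solutions of the heat equation to solutions. -/
theorem pairPartial_heatOp {ψ : (ι → Spin N) × (Pair ι → ℝ) → ℂ}
    (hψ : ContDiffOn ℝ ∞ ψ (covDomain C)) (ℓ ℓ' : Pair ι) :
    Set.EqOn (pairPartial C ℓ (heatOp C ℓ' ψ)) (heatOp C ℓ' (pairPartial C ℓ ψ))
      (covDomain C) := by
  have hU := uniqueDiffOn_covDomain (C := C)
  have hU' := covDomain_subset (C := C)
  intro p hp
  have hd : ∀ ξ η, DifferentiableWithinAt ℝ (fieldPartial C η (fieldPartial C ξ ψ))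
      (covDomain C) p := fun ξ η =>
    (contDiffOn_fieldPartial (contDiffOn_fieldPartial hψ ξ) η).differentiableOn (by simp) p hp
  have hcomm : ∀ ξ η, pairPartial C ℓ (fieldPartial C η (fieldPartial C ξ ψ)) p =
      fieldPartial C η (fieldPartial C ξ (pairPartial C ℓ ψ)) p := fun ξ η =>
    (dirWithin_comm hU hU' (contDiffOn_fieldPartial hψ ξ) _ _ hp).trans
      (dirWithin_congr (dirWithin_comm hU hU' hψ _ _) _ hp)
  have h : HasFDerivWithinAt (heatOp C ℓ' ψ) ((1 / 2 : ℂ) • ∑ ξ, ∑ η, covPart C ℓ' ξ η •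
      fderivWithin ℝ (fieldPartial C η (fieldPartial C ξ ψ)) (covDomain C) p) (covDomain C) p :=
    (HasFDerivWithinAt.fun_sum fun ξ _ => HasFDerivWithinAt.fun_sum fun η _ =>
      (hd ξ η).hasFDerivWithinAt.const_mul _).const_mul _
  simp only [heatOp, ← hcomm]
  unfold pairPartial dirWithin
  rw [h.fderivWithin (hU p hp)]
  simp

theorem IsHeat.pairPartial (hC : C.IsSymm) {ψ : (ι → Spin N) × (Pair ι → ℝ) → ℂ}
    (hψ : IsHeat C ψ) (ℓ : Pair ι) : IsHeat C (pairPartial C ℓ ψ) := by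
  have hU := uniqueDiffOn_covDomain (C := C)
  have hU' := covDomain_subset (C := C)
  obtain ⟨ψ', hm, he⟩ := hψ.mem
  obtain ⟨ψ'', hm', he'⟩ := heatOp_mem hC hψ.smooth hm he ℓ
  refine ⟨ContDiffOn.dirWithin hU hψ.smooth _, ⟨ψ'', hm', (hψ.heat ℓ).trans he'⟩, fun ℓ' => ?_⟩
  exact (dirWithin_comm hU hU' hψ.smooth _ _).trans ((dirWithin_congr (hψ.heat ℓ') _).trans
    (pairPartial_heatOp hψ.smooth ℓ ℓ'))

theorem IsHeat.slice_mem {ψ : (ι → Spin N) × (Pair ι → ℝ) → ℂ} (hψ : IsHeat C ψ)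
    {s : Pair ι → ℝ} (hs : s ∈ covSet C) : (fun φ => ψ (φ, s)) ∈ gaussSlice C s := by
  obtain ⟨ψ', hm, he⟩ := hψ.mem
  exact ⟨ψ', hm, funext fun φ => (he (mem_covDomain _ hs)).symm⟩

/-- Move the outermost weak derivative to the test function, where the heat equation turns it into a
parameter derivative; the result solves the heat equation again. The outermost operator acts on the
test function first, hence `foldl` on the right. -/
theorem IsHeat.foldr_covDeriv (hC : C.IsSymm) {ψ : (ι → Spin N) × (Pair ι → ℝ) → ℂ}
    (hψ : IsHeat C ψ) {s : Pair ι → ℝ} (hs : s ∈ covSet C) {u : ((ι → Spin N) → ℂ) → ℂ}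
    (hu : IsLinearOn (gaussSlice C s) u) (l : List (Pair ι)) :
    l.foldr (covDeriv C) u (fun φ => ψ (φ, s)) =
      u fun φ => l.foldl (fun ψ ℓ => ClusterExpansion.pairPartial C ℓ ψ) ψ (φ, s) := by
  induction l generalizing ψ with
  | nil => rfl
  | cons ℓ l ih =>
    rw [List.foldr_cons, List.foldl_cons, ← ih (hψ.pairPartial hC ℓ),
      covDeriv_eq_fieldHeat hC (isLinearOn_foldr_covDeriv hC hu l) ℓ (hψ.slice_mem hs)]
    refine congrArg _ (funext fun φ => ?_)
    rw [← heatOp_eq hψ.smooth ℓ φ hs, hψ.heat ℓ (mem_covDomain φ hs)]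

theorem IsHeat.foldr_pairPartial (hC : C.IsSymm) {ψ : (ι → Spin N) × (Pair ι → ℝ) → ℂ}
    (hψ : IsHeat C ψ) (l : List (Pair ι)) : IsHeat C (l.foldr (ClusterExpansion.pairPartial C) ψ) := by
  induction l with
  | nil => exact hψ
  | cons ℓ l ih => exact ih.pairPartial hC ℓ

theorem applyAll_pairDeriv_density (F : Finset (Pair ι)) (φ : ι → Spin N) {s : Pair ι → ℝ}
    (hs : s ∈ covSet C) :
    applyAll F pairDeriv (fun s => gaussianDensity (interpCov C s) φ) s =
      applyAll F (pairPartial C) (density C) (φ, s) := by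
  refine (foldr_pairDeriv_eq (c := 1) (S := Set.univ) (a := fun s => (φ, s)) (U := covSet C)
    (v := fun ℓ => (0, Pi.single ℓ 1)) (G := density C)
    uniqueDiffOn_covDomain (contDiffOn_density C)
    (fun s hs ℓ _ => eventually_line_mem (isOpen_covSet C) hs _)
    (fun s t ℓ => by simp) (fun s hs => mem_covDomain φ hs) (fun s _ => (one_mul _).symm) F.toList
    (fun _ _ => trivial) s hs).trans (one_mul _)

/-- The weak derivatives `C(ℓ)∂_ℓ`, evaluated on the Gaussian density, are derivatives of the
density with respect to the parameters `s(ℓ)`. -/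
theorem applyAll_covDeriv_toDistribution (hC : C.IsSymm) {s : Pair ι → ℝ} (hs : s ∈ covSet C)
    {G : (ι → Spin N) → ℂ} (hG : ∀ θ ∈ gaussSlice C s, Integrable fun φ => G φ * θ φ)
    (F : Finset (Pair ι)) :
    applyAll F (covDeriv C) (toDistribution G) (gaussianDensity (interpCov C s)) =
      ∫ φ, G φ * applyAll F pairDeriv (fun s => gaussianDensity (interpCov C s) φ) s := by
  have hU := uniqueDiffOn_covDomain (C := C)
  have hU' := covDomain_subset (C := C)
  refine ((isHeat_density hC).foldr_covDeriv hC hs (isLinearOn_toDistribution hG) F.toList).trans ?_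
  refine integral_congr_ae (Filter.Eventually.of_forall fun φ => ?_)
  simp only
  -- Passing to the test function has reversed the order of the derivatives, which is immaterial.
  rw [applyAll_pairDeriv_density F φ hs, ← List.foldr_reverse]
  congr 1
  exact foldr_dirWithin_perm hU hU' (contDiffOn_density C) _ (List.reverse_perm _) (mem_covDomain _ hs)

theorem applyAll_pairPartial_mem (hC : C.IsSymm) (F : Finset (Pair ι)) :
    ∃ ψ ∈ gaussClass C, Set.EqOn (applyAll F (pairPartial C) (density C)) ψ (covDomain C) :=
  ((isHeat_density hC).foldr_pairPartial hC F.toList).mem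

end GaussClass

end ClusterExpansion

end

noncomputable section

open scoped ENNReal ContDiff

namespace ClusterExpansion

open MeasureTheory Matrix

/-! ### Bounds on the derivatives of the Gaussian density -/

section Bounds

variable {ι : Type*} [Fintype ι] [DecidableEq ι] {N : ℕ}

/-- The parameters for which the interpolated covariance is coercive with constant `c`. -/
def coerciveSet (C : Matrix (ι × Fin N) (ι × Fin N) ℂ) (c : ℝ) : Set (Pair ι → ℝ) :=
  Set.Icc 0 1 ∩ {s | Coercive c (interpCov C s)}

variable {C : Matrix (ι × Fin N) (ι × Fin N) ℂ}

/-- Coercivity with a fixed constant is a closed condition. Compactness then yields constants that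
are uniform over all `s^T`. -/
theorem isCompact_coerciveSet (c : ℝ) : IsCompact (coerciveSet C c) := by
  refine (isCompact_Icc).inter_right ?_
  simp only [Coercive, Set.ofPred_forall]
  refine isClosed_iInter fun v => isClosed_le continuous_const ?_
  simp only [star_dotProduct_mulVec]
  have h : ∀ ξ η, Continuous fun s => interpCov C s ξ η := fun ξ η =>
    (contDiff_interpCov C ξ η).continuous
  fun_prop

theorem coerciveSet_subset {c : ℝ} (hc : 0 < c) : coerciveSet C c ⊆ covSet C :=
  fun _ hs => ⟨c, hc, hs.2⟩

theorem IsUltra.mem_coerciveSet {c : ℝ} (hC : Coercive c C) {s : Pair ι → ℝ} (hs : IsUltra s) :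
    s ∈ coerciveSet C c := ⟨hs.1, hC.interpCov hs⟩

theorem sum_norm_sq_components (φ : ι → Spin N) :
    ∑ ξ, ‖components φ ξ‖ ^ 2 = ∑ x, ‖φ x‖ ^ 2 := by
  rw [Fintype.sum_prod_type]
  refine Finset.sum_congr rfl fun x _ => ?_
  rw [EuclideanSpace.norm_sq_eq]
  simp [components]

/-- `Coercive.inv` bounds the real part of the form of `C_s⁻¹` below by `c / b`, whence the decay
rate `c / (2b)`; the normalisation is bounded by compactness. -/
theorem norm_density_le {c : ℝ} (hc : 0 < c) : ∃ a > 0, ∃ K, 0 ≤ K ∧ ∀ s ∈ coerciveSet C c,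
    ∀ φ : ι → Spin N, ‖density C (φ, s)‖ ≤ K * Real.exp (-a * ∑ x, ‖φ x‖ ^ 2) := by
  -- The weights are at most one, so the sum bounds the squared Hilbert–Schmidt norm of every `C_s`;
  -- the added `1` keeps `b` positive.
  set b : ℝ := (∑ ξ, ∑ η, ‖C ξ η‖ ^ 2) + 1
  have hb : 0 < b := by positivity
  obtain ⟨K, hK⟩ := (isCompact_coerciveSet (C := C) c).exists_bound_of_continuousOn
    ((contDiffOn_gaussNorm_interpCov C).continuousOn.mono (coerciveSet_subset hc))
  refine ⟨c / b / 2, by positivity, max K 0, le_max_right _ _, fun s hs φ => ?_⟩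
  have hle : ∑ ξ, ∑ η, ‖interpCov C s ξ η‖ ^ 2 ≤ b := by
    refine (Finset.sum_le_sum fun ξ _ => Finset.sum_le_sum fun η _ => ?_).trans
      (le_add_of_nonneg_right zero_le_one)
    have hw := pairWeight_mem hs.1 ξ.1 η.1
    rw [interpCov_apply, norm_mul, Complex.norm_real, Real.norm_of_nonneg hw.1]
    exact pow_le_pow_left₀ (mul_nonneg (norm_nonneg _) hw.1)
      (mul_le_of_le_one_right (norm_nonneg (C ξ η)) hw.2) 2
  have hco := hs.2.inv hc hb hle (components φ)
  have hstar : star (components φ) = components φ := funext fun ξ => Complex.conj_ofReal _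
  rw [hstar, sum_norm_sq_components] at hco
  rw [density, gaussianDensity_eq, norm_mul, Complex.norm_exp]
  refine mul_le_mul ((hK s hs).trans (le_max_left _ _)) (Real.exp_le_exp.2 ?_)
    (Real.exp_pos _).le (le_max_right _ _)
  have h2 : (-(1 / 2 : ℂ) * (components φ ⬝ᵥ (interpCov C s)⁻¹ *ᵥ components φ)).re =
      -(1 / 2) * (components φ ⬝ᵥ (interpCov C s)⁻¹ *ᵥ components φ).re := by
    rw [show (-(1 / 2 : ℂ)) = ((-(1 / 2) : ℝ) : ℂ) by push_cast; rfl, Complex.re_ofReal_mul]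
  rw [h2]
  linarith

/-- Polynomials in the field grow more slowly than any Gaussian; in a product each factor gets half
of `ε`. -/
theorem norm_gaussAlg_le {c : ℝ} (hc : 0 < c) {Q : (ι → Spin N) × (Pair ι → ℝ) → ℂ}
    (hQ : Q ∈ gaussAlg C) : ∀ ε > 0, ∃ K, 0 ≤ K ∧ ∀ s ∈ coerciveSet C c,
      ∀ φ : ι → Spin N, ‖Q (φ, s)‖ ≤ K * Real.exp (ε * ∑ x, ‖φ x‖ ^ 2) := by
  have hS : ∀ φ : ι → Spin N, 0 ≤ ∑ x, ‖φ x‖ ^ 2 := fun φ =>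
    Finset.sum_nonneg fun _ _ => by positivity
  have hconst : ∀ K : ℝ, 0 ≤ K → ∀ ε > 0, ∀ φ : ι → Spin N,
      K ≤ K * Real.exp (ε * ∑ x, ‖φ x‖ ^ 2) := fun K hK ε hε φ =>
    le_mul_of_one_le_right hK (Real.one_le_exp (mul_nonneg hε.le (hS φ)))
  induction hQ using Algebra.adjoin_induction with
  | mem Q hQ =>
    intro ε hε
    rcases hQ with ⟨ξ, rfl⟩ | ⟨ξ, rfl⟩
    · refine ⟨1 + 1 / ε, by positivity, fun s hs φ => ?_⟩
      have h1 : ‖components φ ξ‖ ^ 2 ≤ ∑ x, ‖φ x‖ ^ 2 := by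
        rw [← sum_norm_sq_components]
        exact Finset.single_le_sum (f := fun ξ => ‖components φ ξ‖ ^ 2)
          (fun _ _ => by positivity) (Finset.mem_univ ξ)
      have h2 := Real.add_one_le_exp (ε * ∑ x, ‖φ x‖ ^ 2)
      set S := ∑ x, ‖φ x‖ ^ 2
      have h3 : S ≤ 1 / ε * Real.exp (ε * S) := by
        rw [one_div, ← div_eq_inv_mul, le_div_iff₀ hε]
        linarith
      have h4 : 1 ≤ Real.exp (ε * S) := Real.one_le_exp (mul_nonneg hε.le (hS φ))
      simp only
      nlinarith [sq_nonneg (‖components φ ξ‖ - 1)]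
    · have hcont : ContinuousOn (fun s => (interpCov C s)⁻¹ ξ.1 ξ.2) (coerciveSet C c) :=
        (contDiffOn_inv_interpCov C ξ.1 ξ.2).continuousOn.mono (coerciveSet_subset hc)
      obtain ⟨K, hK⟩ := (isCompact_coerciveSet (C := C) c).exists_bound_of_continuousOn hcont
      exact ⟨max K 0, le_max_right _ _, fun s hs φ => ((hK s hs).trans (le_max_left _ _)).trans
        (hconst _ (le_max_right _ _) ε hε φ)⟩
  | algebraMap r =>
    exact fun ε hε => ⟨‖r‖, norm_nonneg _, fun s _ φ => hconst _ (norm_nonneg _) ε hε φ⟩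
  | add f g _ _ hf hg =>
    intro ε hε
    obtain ⟨K, hK, h⟩ := hf ε hε
    obtain ⟨K', hK', h'⟩ := hg ε hε
    refine ⟨K + K', by positivity, fun s hs φ => (norm_add_le _ _).trans ?_⟩
    rw [add_mul]
    exact add_le_add (h s hs φ) (h' s hs φ)
  | mul f g _ _ hf hg =>
    intro ε hε
    obtain ⟨K, hK, h⟩ := hf (ε / 2) (by positivity)
    obtain ⟨K', hK', h'⟩ := hg (ε / 2) (by positivity)
    refine ⟨K * K', by positivity, fun s hs φ => ?_⟩
    rw [Pi.mul_apply, norm_mul]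
    refine (mul_le_mul (h s hs φ) (h' s hs φ) (norm_nonneg _) (by positivity)).trans (le_of_eq ?_)
    rw [mul_mul_mul_comm, ← Real.exp_add]
    congr 2
    ring

/-- Half of the decay of the density absorbs the polynomial, so one rate serves the whole class. -/
theorem norm_gaussClass_le {c : ℝ} (hc : 0 < c) : ∃ a > 0, ∀ ψ ∈ gaussClass C, ∃ K, 0 ≤ K ∧
    ∀ s ∈ coerciveSet C c, ∀ φ : ι → Spin N,
      ‖ψ (φ, s)‖ ≤ K * Real.exp (-a * ∑ x, ‖φ x‖ ^ 2) := by
  obtain ⟨a, ha, K, hK, h⟩ := norm_density_le (C := C) hc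
  refine ⟨a / 2, by positivity, fun ψ hψ => ?_⟩
  obtain ⟨Q, hQ, rfl⟩ := mem_gaussClass.1 hψ
  obtain ⟨K', hK', h'⟩ := norm_gaussAlg_le hc hQ (a / 2) (by positivity)
  refine ⟨K' * K, by positivity, fun s hs φ => ?_⟩
  rw [Pi.mul_apply, norm_mul]
  refine (mul_le_mul (h' s hs φ) (h s hs φ) (norm_nonneg _) (by positivity)).trans (le_of_eq ?_)
  rw [mul_mul_mul_comm, ← Real.exp_add]
  congr 2
  ring

theorem integrable_exp_neg_sum_sq {a : ℝ} (ha : 0 < a) :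
    Integrable fun φ : ι → Spin N => Real.exp (-a * ∑ x, ‖φ x‖ ^ 2) := by
  have h1 : Integrable fun v : Spin N => Real.exp (-a * ‖v‖ ^ 2) := by
    have h := (GaussianFourier.integrable_cexp_neg_mul_sq_norm_add (V := Spin N) (b := (a : ℂ))
      (by simpa using ha) 0 0).norm
    refine h.congr (Filter.Eventually.of_forall fun v => ?_)
    simp only [Complex.norm_exp]
    congr 1
    simp [← Complex.ofReal_pow]
  have h2 := Integrable.fintype_prod (ι := ι) (f := fun _ => fun v : Spin N =>
    Real.exp (-a * ‖v‖ ^ 2)) (μ := fun _ => volume) fun _ => h1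
  simp only [← Real.exp_sum, ← Finset.mul_sum] at h2
  exact h2

end Bounds

/-! ### Factorisation over the blocks of a partition -/

section Blocks

variable {L : Type*} [Fintype L] [DecidableEq L]

theorem sum_eq_sum_parts {M : Type*} [AddCommMonoid M] (P : Finpartition (Finset.univ : Finset L))
    (f : L → M) : ∑ x, f x = ∑ X ∈ P.parts, ∑ x : X, f x := by
  conv_lhs => rw [← P.biUnion_parts, Finset.sum_biUnion P.disjoint]
  exact Finset.sum_congr rfl fun X _ => (Finset.sum_coe_sort X f).symm

theorem sum_sum_eq_sum_parts {M : Type*} [AddCommMonoid M]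
    (P : Finpartition (Finset.univ : Finset L)) {f : L → L → M}
    (hf : ∀ x y, P.part x ≠ P.part y → f x y = 0) :
    ∑ x, ∑ y, f x y = ∑ X ∈ P.parts, ∑ x : X, ∑ y : X, f x y := by
  rw [sum_eq_sum_parts P]
  refine Finset.sum_congr rfl fun X hX => Finset.sum_congr rfl fun x _ => ?_
  rw [Finset.sum_coe_sort X (fun y => f x y)]
  refine (Finset.sum_subset (Finset.subset_univ X) fun y _ hy => hf _ _ fun h => hy ?_).symm
  rw [← P.part_eq_of_mem hX x.2, h]
  exact P.mem_part (Finset.mem_univ y)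

variable {N : ℕ}

theorem det_eq_prod_parts {R : Type*} [CommRing R] (P : Finpartition (Finset.univ : Finset L))
    {M : Matrix (L × Fin N) (L × Fin N) R}
    (hM : ∀ ξ η, P.part ξ.1 ≠ P.part η.1 → M ξ η = 0) :
    M.det = ∏ X ∈ P.parts, (M.submatrix (fun ξ : X × Fin N => ((ξ.1 : L), ξ.2))
      fun ξ => ((ξ.1 : L), ξ.2)).det := by
  set e := Fintype.equivFin P.parts
  set b : L × Fin N → Fin (Fintype.card P.parts) := fun ξ =>
    e ⟨P.part ξ.1, P.part_mem.2 (Finset.mem_univ _)⟩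
  have hb : M.BlockTriangular b := fun ξ η h => hM ξ η fun h' => h.ne (by simp [b, h'])
  rw [hb.det_fintype, ← e.prod_comp]
  refine Eq.trans ?_ (Finset.prod_coe_sort P.parts fun X => (M.submatrix
    (fun ξ : X × Fin N => ((ξ.1 : L), ξ.2)) fun ξ => ((ξ.1 : L), ξ.2)).det)
  refine Finset.prod_congr rfl fun X _ => ?_
  have hiff : ∀ ξ, b ξ = e X ↔ ξ.1 ∈ X.1 := fun ξ => by
    simp only [b, e.apply_eq_iff_eq, Subtype.ext_iff]
    exact ⟨fun h => h ▸ P.mem_part (Finset.mem_univ _), fun h => P.part_eq_of_mem X.2 h⟩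
  let f : X.1 × Fin N ≃ {ξ // b ξ = e X} :=
    { toFun := fun ξ => ⟨((ξ.1 : L), ξ.2), (hiff _).2 ξ.1.2⟩
      invFun := fun ξ => (⟨ξ.1.1, (hiff _).1 ξ.2⟩, ξ.1.2)
      left_inv := fun _ => rfl
      right_inv := fun _ => rfl }
  rw [← Matrix.det_submatrix_equiv_self f]
  rfl

theorem coe_prod_eq_iff {X : Finset L} {ξ η : X × Fin N} :
    ((ξ.1 : L), ξ.2) = ((η.1 : L), η.2) ↔ ξ = η :=
  ⟨fun h => Prod.ext (Subtype.ext (Prod.ext_iff.1 h).1) (Prod.ext_iff.1 h).2, fun h => h ▸ rfl⟩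

theorem charpoly_eq_prod_parts (P : Finpartition (Finset.univ : Finset L))
    {M : Matrix (L × Fin N) (L × Fin N) ℂ}
    (hM : ∀ ξ η, P.part ξ.1 ≠ P.part η.1 → M ξ η = 0) :
    M.charpoly = ∏ X ∈ P.parts, (restrictCov X M).charpoly := by
  rw [Matrix.charpoly, det_eq_prod_parts P fun ξ η h => ?_]
  · refine Finset.prod_congr rfl fun X _ => ?_
    rw [Matrix.charpoly]
    congr 1
    ext ξ η : 1
    simp only [Matrix.submatrix_apply, Matrix.charmatrix_apply, restrictCov, Matrix.diagonal_apply]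
    simp only [coe_prod_eq_iff]
  · rw [Matrix.charmatrix_apply_ne _ _ _ fun h' => h (by rw [h']), hM ξ η h]
    simp

/-- The characteristic polynomial factors over the parts, so the eigenvalues of `M` are those of the
blocks with multiplicity, and the principal powers multiply without a choice of branch. -/
theorem gaussNorm_eq_prod_parts (P : Finpartition (Finset.univ : Finset L))
    {M : Matrix (L × Fin N) (L × Fin N) ℂ}
    (hM : ∀ ξ η, P.part ξ.1 ≠ P.part η.1 → M ξ η = 0) :
    gaussNorm M = ∏ X ∈ P.parts, gaussNorm (restrictCov X M) := by
  simp only [gaussNorm]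
  rw [charpoly_eq_prod_parts P hM, Polynomial.roots_prod _ _ (Finset.prod_ne_zero_iff.2
    fun X _ => (Matrix.charpoly_monic _).ne_zero), Multiset.map_bind, Multiset.prod_bind]
  rfl

/-- The block truncation of `M⁻¹` is a right inverse of `M`, hence is `M⁻¹`. -/
theorem inv_eq_zero_of_part_ne (P : Finpartition (Finset.univ : Finset L))
    {M : Matrix (L × Fin N) (L × Fin N) ℂ}
    (hM : ∀ ξ η, P.part ξ.1 ≠ P.part η.1 → M ξ η = 0) (hdet : IsUnit M.det) (ξ η : L × Fin N)
    (h : P.part ξ.1 ≠ P.part η.1) : M⁻¹ ξ η = 0 := by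
  set D : Matrix (L × Fin N) (L × Fin N) ℂ := fun ξ η =>
    if P.part ξ.1 = P.part η.1 then M⁻¹ ξ η else 0
  have hD : M * D = 1 := by
    ext ξ η
    rw [Matrix.mul_apply]
    by_cases h : P.part ξ.1 = P.part η.1
    · rw [← Matrix.mul_nonsing_inv M hdet, Matrix.mul_apply]
      refine Finset.sum_congr rfl fun ζ _ => ?_
      by_cases h' : P.part ξ.1 = P.part ζ.1
      · simp [D, ← h', h]
      · simp [hM ξ ζ h']
    · rw [Matrix.one_apply_ne fun h' => h (by rw [h'])]
      refine Finset.sum_eq_zero fun ζ _ => ?_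
      by_cases h' : P.part ξ.1 = P.part ζ.1
      · simp [D, ← h', h]
      · simp [hM ξ ζ h']
  rw [Matrix.inv_eq_right_inv hD]
  simp [D, h]

theorem gaussianDensity_eq_prod_parts (P : Finpartition (Finset.univ : Finset L))
    {M : Matrix (L × Fin N) (L × Fin N) ℂ}
    (hM : ∀ ξ η, P.part ξ.1 ≠ P.part η.1 → M ξ η = 0) (hdet : IsUnit M.det) (φ : L → Spin N) :
    gaussianDensity M φ =
      ∏ X ∈ P.parts, gaussianDensity (restrictCov X M) (restrictField X φ) := by
  have hinv := inv_eq_zero_of_part_ne P hM hdet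
  have hX : ∀ X ∈ P.parts, (restrictCov X M)⁻¹ = restrictCov X M⁻¹ := by
    intro X hX
    refine Matrix.inv_eq_right_inv ?_
    ext ξ η
    have h1 : (1 : Matrix (X × Fin N) (X × Fin N) ℂ) ξ η =
        (1 : Matrix (L × Fin N) (L × Fin N) ℂ) ((ξ.1 : L), ξ.2) ((η.1 : L), η.2) := by
      simp only [Matrix.one_apply, coe_prod_eq_iff]
    rw [h1, ← Matrix.mul_nonsing_inv M hdet, Matrix.mul_apply, Matrix.mul_apply,
      Fintype.sum_prod_type, Fintype.sum_prod_type]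
    simp only [restrictCov, Matrix.submatrix_apply]
    rw [Finset.sum_coe_sort X (fun y => ∑ n, M ((ξ.1 : L), ξ.2) (y, n) *
      M⁻¹ (y, n) ((η.1 : L), η.2))]
    refine Finset.sum_subset (Finset.subset_univ X) fun y _ hy => Finset.sum_eq_zero fun n _ => ?_
    rw [hM _ _ fun h => hy ?_, zero_mul]
    rw [← P.part_eq_of_mem hX ξ.1.2, h]
    exact P.mem_part (Finset.mem_univ y)
  simp only [gaussianDensity_eq]
  rw [Finset.prod_mul_distrib, ← gaussNorm_eq_prod_parts P hM, ← Complex.exp_sum,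
    ← Finset.mul_sum]
  congr 3
  simp only [dotProduct, mulVec, Finset.mul_sum, Fintype.sum_prod_type]
  refine Eq.trans (Finset.sum_congr rfl fun x _ => Finset.sum_comm) ?_
  rw [sum_sum_eq_sum_parts P fun x y h => Finset.sum_eq_zero fun m _ => Finset.sum_eq_zero fun n _ =>
    by rw [hinv (x, m) (y, n) h, zero_mul, mul_zero]]
  refine Finset.sum_congr rfl fun X hX' => ?_
  rw [hX X hX']
  exact Finset.sum_congr rfl fun x _ => Finset.sum_comm

theorem gaussianDensity_interpCov_eq_prod_parts (P : Finpartition (Finset.univ : Finset L))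
    {C : Matrix (L × Fin N) (L × Fin N) ℂ} {s : Pair L → ℝ}
    (hs : ∀ (e : Pair L) (x y : L), s(x, y) = e.1 → P.part x ≠ P.part y → s e = 0)
    (hsC : s ∈ covSet C) (φ : L → Spin N) :
    gaussianDensity (interpCov C s) φ = ∏ X ∈ P.parts,
      gaussianDensity (interpCov (restrictCov X C) (restrictPairs X s)) (restrictField X φ) := by
  rw [gaussianDensity_eq_prod_parts P (fun ξ η h => ?_) (det_interpCov_ne_zero C hsC).isUnit]
  · refine Finset.prod_congr rfl fun X _ => ?_
    congr 1
    ext ξ η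
    simp only [restrictCov, interpCov, Matrix.submatrix_apply, Subtype.ext_iff]
    rfl
  · have hne : ξ.1 ≠ η.1 := fun h' => h (by rw [h'])
    rw [interpCov_apply, pairWeight, dif_neg hne, hs _ ξ.1 η.1 rfl h]
    simp

end Blocks

end ClusterExpansion

end

/-! ### The activities as absolutely convergent integrals -/

noncomputable section

open scoped ENNReal ContDiff

namespace ClusterExpansion

open MeasureTheory

/-! ### The cutoff and the open cube of parameters -/

section Cutoff

variable {ι : Type*} {N : ℕ}

theorem cutoff_eq_indicator [Fintype ι] (R : ℝ≥0∞) (φ : ι → Spin N) :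
    cutoff R φ = (smallFields ι N R).indicator 1 φ := by
  classical
  rw [cutoff, Finset.prod_ite_zero, Set.indicator_apply]
  simp [smallFields]

theorem isClosed_smallFields (R : ℝ≥0∞) : IsClosed (smallFields ι N R) := by
  simp only [smallFields, Set.ofPred_forall]
  refine isClosed_iInter fun x => isClosed_le ?_ continuous_const
  exact ENNReal.continuous_ofReal.comp (continuous_apply x).norm

theorem measurableSet_smallFields [Fintype ι] (R : ℝ≥0∞) : MeasurableSet (smallFields ι N R) :=
  (isClosed_smallFields R).measurableSet

theorem norm_cutoff_le [Fintype ι] (R : ℝ≥0∞) (φ : ι → Spin N) : ‖cutoff R φ‖ ≤ 1 := by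
  classical
  rw [cutoff_eq_indicator, Set.indicator_apply]
  split_ifs <;> simp

/-- The interior of the unit cube. -/
def openCube (κ : Type*) : Set (κ → ℝ) := Set.pi Set.univ fun _ => Set.Ioo 0 1

theorem mem_openCube {κ : Type*} {w : κ → ℝ} : w ∈ openCube κ ↔ ∀ i, w i ∈ Set.Ioo (0 : ℝ) 1 := by
  simp [openCube]

theorem isOpen_openCube (κ : Type*) [Finite κ] : IsOpen (openCube κ) :=
  isOpen_set_pi Set.finite_univ fun _ _ => isOpen_Ioo

theorem openCube_subset (κ : Type*) : openCube κ ⊆ Set.Icc 0 1 := fun _ hw =>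
  ⟨fun i => (mem_openCube.1 hw i).1.le, fun i => (mem_openCube.1 hw i).2.le⟩

theorem isUltra_treeInterp [Fintype ι] {T : Finset (Pair ι)} (hT : (pairGraph T).IsAcyclic)
    {w : T → ℝ} (hw : ∀ ℓ, w ℓ ∈ Set.Icc (0 : ℝ) 1) : IsUltra (treeInterp T w) := by
  classical
  set θ : Pair ι → ℝ := fun ℓ => if h : ℓ ∈ T then w ⟨ℓ, h⟩ else 0
  have hθ : θ ∈ Set.Icc (0 : Pair ι → ℝ) 1 := by
    constructor <;> intro ℓ <;> simp only [θ, Pi.zero_apply, Pi.one_apply] <;> split_ifs with h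
    · exact (hw _).1
    · exact le_rfl
    · exact (hw _).2
    · exact zero_le_one
  have h := isUltra_forestInterp hT hθ (u := 0) ⟨le_rfl, zero_le_one⟩
  rw [forestInterp_zero hθ.1] at h
  have hw' : (fun ℓ : T => θ ℓ) = w := funext fun ℓ => by simp [θ]
  rwa [hw'] at h

theorem thresholdGraph_eq {T : Finset (Pair ι)} {w : T → ℝ} {t : ℝ} (h : ∀ ℓ, t ≤ w ℓ) :
    thresholdGraph T w t = pairGraph T := by
  refine le_antisymm (thresholdGraph_le T w t) fun x y hxy => ?_
  obtain ⟨ℓ, hℓ, h'⟩ := (pairGraph_adj _ _ _).1 hxy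
  exact (thresholdGraph_adj _ _ _ _ _).2 ⟨⟨ℓ, hℓ⟩, h', h _⟩

theorem treeInterp_pos {T : Finset (Pair ι)} (hT : (pairGraph T).IsAcyclic)
    {w : T → ℝ} (hw : ∀ ℓ, 0 < w ℓ) {e : Pair ι} {x y : ι} (h : s(x, y) = e.1)
    (hxy : (pairGraph T).Reachable x y) : 0 < treeInterp T w e := by
  have hne : x ≠ y := fun h' => e.2 (h ▸ Sym2.mk_isDiag_iff.2 h')
  obtain ⟨p⟩ := hxy
  have hTne : Nonempty T := by
    cases p with
    | nil => exact absurd rfl hne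
    | cons h _ =>
      obtain ⟨ℓ, hℓ, -⟩ := (pairGraph_adj _ _ _).1 h
      exact ⟨⟨ℓ, hℓ⟩⟩
  obtain ⟨ℓ₀, hℓ₀⟩ := Finite.exists_min w
  refine (hw ℓ₀).trans_le ((le_treeInterp_iff hT w (hw ℓ₀) h).2 ?_)
  rw [thresholdGraph_eq hℓ₀]
  exact ⟨p⟩

theorem treeInterp_lt_one {T : Finset (Pair ι)} (hT : (pairGraph T).IsAcyclic)
    {w : T → ℝ} (hw : ∀ ℓ, w ℓ < 1) (e : Pair ι) : treeInterp T w e < 1 := by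
  by_contra hle
  rw [not_lt] at hle
  obtain ⟨⟨x, y⟩, hxy⟩ := Quot.exists_rep e.1
  have hne : x ≠ y := fun h' => e.2 (hxy ▸ Sym2.mk_isDiag_iff.2 h')
  obtain ⟨p⟩ := (le_treeInterp_iff hT w one_pos (show s(x, y) = e.1 from hxy)).1 hle
  cases p with
  | nil => exact hne rfl
  | cons h _ =>
    obtain ⟨ℓ, -, hℓ⟩ := (thresholdGraph_adj _ _ _ _ _).1 h
    exact (hw ℓ).not_ge hℓ

/-- A spanning tree links all pairs, so `s^T` is interior to the cube whenever the weights are, and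
the two-sided parameter derivatives in the activities make sense. -/
theorem treeInterp_mem_openCube {T : Finset (Pair ι)} (hT : (pairGraph T).IsTree)
    {w : T → ℝ} (hw : w ∈ openCube T) : treeInterp T w ∈ openCube (Pair ι) := by
  refine mem_openCube.2 fun e => ⟨?_, treeInterp_lt_one hT.isAcyclic
    (fun ℓ => (mem_openCube.1 hw ℓ).2) e⟩
  obtain ⟨⟨x, y⟩, hxy⟩ := Quot.exists_rep e.1
  exact treeInterp_pos hT.isAcyclic (fun ℓ => (mem_openCube.1 hw ℓ).1)
    (show s(x, y) = e.1 from hxy) (hT.connected.preconnected x y)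

end Cutoff

/-! ### The activities as integrals of integrable functions -/

section Local

variable {ι : Type*} [Fintype ι] [DecidableEq ι] {N : ℕ}

/-- The regularity of the integrand of an activity that is needed for the interpolation. -/
structure IsRegular (R : ℝ≥0∞) (A' : (ι → Spin N) → (Pair ι → ℝ) → ℂ) : Prop where
  smooth : ∀ φ ∈ smallFields ι N R, ContDiffOn ℝ ∞ (A' φ) (openCube (Pair ι))
  cont : ∀ F : Finset (Pair ι), ContinuousOn
    (fun p : (ι → Spin N) × (Pair ι → ℝ) => applyAll F pairDeriv (A' p.1) p.2)
    (smallFields ι N R ×ˢ openCube (Pair ι))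
  bound : ∀ ε > 0, ∃ K, ∀ T : Finset (Pair ι), (pairGraph T).IsTree → ∀ F ⊆ T, ∀ w ∈ openCube T,
    ∀ φ ∈ smallFields ι N R, ‖applyAll F pairDeriv (A' φ) (treeInterp T w)‖ ≤
      K * Real.exp (ε * ∑ x, ‖φ x‖ ^ 2)

/-- The contribution of the tree `T` to an activity, as a function of the field and of the weights
of the edges of `T`. -/
def treeIntegrand (C : Matrix (ι × Fin N) (ι × Fin N) ℂ) (R : ℝ≥0∞)
    (A' : (ι → Spin N) → (Pair ι → ℝ) → ℂ) (T : Finset (Pair ι)) (φ : ι → Spin N) (w : T → ℝ) :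
    ℂ :=
  cutoff R φ * applyAll T pairDeriv (fun s => gaussianDensity (interpCov C s) φ * A' φ s)
    (treeInterp T w)

variable {C : Matrix (ι × Fin N) (ι × Fin N) ℂ} {R : ℝ≥0∞}
  {A' : (ι → Spin N) → (Pair ι → ℝ) → ℂ}

theorem contDiffOn_gaussianDensity (C : Matrix (ι × Fin N) (ι × Fin N) ℂ) (φ : ι → Spin N) :
    ContDiffOn ℝ ∞ (fun s => gaussianDensity (interpCov C s) φ) (covSet C) := by
  have hm : Set.MapsTo (fun s : Pair ι → ℝ => (φ, s)) (covSet C) (covDomain C) :=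
    fun s hs => mem_covDomain φ hs
  have hd : ContDiffOn ℝ ∞ (density C) (covDomain C) := contDiffOn_density C
  have hp : ContDiff ℝ ∞ fun s : Pair ι → ℝ => (φ, s) := contDiff_const.prodMk contDiff_id
  have h := hd.comp hp.contDiffOn hm
  exact h.congr fun s _ => by simp only [Function.comp_apply, density]

theorem treeInterp_mem_coerciveSet {c : ℝ} (hC : Coercive c C) {T : Finset (Pair ι)}
    (hT : (pairGraph T).IsAcyclic) {w : T → ℝ} (hw : w ∈ openCube T) :
    treeInterp T w ∈ coerciveSet C c :=
  IsUltra.mem_coerciveSet hC (isUltra_treeInterp hT fun ℓ =>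
    Set.Ioo_subset_Icc_self (mem_openCube.1 hw ℓ))

/-- A term of the expansion of `treeIntegrand` by the Leibniz rule. -/
def leibnizTerm (C : Matrix (ι × Fin N) (ι × Fin N) ℂ) (R : ℝ≥0∞)
    (A' : (ι → Spin N) → (Pair ι → ℝ) → ℂ) (T F : Finset (Pair ι))
    (p : (ι → Spin N) × (T → ℝ)) : ℂ :=
  cutoff R p.1 * applyAll (T \ F) pairDeriv (A' p.1) (treeInterp T p.2) *
    applyAll F pairDeriv (fun s => gaussianDensity (interpCov C s) p.1) (treeInterp T p.2)

theorem treeIntegrand_eq_sum {c : ℝ} (hc : 0 < c) (hC : Coercive c C) (hA : IsRegular R A')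
    {T : Finset (Pair ι)} (hT : (pairGraph T).IsTree) (φ : ι → Spin N) {w : T → ℝ}
    (hw : w ∈ openCube T) :
    treeIntegrand C R A' T φ w = ∑ F ∈ T.powerset, leibnizTerm C R A' T F (φ, w) := by
  simp only [treeIntegrand, leibnizTerm]
  by_cases hφ : φ ∈ smallFields ι N R
  · have hs : treeInterp T w ∈ covSet C ∩ openCube (Pair ι) :=
      ⟨coerciveSet_subset hc (treeInterp_mem_coerciveSet hC hT.isAcyclic hw),
        treeInterp_mem_openCube hT hw⟩
    rw [applyAll_pairDeriv_mul ((isOpen_covSet C).inter (isOpen_openCube _))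
      ((contDiffOn_gaussianDensity C φ).mono Set.inter_subset_left)
      ((hA.smooth φ hφ).mono Set.inter_subset_right) T hs, Finset.mul_sum]
    exact Finset.sum_congr rfl fun F _ => by ring
  · simp [cutoff_eq_indicator, hφ]

/-- The rate is fixed before `F`, `s` and `θ`, so the admissible growth of the interaction can be
set to `a / 2` once and for all. -/
theorem exists_bound_density_deriv (hC' : C.IsSymm) {c : ℝ} (hc : 0 < c) :
    ∃ a > 0, (∀ F : Finset (Pair ι), ∃ K, 0 ≤ K ∧ ∀ s ∈ coerciveSet C c, ∀ φ : ι → Spin N,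
      ‖applyAll F pairDeriv (fun s => gaussianDensity (interpCov C s) φ) s‖ ≤
        K * Real.exp (-a * ∑ x, ‖φ x‖ ^ 2)) ∧
      ∀ s ∈ coerciveSet C c, ∀ θ ∈ gaussSlice C s, ∃ K, 0 ≤ K ∧ ∀ φ,
        ‖θ φ‖ ≤ K * Real.exp (-a * ∑ x, ‖φ x‖ ^ 2) := by
  obtain ⟨a, ha, h⟩ := norm_gaussClass_le (C := C) hc
  refine ⟨a, ha, fun F => ?_, fun s hs θ hθ => ?_⟩
  · obtain ⟨ψ, hψ, he⟩ := applyAll_pairPartial_mem hC' F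
    obtain ⟨K, hK, hb⟩ := h ψ hψ
    refine ⟨K, hK, fun s hs φ => ?_⟩
    rw [applyAll_pairDeriv_density F φ (coerciveSet_subset hc hs),
      he (mem_covDomain φ (coerciveSet_subset hc hs))]
    exact hb s hs φ
  · obtain ⟨ψ, hψ, rfl⟩ := hθ
    obtain ⟨K, hK, hb⟩ := h ψ hψ
    exact ⟨K, hK, fun φ => hb s hs φ⟩

theorem aestronglyMeasurable_of_continuousOn {α : Type*} [TopologicalSpace α] [MeasurableSpace α]
    [OpensMeasurableSpace α] [SecondCountableTopology α] {μ : Measure α} {S : Set α}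
    (hS : MeasurableSet S) {f : α → ℂ} (hf : ContinuousOn f S) (h0 : ∀ᵐ p ∂μ, p ∉ S → f p = 0) :
    AEStronglyMeasurable f μ := by
  have h1 : AEStronglyMeasurable (S.indicator f) μ :=
    (aestronglyMeasurable_indicator_iff hS).2 (hf.aestronglyMeasurable hS)
  refine h1.congr (h0.mono fun p hp => ?_)
  by_cases h : p ∈ S
  · rw [Set.indicator_of_mem h]
  · rw [Set.indicator_of_notMem h, hp h]

theorem ae_openCube {κ : Type*} [Fintype κ] : ∀ᵐ w ∂cubeMeasure κ, w ∈ openCube κ :=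
  (ae_mem_open_cube κ).mono fun _ hw => mem_openCube.2 hw

/-- Growth `a / 2` of the interaction against decay `a` of the density leaves an integrable
Gaussian, uniformly in the weights. The faces of the weight cube are null sets and need no bound. -/
theorem integrable_leibnizTerm (hC' : C.IsSymm) {c : ℝ} (hc : 0 < c) (hC : Coercive c C)
    (hA : IsRegular R A') {T : Finset (Pair ι)} (hT : (pairGraph T).IsTree) (F : Finset (Pair ι)) :
    Integrable (leibnizTerm C R A' T F) ((volume : Measure (ι → Spin N)).prod (cubeMeasure T)) := by
  obtain ⟨a, ha, hb, -⟩ := exists_bound_density_deriv hC' hc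
  obtain ⟨K, hK, hb⟩ := hb F
  obtain ⟨K', hK'⟩ := hA.bound (a / 2) (by positivity)
  have hae : ∀ᵐ p ∂((volume : Measure (ι → Spin N)).prod (cubeMeasure T)),
      p.2 ∈ openCube T := Measure.quasiMeasurePreserving_snd.ae ae_openCube
  have hi : Integrable (fun p : (ι → Spin N) × (T → ℝ) =>
      max K' 0 * K * Real.exp (-(a / 2) * ∑ x, ‖p.1 x‖ ^ 2))
      ((volume : Measure (ι → Spin N)).prod (cubeMeasure T)) :=
    ((integrable_exp_neg_sum_sq (by positivity)).comp_fst (cubeMeasure T)).const_mul _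
  refine hi.mono' ?_ (hae.mono fun p hp => ?_)
  · refine aestronglyMeasurable_of_continuousOn
      (S := smallFields ι N R ×ˢ openCube T)
      ((measurableSet_smallFields R).prod (isOpen_openCube _).measurableSet) ?_
      (hae.mono fun p hp hpS => ?_)
    · have hmaps : Set.MapsTo (fun p : (ι → Spin N) × (T → ℝ) => (p.1, treeInterp T p.2))
          (smallFields ι N R ×ˢ openCube T) (smallFields ι N R ×ˢ openCube (Pair ι)) :=
        fun p hp => ⟨hp.1, treeInterp_mem_openCube hT hp.2⟩
      have hmaps' : Set.MapsTo (fun p : (ι → Spin N) × (T → ℝ) => (p.1, treeInterp T p.2))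
          (smallFields ι N R ×ˢ openCube T) (covDomain C) :=
        fun p hp => mem_covDomain _ (coerciveSet_subset hc
          (treeInterp_mem_coerciveSet hC hT.isAcyclic hp.2))
      have hcont : Continuous fun p : (ι → Spin N) × (T → ℝ) => (p.1, treeInterp T p.2) :=
        continuous_fst.prodMk ((continuous_treeInterp T).comp continuous_snd)
      have h1 := (hA.cont (T \ F)).comp hcont.continuousOn hmaps
      have h2 := (ContDiffOn.foldr_dirWithin uniqueDiffOn_covDomain (contDiffOn_density C)
        (fun ℓ => ((0 : ι → Spin N), (Pi.single ℓ 1 : Pair ι → ℝ)))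
        F.toList).continuousOn.comp hcont.continuousOn hmaps'
      refine (h1.mul h2).congr fun p hp => ?_
      simp only [leibnizTerm, cutoff_eq_indicator, Set.indicator_of_mem hp.1, Pi.one_apply, one_mul]
      rw [applyAll_pairDeriv_density F p.1 (coerciveSet_subset hc
          (treeInterp_mem_coerciveSet hC hT.isAcyclic hp.2))]
      rfl
    · have : p.1 ∉ smallFields ι N R := fun h => hpS ⟨h, hp⟩
      simp [leibnizTerm, cutoff_eq_indicator, this]
  · by_cases hφ : p.1 ∈ smallFields ι N R
    · rw [leibnizTerm, norm_mul, norm_mul]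
      have h1 := hK' T hT (T \ F) Finset.sdiff_subset p.2 hp p.1 hφ
      have h2 := hb _ (treeInterp_mem_coerciveSet hC hT.isAcyclic hp) p.1
      calc _ ≤ 1 * (max K' 0 * Real.exp (a / 2 * ∑ x, ‖p.1 x‖ ^ 2)) *
            (K * Real.exp (-a * ∑ x, ‖p.1 x‖ ^ 2)) := by
            gcongr
            · exact norm_cutoff_le R p.1
            · exact h1.trans (by gcongr; exact le_max_left _ _)
        _ = _ := by
            rw [one_mul, mul_mul_mul_comm, ← Real.exp_add]
            congr 2
            ring
    · simp only [leibnizTerm, cutoff_eq_indicator, Set.indicator_of_notMem hφ, zero_mul, norm_zero]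
      positivity

/-- The bounds give integrability against all Gaussian test functions, so the weak derivatives may
be moved to the density. -/
theorem applyAll_covDeriv_eq_integral (hC' : C.IsSymm) {c : ℝ} (hc : 0 < c) (hC : Coercive c C)
    (hA : IsRegular R A') {T : Finset (Pair ι)} (hT : (pairGraph T).IsTree) (F : Finset (Pair ι))
    {w : T → ℝ} (hw : w ∈ openCube T) :
    applyAll F (covDeriv C) (toDistribution fun φ =>
        cutoff R φ * applyAll (T \ F) pairDeriv (A' φ) (treeInterp T w))
      (gaussianDensity (interpCov C (treeInterp T w))) =
    ∫ φ, leibnizTerm C R A' T F (φ, w) := by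
  obtain ⟨a, ha, -, hb⟩ := exists_bound_density_deriv hC' hc
  obtain ⟨K', hK'⟩ := hA.bound (a / 2) (by positivity)
  have hs := treeInterp_mem_coerciveSet hC hT.isAcyclic hw
  rw [applyAll_covDeriv_toDistribution hC' (coerciveSet_subset hc hs)]
  · rfl
  intro θ hθ
  obtain ⟨K, hK, hb⟩ := hb _ hs θ hθ
  have hi : Integrable fun φ : ι → Spin N =>
      max K' 0 * K * Real.exp (-(a / 2) * ∑ x, ‖φ x‖ ^ 2) :=
    (integrable_exp_neg_sum_sq (by positivity)).const_mul _
  refine hi.mono' ?_ (Filter.Eventually.of_forall fun φ => ?_)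
  · refine aestronglyMeasurable_of_continuousOn (S := smallFields ι N R)
      (measurableSet_smallFields R) ?_ (Filter.Eventually.of_forall fun φ hφ => ?_)
    · have hcont : Continuous fun φ : ι → Spin N => (φ, treeInterp T w) := by fun_prop
      have h1 := (hA.cont (T \ F)).comp hcont.continuousOn
        (fun φ (hφ : φ ∈ smallFields ι N R) => ⟨hφ, treeInterp_mem_openCube hT hw⟩)
      refine (h1.mul (gaussSlice_continuous hθ).continuousOn).congr fun φ hφ => ?_
      simp [cutoff_eq_indicator, Set.indicator_of_mem hφ]
    · simp [cutoff_eq_indicator, hφ]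
  · by_cases hφ : φ ∈ smallFields ι N R
    · rw [norm_mul, norm_mul]
      have h1 := hK' T hT (T \ F) Finset.sdiff_subset w hw φ hφ
      calc _ ≤ 1 * (max K' 0 * Real.exp (a / 2 * ∑ x, ‖φ x‖ ^ 2)) *
            (K * Real.exp (-a * ∑ x, ‖φ x‖ ^ 2)) := by
            gcongr
            · exact norm_cutoff_le R φ
            · exact h1.trans (by gcongr; exact le_max_left _ _)
            · exact hb φ
        _ = _ := by
            rw [one_mul, mul_mul_mul_comm, ← Real.exp_add]
            congr 2
            ring
    · simp only [cutoff_eq_indicator, Set.indicator_of_notMem hφ, zero_mul, norm_zero]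
      positivity

theorem integrable_treeIntegrand (hC' : C.IsSymm) {c : ℝ} (hc : 0 < c) (hC : Coercive c C)
    (hA : IsRegular R A') {T : Finset (Pair ι)} (hT : (pairGraph T).IsTree) :
    Integrable (fun p : (ι → Spin N) × (T → ℝ) => treeIntegrand C R A' T p.1 p.2)
      ((volume : Measure (ι → Spin N)).prod (cubeMeasure T)) := by
  have hae : ∀ᵐ p ∂((volume : Measure (ι → Spin N)).prod (cubeMeasure T)),
      p.2 ∈ openCube T := Measure.quasiMeasurePreserving_snd.ae ae_openCube
  refine (integrable_finsetSum T.powerset fun F _ =>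
    integrable_leibnizTerm hC' hc hC hA hT F).congr (hae.mono fun p hp => ?_)
  exact (treeIntegrand_eq_sum hc hC hA hT p.1 hp).symm

-- The sum over `F_C ⊔ F_V = T` is the Leibniz rule read backwards. Fubini moves the weight integral
-- inside the field integral, the order in which the forest formula produces them.
open scoped Classical in
theorem treeActivity_eq (hC' : C.IsSymm) {c : ℝ} (hc : 0 < c) (hC : Coercive c C)
    (hA : IsRegular R A') : treeActivity C R A' =
      ∑ T : Finset (Pair ι) with (pairGraph T).IsTree,
        ∫ φ, ∫ w, treeIntegrand C R A' T φ w ∂cubeMeasure T := by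
  rw [treeActivity]
  refine Finset.sum_congr rfl fun T hT => ?_
  replace hT : (pairGraph T).IsTree := (Finset.mem_filter.1 hT).2
  have hae : ∀ᵐ p ∂((volume : Measure (ι → Spin N)).prod (cubeMeasure T)),
      p.2 ∈ openCube T := Measure.quasiMeasurePreserving_snd.ae ae_openCube
  have hi := fun F => integrable_leibnizTerm hC' hc hC hA hT F
  rw [← integral_prod _ (integrable_treeIntegrand hC' hc hC hA hT),
    integral_congr_ae (hae.mono fun p hp => treeIntegrand_eq_sum hc hC hA hT p.1 hp),
    integral_finsetSum _ fun F _ => hi F]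
  refine Finset.sum_congr rfl fun F _ => ?_
  rw [integral_prod_symm _ (hi F), ← cubeMeasure_eq]
  exact integral_congr_ae (ae_openCube.mono fun w hw =>
    applyAll_covDeriv_eq_integral hC' hc hC hA hT F hw)

end Local

end ClusterExpansion

end

/-! ### Restriction of forests and parameters to the parts of a partition -/

noncomputable section

open scoped ENNReal ContDiff

namespace ClusterExpansion

/-! ### Graphs restricted to a union of components -/

section Restrict

variable {L : Type*}

theorem reachable_comap_of_closed {G : SimpleGraph L} {X : Finset L}
    (hX : ∀ x y, G.Adj x y → x ∈ X → y ∈ X) {x y : L} (hxy : G.Reachable x y) (hx : x ∈ X) :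
    ∃ hy : y ∈ X, (G.comap (Subtype.val : X → L)).Reachable ⟨x, hx⟩ ⟨y, hy⟩ := by
  obtain ⟨p⟩ := hxy
  induction p with
  | nil => exact ⟨hx, .refl _⟩
  | @cons u v w huv p ih =>
    have hv := hX _ _ huv hx
    obtain ⟨hw, hr⟩ := ih hv
    have hadj : (G.comap (Subtype.val : X → L)).Adj ⟨u, hx⟩ ⟨v, hv⟩ := huv
    exact ⟨hw, hadj.reachable.trans hr⟩

theorem reachable_comap_iff {G : SimpleGraph L} {X : Finset L}
    (hX : ∀ x y, G.Adj x y → x ∈ X → y ∈ X) (x y : X) :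
    (G.comap (Subtype.val : X → L)).Reachable x y ↔ G.Reachable x y := by
  constructor
  · exact fun h => h.map ⟨Subtype.val, fun h => h⟩
  · exact fun h => (reachable_comap_of_closed hX h x.2).2

/-- A pair of elements of `X`, regarded as a pair of elements of `L`. -/
def pairEmb (X : Finset L) : Pair X ↪ Pair L where
  toFun e := ⟨e.1.map Subtype.val, fun h => e.2 ((Sym2.isDiag_map Subtype.val_injective).1 h)⟩
  inj' _ _ h := Subtype.ext (Sym2.map.injective Subtype.val_injective (Subtype.ext_iff.1 h))

theorem restrictPairs_eq (X : Finset L) (s : Pair L → ℝ) :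
    restrictPairs X s = fun e => s (pairEmb X e) := rfl

theorem pairEmb_eq_iff {X : Finset L} {e : Pair X} {x y : X} :
    (pairEmb X e).1 = s((x : L), (y : L)) ↔ e.1 = s(x, y) := by
  constructor
  · exact fun h => Sym2.map.injective Subtype.val_injective h
  · intro h
    change e.1.map Subtype.val = _
    rw [h]
    rfl

theorem exists_pairEmb_eq {X : Finset L} {e : Pair L} {x y : X} (h : e.1 = s((x : L), (y : L))) :
    ∃ e' : Pair X, pairEmb X e' = e ∧ e'.1 = s(x, y) := by
  have hne : ¬ (s(x, y) : Sym2 X).IsDiag := fun hd =>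
    e.2 (h ▸ Sym2.mk_isDiag_iff.2 (congrArg Subtype.val (Sym2.mk_isDiag_iff.1 hd)))
  exact ⟨⟨s(x, y), hne⟩, Subtype.ext h.symm, rfl⟩

theorem pair_exists_rep {ι : Type*} (e : Pair ι) : ∃ x y, s(x, y) = e.1 := by
  obtain ⟨⟨x, y⟩, h⟩ := Quot.exists_rep e.1
  exact ⟨x, y, h⟩

open scoped Classical in
/-- The edges of `F` with both ends in `X`. -/
def restrictEdges (X : Finset L) (F : Finset (Pair L)) : Finset (Pair X) :=
  F.preimage (pairEmb X) (pairEmb X).injective.injOn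

theorem mem_restrictEdges {X : Finset L} {F : Finset (Pair L)} {e : Pair X} :
    e ∈ restrictEdges X F ↔ pairEmb X e ∈ F := by
  simp [restrictEdges]

theorem comap_pairGraph (X : Finset L) (F : Finset (Pair L)) :
    (pairGraph F).comap (Subtype.val : X → L) = pairGraph (restrictEdges X F) := by
  ext x y
  rw [SimpleGraph.comap_adj, pairGraph_adj, pairGraph_adj]
  constructor
  · rintro ⟨ℓ, hℓ, h⟩
    obtain ⟨e, rfl, he⟩ := exists_pairEmb_eq h
    exact ⟨e, mem_restrictEdges.2 hℓ, he⟩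
  · rintro ⟨e, he, h⟩
    exact ⟨_, mem_restrictEdges.1 he, pairEmb_eq_iff.2 h⟩

theorem comap_thresholdGraph (X : Finset L) (F : Finset (Pair L)) (θ : Pair L → ℝ) (t : ℝ) :
    (thresholdGraph F (fun ℓ => θ ℓ) t).comap (Subtype.val : X → L) =
      thresholdGraph (restrictEdges X F) (fun ℓ => θ (pairEmb X ℓ)) t := by
  ext x y
  rw [SimpleGraph.comap_adj, thresholdGraph_adj, thresholdGraph_adj]
  constructor
  · rintro ⟨⟨ℓ, hℓ⟩, h, ht⟩
    obtain ⟨e, rfl, he⟩ := exists_pairEmb_eq h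
    exact ⟨⟨e, mem_restrictEdges.2 hℓ⟩, he, ht⟩
  · rintro ⟨⟨e, he⟩, h, ht⟩
    exact ⟨⟨_, mem_restrictEdges.1 he⟩, pairEmb_eq_iff.2 h, ht⟩

theorem isAcyclic_restrictEdges {F : Finset (Pair L)} (hF : (pairGraph F).IsAcyclic)
    (X : Finset L) : (pairGraph (restrictEdges X F)).IsAcyclic := by
  rw [← comap_pairGraph]
  exact hF.comap ⟨Subtype.val, fun h => h⟩ Subtype.val_injective

/-- Both sides have the same level sets: no edge of `F` leaves `X`, so reachability between points
of `X` is decided inside `X`. -/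
theorem restrictPairs_treeInterp {F : Finset (Pair L)} (hF : (pairGraph F).IsAcyclic)
    {θ : Pair L → ℝ} (hθ : ∀ ℓ, 0 ≤ θ ℓ) {X : Finset L}
    (hX : ∀ x y, (pairGraph F).Adj x y → x ∈ X → y ∈ X) :
    restrictPairs X (treeInterp F fun ℓ => θ ℓ) =
      treeInterp (restrictEdges X F) fun ℓ => θ (pairEmb X ℓ) := by
  funext e
  change treeInterp F (fun ℓ => θ ℓ) (pairEmb X e) = _
  refine eq_of_forall_pos_le_iff (treeInterp_nonneg F (fun ℓ => θ ℓ) (fun ℓ => hθ ℓ) _)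
    (treeInterp_nonneg (restrictEdges X F) (fun ℓ => θ (pairEmb X ℓ)) (fun ℓ => hθ _) _)
    fun t ht => ?_
  obtain ⟨x, y, h⟩ := pair_exists_rep e
  rw [le_treeInterp_iff hF _ ht (pairEmb_eq_iff.2 h.symm).symm,
    le_treeInterp_iff (isAcyclic_restrictEdges hF X) _ ht h, ← comap_thresholdGraph,
    reachable_comap_iff fun x y hxy => hX x y (thresholdGraph_le _ _ _ hxy)]

theorem treeInterp_eq_zero {F : Finset (Pair L)} (hF : (pairGraph F).IsAcyclic) {w : F → ℝ}
    (hw : ∀ ℓ, 0 ≤ w ℓ) {e : Pair L} {x y : L} (h : s(x, y) = e.1)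
    (hxy : ¬ (pairGraph F).Reachable x y) : treeInterp F w e = 0 := by
  by_contra hne
  have hpos := lt_of_le_of_ne (treeInterp_nonneg F w hw e) (Ne.symm hne)
  exact hxy (((le_treeInterp_iff hF w hpos h).1 le_rfl).mono (thresholdGraph_le _ _ _))

/-- Acyclicity means that every edge is a bridge. A detour around an edge cannot leave a closed set
that contains it, so the condition can be tested on such sets. -/
theorem isAcyclic_of_comap {G : SimpleGraph L}
    (h : ∀ x, ∃ X : Finset L, x ∈ X ∧ (∀ x y, G.Adj x y → x ∈ X → y ∈ X) ∧
      (G.comap (Subtype.val : X → L)).IsAcyclic) : G.IsAcyclic := by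
  rw [SimpleGraph.isAcyclic_iff_forall_adj_isBridge]
  intro v w hvw
  obtain ⟨X, hv, hX, hac⟩ := h v
  have hw := hX v w hvw hv
  rw [SimpleGraph.isBridge_iff]
  intro hr
  rw [SimpleGraph.isAcyclic_iff_forall_adj_isBridge] at hac
  have hb := @hac ⟨v, hv⟩ ⟨w, hw⟩ hvw
  rw [SimpleGraph.isBridge_iff] at hb
  refine hb ?_
  obtain ⟨_, hr'⟩ := reachable_comap_of_closed
    (fun x y hxy => hX x y (SimpleGraph.deleteEdges_le _ hxy)) hr hv
  refine hr'.mono fun x y hxy => ?_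
  rw [SimpleGraph.comap_adj, SimpleGraph.deleteEdges_adj] at hxy
  rw [SimpleGraph.deleteEdges_adj, SimpleGraph.comap_adj]
  refine ⟨hxy.1, fun hmem => hxy.2 ?_⟩
  rw [Set.mem_singleton_iff] at hmem ⊢
  exact congrArg (Sym2.map Subtype.val) hmem

end Restrict

/-! ### Forests as families of trees on the parts of a partition -/

section Forests

variable {L : Type*} [Fintype L] [DecidableEq L]

open scoped Classical in
/-- The partition of `L` into the trees of a forest. -/
def forestPartition (F : Finset (Pair L)) : Finpartition (Finset.univ : Finset L) :=
  Finpartition.ofSetoid (pairGraph F).reachableSetoid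

theorem mem_part_forestPartition {F : Finset (Pair L)} {x y : L} :
    y ∈ (forestPartition F).part x ↔ (pairGraph F).Reachable x y := by
  classical
  exact Finpartition.mem_part_ofSetoid_iff_rel

theorem finpartition_ext_part {P Q : Finpartition (Finset.univ : Finset L)}
    (h : ∀ x y, y ∈ P.part x ↔ y ∈ Q.part x) : P = Q := by
  have h' : ∀ x, P.part x = Q.part x := fun x => Finset.ext (h x)
  ext X
  constructor
  · intro hX
    obtain ⟨x, hx⟩ := P.nonempty_of_mem_parts hX
    rw [← P.part_eq_of_mem hX hx, h']
    exact Q.part_mem.2 (Finset.mem_univ x)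
  · intro hX
    obtain ⟨x, hx⟩ := Q.nonempty_of_mem_parts hX
    rw [← Q.part_eq_of_mem hX hx, ← h']
    exact P.part_mem.2 (Finset.mem_univ x)

variable (P : Finpartition (Finset.univ : Finset L))

theorem mem_part_iff {X : Finset L} (hX : X ∈ P.parts) {x : L} : x ∈ X ↔ P.part x = X :=
  ⟨fun h => P.part_eq_of_mem hX h, fun h => h ▸ P.mem_part (Finset.mem_univ x)⟩

/-- The pairs of elements of the same part. -/
def partPairEmb : (Σ X : P.parts, Pair X.1) ↪ Pair L where
  toFun e := pairEmb e.1.1 e.2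
  inj' := by
    rintro ⟨X, e⟩ ⟨Y, e'⟩ h
    simp only at h
    obtain ⟨x, y, hxy⟩ := pair_exists_rep e
    obtain ⟨x', y', hxy'⟩ := pair_exists_rep e'
    have h1 : (s((x : L), (y : L)) : Sym2 L) = s((x' : L), (y' : L)) := by
      rw [← pairEmb_eq_iff.2 hxy.symm, h, pairEmb_eq_iff.2 hxy'.symm]
    have hXY : X = Y := by
      refine Subtype.ext ?_
      have hx : (x : L) ∈ Y.1 := by
        rcases Sym2.eq_iff.1 h1 with ⟨h, -⟩ | ⟨h, -⟩
        · exact h ▸ x'.2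
        · exact h ▸ y'.2
      rw [← (mem_part_iff P X.2).1 x.2, (mem_part_iff P Y.2).1 hx]
    subst hXY
    rw [(pairEmb X.1).injective h]

/-- The union of a family of sets of edges in the parts of a partition. -/
def joinEdges (T : ∀ X : P.parts, Finset (Pair X.1)) : Finset (Pair L) :=
  (Finset.univ.sigma T).map (partPairEmb P)

variable {P}

theorem mem_joinEdges {T : ∀ X : P.parts, Finset (Pair X.1)} {ℓ : Pair L} :
    ℓ ∈ joinEdges P T ↔ ∃ X, ∃ e ∈ T X, pairEmb X.1 e = ℓ := by
  rw [joinEdges, Finset.mem_map]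
  constructor
  · rintro ⟨⟨X, e⟩, h, rfl⟩
    exact ⟨X, e, (Finset.mem_sigma.1 h).2, rfl⟩
  · rintro ⟨X, e, h, rfl⟩
    exact ⟨⟨X, e⟩, Finset.mem_sigma.2 ⟨Finset.mem_univ _, h⟩, rfl⟩

theorem part_eq_of_pairEmb {X : P.parts} {e : Pair X.1} {x y : L}
    (h : (pairEmb X.1 e).1 = s(x, y)) : P.part x = X.1 ∧ P.part y = X.1 := by
  obtain ⟨x', y', hxy⟩ := pair_exists_rep e
  rw [pairEmb_eq_iff.2 hxy.symm] at h
  have hx := (mem_part_iff P X.2).1 x'.2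
  have hy := (mem_part_iff P X.2).1 y'.2
  rcases Sym2.eq_iff.1 h with ⟨h1, h2⟩ | ⟨h1, h2⟩
  · exact ⟨h1 ▸ hx, h2 ▸ hy⟩
  · exact ⟨h2 ▸ hy, h1 ▸ hx⟩

theorem part_eq_of_adj_joinEdges {T : ∀ X : P.parts, Finset (Pair X.1)} {x y : L}
    (h : (pairGraph (joinEdges P T)).Adj x y) : P.part x = P.part y := by
  obtain ⟨ℓ, hℓ, h⟩ := (pairGraph_adj _ _ _).1 h
  obtain ⟨X, e, -, rfl⟩ := mem_joinEdges.1 hℓ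
  exact (part_eq_of_pairEmb h).1.trans (part_eq_of_pairEmb h).2.symm

theorem joinEdges_closed {T : ∀ X : P.parts, Finset (Pair X.1)} {X : Finset L} (hX : X ∈ P.parts)
    (x y : L) (h : (pairGraph (joinEdges P T)).Adj x y) (hx : x ∈ X) : y ∈ X := by
  rw [mem_part_iff P hX] at hx ⊢
  exact (part_eq_of_adj_joinEdges h).symm.trans hx

theorem restrictEdges_joinEdges (T : ∀ X : P.parts, Finset (Pair X.1)) (X : P.parts) :
    restrictEdges X.1 (joinEdges P T) = T X := by
  ext e
  rw [mem_restrictEdges, mem_joinEdges]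
  constructor
  · rintro ⟨Y, e', he', h⟩
    have h1 : (⟨Y, e'⟩ : Σ X : P.parts, Pair X.1) = ⟨X, e⟩ := (partPairEmb P).injective h
    cases h1
    exact he'
  · exact fun h => ⟨X, e, h, rfl⟩

theorem reachable_joinEdges {T : ∀ X : P.parts, Finset (Pair X.1)}
    (hT : ∀ X, (pairGraph (T X)).IsTree) {x y : L} :
    (pairGraph (joinEdges P T)).Reachable x y ↔ y ∈ P.part x := by
  have hX : P.part x ∈ P.parts := P.part_mem.2 (Finset.mem_univ x)
  have hx : x ∈ P.part x := P.mem_part (Finset.mem_univ x)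
  constructor
  · exact fun h => (reachable_comap_of_closed (joinEdges_closed hX) h hx).1
  · intro hy
    have h := (reachable_comap_iff (joinEdges_closed (T := T) hX) ⟨x, hx⟩ ⟨y, hy⟩).1
    rw [comap_pairGraph, restrictEdges_joinEdges T ⟨_, hX⟩] at h
    exact h ((hT ⟨_, hX⟩).connected.preconnected _ _)

theorem isAcyclic_joinEdges {T : ∀ X : P.parts, Finset (Pair X.1)}
    (hT : ∀ X, (pairGraph (T X)).IsAcyclic) : (pairGraph (joinEdges P T)).IsAcyclic := by
  refine isAcyclic_of_comap fun x => ?_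
  have hX : P.part x ∈ P.parts := P.part_mem.2 (Finset.mem_univ x)
  refine ⟨P.part x, P.mem_part (Finset.mem_univ x), joinEdges_closed hX, ?_⟩
  rw [comap_pairGraph, restrictEdges_joinEdges T ⟨_, hX⟩]
  exact hT _

theorem forestPartition_joinEdges {T : ∀ X : P.parts, Finset (Pair X.1)}
    (hT : ∀ X, (pairGraph (T X)).IsTree) : forestPartition (joinEdges P T) = P :=
  finpartition_ext_part fun x y => by rw [mem_part_forestPartition, reachable_joinEdges hT]

theorem forestPartition_closed {F : Finset (Pair L)} {X : Finset L}
    (hX : X ∈ (forestPartition F).parts) (x y : L) (h : (pairGraph F).Adj x y) (hx : x ∈ X) :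
    y ∈ X := by
  rw [← (mem_part_iff _ hX).1 hx]
  exact mem_part_forestPartition.2 h.reachable

theorem isTree_restrictEdges {F : Finset (Pair L)} (hF : (pairGraph F).IsAcyclic) {X : Finset L}
    (hX : X ∈ (forestPartition F).parts) : (pairGraph (restrictEdges X F)).IsTree := by
  have hne : Nonempty X := (Finpartition.nonempty_of_mem_parts _ hX).coe_sort
  refine ⟨⟨fun x y => ?_⟩, isAcyclic_restrictEdges hF X⟩
  rw [← comap_pairGraph, reachable_comap_iff (forestPartition_closed hX)]
  refine mem_part_forestPartition.1 ?_
  rw [(mem_part_iff _ hX).1 x.2]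
  exact y.2

/-- Both ends of an edge lie in the same component, so restriction to the components loses no edge.
-/
theorem joinEdges_restrictEdges (F : Finset (Pair L)) :
    joinEdges (forestPartition F) (fun X => restrictEdges X.1 F) = F := by
  ext ℓ
  rw [mem_joinEdges]
  constructor
  · rintro ⟨X, e, he, rfl⟩
    exact mem_restrictEdges.1 he
  · intro hℓ
    obtain ⟨x, y, h⟩ := pair_exists_rep ℓ
    have hX : (forestPartition F).part x ∈ (forestPartition F).parts :=
      Finpartition.part_mem _ |>.2 (Finset.mem_univ x)
    have hx : x ∈ (forestPartition F).part x := Finpartition.mem_part _ (Finset.mem_univ x)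
    have hy : y ∈ (forestPartition F).part x :=
      mem_part_forestPartition.2 ((pairGraph_adj _ _ _).2 ⟨ℓ, hℓ, h.symm⟩).reachable
    obtain ⟨e, rfl, -⟩ := exists_pairEmb_eq (X := (forestPartition F).part x) (x := ⟨x, hx⟩)
      (y := ⟨y, hy⟩) h.symm
    exact ⟨⟨_, hX⟩, e, mem_restrictEdges.2 hℓ, rfl⟩

open scoped Classical in
/-- A forest on `L` consists of a partition of `L` and of trees on its parts. -/
theorem sum_forests {M : Type*} [AddCommMonoid M] (f : Finset (Pair L) → M) :
    ∑ F : Finset (Pair L) with (pairGraph F).IsAcyclic, f F =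
      ∑ P : Finpartition (Finset.univ : Finset L),
        ∑ T ∈ Fintype.piFinset fun X : P.parts =>
          (Finset.univ.filter fun T : Finset (Pair X.1) => (pairGraph T).IsTree),
          f (joinEdges P T) := by
  rw [← Finset.sum_fiberwise (Finset.univ.filter fun F : Finset (Pair L) =>
    (pairGraph F).IsAcyclic) forestPartition f]
  refine Finset.sum_congr rfl fun P _ => ?_
  refine Finset.sum_nbij' (fun F X => restrictEdges X.1 F) (joinEdges P) ?_ ?_ ?_ ?_ ?_
  · intro F hF
    simp only [Finset.mem_filter, Finset.mem_univ, true_and] at hF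
    obtain ⟨hF, rfl⟩ := hF
    simp only [Fintype.mem_piFinset, Finset.mem_filter, Finset.mem_univ, true_and]
    exact fun X => isTree_restrictEdges hF X.2
  · intro T hT
    simp only [Fintype.mem_piFinset, Finset.mem_filter, Finset.mem_univ, true_and] at hT ⊢
    exact ⟨isAcyclic_joinEdges fun X => (hT X).isAcyclic, forestPartition_joinEdges hT⟩
  · intro F hF
    simp only [Finset.mem_filter, Finset.mem_univ, true_and] at hF
    obtain ⟨hF, rfl⟩ := hF
    exact joinEdges_restrictEdges F
  · exact fun T _ => funext fun X => restrictEdges_joinEdges T X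
  · intro F hF
    simp only [Finset.mem_filter, Finset.mem_univ, true_and] at hF
    obtain ⟨hF, rfl⟩ := hF
    rw [joinEdges_restrictEdges]

end Forests

end ClusterExpansion

end

/-! ### Regularity of the local factors, inherited from the whole interaction -/

noncomputable section

open scoped ENNReal ContDiff

namespace ClusterExpansion

/-! ### The domain of the interaction -/

section Domain

variable {ι : Type*} [Fintype ι] {N : ℕ}

theorem convex_smallFields (R : ℝ≥0∞) : Convex ℝ (smallFields ι N R) := by
  intro φ hφ ψ hψ a b ha hb hab x
  have h : ‖(a • φ + b • ψ) x‖ ≤ max ‖φ x‖ ‖ψ x‖ := by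
    calc ‖(a • φ + b • ψ) x‖ ≤ ‖a • φ x‖ + ‖b • ψ x‖ := norm_add_le _ _
      _ = a * ‖φ x‖ + b * ‖ψ x‖ := by
        rw [norm_smul, norm_smul, Real.norm_of_nonneg ha, Real.norm_of_nonneg hb]
      _ ≤ a * max ‖φ x‖ ‖ψ x‖ + b * max ‖φ x‖ ‖ψ x‖ := by
        gcongr
        · exact le_max_left _ _
        · exact le_max_right _ _
      _ = max ‖φ x‖ ‖ψ x‖ := by rw [← add_mul, hab, one_mul]
  rcases le_max_iff.1 h with h | h
  · exact (ENNReal.ofReal_le_ofReal h).trans (hφ x)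
  · exact (ENNReal.ofReal_le_ofReal h).trans (hψ x)

theorem interior_smallFields_nonempty {R : ℝ≥0∞} (hR : 0 < R) :
    (interior (smallFields ι N R)).Nonempty := by
  refine ⟨0, mem_interior.2 ⟨{φ | ∀ x, ENNReal.ofReal ‖φ x‖ < R}, fun φ h x => (h x).le, ?_, ?_⟩⟩
  · simp only [Set.ofPred_forall]
    exact isOpen_iInter_of_finite fun x => isOpen_lt
      (ENNReal.continuous_ofReal.comp (continuous_apply x).norm) continuous_const
  · intro x
    simpa using hR

theorem isCompact_smallFields {R : ℝ≥0∞} (hR : R ≠ ⊤) : IsCompact (smallFields ι N R) := by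
  have h : smallFields ι N R = Set.pi Set.univ fun _ => Metric.closedBall 0 R.toReal := by
    ext φ
    simp only [smallFields, Set.mem_ofPred_eq, ENNReal.ofReal_le_iff_le_toReal hR, Set.mem_pi,
      mem_closedBall_zero_iff, Set.mem_univ, true_imp_iff]
  rw [h]
  exact isCompact_univ_pi fun _ => isCompact_closedBall _ _

/-- The domain of the interaction. -/
def smallDomain (ι : Type*) (N : ℕ) (R : ℝ≥0∞) : Set ((ι → Spin N) × (Pair ι → ℝ)) :=
  smallFields ι N R ×ˢ Set.Icc 0 1

theorem convex_smallDomain (R : ℝ≥0∞) : Convex ℝ (smallDomain ι N R) :=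
  (convex_smallFields R).prod (convex_Icc 0 1)

theorem openCube_subset_interior (κ : Type*) [Finite κ] :
    openCube κ ⊆ interior (Set.Icc (0 : κ → ℝ) 1) :=
  interior_maximal (openCube_subset κ) (isOpen_openCube κ)

theorem openCube_nonempty (κ : Type*) : (openCube κ).Nonempty :=
  ⟨fun _ => 1 / 2, mem_openCube.2 fun _ => by norm_num⟩

theorem interior_smallDomain_nonempty {R : ℝ≥0∞} (hR : 0 < R) :
    (interior (smallDomain ι N R)).Nonempty := by
  rw [smallDomain, interior_prod_eq]
  exact (interior_smallFields_nonempty hR).prod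
    ((openCube_nonempty _).mono (openCube_subset_interior _))

/-- The domain is convex, and `R > 0` makes the zero field an interior point of the set of small
fields. -/
theorem uniqueDiffOn_smallDomain {R : ℝ≥0∞} (hR : 0 < R) :
    UniqueDiffOn ℝ (smallDomain ι N R) :=
  uniqueDiffOn_convex (convex_smallDomain R) (interior_smallDomain_nonempty hR)

theorem smallDomain_subset {R : ℝ≥0∞} (hR : 0 < R) :
    smallDomain ι N R ⊆ closure (interior (smallDomain ι N R)) := by
  rw [(convex_smallDomain R).closure_interior_eq_closure_of_nonempty_interior
    (interior_smallDomain_nonempty hR)]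
  exact subset_closure

end Domain

/-! ### Extension by zero -/

section Extend

variable {L : Type*} [DecidableEq L] {N : ℕ} (X : Finset L)

/-- The extension of a field by zero. -/
def extField (φ : X → Spin N) : L → Spin N := fun x => if h : x ∈ X then φ ⟨x, h⟩ else 0

/-- The extension of interpolation parameters by zero. -/
def extPairs (s : Pair X → ℝ) : Pair L → ℝ := Function.extend (pairEmb X) s 0

variable {X}

theorem restrictField_extField (φ : X → Spin N) : restrictField X (extField X φ) = φ := by
  funext x
  simp [restrictField, extField]

theorem extPairs_pairEmb (s : Pair X → ℝ) (e : Pair X) : extPairs X s (pairEmb X e) = s e :=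
  (pairEmb X).injective.extend_apply _ _ _

theorem restrictPairs_extPairs (s : Pair X → ℝ) : restrictPairs X (extPairs X s) = s :=
  funext fun e => extPairs_pairEmb s e

theorem extPairs_eq_zero (s : Pair X → ℝ) {e : Pair L} (h : ∀ e', pairEmb X e' ≠ e) :
    extPairs X s e = 0 := by
  rw [extPairs, Function.extend_apply']
  · rfl
  · rintro ⟨e', he⟩
    exact h e' he

theorem extPairs_eq_zero_of_notMem (s : Pair X → ℝ) {e : Pair L} {x y : L} (h : s(x, y) = e.1)
    (hxy : ¬ (x ∈ X ∧ y ∈ X)) : extPairs X s e = 0 := by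
  refine extPairs_eq_zero s fun e' he' => hxy ?_
  obtain ⟨x', y', h'⟩ := pair_exists_rep e'
  rw [← he', pairEmb_eq_iff.2 h'.symm] at h
  rcases Sym2.eq_iff.1 h with ⟨rfl, rfl⟩ | ⟨rfl, rfl⟩
  · exact ⟨x'.2, y'.2⟩
  · exact ⟨y'.2, x'.2⟩

theorem extPairs_add_smul (s : Pair X → ℝ) (t : ℝ) (ℓ : Pair X) :
    extPairs X (s + t • (Pi.single ℓ 1 : Pair X → ℝ)) =
      extPairs X s + t • (Pi.single (pairEmb X ℓ) 1 : Pair L → ℝ) := by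
  funext e
  by_cases h : ∃ e', pairEmb X e' = e
  · obtain ⟨e', rfl⟩ := h
    simp [extPairs_pairEmb, Pi.single_apply]
  · rw [not_exists] at h
    have h' : e ≠ pairEmb X ℓ := fun h' => h ℓ h'.symm
    simp [extPairs_eq_zero _ h, h']

theorem continuous_extField : Continuous (extField X : (X → Spin N) → L → Spin N) := by
  refine continuous_pi fun x => ?_
  unfold extField
  split_ifs with h
  · exact continuous_apply _
  · exact continuous_const

theorem continuous_extPairs : Continuous (extPairs X) := by
  refine continuous_pi fun e => ?_
  by_cases h : ∃ e', pairEmb X e' = e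
  · obtain ⟨e', rfl⟩ := h
    simp only [extPairs_pairEmb]
    exact continuous_apply _
  · rw [not_exists] at h
    simp only [extPairs_eq_zero _ h]
    exact continuous_const

theorem extField_mem {R : ℝ≥0∞} {φ : X → Spin N} (hφ : φ ∈ smallFields X N R) :
    extField X φ ∈ smallFields L N R := by
  intro x
  unfold extField
  split_ifs with h
  · exact hφ _
  · simp

theorem extPairs_mem {s : Pair X → ℝ} (hs : s ∈ Set.Icc (0 : Pair X → ℝ) 1) :
    extPairs X s ∈ Set.Icc (0 : Pair L → ℝ) 1 := by
  have h : ∀ e, extPairs X s e ∈ Set.Icc (0 : ℝ) 1 := by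
    intro e
    by_cases h : ∃ e', pairEmb X e' = e
    · obtain ⟨e', rfl⟩ := h
      rw [extPairs_pairEmb]
      exact ⟨hs.1 e', hs.2 e'⟩
    · rw [not_exists] at h
      simp [extPairs_eq_zero _ h]
  exact ⟨fun e => (h e).1, fun e => (h e).2⟩

theorem sum_norm_sq_extField [Fintype L] (φ : X → Spin N) :
    ∑ x, ‖extField X φ x‖ ^ 2 = ∑ x, ‖φ x‖ ^ 2 := by
  rw [← Finset.sum_subset (Finset.subset_univ X), ← Finset.sum_coe_sort X]
  · exact Finset.sum_congr rfl fun x _ => by simp [extField]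
  · intro x _ hx
    simp [extField, hx]

theorem restrictEdges_map (T : Finset (Pair X)) : restrictEdges X (T.map (pairEmb X)) = T := by
  ext e
  simp [mem_restrictEdges]

theorem adj_map_pairEmb {T : Finset (Pair X)} {x y : L}
    (h : (pairGraph (T.map (pairEmb X))).Adj x y) : x ∈ X ∧ y ∈ X := by
  obtain ⟨ℓ, hℓ, h⟩ := (pairGraph_adj _ _ _).1 h
  obtain ⟨e, -, rfl⟩ := Finset.mem_map.1 hℓ
  obtain ⟨x', y', h'⟩ := pair_exists_rep e
  rw [pairEmb_eq_iff.2 h'.symm] at h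
  rcases Sym2.eq_iff.1 h with ⟨rfl, rfl⟩ | ⟨rfl, rfl⟩
  · exact ⟨x'.2, y'.2⟩
  · exact ⟨y'.2, x'.2⟩

theorem isAcyclic_map_pairEmb {T : Finset (Pair X)} (hT : (pairGraph T).IsAcyclic) :
    (pairGraph (T.map (pairEmb X))).IsAcyclic := by
  refine isAcyclic_of_comap fun x => ?_
  by_cases hx : x ∈ X
  · refine ⟨X, hx, fun x y h _ => (adj_map_pairEmb h).2, ?_⟩
    rwa [comap_pairGraph, restrictEdges_map]
  · refine ⟨{x}, Finset.mem_singleton_self x, fun u v h hu => ?_, ?_⟩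
    · rw [Finset.mem_singleton] at hu
      exact absurd (hu ▸ (adj_map_pairEmb h).1) hx
    · have : Subsingleton ({x} : Finset L) := by
        refine ⟨fun a b => Subtype.ext ?_⟩
        rw [Finset.mem_singleton.1 a.2, Finset.mem_singleton.1 b.2]
      have hbot : (pairGraph (T.map (pairEmb X))).comap
          (Subtype.val : ({x} : Finset L) → L) = ⊥ := by
        ext a b
        rw [Subsingleton.elim a b]
        simp
      rw [hbot]
      exact SimpleGraph.isAcyclic_bot

-- The points outside `X` are isolated in the extended forest, so pairs not contained in `X` get the
-- value `0`, as in the extension by zero.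
open scoped Classical in
theorem extPairs_treeInterp {T : Finset (Pair X)} (hT : (pairGraph T).IsAcyclic) {θ : Pair X → ℝ}
    (hθ : ∀ ℓ, 0 ≤ θ ℓ) : extPairs X (treeInterp T fun ℓ => θ ℓ) =
      treeInterp (T.map (pairEmb X)) fun ℓ => extPairs X θ ℓ := by
  have hθ' : ∀ ℓ, 0 ≤ extPairs X θ ℓ := by
    intro e
    by_cases h : ∃ e', pairEmb X e' = e
    · obtain ⟨e', rfl⟩ := h
      rw [extPairs_pairEmb]
      exact hθ e'
    · rw [not_exists] at h
      simp [extPairs_eq_zero _ h]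
  have hac := isAcyclic_map_pairEmb hT
  have h := restrictPairs_treeInterp hac hθ' (X := X) fun x y h _ => (adj_map_pairEmb h).2
  simp only [extPairs_pairEmb] at h
  rw [restrictEdges_map] at h
  funext e
  by_cases he : ∃ e', pairEmb X e' = e
  · obtain ⟨e', rfl⟩ := he
    rw [extPairs_pairEmb, ← h]
    rfl
  · have he' := not_exists.1 he
    rw [extPairs_eq_zero _ he']
    obtain ⟨x, y, hxy⟩ := pair_exists_rep e
    refine (treeInterp_eq_zero hac (fun ℓ => hθ' ℓ) hxy fun hr => he ?_).symm
    have hne : x ≠ y := fun h' => e.2 (hxy ▸ Sym2.mk_isDiag_iff.2 h')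
    have hx : x ∈ X := by
      obtain ⟨p⟩ := hr
      cases p with
      | nil => exact absurd rfl hne
      | cons h _ => exact (adj_map_pairEmb h).1
    have hy : y ∈ X := (reachable_comap_of_closed (fun x y h _ => (adj_map_pairEmb h).2) hr hx).1
    obtain ⟨e', h, -⟩ := exists_pairEmb_eq (x := ⟨x, hx⟩) (y := ⟨y, hy⟩) hxy.symm
    exact ⟨e', h⟩

/-- Edges of weight zero are absent at all positive levels. -/
theorem treeInterp_subset {L : Type*} {T T' : Finset (Pair L)} (h : T ⊆ T')
    (hT' : (pairGraph T').IsAcyclic) {θ : Pair L → ℝ} (hθ : ∀ ℓ, 0 ≤ θ ℓ)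
    (h0 : ∀ ℓ ∉ T, θ ℓ = 0) : (treeInterp T' fun ℓ => θ ℓ) = treeInterp T fun ℓ => θ ℓ := by
  funext e
  refine eq_of_forall_pos_le_iff (treeInterp_nonneg T' (fun ℓ => θ ℓ) (fun ℓ => hθ ℓ) e)
    (treeInterp_nonneg T (fun ℓ => θ ℓ) (fun ℓ => hθ ℓ) e) fun t ht => ?_
  obtain ⟨x, y, hxy⟩ := pair_exists_rep e
  rw [le_treeInterp_iff hT' _ ht hxy, le_treeInterp_iff (isAcyclic_mono h hT') _ ht hxy]
  have : thresholdGraph T' (fun ℓ => θ ℓ) t = thresholdGraph T (fun ℓ => θ ℓ) t := by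
    ext x y
    rw [thresholdGraph_adj, thresholdGraph_adj]
    constructor
    · rintro ⟨⟨ℓ, hℓ⟩, h1, h2⟩
      refine ⟨⟨ℓ, ?_⟩, h1, h2⟩
      by_contra hn
      have h3 : t ≤ θ ℓ := h2
      rw [h0 ℓ hn] at h3
      exact ht.not_ge h3
    · rintro ⟨⟨ℓ, hℓ⟩, h1, h2⟩
      exact ⟨⟨ℓ, h hℓ⟩, h1, h2⟩
  rw [this]

theorem exists_tree_superset [Fintype L] [Nonempty L] {T : Finset (Pair L)}
    (hT : (pairGraph T).IsAcyclic) : ∃ T', T ⊆ T' ∧ (pairGraph T').IsTree := by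
  classical
  obtain ⟨G, hG, -, hG'⟩ := SimpleGraph.connected_top.exists_isTree_le_of_le_of_isAcyclic
    (le_top : pairGraph T ≤ ⊤) hT
  refine ⟨Finset.univ.filter fun ℓ => ℓ.1 ∈ G.edgeSet, fun ℓ hℓ => ?_, ?_⟩
  · rw [Finset.mem_filter]
    exact ⟨Finset.mem_univ _,
      SimpleGraph.edgeSet_mono hG ((mem_edgeSet_pairGraph T _).2 ⟨ℓ, hℓ, rfl⟩)⟩
  · convert hG'
    ext x y
    rw [pairGraph_adj]
    constructor
    · rintro ⟨ℓ, hℓ, h⟩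
      have := (Finset.mem_filter.1 hℓ).2
      rwa [h] at this
    · intro h
      exact ⟨⟨s(x, y), fun hd => h.ne (Sym2.mk_isDiag_iff.1 hd)⟩, by simpa using h, rfl⟩

end Extend

end ClusterExpansion

end

noncomputable section

open scoped ENNReal ContDiff

namespace ClusterExpansion

/-! ### Regularity of the local factors -/

section Local

variable {L : Type*} [Fintype L] [DecidableEq L] {N : ℕ}

theorem componentPartition_eq {s : Pair L → ℝ} {P : Finpartition (Finset.univ : Finset L)}
    (h : ∀ (e : Pair L) (x y : L), s(x, y) = e.1 → (s e ≠ 0 ↔ P.part x = P.part y)) :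
    componentPartition s = P := by
  refine le_antisymm ((componentPartition_isLeast s).2 fun e x y he hne => ?_) fun X hX => ?_
  · by_contra hs
    exact hne ((h e x y he).1 hs)
  · obtain ⟨x, hx⟩ := P.nonempty_of_mem_parts hX
    refine ⟨(componentPartition s).part x, Finpartition.part_mem _ |>.2 (Finset.mem_univ x), ?_⟩
    intro y hy
    by_cases hxy : x = y
    · exact hxy ▸ Finpartition.mem_part _ (Finset.mem_univ x)
    · have he : ¬ (s(x, y) : Sym2 L).IsDiag := fun hd => hxy (Sym2.mk_isDiag_iff.1 hd)
      have hs : s ⟨s(x, y), he⟩ ≠ 0 := (h ⟨s(x, y), he⟩ x y rfl).2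
        (((mem_part_iff P hX).1 hx).trans ((mem_part_iff P hX).1 hy).symm)
      by_contra hn
      refine hs ((componentPartition_isLeast s).1 ⟨s(x, y), he⟩ x y rfl fun hp => hn ?_)
      rw [hp]
      exact Finpartition.mem_part _ (Finset.mem_univ y)

open scoped Classical in
/-- The partition of `L` into `X` and the singletons outside `X`. -/
def onePart (X : Finset L) : Finpartition (Finset.univ : Finset L) :=
  Finpartition.ofSetoid
    { r := fun x y => x = y ∨ x ∈ X ∧ y ∈ X
      iseqv := by
        refine ⟨fun x => Or.inl rfl, ?_, ?_⟩
        · rintro x y (rfl | h)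
          · exact Or.inl rfl
          · exact Or.inr h.symm
        · rintro x y z (rfl | h) h'
          · exact h'
          · rcases h' with rfl | h'
            · exact Or.inr h
            · exact Or.inr ⟨h.1, h'.2⟩ }

theorem mem_part_onePart {X : Finset L} {x y : L} :
    y ∈ (onePart X).part x ↔ x = y ∨ x ∈ X ∧ y ∈ X := by
  classical
  exact Finpartition.mem_part_ofSetoid_iff_rel

theorem part_onePart_eq_iff {X : Finset L} {x y : L} :
    (onePart X).part x = (onePart X).part y ↔ x = y ∨ x ∈ X ∧ y ∈ X := by
  rw [← mem_part_onePart, mem_part_iff _ (Finpartition.part_mem _ |>.2 (Finset.mem_univ x)), eq_comm]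

theorem mem_onePart {X : Finset L} (hX : X.Nonempty) : X ∈ (onePart X).parts := by
  obtain ⟨x, hx⟩ := hX
  have : (onePart X).part x = X := by
    ext y
    rw [mem_part_onePart]
    constructor
    · rintro (rfl | h)
      · exact hx
      · exact h.2
    · exact fun h => Or.inr ⟨hx, h⟩
  exact this ▸ Finpartition.part_mem _ |>.2 (Finset.mem_univ x)

/-- A function of the field and the interpolation parameters that is a product over the parts of
the partition `componentPartition s`. -/
structure IsLocal (R : ℝ≥0∞) (E : (L → Spin N) × (Pair L → ℝ) → ℂ)
    (B : (X : Finset L) → (X → Spin N) → (Pair X → ℝ) → ℂ) : Prop where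
  smooth : ContDiffOn ℝ ∞ E (smallDomain L N R)
  ne_zero : ∀ X φ s, B X φ s ≠ 0
  factor : ∀ φ ∈ smallFields L N R, ∀ s ∈ Set.Icc (0 : Pair L → ℝ) 1,
    E (φ, s) = ∏ X ∈ (componentPartition s).parts, B X (restrictField X φ) (restrictPairs X s)
  bound : R = ⊤ → ∀ ε : ℝ, 0 < ε → ∃ K : ℝ, ∀ T : Finset (Pair L), (pairGraph T).IsTree →
    ∀ F : Finset (Pair L), F ⊆ T → ∀ w : T → ℝ, (∀ ℓ, w ℓ ∈ Set.Ioo (0 : ℝ) 1) →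
      ∀ φ : L → Spin N, ‖applyAll F pairDeriv (fun s => E (φ, s)) (treeInterp T w)‖ ≤
        K * Real.exp (ε * ∑ x, ‖φ x‖ ^ 2)

variable {R : ℝ≥0∞} {E : (L → Spin N) × (Pair L → ℝ) → ℂ}
  {B : (X : Finset L) → (X → Spin N) → (Pair X → ℝ) → ℂ}

/-- The direction of the parameter of the pair `ℓ`. -/
def pairDir (ℓ : Pair L) : (L → Spin N) × (Pair L → ℝ) := (0, Pi.single ℓ 1)

/-- Nothing is assumed about the regularity of the local factors, so they must be expressed through
`E`. Extending field and parameters by zero makes `X` one part and every other point a singleton,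
whose factor is a nonzero constant independent of `φ` and `s`. The factorization can then be solved
for `B X`. -/
theorem IsLocal.exists_const (h : IsLocal R E B) {X : Finset L} (hX : X.Nonempty) :
    ∃ c, ∀ φ ∈ smallFields X N R, ∀ s ∈ openCube (Pair X),
      B X φ s = c * E (extField X φ, extPairs X s) := by
  set c₀ := ∏ Y ∈ (onePart X).parts.erase X, B Y 0 0 with hc₀
  have hc : c₀ ≠ 0 := Finset.prod_ne_zero_iff.2 fun Y _ => h.ne_zero Y 0 0
  refine ⟨c₀⁻¹, fun φ hφ s hs => ?_⟩
  rw [eq_inv_mul_iff_mul_eq₀ hc, h.factor _ (extField_mem hφ) _ (extPairs_mem (openCube_subset _ hs))]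
  have hP : componentPartition (extPairs X s) = onePart X := by
    refine componentPartition_eq fun e x y hxy => ?_
    rw [part_onePart_eq_iff]
    have hne : x ≠ y := fun h' => e.2 (hxy ▸ Sym2.mk_isDiag_iff.2 h')
    constructor
    · intro h0
      by_contra hn
      exact h0 (extPairs_eq_zero_of_notMem s hxy fun h' => hn (Or.inr h'))
    · rintro (h' | ⟨hx, hy⟩)
      · exact absurd h' hne
      · obtain ⟨e', rfl, -⟩ := exists_pairEmb_eq (x := ⟨x, hx⟩) (y := ⟨y, hy⟩) hxy.symm
        rw [extPairs_pairEmb]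
        exact (mem_openCube.1 hs e').1.ne'
  rw [hP, ← Finset.mul_prod_erase _ _ (mem_onePart hX), restrictField_extField,
    restrictPairs_extPairs, mul_comm, hc₀]
  congr 1
  refine Finset.prod_congr rfl fun Y hY => ?_
  obtain ⟨hne, hY⟩ := Finset.mem_erase.1 hY
  have hd : ∀ y ∈ Y, y ∉ X := fun y hy hyX => hne (by
    rw [← (mem_part_iff _ hY).1 hy, (mem_part_iff _ (mem_onePart hX)).1 hyX])
  congr 1
  · funext y
    simp [restrictField, extField, hd y y.2]
  · funext e
    obtain ⟨x, y, hxy⟩ := pair_exists_rep e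
    exact (extPairs_eq_zero_of_notMem s (pairEmb_eq_iff.2 hxy.symm).symm
      fun h' => hd x x.2 h'.1).symm

theorem eventually_openCube {κ : Type*} [Fintype κ] {s : κ → ℝ} (hs : s ∈ openCube κ) (v : κ → ℝ) :
    ∀ᶠ t : ℝ in nhds 0, s + t • v ∈ openCube κ :=
  eventually_line_mem (isOpen_openCube κ) hs v

/-- A partial derivative of `E` in the parameters. -/
def paramDeriv (R : ℝ≥0∞) (E : (L → Spin N) × (Pair L → ℝ) → ℂ) (F : Finset (Pair L)) :
    (L → Spin N) × (Pair L → ℝ) → ℂ :=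
  applyAll F (fun ℓ => dirWithin (smallDomain L N R) (pairDir ℓ)) E

theorem IsLocal.continuousOn_paramDeriv (hR : 0 < R) (h : IsLocal R E B) (F : Finset (Pair L)) :
    ContinuousOn (paramDeriv R E F) (smallDomain L N R) :=
  (ContDiffOn.foldr_dirWithin (uniqueDiffOn_smallDomain hR) h.smooth pairDir _).continuousOn

theorem IsLocal.applyAll_pairDeriv_eq (hR : 0 < R) (h : IsLocal R E B) {X : Finset L}
    (hX : X.Nonempty) : ∃ c, ∀ F, ∀ φ ∈ smallFields X N R, ∀ s ∈ openCube (Pair X),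
      applyAll F pairDeriv (B X φ) s =
        c * paramDeriv R E (F.map (pairEmb X)) (extField X φ, extPairs X s) := by
  obtain ⟨c, hc⟩ := h.exists_const hX
  refine ⟨c, fun F φ hφ s hs => ?_⟩
  have hm : Set.MapsTo (fun s => (extField X φ, extPairs X s)) (openCube (Pair X))
      (smallDomain L N R) := fun s hs => ⟨extField_mem hφ, extPairs_mem (openCube_subset _ hs)⟩
  have h1 := foldr_pairDeriv_eq (uniqueDiffOn_smallDomain hR) h.smooth (S := Set.univ)
    (a := fun s => (extField X φ, extPairs X s)) (v := fun ℓ => pairDir (pairEmb X ℓ))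
    (fun s hs ℓ _ => eventually_openCube hs (Pi.single ℓ 1))
    (fun s t ℓ => by simp [pairDir, extPairs_add_smul]) hm (hc φ hφ) F.toList
    (fun _ _ => trivial) s hs
  refine h1.trans ?_
  congr 1
  exact (applyAll_dirWithin_map (uniqueDiffOn_smallDomain hR) (smallDomain_subset hR) h.smooth
    pairDir F (pairEmb X) (hm hs)).symm

theorem IsLocal.applyAll_pairDeriv_global (hR : 0 < R) (h : IsLocal R E B) (F : Finset (Pair L))
    {φ : L → Spin N} (hφ : φ ∈ smallFields L N R) {s : Pair L → ℝ} (hs : s ∈ openCube (Pair L)) :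
    applyAll F pairDeriv (fun s => E (φ, s)) s = paramDeriv R E F (φ, s) := by
  have hm : Set.MapsTo (fun s => (φ, s)) (openCube (Pair L))
      (smallDomain L N R) := fun s hs => ⟨hφ, openCube_subset _ hs⟩
  refine (foldr_pairDeriv_eq (c := 1) (uniqueDiffOn_smallDomain hR) h.smooth (S := Set.univ)
    (a := fun s => (φ, s)) (v := pairDir)
    (fun s hs ℓ _ => eventually_openCube hs (Pi.single ℓ 1))
    (fun s t ℓ => by simp [pairDir]) hm (fun s _ => (one_mul _).symm) F.toList
    (fun _ _ => trivial) s hs).trans (one_mul _)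

theorem continuous_ext {X : Finset L} : Continuous fun p : (X → Spin N) × (Pair X → ℝ) =>
    (extField X p.1, extPairs X p.2) :=
  (continuous_extField.comp continuous_fst).prodMk (continuous_extPairs.comp continuous_snd)

theorem contDiff_extPairs {X : Finset L} : ContDiff ℝ ∞ (extPairs X) := by
  refine contDiff_pi.2 fun e => ?_
  by_cases h : ∃ e', pairEmb X e' = e
  · obtain ⟨e', rfl⟩ := h
    simp only [extPairs_pairEmb]
    exact contDiff_apply ℝ ℝ e'
  · rw [not_exists] at h
    simp only [extPairs_eq_zero _ h]
    exact contDiff_const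

/-- The growth hypothesis concerns trees on all of `L` with weights in `(0, 1)`, whereas the
extension of `s^T` from `X` may have zero entries. Complete `T` to a tree on `L` with added edges of
weight zero, raise all weights to at least `δ`, and let `δ → 0`; the parameter derivatives are
continuous up to the boundary. -/
theorem IsLocal.paramDeriv_bound (hR : 0 < R) (h : IsLocal R E B) (hR' : R = ⊤) {ε : ℝ}
    (hε : 0 < ε) : ∃ K : ℝ, ∀ X : Finset L, X.Nonempty → ∀ T : Finset (Pair X),
      (pairGraph T).IsTree → ∀ F ⊆ T, ∀ w ∈ openCube T, ∀ φ : X → Spin N,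
      ‖paramDeriv R E (F.map (pairEmb X)) (extField X φ, extPairs X (treeInterp T w))‖ ≤
        K * Real.exp (ε * ∑ x, ‖φ x‖ ^ 2) := by
  classical
  obtain ⟨K, hK⟩ := h.bound hR' ε hε
  refine ⟨K, fun X hX T hT F hF w hw φ => ?_⟩
  have : Nonempty L := ⟨hX.choose⟩
  have hall : ∀ φ : L → Spin N, φ ∈ smallFields L N R := fun φ x => by simp [hR']
  set w' : Pair X → ℝ := fun ℓ => if h : ℓ ∈ T then w ⟨ℓ, h⟩ else 0 with hw'
  have hww : (fun ℓ : T => w' ℓ) = w := funext fun ℓ => by simp [w']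
  have hw0 : ∀ ℓ, w' ℓ ∈ Set.Ico (0 : ℝ) 1 := by
    intro ℓ
    simp only [w']
    split_ifs
    · exact Set.Ioo_subset_Ico_self (mem_openCube.1 hw _)
    · simp
  set θ := extPairs X w' with hθ
  have hθ0 : ∀ ℓ, θ ℓ ∈ Set.Ico (0 : ℝ) 1 := by
    intro ℓ
    by_cases hℓ : ∃ e', pairEmb X e' = ℓ
    · obtain ⟨e', rfl⟩ := hℓ
      rw [hθ, extPairs_pairEmb]
      exact hw0 e'
    · rw [not_exists] at hℓ
      rw [hθ, extPairs_eq_zero _ hℓ]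
      simp
  have hθT : ∀ ℓ ∉ T.map (pairEmb X), θ ℓ = 0 := by
    intro ℓ hℓ
    by_cases hℓ' : ∃ e', pairEmb X e' = ℓ
    · obtain ⟨e', rfl⟩ := hℓ'
      rw [hθ, extPairs_pairEmb]
      have : e' ∉ T := fun h => hℓ (Finset.mem_map_of_mem _ h)
      simp [w', this]
    · exact extPairs_eq_zero _ (not_exists.1 hℓ')
  obtain ⟨T', hTT', hT'⟩ := exists_tree_superset (isAcyclic_map_pairEmb hT.isAcyclic)
  have hs : extPairs X (treeInterp T w) = treeInterp T' fun ℓ => θ ℓ := by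
    rw [treeInterp_subset hTT' hT'.isAcyclic (fun ℓ => (hθ0 ℓ).1) hθT,
      ← extPairs_treeInterp hT.isAcyclic fun ℓ => (hw0 ℓ).1, hww]
  set g : ℝ → Pair L → ℝ := fun δ => treeInterp T' fun ℓ => max (θ ℓ) δ with hg
  have hg0 : g 0 = extPairs X (treeInterp T w) := by
    rw [hs, hg]
    simp only [max_eq_left (hθ0 _).1]
  have hgc : Continuous g := (continuous_treeInterp T').comp
    (continuous_pi fun ℓ => continuous_const.max continuous_id)
  have hbd : ∀ δ ∈ Set.Ioo (0 : ℝ) 1, g δ ∈ openCube (Pair L) ∧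
      ‖paramDeriv R E (F.map (pairEmb X)) (extField X φ, g δ)‖ ≤
        K * Real.exp (ε * ∑ x, ‖φ x‖ ^ 2) := by
    intro δ hδ
    have hmem : ∀ ℓ : T', max (θ ℓ) δ ∈ Set.Ioo (0 : ℝ) 1 := fun ℓ =>
      ⟨lt_max_of_lt_right hδ.1, max_lt (hθ0 ℓ).2 hδ.2⟩
    have hgδ : g δ ∈ openCube (Pair L) := treeInterp_mem_openCube hT' (mem_openCube.2 hmem)
    refine ⟨hgδ, ?_⟩
    rw [← h.applyAll_pairDeriv_global hR _ (hall _) hgδ, ← sum_norm_sq_extField]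
    exact hK T' hT' _ ((Finset.map_subset_map.2 hF).trans hTT') _ hmem _
  -- Continuity includes `δ = 0`, where the parameters are those of `X` extended by zero; the bound
  -- itself is known only for `δ > 0` and is carried over by the limit.
  have hcont : ContinuousOn (fun δ => ‖paramDeriv R E (F.map (pairEmb X)) (extField X φ, g δ)‖)
      (Set.Ico 0 1) := by
    refine ((h.continuousOn_paramDeriv hR _).comp
      (continuous_const.prodMk hgc).continuousOn fun δ hδ => ⟨hall _, ?_⟩).norm
    rcases hδ.1.eq_or_lt with h0 | h0
    · rw [← h0, hg0]
      exact extPairs_mem (isUltra_treeInterp hT.isAcyclic fun ℓ =>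
        Set.Ioo_subset_Icc_self (mem_openCube.1 hw ℓ)).1
    · exact openCube_subset _ (hbd δ ⟨h0, hδ.2⟩).1
  rw [← hg0]
  have hcl := (hcont 0 ⟨le_rfl, one_pos⟩).mono_left
    (nhdsWithin_mono (0 : ℝ) Set.Ioo_subset_Ico_self : nhdsWithin (0:ℝ) (Set.Ioo 0 1) ≤ _)
  have : (nhdsWithin (0 : ℝ) (Set.Ioo 0 1)).NeBot := by
    rw [nhdsWithin_Ioo_eq_nhdsGT one_pos]
    infer_instance
  exact le_of_tendsto hcl (eventually_mem_nhdsWithin.mono fun δ hδ => (hbd δ hδ).2)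

/-- For finite `R` the derivatives are bounded because the domain is compact; for `R = ∞` the growth
bound comes from `IsLocal.paramDeriv_bound`. -/
theorem IsLocal.isRegular (hR : 0 < R) (h : IsLocal R E B) {X : Finset L} (hX : X.Nonempty) :
    IsRegular R (B X) := by
  obtain ⟨c, hc⟩ := h.applyAll_pairDeriv_eq hR hX
  refine ⟨fun φ hφ => ?_, fun F => ?_, fun ε hε => ?_⟩
  · have hm : Set.MapsTo (fun s => (extField X φ, extPairs X s)) (openCube (Pair X))
      (smallDomain L N R) := fun s hs => ⟨extField_mem hφ, extPairs_mem (openCube_subset _ hs)⟩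
    have hp : ContDiff ℝ ∞ fun s : Pair X → ℝ => (extField X φ, extPairs X s) :=
      contDiff_const.prodMk contDiff_extPairs
    have h2 : ContDiffOn ℝ ∞ (fun s => E (extField X φ, extPairs X s)) (openCube (Pair X)) :=
      h.smooth.comp (t := smallDomain L N R) hp.contDiffOn hm
    have h1 : ContDiffOn ℝ ∞ (fun s => c * E (extField X φ, extPairs X s)) (openCube (Pair X)) :=
      contDiff_const.contDiffOn.mul h2
    refine h1.congr fun s hs => ?_
    have := hc ∅ φ hφ s hs
    simpa [applyAll_empty, paramDeriv] using this
  · have hm : Set.MapsTo (fun p : (X → Spin N) × (Pair X → ℝ) => (extField X p.1, extPairs X p.2))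
      (smallFields X N R ×ˢ openCube (Pair X)) (smallDomain L N R) :=
      fun p hp => ⟨extField_mem hp.1, extPairs_mem (openCube_subset _ hp.2)⟩
    refine (continuousOn_const (c := c).mul ((h.continuousOn_paramDeriv hR
      (F.map (pairEmb X))).comp continuous_ext.continuousOn hm)).congr fun p hp => ?_
    exact hc F p.1 hp.1 p.2 hp.2
  · by_cases hR' : R = ⊤
    · obtain ⟨K, hK⟩ := h.paramDeriv_bound hR hR' hε
      refine ⟨‖c‖ * K, fun T hT F hF w hw φ hφ => ?_⟩
      rw [hc F φ hφ _ (treeInterp_mem_openCube hT hw), norm_mul, mul_assoc]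
      gcongr
      exact hK X hX T hT F hF w hw φ
    · have hcomp : IsCompact (smallDomain L N R) := (isCompact_smallFields hR').prod isCompact_Icc
      choose K hK using fun F => hcomp.exists_bound_of_continuousOn
        (h.continuousOn_paramDeriv hR F)
      refine ⟨‖c‖ * ∑ F, |K F|, fun T hT F hF w hw φ hφ => ?_⟩
      have hs := treeInterp_mem_openCube hT hw
      rw [hc F φ hφ _ hs, norm_mul]
      have hm : (extField X φ, extPairs X (treeInterp T w)) ∈ smallDomain L N R :=
        ⟨extField_mem hφ, extPairs_mem (openCube_subset _ hs)⟩
      have h2 : |K (F.map (pairEmb X))| ≤ ∑ F, |K F| :=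
        Finset.single_le_sum (f := fun F => |K F|) (fun F _ => abs_nonneg _) (Finset.mem_univ _)
      have h1 := ((hK (F.map (pairEmb X)) _ hm).trans (le_abs_self _)).trans h2
      calc _ ≤ ‖c‖ * ∑ F, |K F| := by gcongr
        _ ≤ _ := le_mul_of_one_le_right (by positivity) (Real.one_le_exp (by positivity))

end Local

end ClusterExpansion

end

/-! ### Factorization of the differentiated integrand over the trees of a forest -/

noncomputable section

open scoped ENNReal ContDiff

namespace ClusterExpansion

/-! ### Factorization of the derivatives over the parts of a partition -/

theorem applyAll_pairDeriv_insert {ι : Type*} [DecidableEq ι] [Fintype ι]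
    {U : Set (Pair ι → ℝ)} (hU : IsOpen U) {f : (Pair ι → ℝ) → ℂ} (hf : ContDiffOn ℝ ∞ f U)
    {F : Finset (Pair ι)} {ℓ : Pair ι} (hℓ : ℓ ∉ F) {s : Pair ι → ℝ} (hs : s ∈ U) :
    applyAll (insert ℓ F) pairDeriv f s = pairDeriv ℓ (applyAll F pairDeriv f) s := by
  have hU' : U ⊆ closure (interior U) := by
    rw [hU.interior_eq]
    exact subset_closure
  set v : Pair ι → Pair ι → ℝ := fun ℓ => Pi.single ℓ 1
  have h1 := applyAll_pairDeriv_eq_of_isOpen hU hf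
  have h2 := applyAll_dirWithin_insert hU.uniqueDiffOn hU' hf v hℓ hs
  have hsm : ContDiffOn ℝ ∞ (applyAll F (fun ℓ => dirWithin U (v ℓ)) f) U :=
    ContDiffOn.foldr_dirWithin hU.uniqueDiffOn hf v _
  have hev := eventually_line_mem hU hs (v ℓ)
  rw [h1 (insert ℓ F) hs, h2, ← lineDeriv_eq_dirWithin (hsm.differentiableOn (by simp) s hs) hev,
    pairDeriv, lineDeriv, lineDeriv]
  exact Filter.EventuallyEq.deriv_eq (hev.mono fun t ht => (h1 F ht).symm)

section Factorization

variable {L : Type*} [Fintype L] [DecidableEq L] {N : ℕ}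

/-- The parameters in the unit cube for which the Gaussian density is smooth. -/
def covCube (C : Matrix (L × Fin N) (L × Fin N) ℂ) : Set (Pair L → ℝ) :=
  Set.Icc 0 1 ∩ covSet C

theorem uniqueDiffOn_covCube (C : Matrix (L × Fin N) (L × Fin N) ℂ) :
    UniqueDiffOn ℝ (covCube C) :=
  (uniqueDiffOn_convex (convex_Icc (0 : Pair L → ℝ) 1) ((openCube_nonempty _).mono
    (openCube_subset_interior _))).inter (isOpen_covSet C)

theorem covCube_subset (C : Matrix (L × Fin N) (L × Fin N) ℂ) :
    covCube C ⊆ closure (interior (covCube C)) := by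
  rw [covCube, interior_inter, (isOpen_covSet C).interior_eq]
  have h : Set.Icc (0 : Pair L → ℝ) 1 ⊆ closure (interior (Set.Icc (0 : Pair L → ℝ) 1)) := by
    rw [(convex_Icc (𝕜 := ℝ) (0 : Pair L → ℝ) 1).closure_interior_eq_closure_of_nonempty_interior
      ((openCube_nonempty _).mono (openCube_subset_interior _))]
    exact subset_closure
  intro s hs
  have := (isOpen_covSet C).inter_closure (t := interior (Set.Icc (0 : Pair L → ℝ) 1)) ⟨hs.2, h hs.1⟩
  rwa [Set.inter_comm] at this

theorem mem_covSet_restrict {C : Matrix (L × Fin N) (L × Fin N) ℂ} {s : Pair L → ℝ}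
    (hs : s ∈ covSet C) (X : Finset L) : restrictPairs X s ∈ covSet (restrictCov X C) := by
  obtain ⟨c, hc, h⟩ := hs
  refine ⟨c, hc, ?_⟩
  have hinj : Function.Injective fun ξ : X × Fin N => ((ξ.1 : L), ξ.2) := by
    rintro ⟨x, m⟩ ⟨y, n⟩ h
    simp only [Prod.mk.injEq] at h
    exact Prod.ext (Subtype.ext h.1) h.2
  convert h.submatrix hinj using 1
  ext ξ η
  simp only [restrictCov, interpCov, Matrix.submatrix_apply, Subtype.ext_iff]
  rfl

theorem coercive_restrictCov {C : Matrix (L × Fin N) (L × Fin N) ℂ} {c : ℝ} (hC : Coercive c C)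
    (X : Finset L) : Coercive c (restrictCov X C) := by
  refine hC.submatrix ?_
  rintro ⟨x, m⟩ ⟨y, n⟩ h
  simp only [Prod.mk.injEq] at h
  exact Prod.ext (Subtype.ext h.1) h.2

/-- The parameters that vanish between different parts of `P` and lie in `(0, 1)` within the
parts. -/
def partCube (C : Matrix (L × Fin N) (L × Fin N) ℂ)
    (P : Finpartition (Finset.univ : Finset L)) : Set (Pair L → ℝ) :=
  {s | s ∈ covCube C ∧
    (∀ (e : Pair L) (x y : L), s(x, y) = e.1 → P.part x ≠ P.part y → s e = 0) ∧
    ∀ X ∈ P.parts, restrictPairs X s ∈ openCube (Pair X)}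

variable {C : Matrix (L × Fin N) (L × Fin N) ℂ} {P : Finpartition (Finset.univ : Finset L)}

theorem componentPartition_of_mem_partCube {s : Pair L → ℝ} (hs : s ∈ partCube C P) :
    componentPartition s = P := by
  refine componentPartition_eq fun e x y h => ⟨fun h0 => ?_, fun hp => ?_⟩
  · by_contra hn
    exact h0 (hs.2.1 e x y h hn)
  · have hX : P.part x ∈ P.parts := P.part_mem.2 (Finset.mem_univ x)
    obtain ⟨e', rfl, -⟩ := exists_pairEmb_eq (X := P.part x)
      (x := ⟨x, P.mem_part (Finset.mem_univ x)⟩)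
      (y := ⟨y, hp ▸ P.mem_part (Finset.mem_univ y)⟩) h.symm
    exact (mem_openCube.1 (hs.2.2 _ hX) e').1.ne'

theorem restrictPairs_add_smul (s : Pair L → ℝ) (t : ℝ) (X : P.parts) (e : Pair X.1) :
    restrictPairs X.1 (s + t • (Pi.single (pairEmb X.1 e) 1 : Pair L → ℝ)) =
      restrictPairs X.1 s + t • (Pi.single e 1 : Pair X.1 → ℝ) := by
  funext e'
  simp [restrictPairs_eq, Pi.single_apply]

theorem restrictPairs_add_smul_of_ne (s : Pair L → ℝ) (t : ℝ) {X Y : P.parts} (hXY : Y ≠ X)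
    (e : Pair X.1) :
    restrictPairs Y.1 (s + t • (Pi.single (pairEmb X.1 e) 1 : Pair L → ℝ)) =
      restrictPairs Y.1 s := by
  funext e'
  have h : pairEmb Y.1 e' ≠ pairEmb X.1 e := fun h => by
    have h1 : (⟨Y, e'⟩ : Σ X : P.parts, Pair X.1) = ⟨X, e⟩ := (partPairEmb P).injective h
    exact hXY (congrArg Sigma.fst h1)
  simp [restrictPairs_eq, h]

/-- The set need not be open, but it admits small changes of a parameter within a part: pairs
between parts are untouched, and those within parts have room in `(0, 1)`. -/
theorem eventually_mem_partCube {s : Pair L → ℝ} (hs : s ∈ partCube C P) (X : P.parts)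
    (e : Pair X.1) :
    ∀ᶠ t : ℝ in nhds 0, s + t • (Pi.single (pairEmb X.1 e) 1 : Pair L → ℝ) ∈ partCube C P := by
  have h1 := eventually_line_mem (isOpen_covSet C) hs.1.2 (Pi.single (pairEmb X.1 e) 1)
  have h2 := eventually_line_mem (isOpen_openCube _) (hs.2.2 X.1 X.2) (Pi.single e 1)
  refine (h1.and h2).mono fun t ⟨ht1, ht2⟩ => ?_
  have h3 : ∀ Y ∈ P.parts, restrictPairs Y
      (s + t • (Pi.single (pairEmb X.1 e) 1 : Pair L → ℝ)) ∈ openCube (Pair Y) := by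
    intro Y hY
    by_cases hYX : (⟨Y, hY⟩ : P.parts) = X
    · obtain rfl := congrArg Subtype.val hYX
      rw [restrictPairs_add_smul s t X e]
      exact ht2
    · rw [restrictPairs_add_smul_of_ne s t hYX e]
      exact hs.2.2 Y hY
  have h4 : ∀ (e' : Pair L) (x y : L), s(x, y) = e'.1 → P.part x ≠ P.part y →
      (s + t • (Pi.single (pairEmb X.1 e) 1 : Pair L → ℝ)) e' = 0 := by
    intro e' x y h hne
    have hne' : e' ≠ pairEmb X.1 e := by
      rintro rfl
      have := part_eq_of_pairEmb h.symm
      exact hne (this.1.trans this.2.symm)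
    simp [hne', hs.2.1 e' x y h hne]
  have h5 : ∀ e', (s + t • (Pi.single (pairEmb X.1 e) 1 : Pair L → ℝ)) e' ∈ Set.Icc (0 : ℝ) 1 := by
    intro e'
    obtain ⟨x, y, hxy⟩ := pair_exists_rep e'
    by_cases hp : P.part x = P.part y
    · obtain ⟨e'', rfl, -⟩ := exists_pairEmb_eq (X := P.part x)
        (x := ⟨x, P.mem_part (Finset.mem_univ x)⟩)
        (y := ⟨y, hp ▸ P.mem_part (Finset.mem_univ y)⟩) hxy.symm
      exact Set.Ioo_subset_Icc_self
        (mem_openCube.1 (h3 _ (P.part_mem.2 (Finset.mem_univ x))) e'')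
    · rw [h4 e' x y hxy hp]
      exact ⟨le_rfl, zero_le_one⟩
  exact ⟨⟨⟨fun e' => (h5 e').1, fun e' => (h5 e').2⟩, ht1⟩, h4, h3⟩

theorem treeInterp_mem_partCube {c : ℝ} (hc : 0 < c) (hC : Coercive c C)
    {T : ∀ X : P.parts, Finset (Pair X.1)} (hT : ∀ X, (pairGraph (T X)).IsTree)
    {θ : Pair L → ℝ} (hθ : θ ∈ openCube (Pair L)) :
    (treeInterp (joinEdges P T) fun ℓ => θ ℓ) ∈ partCube C P ∧
    ∀ X : P.parts, restrictPairs X.1 (treeInterp (joinEdges P T) fun ℓ => θ ℓ) =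
      treeInterp (T X) fun ℓ => θ (pairEmb X.1 ℓ) := by
  have hac := isAcyclic_joinEdges fun X => (hT X).isAcyclic
  have hθ0 : ∀ ℓ, 0 ≤ θ ℓ := fun ℓ => (mem_openCube.1 hθ ℓ).1.le
  have hr : ∀ X : P.parts, restrictPairs X.1 (treeInterp (joinEdges P T) fun ℓ => θ ℓ) =
      treeInterp (T X) fun ℓ => θ (pairEmb X.1 ℓ) := by
    intro X
    have h := restrictPairs_treeInterp hac hθ0 (joinEdges_closed X.2)
    rwa [restrictEdges_joinEdges T X] at h
  have hu : IsUltra (treeInterp (joinEdges P T) fun ℓ => θ ℓ) :=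
    isUltra_treeInterp hac fun ℓ => Set.Ioo_subset_Icc_self (mem_openCube.1 hθ ℓ)
  refine ⟨⟨⟨hu.1, coerciveSet_subset hc (hu.mem_coerciveSet hC)⟩, fun e x y h hne => ?_,
    fun X hX => ?_⟩, hr⟩
  · refine treeInterp_eq_zero hac (fun ℓ => hθ0 ℓ) h fun hxy => hne ?_
    have := (reachable_joinEdges hT).1 hxy
    exact ((mem_part_iff P (P.part_mem.2 (Finset.mem_univ x))).1 this).symm
  · rw [hr ⟨X, hX⟩]
    exact treeInterp_mem_openCube (hT ⟨X, hX⟩)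
      (mem_openCube.2 fun ℓ => mem_openCube.1 hθ (pairEmb X ℓ))

variable {R : ℝ≥0∞} {E : (L → Spin N) × (Pair L → ℝ) → ℂ}
  {B : (X : Finset L) → (X → Spin N) → (Pair X → ℝ) → ℂ}

theorem IsLocal.contDiffOn_integrand (h : IsLocal R E B) {φ : L → Spin N}
    (hφ : φ ∈ smallFields L N R) :
    ContDiffOn ℝ ∞ (fun s => gaussianDensity (interpCov C s) φ * E (φ, s)) (covCube C) := by
  have h1 : ContDiffOn ℝ ∞ (fun s => gaussianDensity (interpCov C s) φ) (covCube C) :=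
    (contDiffOn_gaussianDensity C φ).mono Set.inter_subset_right
  have hp : ContDiff ℝ ∞ fun s : Pair L → ℝ => (φ, s) := contDiff_const.prodMk contDiff_id
  have h2 : ContDiffOn ℝ ∞ (fun s => E (φ, s)) (covCube C) :=
    h.smooth.comp (t := smallDomain L N R) hp.contDiffOn fun s hs => ⟨hφ, hs.1⟩
  exact h1.mul h2

theorem restrictField_mem {φ : L → Spin N} (hφ : φ ∈ smallFields L N R) (X : Finset L) :
    restrictField X φ ∈ smallFields X N R := fun x => hφ x

/-- Induction on the edges. On `partCube C P` the integrand is a product over the parts, and a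
parameter inside a part occurs in one factor only. Derivatives in these directions need only values
on this set, where the component partition is constantly `P`. -/
theorem IsLocal.applyAll_map_partPairEmb (hR : 0 < R) (h : IsLocal R E B) {φ : L → Spin N}
    (hφ : φ ∈ smallFields L N R) (S : Finset (Σ X : P.parts, Pair X.1)) :
    ∀ s ∈ partCube C P, applyAll (S.map (partPairEmb P))
        (fun ℓ => dirWithin (covCube C) (Pi.single ℓ 1))
        (fun s => gaussianDensity (interpCov C s) φ * E (φ, s)) s =
      ∏ X : P.parts, applyAll (S.preimage (Sigma.mk X) sigma_mk_injective.injOn) pairDeriv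
        (fun s => gaussianDensity (interpCov (restrictCov X.1 C) s) (restrictField X.1 φ) *
          B X.1 (restrictField X.1 φ) s) (restrictPairs X.1 s) := by
  have hsm := h.contDiffOn_integrand (C := C) hφ
  set v : Pair L → Pair L → ℝ := fun ℓ => Pi.single ℓ 1
  induction S using Finset.induction_on with
  | empty =>
    intro s hs
    simp only [Finset.map_empty, applyAll_empty, Finset.preimage_empty]
    rw [h.factor φ hφ s hs.1.1, componentPartition_of_mem_partCube hs,
      gaussianDensity_interpCov_eq_prod_parts P hs.2.1 hs.1.2, ← Finset.prod_mul_distrib,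
      ← Finset.prod_coe_sort]
  | insert a S ha ih =>
    obtain ⟨X, e⟩ := a
    intro s hs
    have hev : ∀ᶠ t : ℝ in nhds 0, s + t • v (partPairEmb P ⟨X, e⟩) ∈ partCube C P :=
      eventually_mem_partCube hs X e
    have ha' : partPairEmb P ⟨X, e⟩ ∉ S.map (partPairEmb P) := fun h' =>
      ha ((Finset.mem_map' _).1 h')
    have hsm' : ContDiffOn ℝ ∞ (applyAll (S.map (partPairEmb P))
        (fun ℓ => dirWithin (covCube C) (v ℓ))
        (fun s => gaussianDensity (interpCov C s) φ * E (φ, s))) (covCube C) :=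
      ContDiffOn.foldr_dirWithin (uniqueDiffOn_covCube C) hsm v _
    rw [Finset.map_insert, applyAll_dirWithin_insert (uniqueDiffOn_covCube C) (covCube_subset C)
      hsm v ha' hs.1, ← lineDeriv_eq_dirWithin (hsm'.differentiableOn (by simp) s hs.1)
      (hev.mono fun t ht => ht.1), lineDeriv]
    have hXU : restrictPairs X.1 s ∈ covSet (restrictCov X.1 C) ∩ openCube (Pair X.1) :=
      ⟨mem_covSet_restrict hs.1.2 X.1, hs.2.2 X.1 X.2⟩
    have hpre : (insert ⟨X, e⟩ S).preimage (Sigma.mk X) sigma_mk_injective.injOn =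
        insert e (S.preimage (Sigma.mk X) sigma_mk_injective.injOn) := by
      ext e'
      simp
    have hpre' : ∀ Y ≠ X, (insert ⟨X, e⟩ S).preimage (Sigma.mk Y) sigma_mk_injective.injOn =
        S.preimage (Sigma.mk Y) sigma_mk_injective.injOn := by
      intro Y hY
      ext e'
      simp [hY]
    have he : e ∉ S.preimage (Sigma.mk X) sigma_mk_injective.injOn := by simpa using ha
    have hloc : ContDiffOn ℝ ∞ (fun s => gaussianDensity (interpCov (restrictCov X.1 C) s)
        (restrictField X.1 φ) * B X.1 (restrictField X.1 φ) s)
        (covSet (restrictCov X.1 C) ∩ openCube (Pair X.1)) :=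
      ((contDiffOn_gaussianDensity _ _).mono Set.inter_subset_left).mul
        (((h.isRegular hR (P.nonempty_of_mem_parts X.2)).smooth _
          (restrictField_mem hφ X.1)).mono Set.inter_subset_right)
    rw [← Finset.mul_prod_erase _ _ (Finset.mem_univ X), hpre, applyAll_pairDeriv_insert
      ((isOpen_covSet _).inter (isOpen_openCube _)) hloc he hXU, pairDeriv, lineDeriv,
      ← deriv_mul_const_field]
    refine Filter.EventuallyEq.deriv_eq (hev.mono fun t ht => ?_)
    simp only [v]
    refine (ih _ ht).trans ?_
    rw [← Finset.mul_prod_erase _ _ (Finset.mem_univ X)]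
    congr 1
    · exact congrArg _ (restrictPairs_add_smul s t X e)
    · refine Finset.prod_congr rfl fun Y hY => ?_
      rw [hpre' Y (Finset.ne_of_mem_erase hY)]
      exact congrArg _ (restrictPairs_add_smul_of_ne s t (Finset.ne_of_mem_erase hY) e)

theorem cutoff_eq_prod_parts (P : Finpartition (Finset.univ : Finset L)) (R : ℝ≥0∞)
    (φ : L → Spin N) : cutoff R φ = ∏ X : P.parts, cutoff R (restrictField X.1 φ) := by
  classical
  set g : L → ℂ := fun x => if ENNReal.ofReal ‖φ x‖ ≤ R then 1 else 0
  have h : ∀ X : Finset L, cutoff R (restrictField X φ) = ∏ x ∈ X, g x := fun X =>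
    Finset.prod_coe_sort X g
  simp only [h]
  rw [Finset.prod_coe_sort P.parts fun X => ∏ x ∈ X, g x]
  have h' := Finset.prod_biUnion (f := g) (t := id) P.disjoint
  rw [P.biUnion_parts] at h'
  exact h'

theorem IsLocal.cutoff_mul_applyAll (hR : 0 < R) (h : IsLocal R E B) {c : ℝ} (hc : 0 < c)
    (hC : Coercive c C) {T : ∀ X : P.parts, Finset (Pair X.1)}
    (hT : ∀ X, (pairGraph (T X)).IsTree) (φ : L → Spin N) {θ : Pair L → ℝ}
    (hθ : θ ∈ openCube (Pair L)) :
    cutoff R φ * applyAll (joinEdges P T) (fun ℓ => dirWithin (covCube C) (Pi.single ℓ 1))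
        (fun s => gaussianDensity (interpCov C s) φ * E (φ, s))
        (treeInterp (joinEdges P T) fun ℓ => θ ℓ) =
      ∏ X : P.parts, treeIntegrand (restrictCov X.1 C) R (B X.1) (T X) (restrictField X.1 φ)
        fun ℓ => θ (pairEmb X.1 ℓ) := by
  simp only [treeIntegrand]
  rw [Finset.prod_mul_distrib, ← cutoff_eq_prod_parts]
  by_cases hφ : φ ∈ smallFields L N R
  · congr 1
    obtain ⟨hs, hr⟩ := treeInterp_mem_partCube hc hC hT hθ
    refine (h.applyAll_map_partPairEmb hR hφ (Finset.univ.sigma T) _ hs).trans ?_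
    refine Finset.prod_congr rfl fun X _ => ?_
    have hX : (Finset.univ.sigma T).preimage (Sigma.mk X) sigma_mk_injective.injOn = T X := by
      ext e
      simp
    rw [hr X, hX]
  · simp [cutoff_eq_indicator, hφ]

end Factorization

end ClusterExpansion

end

/-! ### Fubini and the polymer representation -/

noncomputable section

open scoped ENNReal ContDiff

namespace ClusterExpansion

open MeasureTheory

/-! ### Integrals of products -/

section Products

variable {ι κ K E : Type*} [Fintype ι] [Fintype κ] [Fintype K] [MeasurableSpace E]
  {α : K → Type*} [∀ k, Fintype (α k)] (ν : Measure E)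

/-- The coordinates outside the range of `j` do not occur and integrate to one. -/
theorem integral_comp_embedding [IsProbabilityMeasure ν] (j : κ ↪ ι) (G : (κ → E) → ℂ) :
    ∫ f, G (fun a => f (j a)) ∂Measure.pi (fun _ : ι => ν) =
      ∫ g, G g ∂Measure.pi (fun _ : κ => ν) := by
  classical
  have h1 := (measurePreserving_piEquivPiSubtypeProd (fun _ : ι => ν)
    (fun i => i ∈ Set.range j)).integral_comp'
    (g := fun p => G fun a => p.1 ⟨j a, Set.mem_range_self a⟩)
  let : Fintype (Set.range j) := Subtype.fintype fun i => i ∈ Set.range j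
  have h2 := (measurePreserving_piCongrLeft (fun _ : Set.range j => ν)
    (Equiv.ofInjective j j.injective)).integral_comp'
    (g := fun x => G fun a => x ⟨j a, Set.mem_range_self a⟩)
  refine h1.trans ?_
  rw [integral_fun_fst (fun x : Set.range j → E => G fun a => x ⟨j a, Set.mem_range_self a⟩)]
  rw [probReal_univ, one_smul]
  refine h2.symm.trans (integral_congr_ae (Filter.Eventually.of_forall fun g => ?_))
  refine congrArg G (funext fun a => ?_)
  exact Equiv.piCongrLeft_apply_apply (fun _ : Set.range j => E)
    (Equiv.ofInjective j j.injective) g a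

/-- The functions on a disjoint union as families of functions. -/
def sigmaArrow (E : Type*) [MeasurableSpace E] (e : (Σ k, α k) ≃ ι) :
    (∀ k, α k → E) ≃ᵐ (ι → E) where
  toFun g i := g (e.symm i).1 (e.symm i).2
  invFun f k a := f (e ⟨k, a⟩)
  left_inv g := by
    funext k a
    simp only
    rw [e.symm_apply_apply]
  right_inv f := by
    funext i
    simp
  measurable_toFun := measurable_pi_lambda _ fun i =>
    (measurable_pi_apply (e.symm i).2).comp (measurable_pi_apply (e.symm i).1)
  measurable_invFun := measurable_pi_lambda _ fun k => measurable_pi_lambda _ fun a =>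
    measurable_pi_apply (e ⟨k, a⟩)

theorem sigmaArrow_apply (e : (Σ k, α k) ≃ ι) (g : ∀ k, α k → E) (k : K) (a : α k) :
    sigmaArrow E e g (e ⟨k, a⟩) = g k a := by
  change g (e.symm (e ⟨k, a⟩)).1 (e.symm (e ⟨k, a⟩)).2 = g k a
  rw [e.symm_apply_apply]

theorem measurePreserving_sigmaArrow [SigmaFinite ν] (e : (Σ k, α k) ≃ ι) :
    MeasurePreserving (sigmaArrow E e) (Measure.pi fun k => Measure.pi fun _ : α k => ν)
      (Measure.pi fun _ : ι => ν) := by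
  refine ⟨(sigmaArrow E e).measurable, (Measure.pi_eq fun t ht => ?_).symm⟩
  have hpre : sigmaArrow E e ⁻¹' Set.pi Set.univ t =
      Set.pi Set.univ fun k => Set.pi Set.univ fun a => t (e ⟨k, a⟩) := by
    ext g
    simp only [Set.mem_preimage, Set.mem_pi, Set.mem_univ, true_imp_iff]
    constructor
    · intro h k a
      simpa only [sigmaArrow_apply] using h (e ⟨k, a⟩)
    · intro h i
      simpa [sigmaArrow] using h (e.symm i).1 (e.symm i).2
  rw [(sigmaArrow E e).map_apply, hpre, Measure.pi_pi]
  simp only [Measure.pi_pi]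
  rw [← e.prod_comp, Fintype.prod_sigma]

theorem integral_prod_comp_sigma [SigmaFinite ν] (e : (Σ k, α k) ≃ ι)
    (g : ∀ k, (α k → E) → ℂ) :
    ∫ f, ∏ k, g k (fun a => f (e ⟨k, a⟩)) ∂Measure.pi (fun _ : ι => ν) =
      ∏ k, ∫ x, g k x ∂Measure.pi (fun _ : α k => ν) := by
  rw [← integral_fintype_prod_eq_prod, ← (measurePreserving_sigmaArrow ν e).integral_comp']
  simp only [sigmaArrow_apply]

theorem integrable_prod_comp_sigma [SigmaFinite ν] (e : (Σ k, α k) ≃ ι)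
    {g : ∀ k, (α k → E) → ℂ} (hg : ∀ k, Integrable (g k) (Measure.pi fun _ : α k => ν)) :
    Integrable (fun f => ∏ k, g k (fun a => f (e ⟨k, a⟩))) (Measure.pi fun _ : ι => ν) := by
  rw [← (measurePreserving_sigmaArrow ν e).integrable_comp_emb
    (sigmaArrow E e).measurableEmbedding]
  refine (Integrable.fintype_prod_dep hg).congr (Filter.Eventually.of_forall fun f => ?_)
  simp only [Function.comp_apply, sigmaArrow_apply]

end Products

/-! ### The polymer representation -/

section Polymer

variable {L : Type*} [Fintype L] [DecidableEq L] {N : ℕ}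

/-- The elements of `L` as elements of the parts of a partition. -/
def sigmaParts (P : Finpartition (Finset.univ : Finset L)) : (Σ X : P.parts, X.1) ≃ L :=
  Equiv.ofBijective (fun p => p.2.1) <| by
    constructor
    · rintro ⟨X, x⟩ ⟨Y, y⟩ h
      simp only at h
      have hXY : X = Y := Subtype.ext <| by
        rw [← (mem_part_iff P X.2).1 x.2, ← (mem_part_iff P Y.2).1 y.2, h]
      subst hXY
      exact congrArg _ (Subtype.ext h)
    · exact fun x => ⟨⟨⟨P.part x, P.part_mem.2 (Finset.mem_univ x)⟩,
        ⟨x, P.mem_part (Finset.mem_univ x)⟩⟩, rfl⟩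

variable {C : Matrix (L × Fin N) (L × Fin N) ℂ} {P : Finpartition (Finset.univ : Finset L)}
  {R : ℝ≥0∞} {E : (L → Spin N) × (Pair L → ℝ) → ℂ}
  {B : (X : Finset L) → (X → Spin N) → (Pair X → ℝ) → ℂ}

/-- The forest formula carries a uniform weight for every pair of `L`. Those off the trees integrate
to one, and the weights of different trees are independent. -/
theorem integral_prod_restrictPairs {T : ∀ X : P.parts, Finset (Pair X.1)}
    (G : ∀ X : P.parts, (T X → ℝ) → ℂ) :
    ∫ θ, ∏ X : P.parts, G X (fun ℓ => θ (pairEmb X.1 ℓ)) ∂cubeMeasure (Pair L) =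
      ∏ X : P.parts, ∫ w, G X w ∂cubeMeasure (T X) := by
  have hinj : Function.Injective fun a : Σ X : P.parts, T X => pairEmb a.1.1 a.2.1 := by
    rintro ⟨X, ℓ⟩ ⟨Y, ℓ'⟩ h
    have h1 : (⟨X, ℓ.1⟩ : Σ X : P.parts, Pair X.1) = ⟨Y, ℓ'.1⟩ := (partPairEmb P).injective h
    obtain ⟨ℓ, hℓ⟩ := ℓ
    obtain ⟨ℓ', hℓ'⟩ := ℓ'
    cases h1
    rfl
  have h1 := integral_comp_embedding (volume.restrict (Set.Icc (0 : ℝ) 1))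
    (⟨_, hinj⟩ : (Σ X : P.parts, T X) ↪ Pair L) fun f => ∏ X : P.parts, G X fun ℓ => f ⟨X, ℓ⟩
  exact h1.trans (integral_prod_comp_sigma (volume.restrict (Set.Icc (0 : ℝ) 1))
    (Equiv.refl (Σ X : P.parts, T X)) G)

theorem interpCov_one (C : Matrix (L × Fin N) (L × Fin N) ℂ) : interpCov C 1 = C := by
  ext ξ η
  simp [interpCov]

/-- The contribution of the tree `T` to an activity, as a function of the field. -/
def fieldIntegrand (C : Matrix (L × Fin N) (L × Fin N) ℂ) (R : ℝ≥0∞)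
    (B : (X : Finset L) → (X → Spin N) → (Pair X → ℝ) → ℂ) (X : Finset L)
    (T : Finset (Pair X)) (φ : X → Spin N) : ℂ :=
  ∫ w, treeIntegrand (restrictCov X C) R (B X) T φ w ∂cubeMeasure T

-- For a fixed field, the forest formula is regrouped into partitions and trees, and the integrand
-- and the integral over the weights factor over the parts. Fields excluded by the cutoff give zero
-- on both sides.
open scoped Classical in
theorem IsLocal.integrand_eq_sum (hR : 0 < R) (h : IsLocal R E B) {c : ℝ} (hc : 0 < c)
    (hC : Coercive c C) (φ : L → Spin N) :
    gaussianDensity C φ * (cutoff R φ * E (φ, 1)) =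
      ∑ P : Finpartition (Finset.univ : Finset L),
        ∑ T ∈ Fintype.piFinset fun X : P.parts =>
          (Finset.univ.filter fun T : Finset (Pair X.1) => (pairGraph T).IsTree),
          ∏ X : P.parts, fieldIntegrand C R B X.1 (T X) (restrictField X.1 φ) := by
  have h1 : gaussianDensity C φ * (cutoff R φ * E (φ, 1)) =
      ∑ F : Finset (Pair L) with (pairGraph F).IsAcyclic, ∫ θ, cutoff R φ *
        applyAll F (fun ℓ => dirWithin (covCube C) (Pi.single ℓ 1))
        (fun s => gaussianDensity (interpCov C s) φ * E (φ, s)) (treeInterp F fun ℓ => θ ℓ)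
        ∂cubeMeasure (Pair L) := by
    by_cases hφ : φ ∈ smallFields L N R
    · have hf := forest_formula (uniqueDiffOn_covCube C) (covCube_subset C)
        (fun s hs => ⟨hs.1, coerciveSet_subset hc (hs.mem_coerciveSet hC)⟩)
        (h.contDiffOn_integrand (C := C) hφ)
      simp only [integral_const_mul]
      rw [← Finset.mul_sum, ← hf, interpCov_one]
      ring
    · simp [cutoff_eq_indicator, hφ]
  rw [h1, sum_forests]
  refine Finset.sum_congr rfl fun P _ => Finset.sum_congr rfl fun T hT => ?_
  have hT' : ∀ X, (pairGraph (T X)).IsTree := by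
    simpa only [Fintype.mem_piFinset, Finset.mem_filter, Finset.mem_univ, true_and] using hT
  simp only [fieldIntegrand]
  rw [← integral_prod_restrictPairs]
  exact integral_congr_ae (ae_openCube.mono fun θ hθ => h.cutoff_mul_applyAll hR hc hC hT' φ hθ)

/-- Lebesgue measure on the fields is a product over the parts, so the field integral factors too,
and the sum over families of trees of a product is the product of the sums over trees. -/
theorem IsLocal.integral_eq_polymerSum (hR : 0 < R) (h : IsLocal R E B) (hC' : C.IsSymm) {c : ℝ}
    (hc : 0 < c) (hC : Coercive c C) :
    ∫ φ, gaussianDensity C φ * (cutoff R φ * E (φ, 1)) =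
      polymerSum fun X => treeActivity (restrictCov X C) R (B X) := by
  classical
  have hsymm : ∀ X : Finset L, (restrictCov X C).IsSymm := fun X => hC'.submatrix _
  have hint : ∀ (P : Finpartition (Finset.univ : Finset L)) (X : P.parts) (T : Finset (Pair X.1)),
      (pairGraph T).IsTree → Integrable (fieldIntegrand C R B X.1 T) := fun P X T hT =>
    (integrable_treeIntegrand (hsymm X.1) hc (coercive_restrictCov hC X.1)
      (h.isRegular hR (P.nonempty_of_mem_parts X.2)) hT).integral_prod_left
  have hprod : ∀ (P : Finpartition (Finset.univ : Finset L)),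
      ∀ T ∈ Fintype.piFinset fun X : P.parts =>
        (Finset.univ.filter fun T : Finset (Pair X.1) => (pairGraph T).IsTree),
      Integrable fun φ : L → Spin N =>
        ∏ X : P.parts, fieldIntegrand C R B X.1 (T X) (restrictField X.1 φ) := by
    intro P T hT
    refine integrable_prod_comp_sigma volume (sigmaParts P) fun X => hint P X (T X) ?_
    exact (Finset.mem_filter.1 (Fintype.mem_piFinset.1 hT X)).2
  simp only [h.integrand_eq_sum hR hc hC]
  rw [integral_finsetSum _ fun P _ => integrable_finsetSum _ (hprod P), polymerSum]
  refine Finset.sum_congr rfl fun P _ => ?_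
  rw [integral_finsetSum _ (hprod P), ← Finset.prod_coe_sort]
  have hact : ∀ X : P.parts, treeActivity (restrictCov X.1 C) R (B X.1) =
      ∑ T : Finset (Pair X.1) with (pairGraph T).IsTree, ∫ φ, fieldIntegrand C R B X.1 T φ :=
    fun X => treeActivity_eq (hsymm X.1) hc (coercive_restrictCov hC X.1)
      (h.isRegular hR (P.nonempty_of_mem_parts X.2))
  simp only [hact]
  rw [Finset.prod_univ_sum]
  refine Finset.sum_congr rfl fun T _ => ?_
  exact integral_prod_comp_sigma volume (sigmaParts P) fun X => fieldIntegrand C R B X.1 (T X)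

end Polymer

end ClusterExpansion

end

/-! ### The theorem -/

open ClusterExpansion in
theorem mainTheorem3 {L : Type*} [Fintype L] [DecidableEq L] (N : ℕ)
    (C : Matrix (L × Fin N) (L × Fin N) ℂ)
    (hC_symm : C.IsSymm) (hC_normal : IsStarNormal C)
    (hC_pos : (C⁻¹.map Complex.re).PosDef)
    (R : ENNReal) (hR : 0 < R)
    (J : L → Spin N)
    (V₁ V₂ : (L → Spin N) → (Pair L → ℝ) → (L → Spin N) → ℂ)
    (V₁loc : (X : Finset L) → (X → Spin N) → (Pair X → ℝ) → (X → Spin N) → ℂ)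
    (V₂loc : (X : Finset L) → X → (X → Spin N) → (Pair X → ℝ) → (X → Spin N) → ℂ)
    (hV₁_smooth : ContDiffOn ℝ (⊤ : ℕ∞)
      (fun p : (L → Spin N) × (Pair L → ℝ) => V₁ p.1 p.2 J)
      (smallFields L N R ×ˢ Set.Icc 0 1))
    (hV₂_smooth : ContDiffOn ℝ (⊤ : ℕ∞)
      (fun p : (L → Spin N) × (Pair L → ℝ) => V₂ p.1 p.2 J)
      (smallFields L N R ×ˢ Set.Icc 0 1))
    (hV₁_factor : ∀ φ ∈ smallFields L N R, ∀ s ∈ Set.Icc (0 : Pair L → ℝ) 1,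
      V₁ φ s J = ∑ X ∈ (componentPartition s).parts,
        V₁loc X (restrictField X φ) (restrictPairs X s) (restrictField X J))
    (hV₂_factor : ∀ φ ∈ smallFields L N R, ∀ s ∈ Set.Icc (0 : Pair L → ℝ) 1,
      V₂ φ s J = ∑ X ∈ (componentPartition s).parts, ∑ x : X,
        V₂loc X x (restrictField X φ) (restrictPairs X s) (restrictField X J))
    (hV_infinite : R = ⊤ → SubGaussian fun φ s => V₁ φ s J + V₂ φ s J)
    (Z : ℂ) (hZ : Z = partitionFunction C R fun φ => V₁ φ 1 J + V₂ φ 1 J)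
    (A : Finset L → ℂ) (hA : ∀ X, A X = activity C R V₁loc V₂loc X (restrictField X J)) :
    Z = polymerSum A ∧
    ((∀ x, A {x} ≠ 0) →
      IsFormalLog (∑ X : Finset L with X.Nonempty, mayerSeries A X) (polymerSeries A) ∧
      ((∀ X : Finset L, 2 ≤ X.card → Summable (mayerTerm A X)) →
        Complex.exp (∑ X : Finset L with X.Nonempty, mayerW A X) = Z)) := by
  set E : (L → Spin N) × (Pair L → ℝ) → ℂ :=
    fun p => Complex.exp (V₁ p.1 p.2 J + V₂ p.1 p.2 J) with hE
  set B : (X : Finset L) → (X → Spin N) → (Pair X → ℝ) → ℂ := fun X φ s =>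
    Complex.exp (V₁loc X φ s (restrictField X J) + ∑ x : X, V₂loc X x φ s (restrictField X J))
    with hB
  -- The exponential turns the additive decomposition of `V₁ + V₂` into a product of factors that
  -- never vanish.
  have hloc : IsLocal R E B := by
    refine ⟨(hV₁_smooth.add hV₂_smooth).cexp, fun X φ s => Complex.exp_ne_zero _,
      fun φ hφ s hs => ?_, hV_infinite⟩
    simp only [hE, hB]
    rw [hV₁_factor φ hφ s hs, hV₂_factor φ hφ s hs, ← Finset.sum_add_distrib, Complex.exp_sum]
  have hmain : Z = polymerSum A := by
    obtain ⟨c, hc, hC⟩ := exists_coercive_of_posDef_inv hC_symm hC_pos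
    rw [hZ, funext hA]
    exact hloc.integral_eq_polymerSum hR hC_symm hc hC
  refine ⟨hmain, fun h => ⟨isFormalLog_mayerSeries A h, fun hs => ?_⟩⟩
  rw [hmain]
  exact exp_sum_mayerW A h hs
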